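/- Let $\eta=\frac{99}{100}$ and, for $\alpha>0$, $\gamma=1+\frac{\alpha}{10}$. On $(0,\infty)\times(0,\pi/2)$, with the measure $dR\,d\theta$, put $D_R=R\partial_R$, $D_\theta=\sin(2\theta)\partial_\theta$, $w(R)=\frac{(1+R)^2}{R^2}$, $W=w\,\sin(2\theta)^{-\gamma/2}$, $K(\theta)=3\sin\theta\cos^2\theta$, and let $\mathcal H^k$ be the space of functions with finite norm $$|f|_{\mathcal H^k}^2=\sum_{j=0}^k\Big|D_R^jf\,\frac{w}{\sin(2\theta)^{\eta/2}}\Big|_{L^2}^2+\sum_{i\ge1,\;i+j\le k}\big|D_\theta^iD_R^jf\,W\big|_{L^2}^2$$ (weak derivatives). Let $b\in\{1,5\}$. **Theorem 5.1 (Elliptic).** There is $\alpha_0>0$ such that for every integer $k\ge2$ there is a constant $C_k>0$ such that for every $\alpha\in(0,\alpha_0)$ the following holds. If $F\in\mathcal H^k$ satisfies $\int_0^{\pi/2}F(R,\theta)K(\theta)\,d\theta=0$ for almost every $R>0$, then the polar Biot–Savart problem $$-\alpha^2D_R^2\Psi-b\,\alpha D_R\Psi-\partial_{\theta\theta}\Psi+\partial_\theta\big(\tan(\theta)\Psi\big)-6\Psi=F,$$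 $$\Psi(R,0)=\Psi(R,\pi/2)=0\ (R\ge0),\qquad \lim_{R\to\infty}\Psi(R,\theta)=0\ \text{ uniformly in }\theta\in[0,\pi/2],$$ where the equation holds almost everywhere, has exactly one solution $\Psi$ which is continuous on $[0,\infty)\times[0,\pi/2]$ and $C^2$ on $(0,\infty)\times(0,\pi/2)$, and $$\alpha^2|D_R^2\Psi|_{\mathcal H^k}+\alpha|D_R\Psi|_{\mathcal H^k}+|\partial_\theta^2\Psi|_{\mathcal H^k}\le C_k|F|_{\mathcal H^k}.$$ -/

import Mathlib

open MeasureTheory Set Filter Topology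
open scoped ENNReal ContDiff

noncomputable section

namespace PolarBiotSavart

/-- The open strip `(0, ∞) × (0, π/2)`; a point is `p = (R, θ)`. -/
def strip : Set (ℝ × ℝ) := Ioi 0 ×ˢ Ioo 0 (Real.pi / 2)

/-- The closed strip `[0, ∞) × [0, π/2]`. -/
def closedStrip : Set (ℝ × ℝ) := Ici 0 ×ˢ Icc 0 (Real.pi / 2)

/-! ### The weights -/

/-- `η = 99/100`. -/
def eta : ℝ := 99 / 100

/-- `γ = 1 + α/10`. -/
def gam (α : ℝ) : ℝ := 1 + α / 10

/-- The radial weight `w(R) = (1 + R)² / R²`. -/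
def wRad (R : ℝ) : ℝ := (1 + R) ^ 2 / R ^ 2

/-- The weight `w(R) / sin(2θ)^{η/2}`, for purely radial derivatives. -/
def weightRad (p : ℝ × ℝ) : ℝ := wRad p.1 / Real.sin (2 * p.2) ^ (eta / 2)

/-- The weight `W(R, θ) = w(R) / sin(2θ)^{γ/2}`, for derivatives with an angular part. -/
def weightAng (α : ℝ) (p : ℝ × ℝ) : ℝ := wRad p.1 / Real.sin (2 * p.2) ^ (gam α / 2)

/-- The function `K(θ) = 3 sin θ cos² θ`. -/
def K (θ : ℝ) : ℝ := 3 * Real.sin θ * Real.cos θ ^ 2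

/-! ### Weak derivatives and the space `𝓗^k` -/

/-- `g` is the weak derivative of `f` on the open strip in the direction `v`. -/
structure HasWeakPartial (v : ℝ × ℝ) (f g : ℝ × ℝ → ℝ) : Prop where
  locInt : LocallyIntegrableOn f strip
  locInt_deriv : LocallyIntegrableOn g strip
  parts : ∀ φ : ℝ × ℝ → ℝ, ContDiff ℝ ∞ φ → HasCompactSupport φ → tsupport φ ⊆ strip →
    ∫ p in strip, f p * fderiv ℝ φ p v = - ∫ p in strip, g p * φ p

/-- `G i j = D_θ^i D_R^j f` in the weak sense on the open strip, for all `i + j ≤ k`, where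
`D_R = R ∂_R` and `D_θ = sin(2θ) ∂_θ`. Such `G i j` are unique almost everywhere on the strip. -/
structure IsDerivFamily (k : ℕ) (f : ℝ × ℝ → ℝ) (G : ℕ → ℕ → ℝ × ℝ → ℝ) : Prop where
  zero : G 0 0 = f
  locInt : ∀ i j, i + j ≤ k → LocallyIntegrableOn (G i j) strip
  radial : ∀ j, j + 1 ≤ k → HasWeakPartial (1, 0) (G 0 j) (fun p => G 0 (j + 1) p / p.1)
  angular : ∀ i j, i + 1 + j ≤ k →
    HasWeakPartial (0, 1) (G i j) (fun p => G (i + 1) j p / Real.sin (2 * p.2))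

/-- The square of the `L²` norm on the strip, with respect to `dR dθ`. -/
def sqL2 (f : ℝ × ℝ → ℝ) : ℝ≥0∞ := ∫⁻ p in strip, ‖f p‖ₑ ^ 2

/-- The sum of weighted squares in the `𝓗^k` norm, for the family `G i j = D_θ^i D_R^j f`. -/
def energy (α : ℝ) (k : ℕ) (G : ℕ → ℕ → ℝ × ℝ → ℝ) : ℝ≥0∞ :=
  (∑ j ∈ Finset.range (k + 1), sqL2 (fun p => G 0 j p * weightRad p)) +
    ∑ i ∈ Finset.Icc 1 k, ∑ j ∈ Finset.range (k + 1 - i),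
      sqL2 (fun p => G i j p * weightAng α p)

/-- The `𝓗^k` norm of `f`, with values in `[0, ∞]`. All families of weak derivatives of `f` agree
almost everywhere, so the infimum is over a single value; it is `∞` if `f` does not have
all the weak derivatives of order at most `k`. -/
def Hnorm (α : ℝ) (k : ℕ) (f : ℝ × ℝ → ℝ) : ℝ≥0∞ :=
  (⨅ (G : ℕ → ℕ → ℝ × ℝ → ℝ) (_ : IsDerivFamily k f G), energy α k G) ^ (1 / 2 : ℝ)

/-- Membership in `𝓗^k`. -/
def MemH (α : ℝ) (k : ℕ) (f : ℝ × ℝ → ℝ) : Prop := Hnorm α k f < ⊤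

/-- `(F, K)_{L²_θ} ≡ 0`. -/
def OrthK (F : ℝ × ℝ → ℝ) : Prop :=
  ∀ᵐ R ∂(volume.restrict (Ioi (0 : ℝ))), ∫ θ in (0 : ℝ)..(Real.pi / 2), F (R, θ) * K θ = 0

/-! ### The polar Biot–Savart problem -/

/-- The classical operator `D_R = R ∂_R`. -/
def DR (f : ℝ × ℝ → ℝ) (p : ℝ × ℝ) : ℝ := p.1 * deriv (fun r => f (r, p.2)) p.1

/-- The classical operator `∂_θ`. -/
def dTheta (f : ℝ × ℝ → ℝ) (p : ℝ × ℝ) : ℝ := deriv (fun t => f (p.1, t)) p.2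

/-- `Ψ` solves `-α² D_R²Ψ - b α D_RΨ - ∂_θθΨ + ∂_θ(tan θ Ψ) - 6Ψ = F` in the open strip, is
continuous on the closed strip, vanishes at `θ = 0` and at `θ = π/2`, and tends to `0` as `R → ∞`,
uniformly in `θ`. -/
structure IsSolution (α b : ℝ) (F Ψ : ℝ × ℝ → ℝ) : Prop where
  cont : ContinuousOn Ψ closedStrip
  smooth : ContDiffOn ℝ 2 Ψ strip
  eqn : ∀ᵐ p ∂(volume.restrict strip),
    - α ^ 2 * DR (DR Ψ) p - b * α * DR Ψ p - dTheta (dTheta Ψ) p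
      + dTheta (fun q => Real.tan q.2 * Ψ q) p - 6 * Ψ p = F p
  bc_zero : ∀ R, 0 ≤ R → Ψ (R, 0) = 0
  bc_top : ∀ R, 0 ≤ R → Ψ (R, Real.pi / 2) = 0
  decay : TendstoUniformlyOn (fun R θ => Ψ (R, θ)) (fun _ => 0) atTop (Icc 0 (Real.pi / 2))

end PolarBiotSavart

end

open scoped NNReal InnerProductSpace Real
open Real (sin cos tan exp log pi_pos exp_pos rpow_pos_of_pos sin_two_mul sin_le_one cos_le_one
  sin_sq_add_cos_sq exp_add neg_one_le_cos cos_two_mul sin_sq_le_one rpow_neg exp_le_exp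
  cos_nonneg_of_mem_Icc hasDerivAt_sin hasDerivAt_cos hasDerivAt_tan
  sin_nonneg_of_nonneg_of_le_pi enorm_eq_ofReal_abs)
open ENNReal (ofReal mul_lt_top ofReal_le_ofReal ofReal_mul ofReal_lt_top coe_le_coe coe_lt_top
  ofReal_ne_top)
open intervalIntegral (integral_of_le integral_add_adjacent_intervals integral_hasDerivAt_right)
open Metric

noncomputable section

namespace PolarBiotSavart

/-- Functions on the plane of the variables `(R, θ)`. -/
local notation "Fn" => ℝ × ℝ → ℝ

/-- The range of the angular variable. -/
local notation "J₀" => Ioo (0 : ℝ) (π / 2)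

/-- The quotient by `R`. -/
local notation "divR" f:max => fun p => f p / Prod.fst p

/-- The quotient by `sin(2θ)`. -/
local notation "divS" f:max => fun p => f p / sin (2 * Prod.snd p)

/-- Lebesgue measure on the open strip. -/
local notation "vol₊" => Measure.restrict volume strip

/-- The square of the norm with the weight `w`. -/
local notation "wSq" w:max f:max => sqL2 (fun p => f p * w p)

/-- The square of the norm with the radial weight. -/
local notation "radSq" f:max => sqL2 (fun p => f p * weightRad p)

/-- The square of the norm with the angular weight. -/
local notation "angSq" a:max f:max => sqL2 (fun p => f p * weightAng a p)

/-! ### Angular weights -/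

/-- The weight `sin(2θ)^{-η}`. -/
def se (θ : ℝ) : ℝ := sin (2 * θ) ^ (-eta)

/-- The weight `sin(2θ)^{1-η}`. -/
def sz (θ : ℝ) : ℝ := sin (2 * θ) ^ (1 - eta)

/-- The weight `sin(2θ)² cos θ`. -/
def mW (θ : ℝ) : ℝ := sin (2 * θ) ^ 2 * cos θ

lemma sin_two_pos {θ : ℝ} (h : θ ∈ J₀) : 0 < sin (2 * θ) :=
  Real.sin_pos_of_pos_of_lt_pi (by linarith [h.1]) (by linarith [h.2])

lemma cos_pos_strip {θ : ℝ} (h : θ ∈ J₀) : 0 < cos θ :=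
  Real.cos_pos_of_mem_Ioo ⟨by linarith [h.1, pi_pos], h.2⟩

lemma sin_pos_strip {θ : ℝ} (h : θ ∈ J₀) : 0 < sin θ :=
  Real.sin_pos_of_pos_of_lt_pi h.1 (by linarith [h.2, pi_pos])

lemma se_pos {θ : ℝ} (h : θ ∈ J₀) : 0 < se θ := rpow_pos_of_pos (sin_two_pos h) _

lemma one_le_se {θ : ℝ} (h : θ ∈ J₀) : 1 ≤ se θ :=
  Real.one_le_rpow_of_pos_of_le_one_of_nonpos (sin_two_pos h) (sin_le_one _) (by norm_num [eta])

lemma sz_eq {θ : ℝ} (h : θ ∈ J₀) : sz θ = sin (2 * θ) * se θ := by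
  unfold sz se
  rw [sub_eq_add_neg, Real.rpow_add (sin_two_pos h), Real.rpow_one]

lemma sz_zero : sz 0 = 0 := by
  simp [sz, eta]; norm_num

lemma sz_top : sz (π / 2) = 0 := by
  have : (2 : ℝ) * (π / 2) = π := by ring
  rw [sz, this, Real.sin_pi, Real.zero_rpow]; norm_num [eta]

lemma continuous_sz : Continuous sz :=
  Continuous.rpow_const (by fun_prop) (fun _ => Or.inr (by norm_num [eta]))

lemma hasDerivAt_sz {θ : ℝ} (h : θ ∈ J₀) :
    HasDerivAt sz (2 * (1 - eta) * cos (2 * θ) * se θ) θ := by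
  have h1 : HasDerivAt (fun t : ℝ => sin (2 * t)) (cos (2 * θ) * 2) θ := by
    have := (hasDerivAt_sin (2 * θ)).comp θ ((hasDerivAt_id θ).const_mul 2)
    exact this.congr_deriv (by simp)
  have := h1.rpow_const (p := 1 - eta) (Or.inl (sin_two_pos h).ne')
  refine this.congr_deriv ?_
  have e : (1 : ℝ) - eta - 1 = -eta := by ring
  rw [e, se]; ring

lemma measurable_se : Measurable se := by unfold se; fun_prop

lemma mul_le_sin_two {θ : ℝ} (h0 : 0 ≤ θ) (h1 : θ ≤ π / 4) : θ ≤ sin (2 * θ) := by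
  have := Real.mul_le_sin (x := 2 * θ) (by linarith) (by linarith)
  have hp : (2 : ℝ) / π * (2 * θ) ≥ θ := by
    have : (2 : ℝ) / π * 2 ≥ 1 := by
      rw [ge_iff_le, div_mul_eq_mul_div, le_div_iff₀ pi_pos]; linarith [Real.pi_le_four]
    nlinarith
  linarith

lemma se_le {θ : ℝ} (h : θ ∈ J₀) : se θ ≤ θ ^ (-eta) + (π / 2 - θ) ^ (-eta) := by
  have hη : -eta ≤ 0 := by norm_num [eta]
  rcases le_total θ (π / 4) with h1 | h1
  · have := Real.rpow_le_rpow_of_nonpos h.1 (mul_le_sin_two h.1.le h1) hη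
    have h2 : 0 ≤ (π / 2 - θ) ^ (-eta) := Real.rpow_nonneg (by linarith [h.2]) _
    unfold se; linarith
  · have hs : sin (2 * θ) = sin (2 * (π / 2 - θ)) := by
      rw [← Real.sin_pi_sub]; congr 1; ring
    have := Real.rpow_le_rpow_of_nonpos (x := π / 2 - θ) (by linarith [h.2])
      (mul_le_sin_two (by linarith [h.2]) (by linarith)) hη
    have h2 : 0 ≤ θ ^ (-eta) := Real.rpow_nonneg h.1.le _
    unfold se; rw [hs]; linarith

lemma integrableOn_se : IntegrableOn se J₀ := by
  have hη : -1 < -eta := by norm_num [eta]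
  have h1 : IntervalIntegrable (fun θ : ℝ => θ ^ (-eta)) volume 0 (π / 2) :=
    intervalIntegral.intervalIntegrable_rpow' hη
  have h2 : IntervalIntegrable (fun θ : ℝ => (π / 2 - θ) ^ (-eta)) volume 0 (π / 2) := by
    have := (h1.comp_sub_left (π / 2)).symm
    simpa using this
  have h3 := (h1.add h2)
  rw [intervalIntegrable_iff_integrableOn_Ioo_of_le (by positivity)] at h3
  refine Integrable.mono' h3 measurable_se.aestronglyMeasurable ?_
  filter_upwards [ae_restrict_mem measurableSet_Ioo] with θ hθ
  rw [Real.norm_of_nonneg (se_pos hθ).le]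
  exact se_le hθ

/-- Integral over the open angular interval. -/
def angInt (f : ℝ → ℝ) : ℝ := ∫ θ in J₀, f θ

lemma integrableOn_cont {f : ℝ → ℝ} (hf : Continuous f) : IntegrableOn f J₀ :=
  (hf.integrableOn_Icc (a := 0) (b := π / 2)).mono_set Ioo_subset_Icc_self

lemma integrableOn_se_mul {f : ℝ → ℝ} (hf : Continuous f) :
    IntegrableOn (fun θ => se θ * f θ) J₀ := by
  obtain ⟨C, hC⟩ := (isCompact_Icc (a := (0 : ℝ)) (b := π / 2)).exists_bound_of_continuousOn
    hf.continuousOn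
  refine Integrable.mul_bdd (c := C) integrableOn_se hf.aestronglyMeasurable ?_
  filter_upwards [ae_restrict_mem measurableSet_Ioo] with θ hθ using hC θ (Ioo_subset_Icc_self hθ)

lemma angInt_deriv_eq {B b : ℝ → ℝ} (hB : Continuous B) (hd : ∀ θ ∈ J₀, HasDerivAt B (b θ) θ)
    (hi : IntegrableOn b J₀) :
    angInt b = B (π / 2) - B 0 := by
  have := intervalIntegral.integral_eq_sub_of_hasDerivAt_of_le (a := 0) (b := π / 2)
    (by positivity) hB.continuousOn hd
    ((intervalIntegrable_iff_integrableOn_Ioo_of_le (by positivity)).2 hi)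
  rw [← this, angInt, integral_of_le (by positivity), integral_Ioc_eq_integral_Ioo]

lemma angInt_mono {f g : ℝ → ℝ} (hf : IntegrableOn f J₀)
    (hg : IntegrableOn g J₀) (h : ∀ θ ∈ J₀, f θ ≤ g θ) :
    angInt f ≤ angInt g :=
  setIntegral_mono_on hf hg measurableSet_Ioo h

lemma angInt_nonneg {f : ℝ → ℝ} (h : ∀ θ ∈ J₀, 0 ≤ f θ) : 0 ≤ angInt f :=
  setIntegral_nonneg measurableSet_Ioo h

/-! ### The one-dimensional angular problem

A function `Ψ = sin(2θ) g` satisfies `-Ψ'' + (tan θ Ψ)' - 6 Ψ = angOp g' g''`. -/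

/-- The angular operator applied to `sin(2θ) g`, in terms of `g'` and `g''`. -/
def angOp (g1 g2 : ℝ → ℝ) (θ : ℝ) : ℝ := -(sin (2 * θ) * g2 θ) - (5 * cos (2 * θ) - 1) * g1 θ

lemma hasDerivAt_sin_two (θ : ℝ) : HasDerivAt (fun t : ℝ => sin (2 * t)) (2 * cos (2 * θ)) θ := by
  have := (hasDerivAt_sin (2 * θ)).comp θ ((hasDerivAt_id θ).const_mul 2)
  refine (this.congr_deriv (by simp [mul_comm]))

lemma hasDerivAt_cos_two (θ : ℝ) : HasDerivAt (fun t : ℝ => cos (2 * t)) (-2 * sin (2 * θ)) θ := by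
  have := (hasDerivAt_cos (2 * θ)).comp θ ((hasDerivAt_id θ).const_mul 2)
  refine (this.congr_deriv (by simp; ring))

lemma hasDerivAt_mW (θ : ℝ) : HasDerivAt mW (sin (2 * θ) * cos θ * (5 * cos (2 * θ) - 1)) θ := by
  have h := ((hasDerivAt_sin_two θ).pow 2).mul (hasDerivAt_cos θ)
  refine h.congr_deriv ?_
  simp only [Nat.cast_ofNat, Nat.add_one_sub_one, pow_one, Pi.pow_apply]
  rw [cos_two_mul, sin_two_mul]
  have h1 := sin_sq_add_cos_sq θ
  have : sin θ ^ 3 = sin θ * (1 - cos θ ^ 2) := by rw [← h1]; ring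
  ring_nf
  rw [this]; ring

lemma continuous_mW : Continuous mW := by unfold mW; fun_prop

lemma mW_nonneg {θ : ℝ} (h : θ ∈ Icc 0 (π / 2)) : 0 ≤ mW θ :=
  mul_nonneg (sq_nonneg _) (cos_nonneg_of_mem_Icc ⟨by linarith [h.1, pi_pos], h.2⟩)

section OneDim

variable {g g1 g2 : ℝ → ℝ}

lemma hasDerivAt_mW_mul (h2 : ∀ θ, HasDerivAt g1 (g2 θ) θ) (θ : ℝ) :
    HasDerivAt (fun t => mW t * g1 t) (-(sin (2 * θ) * cos θ * angOp g1 g2 θ)) θ := by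
  refine ((hasDerivAt_mW θ).mul (h2 θ)).congr_deriv ?_
  unfold angOp mW; ring

lemma continuous_of_hasDerivAt {f f' : ℝ → ℝ} (h : ∀ θ, HasDerivAt f (f' θ) θ) : Continuous f :=
  continuous_iff_continuousAt.2 fun θ => (h θ).continuousAt

lemma continuous_angOp (h1 : Continuous g1) (h2 : Continuous g2) : Continuous (angOp g1 g2) := by
  unfold angOp; fun_prop

lemma angInt_angOp_cos (h1 : ∀ θ, HasDerivAt g (g1 θ) θ) (h2 : ∀ θ, HasDerivAt g1 (g2 θ) θ)
    (hc : Continuous g2) :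
    angInt (fun θ => angOp g1 g2 θ * (sin (2 * θ) * g θ) * cos θ) =
      angInt (fun θ => mW θ * g1 θ ^ 2) := by
  have c := continuous_of_hasDerivAt h1
  have c1 := continuous_of_hasDerivAt h2
  have ca := continuous_angOp c1 hc
  have cm := continuous_mW
  have key := angInt_deriv_eq (B := fun t => mW t * g1 t * g t)
    (b := fun θ => mW θ * g1 θ ^ 2 - angOp g1 g2 θ * (sin (2 * θ) * g θ) * cos θ)
    (by fun_prop)
    (fun θ _ => ((hasDerivAt_mW_mul h2 θ).mul (h1 θ)).congr_deriv (by ring))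
    (integrableOn_cont (by fun_prop))
  have e0 : mW 0 = 0 := by simp [mW]
  have e1 : mW (π / 2) = 0 := by simp [mW]
  rw [e0, e1] at key
  unfold angInt at key ⊢
  rw [integral_sub (integrableOn_cont (by fun_prop)) (integrableOn_cont (by fun_prop))] at key
  linarith

/-- The bracket in the derivative of the weight `m κ'`. -/
def brk (θ : ℝ) : ℝ := 2 * (1 - eta) * cos (2 * θ) * (1 - (1 + 2 * eta) * cos (2 * θ))
    + 2 * (1 + 2 * eta) * sin (2 * θ) ^ 2

lemma angInt_angOp_se (h1 : ∀ θ, HasDerivAt g (g1 θ) θ) (h2 : ∀ θ, HasDerivAt g1 (g2 θ) θ)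
    (hc : Continuous g2) :
    angInt (fun θ => se θ * (angOp g1 g2 θ * (sin (2 * θ) * g θ))) =
      angInt (fun θ => se θ * (sin (2 * θ) ^ 2 * g1 θ ^ 2 - 1 / 2 * brk θ * g θ ^ 2)) := by
  have c := continuous_of_hasDerivAt h1
  have c1 := continuous_of_hasDerivAt h2
  have ca := continuous_angOp c1 hc
  have cz := continuous_sz
  have cb : Continuous brk := by unfold brk; fun_prop
  have key := angInt_deriv_eq (B := fun t => sz t * (sin (2 * t) * (g t * g1 t)) -
      sz t * ((1 / 2) * (1 - (1 + 2 * eta) * cos (2 * t)) * g t ^ 2))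
    (b := fun θ => se θ * (sin (2 * θ) ^ 2 * g1 θ ^ 2 - 1 / 2 * brk θ * g θ ^ 2) -
      se θ * (angOp g1 g2 θ * (sin (2 * θ) * g θ)))
    (by fun_prop) ?_ ((integrableOn_se_mul (by fun_prop)).sub (integrableOn_se_mul (by fun_prop)))
  · rw [sz_zero, sz_top] at key
    unfold angInt at key ⊢
    rw [integral_sub (integrableOn_se_mul (by fun_prop)) (integrableOn_se_mul (by fun_prop))] at key
    linarith
  · intro θ hθ
    have d1 := (hasDerivAt_sz hθ).mul ((hasDerivAt_sin_two θ).mul ((h1 θ).mul (h2 θ)))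
    have d2 := (hasDerivAt_sz hθ).mul
      (((((hasDerivAt_cos_two θ).const_mul (1 + 2 * eta)).const_sub 1).const_mul (1 / 2)).mul
        ((h1 θ).pow 2))
    refine (d1.sub d2).congr_deriv ?_
    simp only [sz_eq hθ, Pi.mul_apply, Pi.pow_apply, angOp, brk]
    push_cast
    ring

lemma brk_le {θ : ℝ} (h : θ ∈ J₀) : se θ * brk θ ≤ se θ * (-(19 / 1000)) + 5000 * mW θ := by
  have hs := sin_two_pos h
  have hs1 := sin_le_one (2 * θ)
  have hse := se_pos h
  have hsc := sin_sq_add_cos_sq (2 * θ)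
  have hc := cos_pos_strip h
  have hm : sin (2 * θ) ^ 3 / 2 ≤ mW θ := by
    unfold mW
    have : sin (2 * θ) / 2 ≤ cos θ := by
      rw [sin_two_mul]; nlinarith [sin_le_one θ]
    nlinarith [mul_le_mul_of_nonneg_left this (sq_nonneg (sin (2 * θ)))]
  have hb : brk θ ≤ -(396 / 10000) + 603 / 100 * sin (2 * θ) ^ 2 := by
    unfold brk eta
    nlinarith [cos_le_one (2 * θ)]
  rcases le_total (sin (2 * θ)) (1 / 20) with h1 | h1
  · have : brk θ ≤ -(19 / 1000) := by nlinarith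
    have hm0 : 0 ≤ mW θ := mW_nonneg (Ioo_subset_Icc_self h)
    nlinarith
  · have hse2 : se θ ≤ 20 := by
      have h3 : se θ ≤ sin (2 * θ) ^ (-1 : ℝ) := by
        apply Real.rpow_le_rpow_of_exponent_ge hs hs1; norm_num [eta]
      rw [Real.rpow_neg_one] at h3
      refine h3.trans ?_
      rw [inv_le_comm₀ hs (by norm_num)]; linarith
    have h4 : se θ * (603 / 100 * sin (2 * θ) ^ 2) ≤ 5000 * mW θ := by
      have : sin (2 * θ) ^ 2 ≤ 20 * sin (2 * θ) ^ 3 := by nlinarith [sq_nonneg (sin (2 * θ))]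
      have h5 : 0 ≤ sin (2 * θ) ^ 2 := sq_nonneg _
      nlinarith
    nlinarith

/-- Cauchy-Schwarz for weighted integrals over a subinterval. -/
lemma sq_integral_mul_le {a b : ℝ} (hab : a ≤ b) {m f : ℝ → ℝ} (hm : Continuous m) (hf : Continuous f)
    (h0 : ∀ t ∈ Icc a b, 0 ≤ m t) :
    (∫ t in a..b, m t * f t) ^ 2 ≤ (∫ t in a..b, m t) * ∫ t in a..b, m t * f t ^ 2 := by
  have key : ∀ l : ℝ, 0 ≤ (∫ t in a..b, m t) * (l * l) + (-2 * ∫ t in a..b, m t * f t) * l +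
      ∫ t in a..b, m t * f t ^ 2 := by
    intro l
    have : 0 ≤ ∫ t in a..b, m t * (f t - l) ^ 2 :=
      intervalIntegral.integral_nonneg hab fun t ht => mul_nonneg (h0 t ht) (sq_nonneg _)
    have e : ∀ t, m t * (f t - l) ^ 2 = m t * (l * l) + ((-2 * (m t * f t)) * l + m t * f t ^ 2) := by
      intro t; ring
    simp only [e] at this
    rw [intervalIntegral.integral_add (Continuous.intervalIntegrable (by fun_prop) _ _)
      (Continuous.intervalIntegrable (by fun_prop) _ _),
      intervalIntegral.integral_add (Continuous.intervalIntegrable (by fun_prop) _ _)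
      (Continuous.intervalIntegrable (by fun_prop) _ _)] at this
    simp only [intervalIntegral.integral_mul_const, intervalIntegral.integral_const_mul] at this
    linarith
  have := discrim_le_zero key
  unfold discrim at this
  nlinarith

lemma angInt_eq_interval (f : ℝ → ℝ) : angInt f = ∫ θ in (0 : ℝ)..(π / 2), f θ := by
  rw [angInt, integral_of_le (by positivity), integral_Ioc_eq_integral_Ioo]

/-- Weighted Poincaré inequality. -/
lemma poincare (h1 : ∀ θ, HasDerivAt g (g1 θ) θ) (hc : Continuous g1)
    (h0 : angInt (fun θ => mW θ * g θ) = 0) :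
    angInt (fun θ => mW θ * g θ ^ 2) ≤ 40 * angInt (fun θ => mW θ * g1 θ ^ 2) := by
  have c := continuous_of_hasDerivAt h1
  have cm := continuous_mW
  set A := angInt (fun θ => mW θ * g θ ^ 2) with hA
  have hpi := pi_pos
  have hpi4 := Real.pi_le_four
  have hA0 : 0 ≤ A := angInt_nonneg fun θ hθ =>
    mul_nonneg (mW_nonneg (Ioo_subset_Icc_self hθ)) (sq_nonneg _)
  set N : ℝ → ℝ := fun θ => ∫ t in (0 : ℝ)..θ, mW t * g t with hN
  have hNd : ∀ θ, HasDerivAt N (mW θ * g θ) θ := fun θ =>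
    integral_hasDerivAt_right (Continuous.intervalIntegrable (by fun_prop) _ _)
      (Continuous.stronglyMeasurableAtFilter (by fun_prop) _ _) (by fun_prop)
  have cN : Continuous N := continuous_of_hasDerivAt hNd
  have hN0 : N 0 = 0 := by simp [hN]
  have hN1 : N (π / 2) = 0 := by rw [← h0, angInt_eq_interval]
  have hsub : ∀ a b : ℝ, 0 ≤ a → a ≤ b → b ≤ π / 2 → ∫ t in a..b, mW t * g t ^ 2 ≤ A := by
    intro a b ha hab hb
    rw [hA, angInt_eq_interval]
    refine intervalIntegral.integral_mono_interval ha hab hb ?_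
      (Continuous.intervalIntegrable (by fun_prop) _ _)
    filter_upwards [ae_restrict_mem measurableSet_Ioc] with t ht
    exact mul_nonneg (mW_nonneg (Ioc_subset_Icc_self ht)) (sq_nonneg _)
  -- the pointwise bound on the primitive
  have hNb : ∀ θ ∈ J₀, N θ ^ 2 ≤ 4 * mW θ * A := by
    intro θ hθ
    have hsθ := sin_pos_strip hθ
    have hcθ := cos_pos_strip hθ
    rcases le_total θ (π / 4) with h | h
    · have hcs : (7 / 10 : ℝ) ≤ cos θ := by
        have : cos (π / 4) ≤ cos θ := Real.cos_le_cos_of_nonneg_of_le_pi hθ.1.le (by linarith) h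
        rw [Real.cos_pi_div_four] at this
        have h2 : (1.4 : ℝ) ≤ Real.sqrt 2 := Real.le_sqrt_of_sq_le (by norm_num)
        linarith
      have b1 : ∫ t in (0 : ℝ)..θ, mW t ≤ ∫ t in (0 : ℝ)..θ, 4 * sin θ ^ 2 := by
        refine intervalIntegral.integral_mono_on hθ.1.le (cm.intervalIntegrable _ _)
          (Continuous.intervalIntegrable (by fun_prop) _ _) fun t ht => ?_
        have ht0 : 0 ≤ sin t := sin_nonneg_of_nonneg_of_le_pi ht.1 (by linarith [ht.2])
        have ht1 : sin t ≤ sin θ :=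
          Real.sin_le_sin_of_le_of_le_pi_div_two (by linarith [ht.1]) hθ.2.le ht.2
        have hct0 : 0 ≤ cos t := cos_nonneg_of_mem_Icc ⟨by linarith [ht.1], by linarith [ht.2]⟩
        have hct : cos t ^ 3 ≤ 1 := pow_le_one₀ hct0 (cos_le_one _)
        have hq : sin t ^ 2 ≤ sin θ ^ 2 := by nlinarith
        unfold mW; rw [sin_two_mul]
        calc (2 * sin t * cos t) ^ 2 * cos t
            = 4 * sin t ^ 2 * cos t ^ 3 := by ring
          _ ≤ 4 * sin t ^ 2 * 1 := by gcongr
          _ ≤ _ := by linarith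
      rw [intervalIntegral.integral_const, smul_eq_mul, sub_zero] at b1
      have b2 := sq_integral_mul_le hθ.1.le cm c fun t ht => mW_nonneg ⟨ht.1, ht.2.trans hθ.2.le⟩
      have b3 := hsub 0 θ le_rfl hθ.1.le hθ.2.le
      have b4 : ∫ t in (0 : ℝ)..θ, mW t ≤ 4 * mW θ := by
        refine b1.trans ?_
        unfold mW; rw [sin_two_mul]
        have : (343 / 1000 : ℝ) ≤ cos θ ^ 3 := by
          have := pow_le_pow_left₀ (by norm_num) hcs 3; norm_num at this ⊢; linarith
        have h5 : 0 ≤ sin θ ^ 2 := sq_nonneg _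
        have h6 : θ ≤ 1 := by linarith
        calc θ * (4 * sin θ ^ 2) ≤ 1 * (4 * sin θ ^ 2) := by gcongr
          _ ≤ 16 * sin θ ^ 2 * cos θ ^ 3 := by nlinarith
          _ = _ := by ring
      have hm0 : 0 ≤ mW θ := mW_nonneg (Ioo_subset_Icc_self hθ)
      calc N θ ^ 2 ≤ _ := b2
        _ ≤ (4 * mW θ) * A := by
          refine mul_le_mul b4 b3 (intervalIntegral.integral_nonneg hθ.1.le fun t ht => ?_) (by positivity)
          exact mul_nonneg (mW_nonneg ⟨ht.1, ht.2.trans hθ.2.le⟩) (sq_nonneg _)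
        _ = _ := by ring
    · have hss : (7 / 10 : ℝ) ≤ sin θ := by
        have : sin (π / 4) ≤ sin θ := Real.sin_le_sin_of_le_of_le_pi_div_two (by linarith) hθ.2.le h
        rw [Real.sin_pi_div_four] at this
        have h2 : (1.4 : ℝ) ≤ Real.sqrt 2 := Real.le_sqrt_of_sq_le (by norm_num)
        linarith
      have b1 : ∫ t in θ..(π / 2), mW t ≤ ∫ t in θ..(π / 2), 4 * cos θ ^ 3 := by
        refine intervalIntegral.integral_mono_on hθ.2.le (cm.intervalIntegrable _ _)
          (Continuous.intervalIntegrable (by fun_prop) _ _) fun t ht => ?_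
        have ht1 : cos t ≤ cos θ :=
          Real.cos_le_cos_of_nonneg_of_le_pi hθ.1.le (by linarith [ht.2]) ht.1
        have hct0 : 0 ≤ cos t :=
          cos_nonneg_of_mem_Icc ⟨by linarith [ht.1, hθ.1], by linarith [ht.2]⟩
        have hq : cos t ^ 3 ≤ cos θ ^ 3 := pow_le_pow_left₀ hct0 ht1 3
        have hs2 : sin t ^ 2 ≤ 1 := sin_sq_le_one t
        have hc3 : 0 ≤ cos t ^ 3 := by positivity
        unfold mW; rw [sin_two_mul]
        calc (2 * sin t * cos t) ^ 2 * cos t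
            = 4 * sin t ^ 2 * cos t ^ 3 := by ring
          _ ≤ 4 * 1 * cos t ^ 3 := by gcongr
          _ ≤ _ := by linarith
      rw [intervalIntegral.integral_const, smul_eq_mul] at b1
      have b2 := sq_integral_mul_le hθ.2.le cm c fun t ht => mW_nonneg ⟨hθ.1.le.trans ht.1, ht.2⟩
      have b3 := hsub θ (π / 2) hθ.1.le hθ.2.le le_rfl
      have hNeq : N θ = -∫ t in θ..(π / 2), mW t * g t := by
        have := integral_add_adjacent_intervals (μ := volume)
          (a := 0) (b := θ) (c := π / 2) (f := fun t => mW t * g t)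
          (Continuous.intervalIntegrable (by fun_prop) _ _)
          (Continuous.intervalIntegrable (by fun_prop) _ _)
        have h6 : N θ + ∫ t in θ..(π / 2), mW t * g t = N (π / 2) := this
        linarith
      have b4 : ∫ t in θ..(π / 2), mW t ≤ 4 * mW θ := by
        refine b1.trans ?_
        unfold mW; rw [sin_two_mul]
        have : (49 / 100 : ℝ) ≤ sin θ ^ 2 := by nlinarith
        have h5 : 0 ≤ cos θ ^ 3 := by positivity
        have h6 : π / 2 - θ ≤ 1 := by linarith
        calc (π / 2 - θ) * (4 * cos θ ^ 3) ≤ 1 * (4 * cos θ ^ 3) := by gcongr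
          _ ≤ 16 * sin θ ^ 2 * cos θ ^ 3 := by nlinarith
          _ = _ := by ring
      have hm0 : 0 ≤ mW θ := mW_nonneg (Ioo_subset_Icc_self hθ)
      rw [hNeq, neg_sq]
      calc _ ≤ _ := b2
        _ ≤ (4 * mW θ) * A := by
          refine mul_le_mul b4 b3 (intervalIntegral.integral_nonneg hθ.2.le fun t ht => ?_) (by positivity)
          exact mul_nonneg (mW_nonneg ⟨hθ.1.le.trans ht.1, ht.2⟩) (sq_nonneg _)
        _ = _ := by ring
  -- integrate by parts
  have key := angInt_deriv_eq (B := fun t => N t * g t)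
    (b := fun θ => mW θ * g θ ^ 2 + N θ * g1 θ) (by fun_prop)
    (fun θ _ => ((hNd θ).mul (h1 θ)).congr_deriv (by ring)) (integrableOn_cont (by fun_prop))
  rw [hN0, hN1] at key
  have hle : angInt (fun θ => mW θ * g θ ^ 2) ≤
      angInt (fun θ => A / 4 + 4 * (mW θ * g1 θ ^ 2)) := by
    have e : angInt (fun θ => mW θ * g θ ^ 2) = angInt (fun θ => -(N θ * g1 θ)) := by
      unfold angInt at key ⊢
      rw [integral_add (integrableOn_cont (by fun_prop)) (integrableOn_cont (by fun_prop))] at key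
      rw [integral_neg]; linarith
    rw [e]
    refine angInt_mono (integrableOn_cont (by fun_prop)) (integrableOn_cont (by fun_prop)) ?_
    intro θ hθ
    have hm0 : 0 ≤ mW θ := mW_nonneg (Ioo_subset_Icc_self hθ)
    refine (neg_le_abs _).trans (abs_le_of_sq_le_sq ?_ (by positivity))
    have h7 : (N θ * g1 θ) ^ 2 ≤ 4 * mW θ * A * g1 θ ^ 2 := by
      rw [mul_pow]; exact mul_le_mul_of_nonneg_right (hNb θ hθ) (sq_nonneg _)
    nlinarith [sq_nonneg (A / 4 - 4 * (mW θ * g1 θ ^ 2))]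
  have e2 : angInt (fun θ => A / 4 + 4 * (mW θ * g1 θ ^ 2)) =
      π / 2 * (A / 4) + 4 * angInt (fun θ => mW θ * g1 θ ^ 2) := by
    unfold angInt
    rw [integral_add (integrableOn_cont (by fun_prop)) (integrableOn_cont (by fun_prop)),
      integral_const_mul]
    simp
    left; positivity
  rw [e2] at hle
  have : A ≤ π / 2 * (A / 4) + 4 * angInt (fun θ => mW θ * g1 θ ^ 2) := hle
  nlinarith

/-- Angular coercivity in the weighted space. -/
lemma angular_coercive (h1 : ∀ θ, HasDerivAt g (g1 θ) θ) (h2 : ∀ θ, HasDerivAt g1 (g2 θ) θ)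
    (hc : Continuous g2) (h0 : angInt (fun θ => mW θ * g θ) = 0) :
    1 / 200 * angInt (fun θ => se θ * (sin (2 * θ) ^ 2 * g1 θ ^ 2 + g θ ^ 2)) ≤
      angInt (fun θ => (100000 * cos θ + se θ) * (angOp g1 g2 θ * (sin (2 * θ) * g θ))) := by
  have c := continuous_of_hasDerivAt h1
  have c1 := continuous_of_hasDerivAt h2
  have ca := continuous_angOp c1 hc
  have cm := continuous_mW
  have cb : Continuous brk := by unfold brk; fun_prop
  have i1 := angInt_angOp_cos h1 h2 hc
  have i2 := angInt_angOp_se h1 h2 hc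
  have i3 := poincare h1 c1 h0
  have e : angInt (fun θ => (100000 * cos θ + se θ) * (angOp g1 g2 θ * (sin (2 * θ) * g θ))) =
      100000 * angInt (fun θ => angOp g1 g2 θ * (sin (2 * θ) * g θ) * cos θ) +
      angInt (fun θ => se θ * (angOp g1 g2 θ * (sin (2 * θ) * g θ))) := by
    unfold angInt
    rw [← integral_const_mul, ← integral_add (integrableOn_cont (by fun_prop))
      (integrableOn_se_mul (by fun_prop))]
    congr 1; ext θ; ring
  rw [e, i1, i2]
  have i4 : angInt (fun θ => 1 / 200 * (se θ * (sin (2 * θ) ^ 2 * g1 θ ^ 2 + g θ ^ 2))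
      + -(2500 * (mW θ * g θ ^ 2))) ≤
      angInt (fun θ => se θ * (sin (2 * θ) ^ 2 * g1 θ ^ 2 - 1 / 2 * brk θ * g θ ^ 2)) := by
    refine angInt_mono (((integrableOn_se_mul (by fun_prop)).const_mul _).add
      (integrableOn_cont (by fun_prop))) (integrableOn_se_mul (by fun_prop)) fun θ hθ => ?_
    have := brk_le hθ
    have hse := se_pos hθ
    have h9 : 0 ≤ se θ * (sin (2 * θ) ^ 2 * g1 θ ^ 2) := by positivity
    have h10 : 0 ≤ se θ * g θ ^ 2 := by positivity
    nlinarith [mul_le_mul_of_nonneg_right this (sq_nonneg (g θ))]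
  unfold angInt at i3 i4 ⊢
  rw [integral_add ((integrableOn_se_mul (by fun_prop)).const_mul _)
      (integrableOn_cont (by fun_prop)), integral_neg, integral_const_mul, integral_const_mul] at i4
  linarith

/-- The auxiliary function `2 sin²θ g'` is controlled by the right-hand side. -/
lemma aux_bound (h2 : ∀ θ, HasDerivAt g1 (g2 θ) θ) (hc : Continuous g2) :
    angInt (fun θ => se θ * ((1 - cos (2 * θ)) * g1 θ) ^ 2) ≤
      20 * angInt (fun θ => se θ * angOp g1 g2 θ ^ 2) := by
  have c1 := continuous_of_hasDerivAt h2
  have ca := continuous_angOp c1 hc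
  set Q : ℝ → ℝ := fun θ => (1 - cos (2 * θ)) * g1 θ with hQ
  have cQ : Continuous Q := by rw [hQ]; fun_prop
  have cz := continuous_sz
  have hQd : ∀ θ, HasDerivAt Q (2 * sin (2 * θ) * g1 θ + (1 - cos (2 * θ)) * g2 θ) θ :=
    fun θ => (((hasDerivAt_cos_two θ).const_sub 1).mul (h2 θ)).congr_deriv (by ring)
  have key := angInt_deriv_eq (B := fun t => sz t * Q t ^ 2)
    (b := fun θ => se θ * ((2 * (1 - eta) * cos (2 * θ) + 6 * (1 - cos (2 * θ))) * Q θ ^ 2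
      - 2 * (1 - cos (2 * θ)) * (Q θ * angOp g1 g2 θ))) (by fun_prop) ?_
      (integrableOn_se_mul (by fun_prop))
  · rw [sz_zero, sz_top] at key
    have hle : angInt (fun θ => 1 / 50 * (se θ * Q θ ^ 2) - 2 / 5 * (se θ * angOp g1 g2 θ ^ 2)) ≤
      angInt (fun θ => se θ * ((2 * (1 - eta) * cos (2 * θ) + 6 * (1 - cos (2 * θ))) * Q θ ^ 2
      - 2 * (1 - cos (2 * θ)) * (Q θ * angOp g1 g2 θ))) := by
      refine angInt_mono (((integrableOn_se_mul (by fun_prop)).const_mul _).sub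
        ((integrableOn_se_mul (by fun_prop)).const_mul _)) (integrableOn_se_mul (by fun_prop))
        fun θ hθ => ?_
      have hse := se_pos hθ
      have hy : 0 ≤ 1 - cos (2 * θ) := by linarith [cos_le_one (2 * θ)]
      have hy2 : 1 - cos (2 * θ) ≤ 2 := by linarith [neg_one_le_cos (2 * θ)]
      have : 1 / 50 * Q θ ^ 2 - 2 / 5 * angOp g1 g2 θ ^ 2 ≤
        (2 * (1 - eta) * cos (2 * θ) + 6 * (1 - cos (2 * θ))) * Q θ ^ 2
          - 2 * (1 - cos (2 * θ)) * (Q θ * angOp g1 g2 θ) := by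
        unfold eta
        set u := 1 - cos (2 * θ) with hu
        have hcu : cos (2 * θ) = 1 - u := by rw [hu]; ring
        rw [hcu]
        have hh : 0 ≤ u * (5 * Q θ - angOp g1 g2 θ) ^ 2 := by positivity
        nlinarith [mul_nonneg hy (sq_nonneg (Q θ)),
          mul_le_mul_of_nonneg_right hy2 (sq_nonneg (angOp g1 g2 θ))]
      nlinarith [mul_le_mul_of_nonneg_left this hse.le]
    rw [key] at hle
    unfold angInt at hle ⊢
    rw [integral_sub ((integrableOn_se_mul (by fun_prop)).const_mul _)
      ((integrableOn_se_mul (by fun_prop)).const_mul _), integral_const_mul,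
      integral_const_mul] at hle
    linarith
  · intro θ hθ
    refine ((hasDerivAt_sz hθ).mul ((hQd θ).pow 2)).congr_deriv ?_
    simp only [sz_eq hθ, Pi.pow_apply, angOp, hQ]
    push_cast
    have hsc := sin_sq_add_cos_sq (2 * θ)
    linear_combination (4 - 4 * cos (2 * θ)) * se θ * g1 θ ^ 2 * hsc

end OneDim


/-! ### Smooth functions with compact radial support -/

/-- Smooth functions on the plane whose support in `R` is a compact subset of `(0, ∞)`. -/
structure RadTest (f : Fn) : Prop where
  smooth : ContDiff ℝ ∞ f
  supp : ∃ a b : ℝ, 0 < a ∧ ∀ p : ℝ × ℝ, p.1 ∉ Icc a b → f p = 0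

lemma hasDerivAt_fst {f : Fn} {p : ℝ × ℝ} (hf : DifferentiableAt ℝ f p) :
    HasDerivAt (fun r => f (r, p.2)) (fderiv ℝ f p (1, 0)) p.1 := by
  have h1 : HasDerivAt (fun r : ℝ => (r, p.2)) ((1 : ℝ), (0 : ℝ)) p.1 :=
    (hasDerivAt_id p.1).prodMk (hasDerivAt_const p.1 p.2)
  exact (show HasFDerivAt f (fderiv ℝ f p) (p.1, p.2) from hf.hasFDerivAt).comp_hasDerivAt p.1 h1

lemma hasDerivAt_snd {f : Fn} {p : ℝ × ℝ} (hf : DifferentiableAt ℝ f p) :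
    HasDerivAt (fun t => f (p.1, t)) (fderiv ℝ f p (0, 1)) p.2 := by
  have h1 : HasDerivAt (fun t : ℝ => (p.1, t)) ((0 : ℝ), (1 : ℝ)) p.2 :=
    (hasDerivAt_const p.2 p.1).prodMk (hasDerivAt_id p.2)
  exact (show HasFDerivAt f (fderiv ℝ f p) (p.1, p.2) from hf.hasFDerivAt).comp_hasDerivAt p.2 h1

lemma DR_eq {f : Fn} {p : ℝ × ℝ} (hf : DifferentiableAt ℝ f p) :
    DR f p = p.1 * fderiv ℝ f p (1, 0) := by
  rw [DR, (hasDerivAt_fst hf).deriv]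

lemma dTheta_eq {f : Fn} {p : ℝ × ℝ} (hf : DifferentiableAt ℝ f p) :
    dTheta f p = fderiv ℝ f p (0, 1) := by
  rw [dTheta, (hasDerivAt_snd hf).deriv]

section smooth

variable {f g : Fn}

lemma contDiff_fderiv_apply (hf : ContDiff ℝ ∞ f) (v : ℝ × ℝ) :
    ContDiff ℝ ∞ (fun p => fderiv ℝ f p v) :=
  (hf.fderiv_right (m := ∞) (by simp)).clm_apply contDiff_const

lemma ContDiff.diffAt (hf : ContDiff ℝ ∞ f) (p : ℝ × ℝ) : DifferentiableAt ℝ f p :=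
  (hf.differentiable (by simp)) p

lemma DR_fun_eq (hf : ContDiff ℝ ∞ f) : DR f = fun p => p.1 * fderiv ℝ f p (1, 0) :=
  funext fun p => DR_eq (ContDiff.diffAt hf p)

lemma dTheta_fun_eq (hf : ContDiff ℝ ∞ f) : dTheta f = fun p => fderiv ℝ f p (0, 1) :=
  funext fun p => dTheta_eq (ContDiff.diffAt hf p)

lemma contDiff_DR (hf : ContDiff ℝ ∞ f) : ContDiff ℝ ∞ (DR f) := by
  rw [DR_fun_eq hf]; exact contDiff_fst.mul (contDiff_fderiv_apply hf _)

lemma contDiff_dTheta (hf : ContDiff ℝ ∞ f) : ContDiff ℝ ∞ (dTheta f) := by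
  rw [dTheta_fun_eq hf]; exact contDiff_fderiv_apply hf _

lemma hasDerivAt_dTheta (hf : ContDiff ℝ ∞ f) (R θ : ℝ) :
    HasDerivAt (fun t => f (R, t)) (dTheta f (R, θ)) θ := by
  rw [dTheta_eq (ContDiff.diffAt hf _)]
  exact hasDerivAt_snd (p := (R, θ)) (ContDiff.diffAt hf _)

lemma DR_mul (hf : ContDiff ℝ ∞ f) (hg : ContDiff ℝ ∞ g) (p : ℝ × ℝ) :
    DR (fun p => f p * g p) p = DR f p * g p + f p * DR g p := by
  have hf' := ContDiff.diffAt hf p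
  have hg' := ContDiff.diffAt hg p
  rw [DR_eq hf', DR_eq hg', DR_eq (f := fun p => f p * g p) (hf'.mul hg'), fderiv_fun_mul hf' hg']
  simp; ring

lemma dTheta_mul (hf : ContDiff ℝ ∞ f) (hg : ContDiff ℝ ∞ g) (p : ℝ × ℝ) :
    dTheta (fun p => f p * g p) p = dTheta f p * g p + f p * dTheta g p := by
  have hf' := ContDiff.diffAt hf p
  have hg' := ContDiff.diffAt hg p
  rw [dTheta_eq hf', dTheta_eq hg', dTheta_eq (f := fun p => f p * g p) (hf'.mul hg'), fderiv_fun_mul hf' hg']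
  simp; ring

lemma DR_add (hf : ContDiff ℝ ∞ f) (hg : ContDiff ℝ ∞ g) (p : ℝ × ℝ) :
    DR (fun p => f p + g p) p = DR f p + DR g p := by
  have hf' := ContDiff.diffAt hf p
  have hg' := ContDiff.diffAt hg p
  rw [DR_eq hf', DR_eq hg', DR_eq (f := fun p => f p + g p) (hf'.add hg'), fderiv_fun_add hf' hg']
  simp; ring

lemma dTheta_add (hf : ContDiff ℝ ∞ f) (hg : ContDiff ℝ ∞ g) (p : ℝ × ℝ) :
    dTheta (fun p => f p + g p) p = dTheta f p + dTheta g p := by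
  have hf' := ContDiff.diffAt hf p
  have hg' := ContDiff.diffAt hg p
  rw [dTheta_eq hf', dTheta_eq hg', dTheta_eq (f := fun p => f p + g p) (hf'.add hg'), fderiv_fun_add hf' hg']
  simp

lemma DR_angular {a : ℝ → ℝ} (p : ℝ × ℝ) : DR (fun p => a p.2) p = 0 := by
  simp [DR]

lemma DR_angular_mul {a : ℝ → ℝ} (ha : ContDiff ℝ ∞ a) (hf : ContDiff ℝ ∞ f) (p : ℝ × ℝ) :
    DR (fun p => a p.2 * f p) p = a p.2 * DR f p := by
  rw [DR_mul (f := fun p => a p.2) (ha.comp contDiff_snd) hf]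
  rw [DR_angular]; simp

lemma dTheta_DR (hf : ContDiff ℝ ∞ f) : dTheta (DR f) = DR (dTheta f) := by
  funext p
  have h1 := contDiff_fderiv_apply hf (1, 0)
  have h2 := contDiff_fderiv_apply hf (0, 1)
  have hs : IsSymmSndFDerivAt ℝ f p := (hf.contDiffAt).isSymmSndFDerivAt (by
    simp only [minSmoothness_of_isRCLikeNormedField]; exact WithTop.coe_le_coe.2 (le_top : (2 : ℕ∞) ≤ ⊤))
  have hd : DifferentiableAt ℝ (fderiv ℝ f) p :=
    ((hf.fderiv_right (m := ∞) (by simp)).differentiable (by simp)) p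
  have e : ∀ v w : ℝ × ℝ, fderiv ℝ (fun q => fderiv ℝ f q v) p w = fderiv ℝ (fderiv ℝ f) p w v := by
    intro v w
    rw [fderiv_clm_apply hd (differentiableAt_const v)]
    simp
  rw [DR_fun_eq hf, dTheta_fun_eq hf, dTheta_mul contDiff_fst h1, DR_eq (ContDiff.diffAt h2 p),
    dTheta_eq (ContDiff.diffAt h1 p), e, e, hs.eq (1, 0) (0, 1)]
  have : dTheta Prod.fst p = 0 := by simp [dTheta]
  rw [this]; ring

lemma RadTest.DR (hf : RadTest f) : RadTest (DR f) := by
  refine ⟨contDiff_DR hf.smooth, ?_⟩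
  obtain ⟨a, b, ha, h⟩ := hf.supp
  refine ⟨a, b, ha, fun p hp => ?_⟩
  have : (fun r => f (r, p.2)) =ᶠ[𝓝 p.1] fun _ => 0 := by
    filter_upwards [isClosed_Icc.isOpen_compl.mem_nhds hp] with r hr using h (r, p.2) hr
  rw [PolarBiotSavart.DR, this.deriv_eq]; simp

lemma RadTest.dTheta (hf : RadTest f) : RadTest (dTheta f) := by
  refine ⟨contDiff_dTheta hf.smooth, ?_⟩
  obtain ⟨a, b, ha, h⟩ := hf.supp
  refine ⟨a, b, ha, fun p hp => ?_⟩
  have : (fun r => f (p.1, r)) = fun _ => 0 := funext fun r => h (p.1, r) hp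
  rw [PolarBiotSavart.dTheta, this]; simp

lemma RadTest.mul_left (hf : RadTest f) {a : Fn} (ha : ContDiff ℝ ∞ a) :
    RadTest (fun p => a p * f p) := by
  refine ⟨ha.mul hf.smooth, ?_⟩
  obtain ⟨c, b, hc, h⟩ := hf.supp
  exact ⟨c, b, hc, fun p hp => by rw [h p hp, mul_zero]⟩

lemma RadTest.mul (hf : RadTest f) (hg : RadTest g) : RadTest (fun p => f p * g p) :=
  hg.mul_left hf.smooth

lemma RadTest.sq (hf : RadTest f) : RadTest (fun p => f p ^ 2) := by
  simpa only [pow_two] using hf.mul hf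

lemma RadTest.const_mul (hf : RadTest f) (c : ℝ) : RadTest (fun p => c * f p) :=
  hf.mul_left contDiff_const

lemma RadTest.ang_mul (hf : RadTest f) {a : ℝ → ℝ} (ha : ContDiff ℝ ∞ a) :
    RadTest (fun p => a p.2 * f p) :=
  hf.mul_left (ha.comp contDiff_snd)

lemma RadTest.add (hf : RadTest f) (hg : RadTest g) : RadTest (fun p => f p + g p) := by
  refine ⟨hf.smooth.add hg.smooth, ?_⟩
  obtain ⟨a, b, ha, h⟩ := hf.supp
  obtain ⟨a', b', ha', h'⟩ := hg.supp
  refine ⟨min a a', max b b', lt_min ha ha', fun p hp => ?_⟩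
  rw [h p fun hh => hp ⟨(min_le_left _ _).trans hh.1, hh.2.trans (le_max_left _ _)⟩,
    h' p fun hh => hp ⟨(min_le_right _ _).trans hh.1, hh.2.trans (le_max_right _ _)⟩, add_zero]

lemma RadTest.sub (hf : RadTest f) (hg : RadTest g) : RadTest (fun p => f p - g p) := by
  have := hf.add (hg.const_mul (-1))
  refine ⟨hf.smooth.sub hg.smooth, ?_⟩
  obtain ⟨a, b, ha, h⟩ := this.supp
  exact ⟨a, b, ha, fun p hp => by have := h p hp; linarith⟩

end smooth

/-! ### Weighted integrals over the strip -/

lemma measurableSet_strip : MeasurableSet strip := measurableSet_Ioi.prod measurableSet_Ioo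

lemma volume_restrict_strip : (volume : Measure (ℝ × ℝ)).restrict strip =
    (volume.restrict (Ioi (0 : ℝ))).prod (volume.restrict J₀) := by
  rw [Measure.volume_eq_prod, strip, Measure.prod_restrict]

/-- The integral over the strip against `w(R)² ρ(θ)`. -/
def wInt (ρ : ℝ → ℝ) (f : Fn) : ℝ := ∫ p in strip, f p * (wRad p.1 ^ 2 * ρ p.2)

/-- Integrability over the strip against `w(R)² ρ(θ)`. -/
def WIntegrable (ρ : ℝ → ℝ) (f : Fn) : Prop :=
  IntegrableOn (fun p => f p * (wRad p.1 ^ 2 * ρ p.2)) strip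

lemma measurable_wRad : Measurable wRad := by unfold wRad; fun_prop

lemma continuousOn_wRad : ContinuousOn wRad (Ioi 0) := by
  unfold wRad
  exact ContinuousOn.div (by fun_prop) (by fun_prop) fun x hx => pow_ne_zero _ (ne_of_gt hx)

section

variable {f g : Fn} {ρ : ℝ → ℝ}

lemma wIntegrable_of_cont (hf : Continuous f)
    (hs : ∃ a b : ℝ, 0 < a ∧ ∀ p : ℝ × ℝ, p.1 ∉ Icc a b → f p = 0)
    (hρ : IntegrableOn ρ J₀) : WIntegrable ρ f := by
  obtain ⟨a, b, ha, h⟩ := hs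
  obtain ⟨C, hC⟩ := ((isCompact_Icc (a := a) (b := b)).prod
    (isCompact_Icc (a := (0 : ℝ)) (b := π / 2))).exists_bound_of_continuousOn hf.continuousOn
  have i1 : Integrable ((Icc a b).indicator fun R => wRad R ^ 2) (volume.restrict (Ioi (0 : ℝ))) := by
    refine Integrable.restrict ?_
    rw [integrable_indicator_iff measurableSet_Icc]
    refine ContinuousOn.integrableOn_compact isCompact_Icc ?_
    exact (continuousOn_wRad.mono fun x hx => lt_of_lt_of_le ha hx.1).pow 2
  have i2 := i1.mul_prod hρ
  rw [← volume_restrict_strip] at i2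
  have i3 := Integrable.bdd_mul (c := max C 0) i2 hf.aestronglyMeasurable.restrict (f := f) ?_
  · refine (integrable_congr (Eventually.of_forall fun p => ?_)).1 i3
    by_cases hp : p.1 ∈ Icc a b
    · simp [indicator_of_mem hp]
    · simp [h p hp]
  · filter_upwards [ae_restrict_mem measurableSet_strip] with p hp
    by_cases h' : p.1 ∈ Icc a b
    · exact (hC p ⟨h', Ioo_subset_Icc_self hp.2⟩).trans (le_max_left _ _)
    · rw [h p h', norm_zero]; exact le_max_right _ _

lemma RadTest.wIntegrable (hf : RadTest f) (hρ : IntegrableOn ρ J₀) : WIntegrable ρ f :=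
  wIntegrable_of_cont hf.smooth.continuous hf.supp hρ

lemma wInt_nonneg_of_inner {f : Fn} (hf : IntegrableOn f strip)
    (h : ∀ R, 0 < R → 0 ≤ angInt fun θ => f (R, θ)) : 0 ≤ ∫ p in strip, f p := by
  rw [IntegrableOn, volume_restrict_strip] at hf
  rw [volume_restrict_strip, integral_prod f hf]
  exact setIntegral_nonneg measurableSet_Ioi fun R hR => h R hR

lemma wInt_mono (hρ : ∀ θ ∈ J₀, 0 ≤ ρ θ) (hf : WIntegrable ρ f)
    (hg : WIntegrable ρ g) (h : ∀ p ∈ strip, f p ≤ g p) : wInt ρ f ≤ wInt ρ g :=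
  setIntegral_mono_on hf hg measurableSet_strip fun p hp =>
    mul_le_mul_of_nonneg_right (h p hp) (mul_nonneg (sq_nonneg _) (hρ _ hp.2))

lemma wInt_nonneg (hρ : ∀ θ ∈ J₀, 0 ≤ ρ θ) (h : ∀ p ∈ strip, 0 ≤ f p) : 0 ≤ wInt ρ f :=
  setIntegral_nonneg measurableSet_strip fun p hp =>
    mul_nonneg (h p hp) (mul_nonneg (sq_nonneg _) (hρ _ hp.2))

lemma WIntegrable.add (hf : WIntegrable ρ f) (hg : WIntegrable ρ g) :
    WIntegrable ρ (fun p => f p + g p) := by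
  have := Integrable.add hf hg
  refine this.congr (Eventually.of_forall fun p => ?_)
  simp [add_mul]

lemma WIntegrable.const_mul (hf : WIntegrable ρ f) (c : ℝ) : WIntegrable ρ (fun p => c * f p) := by
  have := Integrable.const_mul hf c
  refine this.congr (Eventually.of_forall fun p => ?_)
  simp [mul_assoc]

lemma wInt_add (hf : WIntegrable ρ f) (hg : WIntegrable ρ g) :
    wInt ρ (fun p => f p + g p) = wInt ρ f + wInt ρ g := by
  unfold wInt
  rw [← integral_add hf hg]
  congr 1; ext p; ring

lemma wInt_const_mul (c : ℝ) : wInt ρ (fun p => c * f p) = c * wInt ρ f := by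
  unfold wInt
  rw [← integral_const_mul]
  congr 1; ext p; ring

/-- The multiplier produced by the radial weight when integrating by parts. -/
def qR (p : ℝ × ℝ) : ℝ := 1 - 4 / (p.1 + 1)

lemma abs_qR_le {p : ℝ × ℝ} (hp : p ∈ strip) : |qR p| ≤ 3 := by
  have h : 0 < p.1 := hp.1
  have h1 : 0 < 4 / (p.1 + 1) := by positivity
  have h2 : 4 / (p.1 + 1) ≤ 4 := by rw [div_le_iff₀ (by linarith)]; linarith
  rw [qR, abs_le]; constructor <;> linarith

lemma WIntegrable.qR_mul (hf : WIntegrable ρ f) : WIntegrable ρ (fun p => qR p * f p) := by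
  have := Integrable.bdd_mul (c := 3) hf (f := qR)
    (Measurable.aestronglyMeasurable (by unfold qR; fun_prop)) ?_
  · refine this.congr (Eventually.of_forall fun p => ?_)
    simp [mul_assoc]
  · filter_upwards [ae_restrict_mem measurableSet_strip] with p hp using abs_qR_le hp

lemma hasDerivAt_radial_weight {R : ℝ} (hR : 0 < R) :
    HasDerivAt (fun r => r * wRad r ^ 2) ((1 - 4 / (R + 1)) * wRad R ^ 2) R := by
  have h1 : HasDerivAt (fun r : ℝ => (1 + r) ^ 2 / r ^ 2)
      ((2 * (1 + R) * R ^ 2 - (1 + R) ^ 2 * (2 * R)) / (R ^ 2) ^ 2) R := by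
    have a1 := ((hasDerivAt_id R).const_add 1).pow 2
    have a2 := (hasDerivAt_id R).pow 2
    refine (a1.div a2 (by simpa using hR.ne')).congr_deriv ?_
    simp
  refine ((hasDerivAt_id R).mul (h1.pow 2)).congr_deriv ?_
  simp only [wRad, id, Pi.pow_apply]
  have : R ≠ 0 := hR.ne'
  have : R + 1 ≠ 0 := by positivity
  push_cast
  field_simp
  ring

/-- Integration by parts in `R`. -/
lemma wInt_DR (hf : RadTest f) (hρ : IntegrableOn ρ J₀) :
    wInt ρ (DR f) + wInt ρ (fun p => qR p * f p) = 0 := by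
  have i1 := hf.DR.wIntegrable hρ
  have i2 := (hf.wIntegrable hρ).qR_mul
  rw [← wInt_add i1 i2]
  have i3 := i1.add i2
  unfold WIntegrable at i3
  rw [IntegrableOn, volume_restrict_strip] at i3
  unfold wInt
  rw [volume_restrict_strip, integral_prod_symm _ i3]
  refine integral_eq_zero_of_ae (Eventually.of_forall fun θ => ?_)
  obtain ⟨a, b, ha, hs⟩ := hf.supp
  have e : ∀ R, (DR f (R, θ) + qR (R, θ) * f (R, θ)) * (wRad R ^ 2 * ρ θ) =
      ρ θ * ((DR f (R, θ) + qR (R, θ) * f (R, θ)) * wRad R ^ 2) := fun R => by ring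
  simp only [e, integral_const_mul, Pi.zero_apply]
  by_cases hi : IntegrableOn (fun R => (DR f (R, θ) + qR (R, θ) * f (R, θ)) * wRad R ^ 2) (Ioi 0)
  swap
  · rw [integral_undef hi, mul_zero]
  have := integral_Ioi_of_hasDerivAt_of_tendsto (a := 0) (m := 0)
    (f := fun R => R * wRad R ^ 2 * f (R, θ)) ?_ ?_ hi ?_
  · rw [this, zero_mul, zero_mul, sub_zero, mul_zero]
  · have : (fun R => R * wRad R ^ 2 * f (R, θ)) =ᶠ[𝓝 0] fun _ => 0 := by
      filter_upwards [Iio_mem_nhds ha] with R hR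
      rw [hs (R, θ) fun hh => absurd hh.1 (not_le.2 hR), mul_zero]
    exact (continuousAt_const.congr this.symm).continuousWithinAt
  · intro R hR
    have h1 := hasDerivAt_radial_weight hR
    have h2 := hasDerivAt_fst (p := (R, θ)) (ContDiff.diffAt hf.smooth _)
    refine (h1.mul h2).congr_deriv ?_
    rw [DR_eq (ContDiff.diffAt hf.smooth _), qR]
    ring
  · have : (fun R => R * wRad R ^ 2 * f (R, θ)) =ᶠ[atTop] fun _ => 0 := by
      filter_upwards [Ioi_mem_atTop b] with R hR
      rw [hs (R, θ) fun hh => absurd hh.2 (not_le.2 hR), mul_zero]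
    exact (tendsto_congr' this).2 tendsto_const_nhds

lemma wInt_DR_mul (hf : RadTest f) (hg : RadTest g) (hρ : IntegrableOn ρ J₀) :
    wInt ρ (fun p => DR f p * g p) + wInt ρ (fun p => f p * DR g p) +
      wInt ρ (fun p => qR p * (f p * g p)) = 0 := by
  have := wInt_DR (hf.mul hg) hρ
  have e : DR (fun p => f p * g p) = fun p => DR f p * g p + f p * DR g p :=
    funext fun p => DR_mul hf.smooth hg.smooth p
  rw [e, wInt_add ((hf.DR.mul hg).wIntegrable hρ) ((hf.mul hg.DR).wIntegrable hρ)] at this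
  exact this

/-- Young's inequality for weighted integrals. -/
lemma abs_wInt_mul_le (hρ0 : ∀ θ ∈ J₀, 0 ≤ ρ θ) {c : Fn} {k t s : ℝ}
    (hc : ∀ p ∈ strip, |c p| ≤ k) (ht : 0 ≤ t) (hs : 0 ≤ s) (hts : k ^ 2 ≤ 4 * t * s)
    (hfg : WIntegrable ρ fun p => c p * (f p * g p)) (hf : WIntegrable ρ fun p => f p ^ 2)
    (hg : WIntegrable ρ fun p => g p ^ 2) :
    |wInt ρ fun p => c p * (f p * g p)| ≤
      t * wInt ρ (fun p => f p ^ 2) + s * wInt ρ (fun p => g p ^ 2) := by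
  have key : ∀ p ∈ strip, |c p * (f p * g p)| ≤ t * f p ^ 2 + s * g p ^ 2 := by
    intro p hp
    have h1 : |c p * (f p * g p)| ≤ k * |f p * g p| := by
      rw [abs_mul]; exact mul_le_mul_of_nonneg_right (hc p hp) (abs_nonneg _)
    refine h1.trans ?_
    refine le_of_sq_le_sq ?_ (by positivity)
    rw [mul_pow, sq_abs]
    have h2 : k ^ 2 * (f p * g p) ^ 2 ≤ 4 * t * s * (f p * g p) ^ 2 :=
      mul_le_mul_of_nonneg_right hts (sq_nonneg _)
    nlinarith [sq_nonneg (t * f p ^ 2 - s * g p ^ 2)]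
  rw [← wInt_const_mul, ← wInt_const_mul, ← wInt_add (hf.const_mul t) (hg.const_mul s), abs_le]
  constructor
  · rw [neg_le, ← neg_one_mul, ← wInt_const_mul]
    refine wInt_mono hρ0 (hfg.const_mul _) ((hf.const_mul t).add (hg.const_mul s)) fun p hp => ?_
    have := (abs_le.1 (key p hp)).1
    linarith
  · exact wInt_mono hρ0 hfg ((hf.const_mul t).add (hg.const_mul s)) fun p hp =>
      (abs_le.1 (key p hp)).2

end

/-! ### The energy estimate -/

/-- The angular weight of the energy space. -/
def om (θ : ℝ) : ℝ := 100000 * cos θ + se θ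

lemma integrableOn_om : IntegrableOn om J₀ := (integrableOn_cont (by fun_prop)).add integrableOn_se

lemma om_nonneg : ∀ θ ∈ J₀, 0 ≤ om θ := fun θ hθ => by
  have := se_pos hθ
  have := cos_pos_strip hθ
  unfold om; positivity

lemma se_nonneg : ∀ θ ∈ J₀, 0 ≤ se θ := fun _ hθ => (se_pos hθ).le

/-- Profiles `g` such that `sin(2θ) g` is orthogonal to the kernel. -/
structure Core (g : Fn) : Prop where
  test : RadTest g
  mean : ∀ R, angInt (fun θ => mW θ * g (R, θ)) = 0

/-- The stream function `sin(2θ) g`. -/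
def psi (g : Fn) (p : ℝ × ℝ) : ℝ := sin (2 * p.2) * g p

/-- The angular part `-∂_θθΨ + ∂_θ(tan θ Ψ) - 6Ψ` for `Ψ = sin(2θ) g`. -/
def angL (g : Fn) (p : ℝ × ℝ) : ℝ :=
  -(sin (2 * p.2) * dTheta (dTheta g) p) - (5 * cos (2 * p.2) - 1) * dTheta g p

/-- The full operator for `Ψ = sin(2θ) g`. -/
def fullL (α b : ℝ) (g : Fn) (p : ℝ × ℝ) : ℝ :=
  -α ^ 2 * DR (DR (psi g)) p + -(b * α) * DR (psi g) p + angL g p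

/-- The energy density of `Ψ = sin(2θ) g`. -/
def eDens (g : Fn) (p : ℝ × ℝ) : ℝ := sin (2 * p.2) ^ 2 * dTheta g p ^ 2 + g p ^ 2

section

variable {g : Fn}

lemma contDiff_sin_two : ContDiff ℝ ∞ fun θ : ℝ => sin (2 * θ) := by fun_prop

lemma RadTest.psi (hg : RadTest g) : RadTest (psi g) := hg.ang_mul contDiff_sin_two

lemma RadTest.angL (hg : RadTest g) : RadTest (angL g) := by
  have h1 := (hg.dTheta.dTheta.ang_mul contDiff_sin_two).const_mul (-1)
  have h2 := hg.dTheta.ang_mul (a := fun θ => 5 * cos (2 * θ) - 1) (by fun_prop)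
  have := h1.sub h2
  simp only [neg_one_mul] at this
  exact this

lemma RadTest.fullL (hg : RadTest g) (α b : ℝ) : RadTest (fullL α b g) :=
  ((hg.psi.DR.DR.const_mul _).add (hg.psi.DR.const_mul _)).add hg.angL

lemma RadTest.eDens (hg : RadTest g) : RadTest (eDens g) :=
  (hg.dTheta.sq.ang_mul (contDiff_sin_two.pow 2)).add hg.sq

lemma DR_psi (hg : RadTest g) : DR (psi g) = psi (DR g) :=
  funext fun p => DR_angular_mul contDiff_sin_two hg.smooth p

lemma DR_angL (hg : RadTest g) : DR (angL g) = angL (DR g) := by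
  funext p
  have c1 := (contDiff_dTheta (contDiff_dTheta hg.smooth))
  have c2 := (contDiff_dTheta hg.smooth)
  have e : angL g = fun p => (fun θ => -sin (2 * θ)) p.2 * dTheta (dTheta g) p +
      (fun θ => -(5 * cos (2 * θ) - 1)) p.2 * dTheta g p := by
    funext p; simp only [angL]; ring
  have s1 : ContDiff ℝ ∞ fun θ : ℝ => -sin (2 * θ) := by fun_prop
  have s2 : ContDiff ℝ ∞ fun θ : ℝ => -(5 * cos (2 * θ) - 1) := by fun_prop
  rw [e, DR_add (f := fun p => (fun θ => -sin (2 * θ)) p.2 * dTheta (dTheta g) p)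
    (g := fun p => (fun θ => -(5 * cos (2 * θ) - 1)) p.2 * dTheta g p)
    ((s1.comp contDiff_snd).mul c1) ((s2.comp contDiff_snd).mul c2), DR_angular_mul s1 c1, DR_angular_mul s2 c2, angL, dTheta_DR hg.smooth, dTheta_DR c2]
  ring

lemma Core.DR (hg : Core g) : Core (DR g) := by
  refine ⟨hg.test.DR, fun R => ?_⟩
  have hc : Continuous (fun p : ℝ × ℝ => mW p.2 * fderiv ℝ g p (1, 0)) :=
    (continuous_mW.comp continuous_snd).mul (contDiff_fderiv_apply hg.test.smooth _).continuous
  obtain ⟨C, hC⟩ := ((isCompact_Icc (a := R - 1) (b := R + 1)).prod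
    (isCompact_Icc (a := (0 : ℝ)) (b := π / 2))).exists_bound_of_continuousOn hc.continuousOn
  have hm := continuous_mW
  have hgc := hg.test.smooth.continuous
  have key := (hasDerivAt_integral_of_dominated_loc_of_deriv_le (μ := volume.restrict J₀)
    (F := fun r θ => mW θ * g (r, θ)) (F' := fun r θ => mW θ * fderiv ℝ g (r, θ) (1, 0)) (x₀ := R)
    (bound := fun _ => C) (s := Icc (R - 1) (R + 1))
    (Icc_mem_nhds (by linarith) (by linarith))
    (Eventually.of_forall fun r => (Continuous.aestronglyMeasurable (by fun_prop)))
    (integrableOn_cont (by fun_prop))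
    ((hc.comp (by fun_prop : Continuous fun θ : ℝ => (R, θ))).aestronglyMeasurable) ?_
    (integrable_const C) ?_).2
  · have h0 : (fun r => ∫ θ in J₀, mW θ * g (r, θ)) = fun _ => 0 :=
      funext fun r => hg.mean r
    rw [h0] at key
    have h1 := key.unique (hasDerivAt_const R (0 : ℝ))
    have e : ∀ θ, mW θ * PolarBiotSavart.DR g (R, θ) = R * (mW θ * fderiv ℝ g (R, θ) (1, 0)) := by
      intro θ; rw [DR_eq (ContDiff.diffAt hg.test.smooth _)]; ring
    simp only [e, angInt]
    rw [integral_const_mul, h1, mul_zero]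
  · filter_upwards [ae_restrict_mem measurableSet_Ioo] with θ hθ r hr
    exact hC (r, θ) ⟨hr, Ioo_subset_Icc_self hθ⟩
  · filter_upwards with θ r hr
    exact (hasDerivAt_fst (p := (r, θ)) (ContDiff.diffAt hg.test.smooth _)).const_mul _

lemma continuous_slice {f : Fn} (hf : ContDiff ℝ ∞ f) (R : ℝ) :
    Continuous fun θ => f (R, θ) := hf.continuous.comp (by fun_prop)

/-- Coercivity of the angular operator, integrated in `R`. -/
lemma coercive (hg : Core g) :
    1 / 200 * wInt se (eDens g) ≤ wInt om (fun p => angL g p * psi g p) := by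
  have i1 := (hg.test.eDens.wIntegrable integrableOn_se).const_mul (1 / 200)
  have i2 := (hg.test.angL.mul hg.test.psi).wIntegrable integrableOn_om
  rw [← sub_nonneg, ← wInt_const_mul]
  unfold wInt
  rw [← integral_sub i2 i1]
  refine wInt_nonneg_of_inner (i2.sub i1) fun R _ => ?_
  have s0 := hg.test.smooth
  have s1 := contDiff_dTheta s0
  have s2 := contDiff_dTheta s1
  have c0 := continuous_slice s0 R
  have c1 := continuous_slice s1 R
  have c2 := continuous_slice s2 R
  have key := angular_coercive (g := fun θ => g (R, θ)) (g1 := fun θ => dTheta g (R, θ))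
    (g2 := fun θ => dTheta (dTheta g) (R, θ)) (hasDerivAt_dTheta s0 R) (hasDerivAt_dTheta s1 R)
    c2 (hg.mean R)
  have ca := continuous_angOp c1 c2
  have e : (fun θ => angL g (R, θ) * psi g (R, θ) * (wRad R ^ 2 * om θ) -
      1 / 200 * eDens g (R, θ) * (wRad R ^ 2 * se θ)) =
      fun θ => wRad R ^ 2 * ((100000 * cos θ + se θ) *
        (angOp (fun θ => dTheta g (R, θ)) (fun θ => dTheta (dTheta g) (R, θ)) θ *
          (sin (2 * θ) * g (R, θ))) - 1 / 200 * (se θ *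
          (sin (2 * θ) ^ 2 * dTheta g (R, θ) ^ 2 + g (R, θ) ^ 2))) := by
    funext θ
    simp only [angL, psi, om, eDens, angOp]; ring
  show 0 ≤ angInt (fun θ => angL g (R, θ) * psi g (R, θ) * (wRad R ^ 2 * om θ) -
      1 / 200 * eDens g (R, θ) * (wRad R ^ 2 * se θ))
  rw [e]
  unfold angInt at key ⊢
  rw [integral_const_mul]
  refine mul_nonneg (sq_nonneg _) ?_
  rw [integral_sub _ ((integrableOn_se_mul (by fun_prop)).const_mul _), integral_const_mul]
  · linarith
  · simp only [add_mul]
    exact (integrableOn_cont (by fun_prop)).add (integrableOn_se_mul (by fun_prop))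

/-- The function `2 sin²θ ∂_θ g`. -/
def auxQ (g : Fn) (p : ℝ × ℝ) : ℝ := (1 - cos (2 * p.2)) * dTheta g p

lemma RadTest.auxQ (hg : RadTest g) : RadTest (auxQ g) :=
  hg.dTheta.ang_mul (a := fun θ => 1 - cos (2 * θ)) (by fun_prop)

lemma wInt_auxQ_le (hg : RadTest g) :
    wInt se (fun p => auxQ g p ^ 2) ≤ 20 * wInt se (fun p => angL g p ^ 2) := by
  have i1 := hg.auxQ.sq.wIntegrable integrableOn_se
  have i2 := (hg.angL.sq.wIntegrable integrableOn_se).const_mul 20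
  rw [← sub_nonneg, ← wInt_const_mul]
  unfold wInt
  rw [← integral_sub i2 i1]
  refine wInt_nonneg_of_inner (i2.sub i1) fun R _ => ?_
  have s1 := contDiff_dTheta hg.smooth
  have s2 := contDiff_dTheta s1
  have c1 := continuous_slice s1 R
  have c2 := continuous_slice s2 R
  have key := aux_bound (g1 := fun θ => dTheta g (R, θ))
    (g2 := fun θ => dTheta (dTheta g) (R, θ)) (hasDerivAt_dTheta s1 R) c2
  have ca := continuous_angOp c1 c2
  have e : (fun θ => 20 * angL g (R, θ) ^ 2 * (wRad R ^ 2 * se θ) -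
      auxQ g (R, θ) ^ 2 * (wRad R ^ 2 * se θ)) =
      fun θ => wRad R ^ 2 * (20 * (se θ *
        angOp (fun θ => dTheta g (R, θ)) (fun θ => dTheta (dTheta g) (R, θ)) θ ^ 2) -
        se θ * ((1 - cos (2 * θ)) * dTheta g (R, θ)) ^ 2) := by
    funext θ
    simp only [angL, auxQ, angOp]; ring
  show 0 ≤ angInt (fun θ => 20 * angL g (R, θ) ^ 2 * (wRad R ^ 2 * se θ) -
      auxQ g (R, θ) ^ 2 * (wRad R ^ 2 * se θ))
  rw [e]
  unfold angInt at key ⊢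
  rw [integral_const_mul]
  refine mul_nonneg (sq_nonneg _) ?_
  rw [integral_sub ((integrableOn_se_mul (by fun_prop)).const_mul _)
    (integrableOn_se_mul (by fun_prop)), integral_const_mul]
  linarith

lemma om_le {θ : ℝ} (h : θ ∈ J₀) : om θ ≤ 100001 * se θ := by
  have := one_le_se h
  have := cos_le_one θ
  unfold om; linarith

lemma se_le_om {θ : ℝ} (h : θ ∈ J₀) : se θ ≤ om θ := by
  have := cos_pos_strip h
  unfold om; linarith

lemma wInt_om_le {f : Fn} (hf : RadTest f) (h0 : ∀ p, 0 ≤ f p) :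
    wInt om f ≤ 100001 * wInt se f := by
  rw [← wInt_const_mul]
  refine setIntegral_mono_on (hf.wIntegrable integrableOn_om)
    ((hf.wIntegrable integrableOn_se).const_mul _) measurableSet_strip fun p hp => ?_
  have := om_le hp.2
  have h1 := mul_nonneg (h0 p) (sq_nonneg (wRad p.1))
  nlinarith [mul_le_mul_of_nonneg_left this h1]

lemma wInt_se_le {f : Fn} (hf : RadTest f) (h0 : ∀ p, 0 ≤ f p) : wInt se f ≤ wInt om f := by
  refine setIntegral_mono_on (hf.wIntegrable integrableOn_se)
    (hf.wIntegrable integrableOn_om) measurableSet_strip fun p hp => ?_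
  have := se_le_om hp.2
  have h1 := mul_nonneg (h0 p) (sq_nonneg (wRad p.1))
  nlinarith [mul_le_mul_of_nonneg_left this h1]

lemma sin_sq_le_one' (θ : ℝ) : sin (2 * θ) ^ 2 ≤ 1 := sin_sq_le_one _

lemma wInt_psi_sq_le (hg : RadTest g) : wInt se (fun p => psi g p ^ 2) ≤ wInt se (eDens g) := by
  refine wInt_mono se_nonneg (hg.psi.sq.wIntegrable integrableOn_se)
    (hg.eDens.wIntegrable integrableOn_se) fun p _ => ?_
  unfold psi eDens
  rw [mul_pow]
  nlinarith [sin_sq_le_one' p.2, sq_nonneg (g p), mul_nonneg (sq_nonneg (sin (2 * p.2))) (sq_nonneg (dTheta g p))]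

/-- The constant in the energy estimate. -/
def cEn : ℝ := 10 ^ 20

/-- The upper bound for `α` in the energy estimate. -/
def alphaMax : ℝ := 1 / 10 ^ 12

/-- The scalar inequalities behind the energy estimate. -/
lemma energy_algebra {α b X0 X1 X2 f H E0 E1 a1 a2 a3 a5 a6 a7 a8 a9 b1 b2 b3 b4 : ℝ}
    (hα : 0 < α) (hα1 : α < alphaMax) (hb : 0 < b) (hb5 : b ≤ 5)
    (N0 : 0 ≤ X0) (N1 : 0 ≤ X1) (N2 : 0 ≤ X2) (Nf : 0 ≤ f) (Ne : 0 ≤ E0) (Ne1 : 0 ≤ E1)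
    (ea : a1 + X1 + b1 = 0) (eb : a2 + a2 + b2 = 0) (ec : a5 + a5 + b3 = 0)
    (ed : 1 / 200 * E0 ≤ a3) (ed1 : 1 / 200 * E1 ≤ a7) (ee : a7 + a6 + b4 = 0)
    (l1 : a8 = -α ^ 2 * a1 + -(b * α) * a2 + a3) (l2 : a9 = -α ^ 2 * X2 + -(b * α) * a5 + a6)
    (y1 : |b1| ≤ 1 / 2 * X1 + 9 / 2 * X0) (y2 : |b2| ≤ 3 / 2 * X0 + 3 / 2 * X0)
    (y3 : |b3| ≤ 3 / 2 * X1 + 3 / 2 * X1) (y4 : |b4| ≤ 3 / 2 * H + 3 / 2 * X1)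
    (y5 : |a8| ≤ 3 * 10 ^ 7 * f + 1 / (12 * 10 ^ 7) * X0)
    (y6 : |α ^ 2 * a9| ≤ 1 * f + α ^ 4 / 4 * X2)
    (hh3 : H ≤ 3 * f + 3 * α ^ 4 * X2 + 75 * α ^ 2 * X1) (n0 : X0 ≤ 100001 * E0) :
    E0 ≤ 10 ^ 12 * f ∧ α ^ 2 * E1 ≤ 10 ^ 12 * f ∧ α ^ 4 * X2 ≤ 10 ^ 12 * f ∧ H ≤ 10 ^ 12 * f := by
  unfold alphaMax at hα1
  have hα2 : α ^ 2 ≤ α * (1 / 10 ^ 12) := by nlinarith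
  have hα2' : α ^ 2 ≤ 1 / 10 ^ 12 := by nlinarith
  have hα0 : 0 ≤ α ^ 2 := sq_nonneg _
  have hbα : b * α ≤ 5 * α := mul_le_mul_of_nonneg_right hb5 hα.le
  have hbα0 : 0 ≤ b * α := by positivity
  have h1 : -(α ^ 2 * b1) ≤ α ^ 2 * (1 / 2 * X1 + 9 / 2 * X0) := by
    have := mul_le_mul_of_nonneg_left ((neg_le_abs b1).trans y1) hα0
    linarith
  have h2 : -(b * α * b2) ≤ 15 * α * X0 := by
    have := mul_le_mul_of_nonneg_left ((neg_le_abs b2).trans y2) hbα0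
    linarith [mul_le_mul_of_nonneg_right hbα N0]
  have e1 : a1 = -X1 - b1 := by linarith
  have e2 : a2 = -b2 / 2 := by linarith
  have T1 : α ^ 2 * X1 + 1 / 200 * E0 ≤ a8 - α ^ 2 * b1 - b * α * b2 / 2 := by
    rw [l1, e1, e2]; linarith
  have h3 : α ^ 2 * X0 ≤ 1 / 10 ^ 12 * X0 := mul_le_mul_of_nonneg_right hα2' N0
  have h4 : α * X0 ≤ 1 / 10 ^ 12 * X0 := mul_le_mul_of_nonneg_right hα1.le N0
  have h5 := (le_abs_self a8).trans y5
  have T1' : 1 / 2 * (α ^ 2 * X1) + 1 / 400 * E0 ≤ 3 * 10 ^ 7 * f := by linarith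
  have hX1 : α ^ 2 * X1 ≤ 6 * 10 ^ 7 * f := by linarith
  have e5 : a5 = -b3 / 2 := by linarith
  have e6 : a6 = -a7 - b4 := by linarith
  have hX10 : 0 ≤ α ^ 2 * X1 := mul_nonneg hα0 N1
  have hX20 : 0 ≤ α ^ 4 * X2 := by positivity
  have h6 : b * α * (α ^ 2 * b3) ≤ α ^ 2 * X1 := by
    have i1 := mul_le_mul_of_nonneg_left ((le_abs_self b3).trans y3) hα0
    have i2 := mul_le_mul_of_nonneg_left i1 hbα0
    have i3 : b * α * (α ^ 2 * X1) ≤ 1 / 3 * (α ^ 2 * X1) :=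
      mul_le_mul_of_nonneg_right (by linarith) hX10
    linarith
  have h7 : -(α ^ 2 * b4) ≤ 3 / 2 * (α ^ 2 * H) + 3 / 2 * (α ^ 2 * X1) := by
    have := mul_le_mul_of_nonneg_left ((neg_le_abs b4).trans y4) hα0
    linarith
  have h8 : α ^ 2 * H ≤ f + 1 / 10 * (α ^ 4 * X2) + α ^ 2 * X1 := by
    have i1 := mul_le_mul_of_nonneg_left hh3 hα0
    have i2 : α ^ 2 * f ≤ 1 / 10 ^ 12 * f := mul_le_mul_of_nonneg_right hα2' Nf
    have i3 : α ^ 2 * (α ^ 4 * X2) ≤ 1 / 10 ^ 12 * (α ^ 4 * X2) :=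
      mul_le_mul_of_nonneg_right hα2' hX20
    have i4 : α ^ 2 * (α ^ 2 * X1) ≤ 1 / 10 ^ 12 * (α ^ 2 * X1) :=
      mul_le_mul_of_nonneg_right hα2' hX10
    linarith
  have T2 : α ^ 4 * X2 + 1 / 200 * (α ^ 2 * E1) ≤
      -(α ^ 2 * a9) + b * α * (α ^ 2 * b3) / 2 - α ^ 2 * b4 := by
    have i1 := mul_le_mul_of_nonneg_left ed1 hα0
    rw [l2, e5, e6]; linarith
  have h9 := (neg_le_abs (α ^ 2 * a9)).trans y6
  have hE1 : 0 ≤ α ^ 2 * E1 := mul_nonneg hα0 Ne1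
  refine ⟨by linarith, by linarith, by linarith, by linarith⟩

/-- The basic energy estimate. -/
theorem energy_estimate {α b : ℝ} (hα : 0 < α) (hα1 : α < alphaMax) (hb : 0 < b) (hb5 : b ≤ 5)
    (hg : Core g) :
    wInt se (eDens g) ≤ cEn * wInt se (fun p => fullL α b g p ^ 2) ∧
    α ^ 2 * wInt se (eDens (DR g)) ≤ cEn * wInt se (fun p => fullL α b g p ^ 2) ∧
    α ^ 4 * wInt se (fun p => DR (DR (psi g)) p ^ 2) ≤ cEn * wInt se (fun p => fullL α b g p ^ 2) ∧
    wInt se (fun p => angL g p ^ 2) ≤ cEn * wInt se (fun p => fullL α b g p ^ 2) := by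
  have ho := integrableOn_om
  have t := hg.test
  set P := psi g with hP
  set P1 := DR P with hP1
  set P2 := DR P1 with hP2
  set h := angL g with hh
  set F := fullL α b g with hF
  have tP : RadTest P := t.psi
  have tP1 : RadTest P1 := tP.DR
  have tP2 : RadTest P2 := tP1.DR
  have th : RadTest h := t.angL
  have tF : RadTest F := t.fullL α b
  have ea := wInt_DR_mul tP1 tP ho
  have eb := wInt_DR_mul tP tP ho
  have ec := wInt_DR_mul tP1 tP1 ho
  have ed := coercive hg
  have ed1 := coercive hg.DR
  have ee := wInt_DR_mul th tP1 ho
  rw [← DR_psi t, ← DR_angL t] at ed1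
  rw [← hP, ← hP1] at ed1
  rw [← hP1] at eb
  rw [← hP2] at ea ec ee
  rw [← hh] at ed ed1
  rw [← hP] at ed
  have sym1 : wInt om (fun p => P p * P1 p) = wInt om (fun p => P1 p * P p) := by
    congr 1; funext p; ring
  have sym2 : wInt om (fun p => P1 p * P2 p) = wInt om (fun p => P2 p * P1 p) := by
    congr 1; funext p; ring
  have sq0 : wInt om (fun p => P1 p * P1 p) = wInt om (fun p => P1 p ^ 2) := by
    congr 1; funext p; ring
  rw [sym1] at eb
  rw [sym2] at ec
  rw [sq0] at ea
  have lin : ∀ z : Fn, RadTest z → wInt om (fun p => F p * z p) =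
      -α ^ 2 * wInt om (fun p => P2 p * z p) + -(b * α) * wInt om (fun p => P1 p * z p) +
        wInt om (fun p => h p * z p) := by
    intro z tz
    have i1 := (tP2.mul tz).wIntegrable ho
    have i2 := (tP1.mul tz).wIntegrable ho
    have i3 := (th.mul tz).wIntegrable ho
    rw [← wInt_const_mul, ← wInt_const_mul, ← wInt_add (i1.const_mul _) (i2.const_mul _),
      ← wInt_add ((i1.const_mul _).add (i2.const_mul _)) i3]
    congr 1; funext p
    simp only [hF, fullL]; ring
  have l1 := lin P tP
  have l2 := lin P2 tP2
  have young : ∀ (c : Fn) (u v : Fn) (k t s : ℝ), RadTest u → RadTest v →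
      (∀ p ∈ strip, |c p| ≤ k) → 0 ≤ t → 0 ≤ s → k ^ 2 ≤ 4 * t * s →
      WIntegrable om (fun p => c p * (u p * v p)) → |wInt om fun p => c p * (u p * v p)| ≤
      t * wInt om (fun p => u p ^ 2) + s * wInt om (fun p => v p ^ 2) :=
    fun c u v k t s tu tv hc ht hs hts hi => abs_wInt_mul_le om_nonneg hc ht hs hts hi
      (tu.sq.wIntegrable ho) (tv.sq.wIntegrable ho)
  have q3 : ∀ p ∈ strip, |qR p| ≤ 3 := fun p hp => abs_qR_le hp
  have y1 := young qR P1 P 3 (1 / 2) (9 / 2) tP1 tP q3 (by norm_num) (by norm_num)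
    (by norm_num) ((tP1.mul tP).wIntegrable ho).qR_mul
  have y2 := young qR P P 3 (3 / 2) (3 / 2) tP tP q3 (by norm_num) (by norm_num)
    (by norm_num) ((tP.mul tP).wIntegrable ho).qR_mul
  have y3 := young qR P1 P1 3 (3 / 2) (3 / 2) tP1 tP1 q3 (by norm_num) (by norm_num)
    (by norm_num) ((tP1.mul tP1).wIntegrable ho).qR_mul
  have y4 := young qR h P1 3 (3 / 2) (3 / 2) th tP1 q3 (by norm_num) (by norm_num)
    (by norm_num) ((th.mul tP1).wIntegrable ho).qR_mul
  have y5 := young (fun _ => 1) F P 1 (3 * 10 ^ 7) (1 / (12 * 10 ^ 7)) tF tP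
    (by simp) (by norm_num) (by norm_num) (by norm_num)
    (by simpa using (tF.mul tP).wIntegrable ho)
  have y6 := young (fun _ => α ^ 2) F P2 (α ^ 2) 1 (α ^ 4 / 4) tF tP2
    (fun p _ => by rw [abs_of_nonneg (by positivity)]) (by norm_num) (by positivity)
    (le_of_eq (by ring)) (((tF.mul tP2).wIntegrable ho).const_mul _)
  rw [wInt_const_mul] at y6
  simp only [one_mul] at y5
  have hh3 : wInt om (fun p => h p ^ 2) ≤ 3 * wInt om (fun p => F p ^ 2) +
      3 * α ^ 4 * wInt om (fun p => P2 p ^ 2) + 75 * α ^ 2 * wInt om (fun p => P1 p ^ 2) := by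
    have i1 := (tF.sq.wIntegrable ho).const_mul 3
    have i2 := (tP2.sq.wIntegrable ho).const_mul (3 * α ^ 4)
    have i3 := (tP1.sq.wIntegrable ho).const_mul (75 * α ^ 2)
    rw [← wInt_const_mul, ← wInt_const_mul, ← wInt_const_mul, ← wInt_add i1 i2,
      ← wInt_add (i1.add i2) i3]
    refine wInt_mono om_nonneg (th.sq.wIntegrable ho) ((i1.add i2).add i3) fun p _ => ?_
    have e : h p = F p + α ^ 2 * P2 p + b * α * P1 p := by simp only [hF, fullL]; ring
    rw [e]
    have b2 : b ^ 2 ≤ 25 := by nlinarith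
    have : (F p + α ^ 2 * P2 p + b * α * P1 p) ^ 2 ≤
      3 * F p ^ 2 + 3 * (α ^ 2 * P2 p) ^ 2 + 3 * (b * α * P1 p) ^ 2 := by
      linarith [sq_nonneg (F p - α ^ 2 * P2 p), sq_nonneg (F p - b * α * P1 p),
        sq_nonneg (α ^ 2 * P2 p - b * α * P1 p)]
    have h4 : (b * α * P1 p) ^ 2 ≤ 25 * (α ^ 2 * P1 p ^ 2) := by
      have : (b * α * P1 p) ^ 2 = b ^ 2 * (α ^ 2 * P1 p ^ 2) := by ring
      rw [this]; exact mul_le_mul_of_nonneg_right b2 (by positivity)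
    linarith
  have n0 : wInt om (fun p => P p ^ 2) ≤ 100001 * wInt se (eDens g) :=
    (wInt_om_le tP.sq fun p => sq_nonneg _).trans
      (mul_le_mul_of_nonneg_left (wInt_psi_sq_le t) (by norm_num))
  have fle := wInt_om_le tF.sq fun p => sq_nonneg _
  have p2le := wInt_se_le tP2.sq fun p => sq_nonneg _
  have hle := wInt_se_le th.sq fun p => sq_nonneg _
  have N0 := wInt_nonneg (f := fun p => P p ^ 2) om_nonneg fun p _ => sq_nonneg _
  have N1 := wInt_nonneg (f := fun p => P1 p ^ 2) om_nonneg fun p _ => sq_nonneg _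
  have N2 := wInt_nonneg (f := fun p => P2 p ^ 2) om_nonneg fun p _ => sq_nonneg _
  have Nf := wInt_nonneg (f := fun p => F p ^ 2) om_nonneg fun p _ => sq_nonneg _
  have Ne : 0 ≤ wInt se (eDens g) := wInt_nonneg se_nonneg fun p _ => by unfold eDens; positivity
  have Ne1 : 0 ≤ wInt se (eDens (DR g)) :=
    wInt_nonneg se_nonneg fun p _ => by unfold eDens; positivity
  have sq2 : wInt om (fun p => P2 p * P2 p) = wInt om (fun p => P2 p ^ 2) := by
    congr 1; funext p; ring
  rw [sq2, sym2] at l2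
  obtain ⟨r1, r2, r3, r4⟩ := energy_algebra hα hα1 hb hb5 N0 N1 N2 Nf Ne Ne1 ea eb ec ed ed1 ee l1 l2
    y1 y2 y3 y4 y5 y6 hh3 n0
  have hF0 : 0 ≤ wInt se (fun p => F p ^ 2) := wInt_nonneg se_nonneg fun p _ => sq_nonneg _
  have ha4 : 0 ≤ α ^ 4 := by positivity
  unfold cEn
  refine ⟨by linarith, by linarith, ?_, by linarith⟩
  have := mul_le_mul_of_nonneg_left p2le ha4
  linarith

end


/-! ### Weak derivatives on slices -/

lemma exists_rat_Icc {A : Set ℝ} (hA : IsOpen A) {x : ℝ} (hx : x ∈ A) :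
    ∃ p q : ℚ, x ∈ Ioo (p : ℝ) q ∧ Icc (p : ℝ) q ⊆ A := by
  obtain ⟨ε, hε, hb⟩ := isOpen_iff.1 hA x hx
  obtain ⟨p, hp1, hp2⟩ := exists_rat_btwn (show x - ε / 2 < x by linarith)
  obtain ⟨q, hq1, hq2⟩ := exists_rat_btwn (show x < x + ε / 2 by linarith)
  refine ⟨p, q, ⟨hp2, hq1⟩, fun y hy => hb ?_⟩
  rw [mem_ball, Real.dist_eq, abs_lt]
  constructor <;> linarith [hy.1, hy.2]

lemma ae_restrict_of_rat_Icc {A : Set ℝ} (hA : IsOpen A) {P : ℝ → Prop}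
    (h : ∀ p q : ℚ, Icc (p : ℝ) q ⊆ A → ∀ᵐ x ∂volume.restrict (Icc (p : ℝ) q), P x) :
    ∀ᵐ x ∂volume.restrict A, P x := by
  have h1 : ∀ p q : ℚ, ∀ᵐ x : ℝ, Icc (p : ℝ) q ⊆ A → x ∈ Icc (p : ℝ) q → P x := by
    intro p q
    by_cases hpq : Icc (p : ℝ) q ⊆ A
    · filter_upwards [(ae_restrict_iff' measurableSet_Icc).1 (h p q hpq)] with x hx _ using hx
    · exact Eventually.of_forall fun x h' => absurd h' hpq
  rw [ae_restrict_iff' hA.measurableSet]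
  filter_upwards [ae_all_iff.2 fun p => ae_all_iff.2 fun q => h1 p q] with x hx hxA
  obtain ⟨p, q, hpq, hs⟩ := exists_rat_Icc hA hxA
  exact hx p q hs (Ioo_subset_Icc_self hpq)

lemma locallyIntegrableOn_of_rat_Icc {B : Set ℝ} (hB : IsOpen B) {u : ℝ → ℝ}
    (h : ∀ p q : ℚ, Icc (p : ℝ) q ⊆ B → IntegrableOn u (Icc (p : ℝ) q)) :
    LocallyIntegrableOn u B := by
  intro x hx
  obtain ⟨p, q, hpq, hs⟩ := exists_rat_Icc hB hx
  exact ⟨Icc (p : ℝ) q, mem_nhdsWithin_of_mem_nhds (Icc_mem_nhds hpq.1 hpq.2), h p q hs⟩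

lemma ae_slice_locallyIntegrableOn {A B : Set ℝ} (hA : IsOpen A) (hB : IsOpen B) {f : Fn}
    (hf : LocallyIntegrableOn f (A ×ˢ B)) :
    ∀ᵐ x ∂volume.restrict A, LocallyIntegrableOn (fun y => f (x, y)) B := by
  have h1 : ∀ r s : ℚ, ∀ᵐ x ∂volume.restrict A, Icc (r : ℝ) s ⊆ B →
      IntegrableOn (fun y => f (x, y)) (Icc (r : ℝ) s) := by
    intro r s
    by_cases hrs : Icc (r : ℝ) s ⊆ B
    · refine ae_restrict_of_rat_Icc hA fun p q hpq => ?_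
      have := hf.integrableOn_compact_subset (prod_mono hpq hrs) (isCompact_Icc.prod isCompact_Icc)
      rw [IntegrableOn, Measure.volume_eq_prod, ← Measure.prod_restrict] at this
      filter_upwards [this.prod_right_ae] with x hx _ using hx
    · exact Eventually.of_forall fun x h' => absurd h' hrs
  filter_upwards [ae_all_iff.2 fun r => ae_all_iff.2 fun s => h1 r s] with x hx
  exact locallyIntegrableOn_of_rat_Icc hB fun p q => hx p q

/-- A primitive with compact support. -/
lemma exists_primitive {B : Set ℝ} [hB : B.OrdConnected] {β β0 : ℝ → ℝ}
    (h : ContDiff ℝ ∞ β) (hc : HasCompactSupport β) (hs : tsupport β ⊆ B)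
    (h0 : ContDiff ℝ ∞ β0) (hc0 : HasCompactSupport β0) (hs0 : tsupport β0 ⊆ B)
    (hi : ∫ y, β0 y = 1) :
    ∃ b : ℝ → ℝ, ContDiff ℝ ∞ b ∧ HasCompactSupport b ∧ tsupport b ⊆ B ∧
      ∀ y, HasDerivAt b (β y - (∫ t, β t) * β0 y) y := by
  set K := tsupport β ∪ tsupport β0 with hK
  have hKc : IsCompact K := hc.isCompact.union hc0.isCompact
  have hKn : K.Nonempty := by
    by_contra hne
    rw [not_nonempty_iff_eq_empty] at hne
    have : tsupport β0 = ∅ := by rw [← subset_empty_iff, ← hne]; exact subset_union_right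
    rw [tsupport_eq_empty_iff] at this
    simp [this] at hi
  have hl := hKc.sInf_mem hKn
  have hr := hKc.sSup_mem hKn
  set l := sInf K
  set r := sSup K
  have hKB : K ⊆ B := union_subset hs hs0
  have hsub : Icc l r ⊆ B := hB.out (hKB hl) (hKB hr)
  have hKI : K ⊆ Icc l r := fun x hx =>
    ⟨csInf_le hKc.bddBelow hx, le_csSup hKc.bddAbove hx⟩
  have hlr : l ≤ r := (hKI hl).2
  set γ : ℝ → ℝ := fun y => β y - (∫ t, β t) * β0 y with hγ
  have cγ : ContDiff ℝ ∞ γ := h.sub (contDiff_const.mul h0)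
  have z : ∀ y ∉ Icc l r, γ y = 0 := by
    intro y hy
    have h1 : β y = 0 := image_eq_zero_of_notMem_tsupport fun hh => hy (hKI (Or.inl hh))
    have h2 : β0 y = 0 := image_eq_zero_of_notMem_tsupport fun hh => hy (hKI (Or.inr hh))
    simp [hγ, h1, h2]
  set b : ℝ → ℝ := fun y => ∫ t in l..y, γ t with hb
  have hd : ∀ y, HasDerivAt b (γ y) y := fun y =>
    integral_hasDerivAt_right (cγ.continuous.intervalIntegrable _ _)
      (cγ.continuous.stronglyMeasurableAtFilter _ _) cγ.continuous.continuousAt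
  have tot : ∫ t in l..r, γ t = 0 := by
    have e1 : ∫ t in l..r, γ t = ∫ t, γ t := by
      rw [integral_of_le hlr, ← integral_Icc_eq_integral_Ioc]
      exact setIntegral_eq_integral_of_forall_compl_eq_zero z
    rw [e1, hγ, integral_sub (h.continuous.integrable_of_hasCompactSupport hc)
      ((h0.continuous.integrable_of_hasCompactSupport hc0).const_mul _), integral_const_mul, hi]
    ring
  have bz : ∀ y ∉ Icc l r, b y = 0 := by
    intro y hy
    rcases lt_or_ge y l with h1 | h1
    · have : b y = ∫ t in l..y, (0 : ℝ) := by
        refine intervalIntegral.integral_congr_ae ?_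
        filter_upwards [compl_mem_ae_iff.2 (show volume ({l} : Set ℝ) = 0 by simp)] with t htl ht
        refine z t fun hh => ?_
        rw [uIoc_of_ge h1.le] at ht
        exact htl (le_antisymm ht.2 hh.1)
      simpa using this
    · have h2 : r < y := by
        by_contra h3
        exact hy ⟨h1, not_lt.1 h3⟩
      have e2 := integral_add_adjacent_intervals (μ := volume) (a := l) (b := r)
        (c := y) (f := γ) (cγ.continuous.intervalIntegrable _ _) (cγ.continuous.intervalIntegrable _ _)
      have e3 : ∫ t in r..y, γ t = ∫ t in r..y, (0 : ℝ) := by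
        refine intervalIntegral.integral_congr_ae ?_
        filter_upwards with t ht
        rw [uIoc_of_le h2.le] at ht
        exact z t fun hh => absurd ht.1 (not_lt.2 hh.2)
      rw [tot, e3] at e2
      simp only [hb]; rw [← e2]; simp
  have bs : tsupport b ⊆ Icc l r :=
    closure_minimal (fun y hy => by by_contra h'; exact hy (bz y h')) isClosed_Icc
  refine ⟨b, ?_, HasCompactSupport.of_support_subset_isCompact isCompact_Icc
    ((subset_tsupport _).trans bs), bs.trans hsub, hd⟩
  rw [contDiff_infty_iff_deriv]
  refine ⟨fun y => (hd y).differentiableAt, ?_⟩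
  rw [show deriv b = γ from funext fun y => (hd y).deriv]
  exact cγ

/-- The moment problem on a compact interval. -/
lemma ae_eq_zero_of_moments {a b c d : ℝ} {τ σ w : ℝ → ℝ} (hτ : ContinuousOn τ (Icc a b))
    (hmap : MapsTo τ (Icc a b) (Icc c d)) (hσ : ContinuousOn σ (Icc c d))
    (hinv : ∀ y ∈ Icc a b, σ (τ y) = y) (hw : IntegrableOn w (Icc a b))
    (h : ∀ n : ℕ, ∫ y in Icc a b, w y * τ y ^ n = 0) :
    ∀ᵐ y ∂volume.restrict (Ioo a b), w y = 0 := by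
  have bddτ : ∃ C, ∀ y ∈ Icc a b, ‖τ y‖ ≤ C := isCompact_Icc.exists_bound_of_continuousOn hτ
  have hwτ : ∀ {G : ℝ → ℝ}, ContinuousOn G (Icc a b) →
      IntegrableOn (fun y => w y * G y) (Icc a b) := fun hG => hw.mul_continuousOn hG isCompact_Icc
  have hev : ∀ p : Polynomial ℝ, ContinuousOn (fun y => p.eval (τ y)) (Icc a b) :=
    fun p => p.continuous.comp_continuousOn hτ
  have hpoly : ∀ p : Polynomial ℝ, ∫ y in Icc a b, w y * p.eval (τ y) = 0 := by
    intro p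
    induction p using Polynomial.induction_on' with
    | add p q hp hq =>
      simp only [Polynomial.eval_add, mul_add]
      rw [integral_add (hwτ (hev p)) (hwτ (hev q)), hp, hq, add_zero]
    | monomial n r =>
      have : ∀ y, w y * (Polynomial.monomial n r).eval (τ y) = r * (w y * τ y ^ n) := by
        intro y; rw [Polynomial.eval_monomial]; ring
      simp only [this, integral_const_mul, h n, mul_zero]
  have hcont : ∀ G : ℝ → ℝ, Continuous G → ∫ y in Icc a b, w y * G y = 0 := by
    intro G hG
    by_contra hne
    set I := ∫ y in Icc a b, w y * G y with hI
    set W := ∫ y in Icc a b, |w y| with hW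
    have hW0 : 0 ≤ W := integral_nonneg fun y => abs_nonneg _
    have hε : 0 < |I| / (W + 1) := by positivity
    obtain ⟨p, hp⟩ := exists_polynomial_near_of_continuousOn c d (G ∘ σ)
      (hG.comp_continuousOn hσ) _ hε
    have e : I = ∫ y in Icc a b, w y * (G y - p.eval (τ y)) := by
      simp only [mul_sub]
      rw [integral_sub (hwτ hG.continuousOn) (hwτ (hev p)), hpoly, sub_zero]
    have h2 : |I| ≤ ∫ y in Icc a b, |w y| * (|I| / (W + 1)) := by
      rw [e]
      refine (abs_integral_le_integral_abs).trans ?_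
      refine setIntegral_mono_on ?_ (hw.abs.mul_const _) measurableSet_Icc fun y hy => ?_
      · exact (hwτ (hG.continuousOn.sub (hev p))).abs
      · rw [abs_mul]
        refine mul_le_mul_of_nonneg_left ?_ (abs_nonneg _)
        have := hp (τ y) (hmap hy)
        simp only [Function.comp, hinv y hy] at this
        rw [abs_sub_comm]; rw [← e]; exact this.le
    rw [integral_mul_const, ← hW] at h2
    have : W * (|I| / (W + 1)) < |I| := by
      rw [mul_div_assoc', div_lt_iff₀ (by positivity)]
      have : 0 < |I| := abs_pos.2 hne
      nlinarith
    linarith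
  rw [ae_restrict_iff' measurableSet_Ioo]
  refine IsOpen.ae_eq_zero_of_integral_contDiff_smul_eq_zero isOpen_Ioo
    (hw.mono_set Ioo_subset_Icc_self).locallyIntegrableOn fun G hG _ hGs => ?_
  rw [← hcont G hG.continuous]
  have : ∫ y, G y • w y = ∫ y in Icc a b, G y • w y := by
    refine (setIntegral_eq_integral_of_forall_compl_eq_zero fun y hy => ?_).symm
    rw [image_eq_zero_of_notMem_tsupport fun hh => hy (Ioo_subset_Icc_self (hGs hh)), zero_smul]
  rw [this]
  congr 1; ext y; simp [mul_comm]


lemma LocallyIntegrableOn.mul_test {X : Type*} [TopologicalSpace X] [MeasurableSpace X]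
    [OpensMeasurableSpace X] [T2Space X] {μ : Measure X} {Ω : Set X} {f φ : X → ℝ}
    (hf : LocallyIntegrableOn f Ω μ) (hφ : Continuous φ) (hc : HasCompactSupport φ)
    (hs : tsupport φ ⊆ Ω) : Integrable (fun p => f p * φ p) μ := by
  have h1 : IntegrableOn (fun p => f p * φ p) (tsupport φ) μ :=
    (hf.integrableOn_compact_subset hs hc).mul_continuousOn hφ.continuousOn hc
  refine (integrableOn_iff_integrable_of_support_subset fun p hp => ?_).1 h1
  exact subset_tsupport φ (right_ne_zero_of_mul hp)

lemma integral_primitive_mul_deriv {l r : ℝ} {v b : ℝ → ℝ}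
    (hv : IntervalIntegrable v volume l r) (hb : ContDiff ℝ ∞ b) (hl : b l = 0) (hr : b r = 0)
    {c : ℝ} (hc : c ∈ uIcc l r) :
    ∫ x in l..r, (∫ t in c..x, v t) * deriv b x = - ∫ x in l..r, v x * b x := by
  have a1 := hv.absolutelyContinuousOnInterval_intervalIntegral (c := c) hc
  have a2 : AbsolutelyContinuousOnInterval b l r :=
    (hb.of_le (by simp)).contDiffOn.absolutelyContinuousOnInterval
  have e := a1.integral_mul_deriv_eq_deriv_mul a2
  rw [hl, hr, mul_zero, mul_zero, sub_zero, zero_sub] at e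
  rw [e]
  congr 1
  refine intervalIntegral.integral_congr_ae ?_
  filter_upwards [hv.ae_hasDerivAt_integral] with x hx hx2
  rw [(hx (uIoc_subset_uIcc hx2) c hc).deriv]

/-- `v` is locally integrable and `u` agrees almost everywhere with a primitive of `v`. -/
structure IsPrim (B : Set ℝ) (u v : ℝ → ℝ) (U : ℝ → ℝ) : Prop where
  locInt : LocallyIntegrableOn v B
  ftc : ∀ x ∈ B, ∀ y ∈ B, ∫ t in x..y, v t = U y - U x
  ae_eq : ∀ᵐ y ∂volume.restrict B, u y = U y

lemma intervalIntegrable_of_loc {B : Set ℝ} [hB : B.OrdConnected] {v : ℝ → ℝ}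
    (hv : LocallyIntegrableOn v B) {x y : ℝ} (hx : x ∈ B) (hy : y ∈ B) :
    IntervalIntegrable v volume x y := by
  rw [intervalIntegrable_iff']
  exact hv.integrableOn_compact_subset (hB.uIcc_subset hx hy) isCompact_uIcc

/-- A bump function supported on `[p, q]`. -/
def bump {p q : ℝ} (h : p < q) : ContDiffBump ((p + q) / 2) :=
  ⟨(q - p) / 4, (q - p) / 2, by linarith, by linarith⟩

lemma bump_ball {p q : ℝ} : ball ((p + q) / 2) ((q - p) / 2) = Ioo p q := by
  rw [Real.ball_eq_Ioo]; congr 1 <;> ring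

lemma bump_closedBall {p q : ℝ} : closedBall ((p + q) / 2) ((q - p) / 2) = Icc p q := by
  rw [Real.closedBall_eq_Icc]; congr 1 <;> ring

lemma bump_support {p q : ℝ} (h : p < q) : Function.support (bump h) = Ioo p q := by
  rw [ContDiffBump.support_eq, ← bump_ball]; rfl

lemma bump_tsupport {p q : ℝ} (h : p < q) : tsupport (bump h) = Icc p q := by
  rw [ContDiffBump.tsupport_eq, ← bump_closedBall]; rfl

lemma exists_unit_bump {B : Set ℝ} (hB : IsOpen B) (hne : B.Nonempty) :
    ∃ β : ℝ → ℝ, ContDiff ℝ ∞ β ∧ HasCompactSupport β ∧ tsupport β ⊆ B ∧ ∫ y, β y = 1 := by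
  obtain ⟨x, hx⟩ := hne
  obtain ⟨p, q, hpq, hs⟩ := exists_rat_Icc hB hx
  have hlt : (p : ℝ) < q := hpq.1.trans hpq.2
  have hi : 0 < ∫ y, bump hlt y := (bump hlt).integral_pos
  refine ⟨fun y => (∫ y, bump hlt y)⁻¹ * bump hlt y, contDiff_const.mul (bump hlt).contDiff,
    (bump hlt).hasCompactSupport.mul_left, ?_, ?_⟩
  · exact (closure_mono (Function.support_mul_subset_right _ _)).trans
      ((bump_tsupport hlt).trans_subset hs)
  · rw [integral_const_mul, inv_mul_cancel₀ hi.ne']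

/-- A one-dimensional weak derivative, tested against countably many functions. -/
lemma exists_isPrim {B : Set ℝ} [B.OrdConnected] (hB : IsOpen B) {u v β0 : ℝ → ℝ}
    (h0 : ContDiff ℝ ∞ β0) (hc0 : HasCompactSupport β0) (hs0 : tsupport β0 ⊆ B)
    (hi : ∫ y, β0 y = 1)
    (hu : LocallyIntegrableOn u B) (hv : LocallyIntegrableOn v B)
    (h : ∀ (p q : ℚ) (hpq : (p : ℝ) < q), Icc (p : ℝ) q ⊆ B → ∀ n : ℕ, ∃ b : ℝ → ℝ,
      ContDiff ℝ ∞ b ∧ HasCompactSupport b ∧ tsupport b ⊆ B ∧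
      (∀ y, HasDerivAt b (bump hpq y * y ^ n - (∫ t, bump hpq t * t ^ n) * β0 y) y) ∧
      ∫ y in B, (u y * deriv b y + v y * b y) = 0) :
    ∃ U, IsPrim B u v U := by
  have hsupp0 : (Function.support β0).Nonempty := by
    by_contra hne
    rw [not_nonempty_iff_eq_empty, Function.support_eq_empty_iff] at hne
    simp [hne] at hi
  obtain ⟨y0, hy0⟩ := hsupp0
  have hy0B : y0 ∈ B := hs0 (subset_tsupport _ hy0)
  set V : ℝ → ℝ := fun y => ∫ t in y0..y, v t with hV
  have hVd : ∀ x ∈ B, ∀ y ∈ B, ∫ t in x..y, v t = V y - V x := by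
    intro x hx y hy
    rw [hV, eq_sub_iff_add_eq, add_comm]
    exact integral_add_adjacent_intervals (intervalIntegrable_of_loc hv hy0B hx)
      (intervalIntegrable_of_loc hv hx hy)
  have hVc : ContinuousOn V B := by
    intro x hx
    obtain ⟨p, q, hpq, hs⟩ := exists_rat_Icc hB hx
    have hle : (p : ℝ) ≤ q := (hpq.1.trans hpq.2).le
    have h1 : ContinuousOn (fun y => ∫ t in (p : ℝ)..y, v t) (Icc (p : ℝ) q) :=
      intervalIntegral.continuousOn_primitive_interval'
        (intervalIntegrable_of_loc hv (hs (left_mem_Icc.2 hle)) (hs (right_mem_Icc.2 hle)))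
        left_mem_uIcc |>.mono (by rw [uIcc_of_le hle])
    have h2 : ContinuousAt (fun y => V p + ∫ t in (p : ℝ)..y, v t) x :=
      continuousAt_const.add (h1.continuousAt (Icc_mem_nhds hpq.1 hpq.2))
    refine (h2.congr ?_).continuousWithinAt
    filter_upwards [hB.mem_nhds hx] with y hy
    rw [hVd _ (hs (left_mem_Icc.2 hle)) y hy]; ring
  have hVl : LocallyIntegrableOn V B := hVc.locallyIntegrableOn hB.measurableSet
  set H : ℝ → ℝ := fun y => u y - V y with hH
  have hHl : LocallyIntegrableOn H B := hu.sub hVl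
  set c : ℝ := ∫ y in B, H y * β0 y with hc
  have key : ∀ b : ℝ → ℝ, ContDiff ℝ ∞ b → HasCompactSupport b → tsupport b ⊆ B →
      ∫ y in B, (u y * deriv b y + v y * b y) = 0 → ∫ y in B, H y * deriv b y = 0 := by
    intro b hb hbc hbs hz
    have hdb : Continuous (deriv b) := hb.continuous_deriv (by simp)
    have hds : tsupport (deriv b) ⊆ B := tsupport_deriv_subset.trans hbs
    have i1 := LocallyIntegrableOn.mul_test hu hdb hbc.deriv hds
    have i2 := LocallyIntegrableOn.mul_test hv hb.continuous hbc hbs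
    have i3 := LocallyIntegrableOn.mul_test hVl hdb hbc.deriv hds
    rw [integral_add i1.integrableOn i2.integrableOn] at hz
    have e1 : ∀ y, H y * deriv b y = u y * deriv b y - V y * deriv b y := fun y => by
      simp only [hH]; ring
    simp only [e1]
    rw [integral_sub i1.integrableOn i3.integrableOn]
    have hK : IsCompact (tsupport b ∪ {y0}) := hbc.isCompact.union isCompact_singleton
    have hKB : tsupport b ∪ {y0} ⊆ B := union_subset hbs (singleton_subset_iff.2 hy0B)
    have hKn : (tsupport b ∪ {y0}).Nonempty := ⟨y0, Or.inr rfl⟩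
    obtain ⟨p, q, hpq, hs⟩ := exists_rat_Icc hB (hKB (hK.sInf_mem hKn))
    obtain ⟨p', q', hpq', hs'⟩ := exists_rat_Icc hB (hKB (hK.sSup_mem hKn))
    have hin : ∀ y ∈ tsupport b ∪ {y0}, y ∈ Ioo (p : ℝ) q' := fun y hy =>
      ⟨hpq.1.trans_le (csInf_le hK.bddBelow hy), (le_csSup hK.bddAbove hy).trans_lt hpq'.2⟩
    have hpB : (p : ℝ) ∈ B := hs ⟨le_rfl, (hpq.1.trans hpq.2).le⟩
    have hqB : (q' : ℝ) ∈ B := hs' ⟨(hpq'.1.trans hpq'.2).le, le_rfl⟩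
    have hy0i := hin y0 (Or.inr rfl)
    have hpq0 : (p : ℝ) ≤ q' := (hy0i.1.trans hy0i.2).le
    have hsub : Ioc (p : ℝ) q' ⊆ B := Ioc_subset_Icc_self.trans (OrdConnected.out ‹_› hpB hqB)
    have hbz : ∀ y ∉ Ioo (p : ℝ) q', b y = 0 := fun y hy =>
      image_eq_zero_of_notMem_tsupport fun hh => hy (hin y (Or.inl hh))
    have hdz : ∀ y ∉ Ioo (p : ℝ) q', deriv b y = 0 := fun y hy =>
      image_eq_zero_of_notMem_tsupport fun hh => hy (hin y (Or.inl (tsupport_deriv_subset hh)))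
    have hI := integral_primitive_mul_deriv (intervalIntegrable_of_loc hv hpB hqB) hb
      (hbz p (by simp)) (hbz q' (by simp)) (c := y0)
      (by rw [uIcc_of_le hpq0]; exact Ioo_subset_Icc_self hy0i)
    rw [integral_of_le hpq0, integral_of_le hpq0] at hI
    have r1 : ∫ y in B, V y * deriv b y = ∫ y in Ioc (p : ℝ) q', V y * deriv b y :=
      (setIntegral_eq_of_subset_of_forall_sdiff_eq_zero hB.measurableSet hsub fun y hy => by
        rw [hdz y fun hh => hy.2 (Ioo_subset_Ioc_self hh), mul_zero])
    have r2 : ∫ y in B, v y * b y = ∫ y in Ioc (p : ℝ) q', v y * b y :=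
      (setIntegral_eq_of_subset_of_forall_sdiff_eq_zero hB.measurableSet hsub fun y hy => by
        rw [hbz y fun hh => hy.2 (Ioo_subset_Ioc_self hh), mul_zero])
    have hI' : ∫ y in Ioc (p : ℝ) q', V y * deriv b y = -∫ y in Ioc (p : ℝ) q', v y * b y := hI
    rw [r1, hI', ← r2]; linarith
  have hfin : ∀ᵐ y ∂volume.restrict B, H y - c = 0 := by
    have h1 : ∀ p q : ℚ, ∀ᵐ y : ℝ, Icc (p : ℝ) q ⊆ B → y ∈ Ioo (p : ℝ) q → H y - c = 0 := by
      intro p q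
      by_cases hpB : Icc (p : ℝ) q ⊆ B
      swap
      · exact Eventually.of_forall fun _ h' => absurd h' hpB
      by_cases hpq : (p : ℝ) < q
      swap
      · exact Eventually.of_forall fun y _ hy => absurd (hy.1.trans hy.2) hpq
      have hHc : IntegrableOn (fun y => H y - c) (Icc (p : ℝ) q) :=
        (hHl.integrableOn_compact_subset hpB isCompact_Icc).sub (by simp)
      have hm : ∀ᵐ y ∂volume.restrict (Ioo (p : ℝ) q), (H y - c) * bump hpq y = 0 := by
        refine ae_eq_zero_of_moments (τ := id) (σ := id) (c := p) (d := q) continuousOn_id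
          (fun x hx => hx) continuousOn_id (fun _ _ => rfl)
          (hHc.mul_continuousOn (bump hpq).continuous.continuousOn isCompact_Icc) fun n => ?_
        obtain ⟨b, hb, hbc, hbs, hbd, hz⟩ := h p q hpq hpB n
        have hz2 := key b hb hbc hbs hz
        have hd : deriv b = fun y => bump hpq y * y ^ n - (∫ t, bump hpq t * t ^ n) * β0 y :=
          funext fun y => (hbd y).deriv
        have cβ : Continuous fun y => bump hpq y * y ^ n :=
          (bump hpq).continuous.mul (continuous_id.pow n)
        have sβ : tsupport (fun y => bump hpq y * y ^ n) ⊆ Icc (p : ℝ) q :=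
          (closure_mono (Function.support_mul_subset_left _ _)).trans (bump_tsupport hpq).subset
        have cc : HasCompactSupport fun y => bump hpq y * y ^ n :=
          (bump hpq).hasCompactSupport.mul_right
        have j1 := LocallyIntegrableOn.mul_test hHl cβ cc (sβ.trans hpB)
        have j2 := LocallyIntegrableOn.mul_test hHl h0.continuous hc0 hs0
        have e2 : ∀ y, H y * deriv b y = H y * (bump hpq y * y ^ n) -
            (∫ t, bump hpq t * t ^ n) * (H y * β0 y) := fun y => by rw [hd]; ring
        simp only [e2] at hz2
        rw [integral_sub j1.integrableOn (j2.integrableOn.const_mul _), integral_const_mul,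
          ← hc] at hz2
        have z0 : ∀ y ∉ Icc (p : ℝ) q, bump hpq y * y ^ n = 0 := fun y hy =>
          image_eq_zero_of_notMem_tsupport (f := fun y => bump hpq y * y ^ n) fun hh => hy (sβ hh)
        have e3 : ∫ y in B, H y * (bump hpq y * y ^ n) =
            ∫ y in Icc (p : ℝ) q, H y * (bump hpq y * y ^ n) :=
          (setIntegral_eq_of_subset_of_forall_sdiff_eq_zero hB.measurableSet hpB fun y hy => by
            rw [z0 y hy.2, mul_zero])
        have e4 : ∫ t, bump hpq t * t ^ n = ∫ t in Icc (p : ℝ) q, bump hpq t * t ^ n :=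
          (setIntegral_eq_integral_of_forall_compl_eq_zero z0).symm
        have e5 : ∀ y, (H y - c) * bump hpq y * id y ^ n =
            H y * (bump hpq y * y ^ n) - c * (bump hpq y * y ^ n) := fun y => by
          simp only [id]; ring
        simp only [e5]
        rw [integral_sub j1.integrableOn
          ((cβ.integrable_of_hasCompactSupport cc).integrableOn.const_mul _), integral_const_mul,
          ← e3, ← e4]
        linarith
      rw [ae_restrict_iff' measurableSet_Ioo] at hm
      filter_upwards [hm] with y hy _ hy2
      have hne : bump hpq y ≠ 0 := by
        have : y ∈ Function.support (bump hpq) := by rw [bump_support]; exact hy2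
        exact this
      exact (mul_eq_zero.1 (hy hy2)).resolve_right hne
    rw [ae_restrict_iff' hB.measurableSet]
    filter_upwards [ae_all_iff.2 fun p => ae_all_iff.2 fun q => h1 p q] with y hy hyB
    obtain ⟨p, q, hpq, hs⟩ := exists_rat_Icc hB hyB
    exact hy p q hs hpq
  refine ⟨fun y => V y + c, hv, fun x hx y hy => by rw [hVd x hx y hy]; ring, ?_⟩
  filter_upwards [hfin] with y hy
  simp only [hH] at hy
  linarith

/-- `g` is the weak derivative of `f` in the second variable, tested against products. -/
structure SliceWeak (A B : Set ℝ) (f g : Fn) : Prop where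
  locInt : LocallyIntegrableOn f (A ×ˢ B)
  locInt_deriv : LocallyIntegrableOn g (A ×ˢ B)
  parts : ∀ a b : ℝ → ℝ, ContDiff ℝ ∞ a → HasCompactSupport a → tsupport a ⊆ A →
    ContDiff ℝ ∞ b → HasCompactSupport b → tsupport b ⊆ B →
    ∫ p in A ×ˢ B, f p * (a p.1 * deriv b p.2) = - ∫ p in A ×ˢ B, g p * (a p.1 * b p.2)

lemma tsupport_prod_mul {a b : ℝ → ℝ} :
    tsupport (fun p : ℝ × ℝ => a p.1 * b p.2) ⊆ tsupport a ×ˢ tsupport b := by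
  refine closure_minimal (fun p hp => ?_) ((isClosed_tsupport a).prod (isClosed_tsupport b))
  exact ⟨subset_tsupport _ (left_ne_zero_of_mul hp), subset_tsupport _ (right_ne_zero_of_mul hp)⟩

lemma hasCompactSupport_prod_mul {a b : ℝ → ℝ} (ha : HasCompactSupport a)
    (hb : HasCompactSupport b) : HasCompactSupport (fun p : ℝ × ℝ => a p.1 * b p.2) :=
  (ha.isCompact.prod hb.isCompact).of_isClosed_subset (isClosed_tsupport _) tsupport_prod_mul

lemma SliceWeak.ae_integral_eq_zero {A B : Set ℝ} (hA : IsOpen A) (hB : IsOpen B)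
    {f g : Fn} (h : SliceWeak A B f g) {b : ℝ → ℝ} (hb : ContDiff ℝ ∞ b)
    (hbc : HasCompactSupport b) (hbs : tsupport b ⊆ B) :
    ∀ᵐ x ∂volume.restrict A, ∫ y in B, (f (x, y) * deriv b y + g (x, y) * b y) = 0 := by
  have hdb : Continuous (deriv b) := hb.continuous_deriv (by simp)
  have hds : tsupport (deriv b) ⊆ B := tsupport_deriv_subset.trans hbs
  have loc : ∀ {f : Fn} {b : ℝ → ℝ}, LocallyIntegrableOn f (A ×ˢ B) → Continuous b →
      HasCompactSupport b → tsupport b ⊆ B → ∀ {p q : ℝ}, Icc p q ⊆ A →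
      Integrable (fun z : ℝ × ℝ => f z * b z.2)
        ((volume.restrict (Icc p q)).prod (volume.restrict B)) := by
    intro f b hf hb hc hs p q hpq
    have h1 : IntegrableOn (fun z : ℝ × ℝ => f z * b z.2) (Icc p q ×ˢ tsupport b) :=
      (hf.integrableOn_compact_subset (prod_mono hpq hs)
        (isCompact_Icc.prod hc)).mul_continuousOn (hb.comp continuous_snd).continuousOn
        (isCompact_Icc.prod hc)
    rw [Measure.prod_restrict, ← Measure.volume_eq_prod]
    refine IntegrableOn.of_forall_sdiff_eq_zero h1
      (measurableSet_Icc.prod hB.measurableSet) fun z hz => ?_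
    have : b z.2 = 0 := image_eq_zero_of_notMem_tsupport fun hh => hz.2 ⟨hz.1.1, hh⟩
    rw [this, mul_zero]
  have hloc : LocallyIntegrableOn
      (fun x => ∫ y in B, (f (x, y) * deriv b y + g (x, y) * b y)) A := by
    refine locallyIntegrableOn_of_rat_Icc hA fun p q hpq => ?_
    exact ((loc h.locInt hdb hbc.deriv hds hpq).add
      (loc h.locInt_deriv hb.continuous hbc hbs hpq)).integral_prod_left
  rw [ae_restrict_iff' hA.measurableSet]
  refine IsOpen.ae_eq_zero_of_integral_contDiff_smul_eq_zero hA hloc fun a ha hac has => ?_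
  have c1 : Continuous fun p : ℝ × ℝ => a p.1 * deriv b p.2 :=
    (ha.continuous.comp continuous_fst).mul (hdb.comp continuous_snd)
  have c2 : Continuous fun p : ℝ × ℝ => a p.1 * b p.2 :=
    (ha.continuous.comp continuous_fst).mul (hb.continuous.comp continuous_snd)
  have i1 := LocallyIntegrableOn.mul_test h.locInt c1 (hasCompactSupport_prod_mul hac hbc.deriv)
    (tsupport_prod_mul.trans (prod_mono has hds))
  have i2 := LocallyIntegrableOn.mul_test h.locInt_deriv c2 (hasCompactSupport_prod_mul hac hbc)
    (tsupport_prod_mul.trans (prod_mono has hbs))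
  have e := h.parts a b ha hac has hb hbc hbs
  rw [← setIntegral_eq_integral_of_forall_compl_eq_zero (s := A) fun x hx => by
    rw [image_eq_zero_of_notMem_tsupport fun hh => hx (has hh), zero_smul]]
  have e2 : ∫ p in A ×ˢ B, (f p * (a p.1 * deriv b p.2) + g p * (a p.1 * b p.2)) = 0 := by
    rw [integral_add i1.integrableOn i2.integrableOn, e]; ring
  have i3 := (i1.add i2).integrableOn (s := A ×ˢ B)
  rw [Measure.volume_eq_prod] at e2
  rw [IntegrableOn, Measure.volume_eq_prod, ← Measure.prod_restrict] at i3
  rw [← Measure.prod_restrict] at e2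
  erw [integral_prod _ i3] at e2
  rw [← e2]
  refine integral_congr_ae (Eventually.of_forall fun x => ?_)
  simp only [smul_eq_mul]
  rw [← integral_const_mul]
  congr 1; ext y; simp only [Pi.add_apply]; ring

theorem SliceWeak.ae_isPrim {A B : Set ℝ} [B.OrdConnected] (hA : IsOpen A) (hB : IsOpen B)
    (hne : B.Nonempty) {f g : Fn} (h : SliceWeak A B f g) :
    ∀ᵐ x ∂volume.restrict A, ∃ U, IsPrim B (fun y => f (x, y)) (fun y => g (x, y)) U := by
  obtain ⟨β0, h0, hc0, hs0, hi⟩ := exists_unit_bump hB hne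
  have hex : ∀ (p q : ℚ) (n : ℕ), ∃ b : ℝ → ℝ, ∀ hpq : (p : ℝ) < q, Icc (p : ℝ) q ⊆ B →
      ContDiff ℝ ∞ b ∧ HasCompactSupport b ∧ tsupport b ⊆ B ∧
      (∀ y, HasDerivAt b (bump hpq y * y ^ n - (∫ t, bump hpq t * t ^ n) * β0 y) y) := by
    intro p q n
    by_cases hpq : (p : ℝ) < q
    · by_cases hB' : Icc (p : ℝ) q ⊆ B
      · have sβ : tsupport (fun y => bump hpq y * y ^ n) ⊆ Icc (p : ℝ) q :=
          (closure_mono (Function.support_mul_subset_left _ _)).trans (bump_tsupport hpq).subset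
        obtain ⟨b, hb⟩ := exists_primitive (B := B) (β := fun y => bump hpq y * y ^ n)
          ((bump hpq).contDiff.mul (contDiff_id.pow n))
          (bump hpq).hasCompactSupport.mul_right (sβ.trans hB') h0 hc0 hs0 hi
        exact ⟨b, fun _ _ => hb⟩
      · exact ⟨0, fun _ h' => absurd h' hB'⟩
    · exact ⟨0, fun h' => absurd h' hpq⟩
  choose b hb using hex
  have hz : ∀ (p q : ℚ) (n : ℕ), ∀ᵐ x ∂volume.restrict A, (p : ℝ) < q → Icc (p : ℝ) q ⊆ B →
      ∫ y in B, (f (x, y) * deriv (b p q n) y + g (x, y) * b p q n y) = 0 := by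
    intro p q n
    by_cases hpq : (p : ℝ) < q
    · by_cases hB' : Icc (p : ℝ) q ⊆ B
      · obtain ⟨h1, h2, h3, _⟩ := hb p q n hpq hB'
        filter_upwards [h.ae_integral_eq_zero hA hB h1 h2 h3] with x hx _ _ using hx
      · exact Eventually.of_forall fun _ _ h' => absurd h' hB'
    · exact Eventually.of_forall fun _ h' => absurd h' hpq
  filter_upwards [ae_slice_locallyIntegrableOn hA hB h.locInt,
    ae_slice_locallyIntegrableOn hA hB h.locInt_deriv,
    ae_all_iff.2 fun p => ae_all_iff.2 fun q => ae_all_iff.2 fun n => hz p q n] with x h1 h2 h3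
  refine exists_isPrim hB h0 hc0 hs0 hi h1 h2 fun p q hpq hB' n => ?_
  obtain ⟨k1, k2, k3, k4⟩ := hb p q n hpq hB'
  exact ⟨b p q n, k1, k2, k3, k4, h3 p q n hpq hB'⟩

lemma isOpen_strip : IsOpen strip := isOpen_Ioi.prod isOpen_Ioo

lemma fderiv_prod_mul_snd {a b : ℝ → ℝ} (ha : ContDiff ℝ ∞ a) (hb : ContDiff ℝ ∞ b) (p : ℝ × ℝ) :
    fderiv ℝ (fun p : ℝ × ℝ => a p.1 * b p.2) p (0, 1) = a p.1 * deriv b p.2 := by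
  have h : ContDiff ℝ ∞ fun p : ℝ × ℝ => a p.1 * b p.2 :=
    (ha.comp contDiff_fst).mul (hb.comp contDiff_snd)
  have h1 := hasDerivAt_snd (ContDiff.diffAt h p)
  have h2 : HasDerivAt (fun t => a p.1 * b t) (a p.1 * deriv b p.2) p.2 :=
    ((hb.differentiable (by simp)).differentiableAt.hasDerivAt).const_mul _
  exact h1.unique h2

lemma fderiv_prod_mul_fst {a b : ℝ → ℝ} (ha : ContDiff ℝ ∞ a) (hb : ContDiff ℝ ∞ b) (p : ℝ × ℝ) :
    fderiv ℝ (fun p : ℝ × ℝ => a p.1 * b p.2) p (1, 0) = deriv a p.1 * b p.2 := by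
  have h : ContDiff ℝ ∞ fun p : ℝ × ℝ => a p.1 * b p.2 :=
    (ha.comp contDiff_fst).mul (hb.comp contDiff_snd)
  have h1 := hasDerivAt_fst (ContDiff.diffAt h p)
  have h2 : HasDerivAt (fun t => a t * b p.2) (deriv a p.1 * b p.2) p.1 :=
    ((ha.differentiable (by simp)).differentiableAt.hasDerivAt).mul_const _
  exact h1.unique h2

lemma HasWeakPartial.sliceWeak_snd {f g : Fn} (h : HasWeakPartial (0, 1) f g) :
    SliceWeak (Ioi 0) J₀ f g := by
  refine ⟨h.locInt, h.locInt_deriv, fun a b ha hac has hb hbc hbs => ?_⟩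
  have := h.parts (fun p => a p.1 * b p.2) ((ha.comp contDiff_fst).mul (hb.comp contDiff_snd))
    (hasCompactSupport_prod_mul hac hbc) (tsupport_prod_mul.trans (prod_mono has hbs))
  simp only [fderiv_prod_mul_snd ha hb, strip] at this
  exact this

lemma setIntegral_swap {A B : Set ℝ} (f : Fn) : ∫ p in B ×ˢ A, f p.swap = ∫ p in A ×ˢ B, f p := by
  rw [Measure.volume_eq_prod, ← Measure.prod_restrict, ← Measure.prod_restrict]
  exact integral_prod_swap f

lemma LocallyIntegrableOn.swap {A B : Set ℝ} {f : Fn} (hf : LocallyIntegrableOn f (A ×ˢ B)) :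
    LocallyIntegrableOn (fun p => f p.swap) (B ×ˢ A) := by
  intro p hp
  obtain ⟨t, ht, hi⟩ := hf p.swap ⟨hp.2, hp.1⟩
  refine ⟨Prod.swap ⁻¹' t, ?_, ?_⟩
  · have : Tendsto Prod.swap (𝓝[B ×ˢ A] p) (𝓝[A ×ˢ B] p.swap) :=
      continuous_swap.continuousWithinAt.tendsto_nhdsWithin fun q hq => ⟨hq.2, hq.1⟩
    exact this ht
  · have hm : MeasurePreserving (Prod.swap : ℝ × ℝ → ℝ × ℝ) volume volume :=
      Measure.measurePreserving_swap
    exact (hm.integrableOn_comp_preimage MeasurableEquiv.prodComm.measurableEmbedding).2 hi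

lemma HasWeakPartial.sliceWeak_fst {f g : Fn} (h : HasWeakPartial (1, 0) f g) :
    SliceWeak J₀ (Ioi 0) (fun p => f p.swap) (fun p => g p.swap) := by
  refine ⟨LocallyIntegrableOn.swap h.locInt, LocallyIntegrableOn.swap h.locInt_deriv,
    fun a b ha hac has hb hbc hbs => ?_⟩
  have := h.parts (fun p => b p.1 * a p.2) ((hb.comp contDiff_fst).mul (ha.comp contDiff_snd))
    (hasCompactSupport_prod_mul hbc hac) (tsupport_prod_mul.trans (prod_mono hbs has))
  simp only [fderiv_prod_mul_fst hb ha] at this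
  rw [strip, ← setIntegral_swap, ← setIntegral_swap (fun p => g p * (b p.1 * a p.2))] at this
  simpa only [Prod.fst_swap, Prod.snd_swap, mul_comm] using this

theorem HasWeakPartial.ae_isPrim_snd {f g : Fn} (h : HasWeakPartial (0, 1) f g) :
    ∀ᵐ R ∂volume.restrict (Ioi (0 : ℝ)), ∃ U, IsPrim J₀ (fun θ => f (R, θ)) (fun θ => g (R, θ)) U :=
  h.sliceWeak_snd.ae_isPrim isOpen_Ioi isOpen_Ioo ⟨π / 4, by constructor <;> linarith [pi_pos]⟩

theorem HasWeakPartial.ae_isPrim_fst {f g : Fn} (h : HasWeakPartial (1, 0) f g) :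
    ∀ᵐ θ ∂volume.restrict J₀, ∃ U, IsPrim (Ioi 0) (fun R => f (R, θ)) (fun R => g (R, θ)) U :=
  h.sliceWeak_fst.ae_isPrim isOpen_Ioo isOpen_Ioi ⟨1, mem_Ioi.2 one_pos⟩


/-! ### The weighted `L²` norm -/

lemma enorm_sq_eq (x : ℝ) : ‖x‖ₑ ^ 2 = ofReal (x ^ 2) := by
  rw [enorm_eq_ofReal_abs, ← ENNReal.ofReal_pow (abs_nonneg _), sq_abs]

lemma sqL2_eq_eLpNorm (f : Fn) : sqL2 f = eLpNorm f 2 vol₊ ^ 2 := by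
  rw [sqL2, eLpNorm_eq_lintegral_rpow_enorm_toReal (by simp) (by simp), ← ENNReal.rpow_natCast,
    ← ENNReal.rpow_mul]
  simp

lemma sqL2_congr_ae {f g : Fn} (h : ∀ᵐ p ∂vol₊, f p = g p) : sqL2 f = sqL2 g := by
  refine lintegral_congr_ae ?_
  filter_upwards [h] with p hp
  rw [hp]

lemma sqL2_mono_ae {f g : Fn} (h : ∀ᵐ p ∂vol₊, |f p| ≤ |g p|) : sqL2 f ≤ sqL2 g := by
  refine lintegral_mono_ae ?_
  filter_upwards [h] with p hp
  rw [enorm_sq_eq, enorm_sq_eq]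
  exact ofReal_le_ofReal (sq_le_sq.2 hp)

lemma ae_strip_of_forall {P : ℝ × ℝ → Prop} (h : ∀ p ∈ strip, P p) : ∀ᵐ p ∂vol₊, P p :=
  (ae_restrict_iff' measurableSet_strip).2 (Eventually.of_forall h)

lemma sqL2_mono {f g : Fn} (h : ∀ p ∈ strip, |f p| ≤ |g p|) : sqL2 f ≤ sqL2 g :=
  sqL2_mono_ae (ae_strip_of_forall h)

lemma sqL2_const_mul (c : ℝ) (f : Fn) : sqL2 (fun p => c * f p) = ofReal (c ^ 2) * sqL2 f := by
  rw [sqL2, sqL2, ← lintegral_const_mul' _ _ ofReal_ne_top]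
  simp only [enorm_mul, mul_pow, enorm_sq_eq]

lemma sqL2_le_of_abs_le {f g : Fn} {c : ℝ} (h : ∀ p ∈ strip, |f p| ≤ c * |g p|) :
    sqL2 f ≤ ofReal (c ^ 2) * sqL2 g := by
  rw [← sqL2_const_mul]
  refine sqL2_mono fun p hp => (h p hp).trans ?_
  rw [abs_mul]
  exact mul_le_mul_of_nonneg_right (le_abs_self c) (abs_nonneg _)

lemma sqL2_neg (f : Fn) : sqL2 (fun p => -f p) = sqL2 f := by
  simp [sqL2]

/-- Measurability on the strip. -/
abbrev StripMeas (f : Fn) : Prop := AEStronglyMeasurable f vol₊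

lemma StripMeas.enorm_sq {f : Fn} (hf : StripMeas f) :
    AEMeasurable (fun p => ‖f p‖ₑ ^ 2) vol₊ := hf.enorm.pow_const 2

lemma sqL2_add_le {f g : Fn} (hf : StripMeas f) :
    sqL2 (fun p => f p + g p) ≤ 2 * sqL2 f + 2 * sqL2 g := by
  have h : ∀ p, ‖f p + g p‖ₑ ^ 2 ≤ 2 * ‖f p‖ₑ ^ 2 + 2 * ‖g p‖ₑ ^ 2 := by
    intro p
    simp only [enorm_sq_eq]
    rw [show (2 : ℝ≥0∞) = ofReal 2 by simp, ← ofReal_mul (by norm_num),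
      ← ofReal_mul (by norm_num), ← ENNReal.ofReal_add (by positivity) (by positivity)]
    exact ofReal_le_ofReal (by nlinarith [sq_nonneg (f p - g p)])
  refine (lintegral_mono h).trans ?_
  rw [lintegral_add_left' (hf.enorm_sq.const_mul _), lintegral_const_mul' _ _ (by simp),
    lintegral_const_mul' _ _ (by simp)]
  rfl

lemma sqL2_sub_le {f g : Fn} (hf : StripMeas f) :
    sqL2 (fun p => f p - g p) ≤ 2 * sqL2 f + 2 * sqL2 g := by
  simp only [sub_eq_add_neg]
  rw [← sqL2_neg g]
  exact sqL2_add_le hf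

/-- A weight on the strip. -/
structure IsWeight (ρ : Fn) : Prop where
  cont : ContinuousOn ρ strip
  pos : ∀ p ∈ strip, 0 < ρ p

lemma IsWeight.meas {ρ : Fn} (h : IsWeight ρ) : StripMeas ρ :=
  h.cont.aestronglyMeasurable measurableSet_strip

lemma sin_two_pos' {p : ℝ × ℝ} (hp : p ∈ strip) : 0 < sin (2 * p.2) := sin_two_pos hp.2

lemma wRad_pos {R : ℝ} (hR : 0 < R) : 0 < wRad R := by unfold wRad; positivity

lemma isWeight_sin_rpow (e : ℝ) : IsWeight fun p => wRad p.1 / sin (2 * p.2) ^ e := by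
  refine ⟨?_, fun p hp => div_pos (wRad_pos hp.1) (rpow_pos_of_pos (sin_two_pos' hp) _)⟩
  refine ContinuousOn.div (continuousOn_wRad.comp continuousOn_fst fun p hp => hp.1) ?_
    fun p hp => (rpow_pos_of_pos (sin_two_pos' hp) _).ne'
  exact ContinuousOn.rpow_const (by fun_prop) fun p hp => Or.inl (sin_two_pos' hp).ne'

lemma isWeight_weightRad : IsWeight weightRad := isWeight_sin_rpow _

lemma isWeight_weightAng (α : ℝ) : IsWeight (weightAng α) := isWeight_sin_rpow _

lemma locallyIntegrableOn_of_sqL2 {f ρ : Fn} (hρ : IsWeight ρ) (hf : StripMeas f)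
    (h : wSq ρ f < ⊤) : LocallyIntegrableOn f strip := by
  rw [locallyIntegrableOn_iff isOpen_strip.isLocallyClosed]
  intro k hk hkc
  have h2 : MemLp (fun p => f p * ρ p) 2 vol₊ := by
    refine ⟨hf.mul hρ.meas, ?_⟩
    rw [sqL2_eq_eLpNorm] at h
    exact ((ENNReal.pow_lt_top_iff).1 h).resolve_right (by simp)
  have : IsFiniteMeasure (volume.restrict k : Measure (ℝ × ℝ)) :=
    ⟨by simpa using hkc.measure_lt_top⟩
  have h3 : IntegrableOn (fun p => f p * ρ p) k := by
    have h4 : MemLp (fun p => f p * ρ p) 2 (volume.restrict k) :=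
      h2.mono_measure (Measure.restrict_mono hk le_rfl)
    exact h4.integrable (by norm_num)
  have h5 : IntegrableOn (fun p => f p * ρ p * (ρ p)⁻¹) k :=
    h3.mul_continuousOn ((hρ.cont.mono hk).inv₀ fun p hp => (hρ.pos p (hk hp)).ne') hkc
  refine h5.congr_fun (fun p hp => ?_) hkc.measurableSet
  have := (hρ.pos p (hk hp)).ne'
  field_simp

/-- Convergence in a weighted `L²` space. -/
def L2Tendsto (ρ : Fn) (f : ℕ → Fn) (g : Fn) : Prop :=
  Tendsto (fun n => sqL2 (fun p => (f n p - g p) * ρ p)) atTop (𝓝 0)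

lemma exists_l2Limit {ρ : Fn} (hρ : IsWeight ρ) {f : ℕ → Fn} {e : ℕ → ℝ≥0∞}
    (he : Tendsto e atTop (𝓝 0)) (hf : ∀ n, StripMeas (f n))
    (h : ∀ n, wSq ρ (f n) < ⊤)
    (hc : ∀ n m, sqL2 (fun p => (f n p - f m p) * ρ p) ≤ e n + e m) :
    ∃ g, StripMeas g ∧ L2Tendsto ρ f g ∧ wSq ρ g < ⊤ := by
  have hm : ∀ n, MemLp (fun p => f n p * ρ p) 2 vol₊ := fun n => by
    refine ⟨(hf n).mul hρ.meas, ?_⟩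
    have := h n
    rw [sqL2_eq_eLpNorm] at this
    exact ((ENNReal.pow_lt_top_iff).1 this).resolve_right (by simp)
  have hcs : CauchySeq fun n => (hm n).toLp := by
    rw [EMetric.cauchySeq_iff']
    intro ε hε
    have hε2 : 0 < ε ^ 2 / 2 := by
      simp only [ENNReal.div_pos_iff]; exact ⟨(ENNReal.pow_pos hε 2).ne', by simp⟩
    obtain ⟨N, hN⟩ := (eventually_atTop.1 (he.eventually (gt_mem_nhds hε2)))
    refine ⟨N, fun n hn => ?_⟩
    rw [Lp.edist_toLp_toLp]
    have h1 := hc n N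
    have h2 : e n + e N < ε ^ 2 := by
      calc e n + e N < ε ^ 2 / 2 + ε ^ 2 / 2 := ENNReal.add_lt_add (hN n hn) (hN N le_rfl)
        _ = ε ^ 2 := ENNReal.add_halves _
    have h3 := h1.trans_lt h2
    rw [sqL2_eq_eLpNorm] at h3
    have h4 := lt_of_not_ge fun hh => h3.not_ge (pow_le_pow_left' hh 2)
    refine lt_of_eq_of_lt (congrArg (fun F => eLpNorm F 2 vol₊) ?_) h4
    ext p
    simp only [Pi.sub_apply]; ring
  obtain ⟨y, hy⟩ := cauchySeq_tendsto_of_complete hcs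
  have hlim : Tendsto (fun n => eLpNorm ((fun p => f n p * ρ p) - ⇑y) 2 vol₊) atTop (𝓝 0) := by
    refine (Lp.tendsto_Lp_iff_tendsto_eLpNorm'' (fun n p => f n p * ρ p) hm (⇑y) (Lp.memLp y)).1 ?_
    rwa [Lp.toLp_coeFn]
  have hym := Lp.memLp y
  refine ⟨fun p => y p / ρ p,
    (hym.1.aemeasurable.div hρ.meas.aemeasurable).aestronglyMeasurable, ?_, ?_⟩
  · have e1 : ∀ n, sqL2 (fun p => (f n p - y p / ρ p) * ρ p) =
        eLpNorm ((fun p => f n p * ρ p) - ⇑y) 2 vol₊ ^ 2 := by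
      intro n
      rw [← sqL2_eq_eLpNorm]
      refine sqL2_congr_ae (ae_strip_of_forall fun p hp => ?_)
      have := (hρ.pos p hp).ne'
      simp only [Pi.sub_apply]
      field_simp
    unfold L2Tendsto
    simp only [e1]
    simpa using ENNReal.Tendsto.pow (n := 2) hlim
  · rw [sqL2_congr_ae (g := ⇑y) (ae_strip_of_forall fun p hp => by
      have := (hρ.pos p hp).ne'
      field_simp), sqL2_eq_eLpNorm]
    exact ENNReal.pow_lt_top hym.2

lemma L2Tendsto.sqL2_le {ρ : Fn} {f F : ℕ → Fn} {g G : Fn} {C : ℝ≥0}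
    {σ : Fn} (hρ : IsWeight ρ) (hσ : IsWeight σ)
    (hf : ∀ n, StripMeas (f n)) (hF : ∀ n, StripMeas (F n)) (hg : StripMeas g) (hG : StripMeas G)
    (h1 : L2Tendsto ρ f g) (h2 : L2Tendsto σ F G)
    (hle : ∀ n, wSq ρ (f n) ≤ C * wSq σ (F n)) :
    wSq ρ g ≤ (4 * C) * wSq σ G := by
  have hb : ∀ n, wSq ρ g ≤ 2 * sqL2 (fun p => (f n p - g p) * ρ p) +
      2 * (C * (2 * sqL2 (fun p => (F n p - G p) * σ p) + 2 * wSq σ G)) := by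
    intro n
    have e1 := sqL2_sub_le (f := fun p => (f n p - g p) * ρ p) (g := fun p => f n p * ρ p)
      (((hf n).sub hg).mul hρ.meas)
    have e2 := sqL2_add_le (f := fun p => (F n p - G p) * σ p) (g := fun p => G p * σ p)
      (((hF n).sub hG).mul hσ.meas)
    have e3 : sqL2 (fun p => (f n p - g p) * ρ p - f n p * ρ p) = wSq ρ g := by
      rw [← sqL2_neg]; congr 1; ext p; ring
    have e4 : (fun p => (F n p - G p) * σ p + G p * σ p) = fun p => F n p * σ p := by
      ext p; ring
    rw [e3] at e1
    rw [e4] at e2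
    refine e1.trans (add_le_add le_rfl (mul_le_mul_right ((hle n).trans ?_) _))
    exact mul_le_mul_right e2 _
  have hl : Tendsto (fun n => 2 * sqL2 (fun p => (f n p - g p) * ρ p) +
      2 * (C * (2 * sqL2 (fun p => (F n p - G p) * σ p) + 2 * wSq σ G))) atTop
      (𝓝 (2 * 0 + 2 * (C * (2 * 0 + 2 * wSq σ G)))) := by
    refine (ENNReal.Tendsto.const_mul h1 (Or.inr (by simp))).add (ENNReal.Tendsto.const_mul
      (ENNReal.Tendsto.const_mul ((ENNReal.Tendsto.const_mul h2 (Or.inr (by simp))).add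
        tendsto_const_nhds) (Or.inr (by simp))) (Or.inr (by simp)))
  refine (ge_of_tendsto' hl hb).trans (le_of_eq ?_)
  ring

/-! ### Calculus of weak derivatives -/

lemma sqL2_lt_top_of_test {φ c : Fn} (hφ : Continuous φ) (hc : HasCompactSupport φ)
    (hs : tsupport φ ⊆ strip) (hcc : ContinuousOn c strip) : sqL2 (fun p => φ p * c p) < ⊤ := by
  obtain ⟨M, hM⟩ := hc.isCompact.exists_bound_of_continuousOn
    (f := fun p => φ p * c p) (hφ.continuousOn.mul (hcc.mono hs))
  have hle : ∀ p, ‖φ p * c p‖ₑ ^ 2 ≤ (tsupport φ).indicator (fun _ => ofReal (M ^ 2)) p := by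
    intro p
    by_cases hp : p ∈ tsupport φ
    · rw [indicator_of_mem hp, enorm_sq_eq]
      refine ofReal_le_ofReal ?_
      have := hM p hp
      rw [← sq_abs, ← Real.norm_eq_abs]
      exact pow_le_pow_left₀ (norm_nonneg _) this 2
    · rw [indicator_of_notMem hp, image_eq_zero_of_notMem_tsupport hp]; simp
  refine (lintegral_mono hle).trans_lt ?_
  rw [lintegral_indicator (isClosed_tsupport φ).measurableSet, lintegral_const]
  refine mul_lt_top ofReal_lt_top ?_
  rw [Measure.restrict_apply_univ]
  exact (Measure.restrict_apply_le _ _).trans_lt hc.isCompact.measure_lt_top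

lemma tendsto_integral_test {ρ c φ : Fn} (hρ : IsWeight ρ) {f : ℕ → Fn}
    {g : Fn} (hcc : ContinuousOn c strip) (hφ : Continuous φ) (hc : HasCompactSupport φ)
    (hs : tsupport φ ⊆ strip) (hf : ∀ n, LocallyIntegrableOn (fun p => f n p * c p) strip)
    (hg : LocallyIntegrableOn (fun p => g p * c p) strip) (hfm : ∀ n, StripMeas (f n))
    (hgm : StripMeas g) (h : L2Tendsto ρ f g) :
    Tendsto (fun n => ∫ p in strip, f n p * c p * φ p) atTop
      (𝓝 (∫ p in strip, g p * c p * φ p)) := by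
  rw [tendsto_iff_edist_tendsto_0]
  set B := sqL2 (fun p => φ p * (c p / ρ p)) with hB
  have hBt : B < ⊤ := sqL2_lt_top_of_test hφ hc hs (hcc.div hρ.cont fun p hp => (hρ.pos p hp).ne')
  have hb : ∀ n, edist (∫ p in strip, f n p * c p * φ p) (∫ p in strip, g p * c p * φ p) ≤
      sqL2 (fun p => (f n p - g p) * ρ p) ^ (1 / 2 : ℝ) * B ^ (1 / 2 : ℝ) := by
    intro n
    rw [edist_eq_enorm_sub, ← integral_sub
      (LocallyIntegrableOn.mul_test (hf n) hφ hc hs).integrableOn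
      (LocallyIntegrableOn.mul_test hg hφ hc hs).integrableOn]
    refine (enorm_integral_le_lintegral_enorm _).trans ?_
    have e1 : ∫⁻ p in strip, ‖f n p * c p * φ p - g p * c p * φ p‖ₑ =
        ∫⁻ p in strip, ((fun p => ‖(f n p - g p) * ρ p‖ₑ) * fun p => ‖φ p * (c p / ρ p)‖ₑ) p := by
      refine setLIntegral_congr_fun measurableSet_strip fun p hp => ?_
      simp only [Pi.mul_apply]
      rw [← enorm_mul]
      have := (hρ.pos p hp).ne'
      congr 1
      field_simp
    rw [e1]
    have m1 : AEMeasurable (fun p => ‖(f n p - g p) * ρ p‖ₑ) vol₊ :=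
      (((hfm n).sub hgm).mul hρ.meas).enorm
    have m2 : AEMeasurable (fun p => ‖φ p * (c p / ρ p)‖ₑ) vol₊ :=
      (hφ.aestronglyMeasurable.mul ((hcc.div hρ.cont fun p hp =>
        (hρ.pos p hp).ne').aestronglyMeasurable measurableSet_strip)).enorm
    refine (ENNReal.lintegral_mul_le_Lp_mul_Lq _ (Real.HolderConjugate.two_two) m1 m2).trans ?_
    rw [hB, sqL2, sqL2]
    simp only [← ENNReal.rpow_natCast]
    norm_num
  refine tendsto_of_tendsto_of_tendsto_of_le_of_le tendsto_const_nhds ?_ (fun _ => zero_le) hb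
  have h1 : Tendsto (fun n => sqL2 (fun p => (f n p - g p) * ρ p) ^ (1 / 2 : ℝ)) atTop (𝓝 0) := by
    have := (ENNReal.continuous_rpow_const (y := 1 / 2)).tendsto (0 : ℝ≥0∞) |>.comp h
    simpa [ENNReal.zero_rpow_of_pos, Function.comp_def] using this
  have h2 := ENNReal.Tendsto.mul_const (b := B ^ (1 / 2 : ℝ)) h1
    (Or.inr (ENNReal.rpow_ne_top_of_nonneg (by norm_num) hBt.ne))
  simpa using h2

lemma tsupport_fderiv_apply_subset' (φ : Fn) (v : ℝ × ℝ) :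
    tsupport (fun p => fderiv ℝ φ p v) ⊆ tsupport φ :=
  tsupport_fderiv_apply_subset ℝ v

variable {v : ℝ × ℝ} {f g f' g' : Fn}

lemma HasWeakPartial.of_tendsto {ρ σ d : Fn} {fn gn : ℕ → Fn} (hρ : IsWeight ρ)
    (hσ : IsWeight σ) (hd : ContinuousOn d strip) (hd0 : ∀ p ∈ strip, d p ≠ 0)
    (h : ∀ n, HasWeakPartial v (fn n) (fun p => gn n p / d p))
    (hgm : ∀ n, StripMeas (gn n)) (hf : LocallyIntegrableOn f strip)
    (hg : LocallyIntegrableOn g strip) (h1 : L2Tendsto ρ fn f) (h2 : L2Tendsto σ gn g) :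
    HasWeakPartial v f (fun p => g p / d p) := by
  have hdi : ContinuousOn (fun p => (d p)⁻¹) strip := hd.inv₀ hd0
  have hgd : LocallyIntegrableOn (fun p => g p * (d p)⁻¹) strip :=
    hg.mul_continuousOn hdi isOpen_strip.isLocallyClosed
  refine ⟨hf, by simpa only [div_eq_mul_inv] using hgd, fun φ hφ hc hs => ?_⟩
  have cdφ : Continuous fun p => fderiv ℝ φ p v := (contDiff_fderiv_apply hφ v).continuous
  have t1 := tendsto_integral_test hρ (c := fun _ => 1) continuousOn_const cdφ
    (hc.fderiv_apply ℝ v) ((tsupport_fderiv_apply_subset' φ v).trans hs)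
    (fun n => by simpa using (h n).locInt) (by simpa using hf)
    (fun n => (h n).locInt.aestronglyMeasurable) hf.aestronglyMeasurable h1
  have t2 := tendsto_integral_test hσ hdi hφ.continuous hc hs
    (fun n => by simpa only [div_eq_mul_inv] using (h n).locInt_deriv) hgd hgm
    hg.aestronglyMeasurable h2
  simp only [mul_one] at t1
  have e : ∀ n, ∫ p in strip, fn n p * fderiv ℝ φ p v = - ∫ p in strip, gn n p * (d p)⁻¹ * φ p :=
    fun n => by simpa only [div_eq_mul_inv] using (h n).parts φ hφ hc hs
  simp only [e] at t1
  simpa only [div_eq_mul_inv] using tendsto_nhds_unique t1 t2.neg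

lemma HasWeakPartial.congr (h : HasWeakPartial v f g)
    (hf : ∀ᵐ p ∂vol₊, f' p = f p) (hg : ∀ᵐ p ∂vol₊, g' p = g p) :
    HasWeakPartial v f' g' := by
  have key : ∀ {f f' : Fn}, (∀ᵐ p ∂vol₊, f' p = f p) →
      LocallyIntegrableOn f strip → LocallyIntegrableOn f' strip := by
    intro f f' hf h
    rw [locallyIntegrableOn_iff isOpen_strip.isLocallyClosed] at h ⊢
    intro k hk hkc
    exact (h k hk hkc).congr (by
      filter_upwards [ae_restrict_of_ae_restrict_of_subset hk hf] with p hp using hp.symm)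
  refine ⟨key hf h.locInt, key hg h.locInt_deriv, fun φ hφ hc hs => ?_⟩
  have e := h.parts φ hφ hc hs
  rw [integral_congr_ae (g := fun p => f p * fderiv ℝ φ p v) (by
    filter_upwards [hf] with p hp; rw [hp]), e, integral_congr_ae (g := fun p => g' p * φ p) (by
    filter_upwards [hg] with p hp; rw [hp])]

lemma HasWeakPartial.congr_on (h : HasWeakPartial v f g) (hf : ∀ p ∈ strip, f' p = f p)
    (hg : ∀ p ∈ strip, g' p = g p) : HasWeakPartial v f' g' :=
  h.congr (ae_strip_of_forall hf) (ae_strip_of_forall hg)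

lemma HasWeakPartial.integrable_left (h : HasWeakPartial v f g) {φ : Fn}
    (hφ : ContDiff ℝ ∞ φ) (hc : HasCompactSupport φ) (hs : tsupport φ ⊆ strip) :
    Integrable (fun p => f p * fderiv ℝ φ p v) vol₊ :=
  (LocallyIntegrableOn.mul_test h.locInt (contDiff_fderiv_apply hφ v).continuous
    (hc.fderiv_apply ℝ v) ((tsupport_fderiv_apply_subset' φ v).trans hs)).integrableOn

lemma HasWeakPartial.integrable_right (h : HasWeakPartial v f g) {φ : Fn}
    (hφ : ContDiff ℝ ∞ φ) (hc : HasCompactSupport φ) (hs : tsupport φ ⊆ strip) :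
    Integrable (fun p => g p * φ p) vol₊ :=
  (LocallyIntegrableOn.mul_test h.locInt_deriv hφ.continuous hc hs).integrableOn

lemma HasWeakPartial.add (h : HasWeakPartial v f g) (h' : HasWeakPartial v f' g') :
    HasWeakPartial v (fun p => f p + f' p) (fun p => g p + g' p) := by
  refine ⟨h.locInt.add h'.locInt, h.locInt_deriv.add h'.locInt_deriv, fun φ hφ hc hs => ?_⟩
  simp only [add_mul]
  rw [integral_add (h.integrable_left hφ hc hs) (h'.integrable_left hφ hc hs),
    integral_add (h.integrable_right hφ hc hs) (h'.integrable_right hφ hc hs),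
    h.parts φ hφ hc hs, h'.parts φ hφ hc hs]
  ring

lemma HasWeakPartial.const_mul (h : HasWeakPartial v f g) (c : ℝ) :
    HasWeakPartial v (fun p => c * f p) (fun p => c * g p) := by
  refine ⟨h.locInt.continuousOn_mul continuousOn_const isOpen_strip.isLocallyClosed,
    h.locInt_deriv.continuousOn_mul continuousOn_const isOpen_strip.isLocallyClosed, fun φ hφ hc hs => ?_⟩
  simp only [mul_assoc, integral_const_mul]
  rw [h.parts φ hφ hc hs]; ring

lemma HasWeakPartial.smul_left (h : HasWeakPartial v f g) {a : Fn} (ha : ContDiff ℝ ∞ a) :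
    HasWeakPartial v (fun p => a p * f p) (fun p => a p * g p + fderiv ℝ a p v * f p) := by
  have hda := contDiff_fderiv_apply ha v
  have l1 : LocallyIntegrableOn (fun p => a p * f p) strip :=
    h.locInt.continuousOn_mul ha.continuous.continuousOn isOpen_strip.isLocallyClosed
  have l2 : LocallyIntegrableOn (fun p => a p * g p) strip :=
    h.locInt_deriv.continuousOn_mul ha.continuous.continuousOn isOpen_strip.isLocallyClosed
  have l3 : LocallyIntegrableOn (fun p => fderiv ℝ a p v * f p) strip :=
    h.locInt.continuousOn_mul hda.continuous.continuousOn isOpen_strip.isLocallyClosed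
  refine ⟨l1, l2.add l3, fun φ hφ hc hs => ?_⟩
  have hs' : tsupport (fun p => a p * φ p) ⊆ strip :=
    (closure_mono (Function.support_mul_subset_right _ _)).trans hs
  have hc' : HasCompactSupport fun p => a p * φ p := hc.mul_left
  have e := h.parts (fun p => a p * φ p) (ha.mul hφ) hc' hs'
  have hfd : ∀ p, fderiv ℝ (fun p => a p * φ p) p v =
      a p * fderiv ℝ φ p v + fderiv ℝ a p v * φ p := by
    intro p
    rw [fderiv_fun_mul (ContDiff.diffAt ha p) (ContDiff.diffAt hφ p)]
    simp; ring
  simp only [hfd] at e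
  have i1 : Integrable (fun p => a p * f p * fderiv ℝ φ p v) vol₊ :=
    (LocallyIntegrableOn.mul_test l1 (contDiff_fderiv_apply hφ v).continuous
      (hc.fderiv_apply ℝ v) ((tsupport_fderiv_apply_subset' φ v).trans hs)).integrableOn
  have i2 := (LocallyIntegrableOn.mul_test l2 hφ.continuous hc hs).integrableOn (s := strip)
  have i3 := (LocallyIntegrableOn.mul_test l3 hφ.continuous hc hs).integrableOn (s := strip)
  have e1 : ∀ p, f p * (a p * fderiv ℝ φ p v + fderiv ℝ a p v * φ p) =
      a p * f p * fderiv ℝ φ p v + fderiv ℝ a p v * f p * φ p := fun p => by ring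
  have e2 : ∀ p, g p * (a p * φ p) = a p * g p * φ p := fun p => by ring
  have e3 : ∀ p, (a p * g p + fderiv ℝ a p v * f p) * φ p =
      a p * g p * φ p + fderiv ℝ a p v * f p * φ p := fun p => by ring
  simp only [e1, e2] at e
  rw [integral_add i1 i3] at e
  simp only [e3]
  rw [integral_add i2 i3]
  linarith

lemma HasWeakPartial.of_contDiff (hf : ContDiff ℝ ∞ f) (v : ℝ × ℝ) :
    HasWeakPartial v f (fun p => fderiv ℝ f p v) := by
  have hd := contDiff_fderiv_apply hf v
  refine ⟨hf.continuous.locallyIntegrable.locallyIntegrableOn _,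
    hd.continuous.locallyIntegrable.locallyIntegrableOn _, fun φ hφ hc hs => ?_⟩
  have hdφ := contDiff_fderiv_apply hφ v
  have r : ∀ {F φ : Fn}, tsupport φ ⊆ strip → ∫ p in strip, F p * φ p = ∫ p, F p * φ p :=
    fun hs => setIntegral_eq_integral_of_forall_compl_eq_zero fun p hp => by
      rw [image_eq_zero_of_notMem_tsupport fun hh => hp (hs hh), mul_zero]
  rw [r ((tsupport_fderiv_apply_subset' φ v).trans hs), r hs]
  refine integral_mul_fderiv_eq_neg_fderiv_mul_of_integrable ?_ ?_ ?_
    (fun p _ => ContDiff.diffAt hf p) (fun p _ => ContDiff.diffAt hφ p)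
  · exact (hd.continuous.mul hφ.continuous).integrable_of_hasCompactSupport hc.mul_left
  · exact (hf.continuous.mul hdφ.continuous).integrable_of_hasCompactSupport
      (hc.fderiv_apply ℝ v).mul_left
  · exact (hf.continuous.mul hφ.continuous).integrable_of_hasCompactSupport hc.mul_left

lemma HasWeakPartial.unique (h : HasWeakPartial v f g)
    (h' : HasWeakPartial v f' g') (hff : ∀ᵐ p ∂vol₊, f' p = f p) :
    ∀ᵐ p ∂vol₊, g' p = g p := by
  have hl : LocallyIntegrableOn (fun p => g' p - g p) strip := h'.locInt_deriv.sub h.locInt_deriv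
  have hz : ∀ᵐ p ∂(volume : Measure (ℝ × ℝ)), p ∈ strip → g' p - g p = 0 := by
    refine IsOpen.ae_eq_zero_of_integral_contDiff_smul_eq_zero isOpen_strip hl fun φ hφ hc hs => ?_
    have i1 := h.integrable_right hφ hc hs
    have i2 := h'.integrable_right hφ hc hs
    have e1 := h.parts φ hφ hc hs
    have e2 := h'.parts φ hφ hc hs
    have e3 : ∫ p in strip, f' p * fderiv ℝ φ p v = ∫ p in strip, f p * fderiv ℝ φ p v :=
      integral_congr_ae (by filter_upwards [hff] with p hp; rw [hp])
    rw [← setIntegral_eq_integral_of_forall_compl_eq_zero (s := strip) fun p hp => by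
      rw [image_eq_zero_of_notMem_tsupport fun hh => hp (hs hh), zero_smul]]
    have e4 : ∀ p, φ p • (g' p - g p) = g' p * φ p - g p * φ p := fun p => by
      rw [smul_eq_mul]; ring
    simp only [e4]
    rw [integral_sub i2 i1]
    linarith
  rw [ae_restrict_iff' measurableSet_strip]
  filter_upwards [hz] with p hp hps
  linarith [hp hps]


/-! ### Weighted inequalities on slices -/

lemma IsPrim.continuousOn {B : Set ℝ} [B.OrdConnected] (hB : IsOpen B) {u v U : ℝ → ℝ}
    (h : IsPrim B u v U) : ContinuousOn U B := by
  intro x hx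
  obtain ⟨p, q, hpq, hs⟩ := exists_rat_Icc hB hx
  have hle : (p : ℝ) ≤ q := (hpq.1.trans hpq.2).le
  have hp := hs (left_mem_Icc.2 hle)
  have h1 : ContinuousOn (fun y => ∫ t in (p : ℝ)..y, v t) (Icc (p : ℝ) q) :=
    intervalIntegral.continuousOn_primitive_interval'
      (intervalIntegrable_of_loc h.locInt hp (hs (right_mem_Icc.2 hle)))
      left_mem_uIcc |>.mono (by rw [uIcc_of_le hle])
  have h2 : ContinuousAt (fun y => U p + ∫ t in (p : ℝ)..y, v t) x :=
    continuousAt_const.add (h1.continuousAt (Icc_mem_nhds hpq.1 hpq.2))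
  refine (h2.congr ?_).continuousWithinAt
  filter_upwards [hB.mem_nhds hx] with y hy
  rw [h.ftc _ hp y hy]; ring

lemma IsPrim.integral_sq {B : Set ℝ} [hBo : B.OrdConnected] {u v U c c' : ℝ → ℝ}
    (h : IsPrim B u v U) (hc : ContDiffOn ℝ 1 c B) (hc' : ∀ x ∈ B, HasDerivAt c (c' x) x)
    {x y : ℝ} (hx : x ∈ B) (hy : y ∈ B) :
    IntervalIntegrable (fun t => c' t * U t ^ 2 + 2 * c t * U t * v t) volume x y ∧
    ∫ t in x..y, (c' t * U t ^ 2 + 2 * c t * U t * v t) = c y * U y ^ 2 - c x * U x ^ 2 := by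
  have hsub : uIcc x y ⊆ B := hBo.uIcc_subset hx hy
  have hv := intervalIntegrable_of_loc h.locInt hx hy
  set V : ℝ → ℝ := fun t => U x + ∫ s in x..t, v s with hV
  have hVU : ∀ t ∈ B, V t = U t := fun t ht => by rw [hV]; simp only; rw [h.ftc x hx t ht]; ring
  have a1 : AbsolutelyContinuousOnInterval V x y :=
    ((contDiffOn_const (n := 1) (c := U x)).absolutelyContinuousOnInterval).add
      (hv.absolutelyContinuousOnInterval_intervalIntegral (c := x) left_mem_uIcc)
  have a2 : AbsolutelyContinuousOnInterval c x y := (hc.mono hsub).absolutelyContinuousOnInterval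
  have a3 := (a2.mul a1).mul a1
  have e := a3.integral_deriv_eq_sub
  have hd : ∀ᵐ t, t ∈ uIoc x y → deriv (c * V * V) t = c' t * U t ^ 2 + 2 * c t * U t * v t := by
    filter_upwards [hv.ae_hasDerivAt_integral] with t ht hm
    have hm' := uIoc_subset_uIcc hm
    have d1 : HasDerivAt V (v t) t := (ht hm' x left_mem_uIcc).const_add (U x)
    rw [(((hc' t (hsub hm')).mul d1).mul d1).deriv, Pi.mul_apply, hVU t (hsub hm')]
    ring
  refine ⟨?_, ?_⟩
  · refine a3.intervalIntegrable_deriv.congr_ae ?_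
    rw [EventuallyEq, ae_restrict_iff' measurableSet_uIoc]
    exact hd
  · rw [← intervalIntegral.integral_congr_ae hd, e]
    simp only [Pi.mul_apply, hVU x hx, hVU y hy]
    ring

lemma exists_small_of_lintegral {a b c : ℝ} (hab : a < b) (hc : c = a ∨ c = b) {f : ℝ → ℝ}
    (h : ∫⁻ x in Ioo a b, ‖f x‖ₑ ^ 2 < ⊤) {ε : ℝ} (hε : 0 < ε) :
    ∃ x ∈ Ioo a b, |x - c| * f x ^ 2 < ε := by
  by_contra! hcon
  have hcn : ∀ x ∈ Ioo a b, 0 < |x - c| := by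
    intro x hx
    refine abs_pos.2 (sub_ne_zero.2 ?_)
    rcases hc with rfl | rfl
    · exact hx.1.ne'
    · exact hx.2.ne
  have hle : ∫⁻ x in Ioo a b, ‖ε * (x - c)⁻¹‖ₑ ≤ ∫⁻ x in Ioo a b, ‖f x‖ₑ ^ 2 := by
    refine setLIntegral_mono' measurableSet_Ioo fun x hx => ?_
    rw [enorm_sq_eq, enorm_eq_ofReal_abs]
    refine ofReal_le_ofReal ?_
    rw [abs_mul, abs_of_pos hε, abs_inv, ← div_eq_mul_inv, div_le_iff₀ (hcn x hx), mul_comm]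
    exact hcon x hx
  have hint : IntegrableOn (fun x => ε * (x - c)⁻¹) (Ioo a b) := ⟨by fun_prop, hle.trans_lt h⟩
  have h2 : IntervalIntegrable (fun x => (x - c)⁻¹) volume a b := by
    rw [intervalIntegrable_iff_integrableOn_Ioo_of_le hab.le]
    refine IntegrableOn.congr_fun (hint.const_mul ε⁻¹) (fun x _ => ?_) measurableSet_Ioo
    field_simp
  rw [intervalIntegrable_sub_inv_iff] at h2
  rcases h2 with h2 | h2
  · exact hab.ne h2
  · refine h2 ?_
    rcases hc with rfl | rfl
    · exact left_mem_uIcc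
    · exact right_mem_uIcc

lemma intervalIntegrable_sq_of_lintegral {x y : ℝ} (hxy : x ≤ y) {f : ℝ → ℝ}
    (hm : AEStronglyMeasurable f (volume.restrict (Ioc x y)))
    (h : ∫⁻ t in Ioc x y, ‖f t‖ₑ ^ 2 < ⊤) : IntervalIntegrable (fun t => f t ^ 2) volume x y := by
  rw [intervalIntegrable_iff_integrableOn_Ioc_of_le hxy]
  refine ⟨hm.pow 2, ?_⟩
  rw [hasFiniteIntegral_iff_enorm]
  simpa only [enorm_pow] using h

lemma ofReal_integral_sq {x y : ℝ} (hxy : x ≤ y) {f : ℝ → ℝ}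
    (h : IntervalIntegrable (fun t => f t ^ 2) volume x y) :
    ofReal (∫ t in x..y, f t ^ 2) = ∫⁻ t in Ioc x y, ‖f t‖ₑ ^ 2 := by
  rw [integral_of_le hxy, ofReal_integral_eq_lintegral_ofReal
    ((intervalIntegrable_iff_integrableOn_Ioc_of_le hxy).1 h)
    (Eventually.of_forall fun t => sq_nonneg (f t))]
  simp only [enorm_sq_eq]

/-- The comparison of two weighted squares on an interval. -/
lemma IsPrim.lintegral_sq_le {B : Set ℝ} [hBo : B.OrdConnected]
    {u v U c c' p q : ℝ → ℝ} (h : IsPrim B u v U) (hc : ContDiffOn ℝ 1 c B)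
    (hc' : ∀ x ∈ B, HasDerivAt c (c' x) x) {x y k : ℝ} (hx : x ∈ B) (hy : y ∈ B) (hxy : x ≤ y)
    (hp : ContinuousOn p B) (hqm : AEStronglyMeasurable q (volume.restrict (Ioc x y)))
    (hk : 0 ≤ k) {σ : ℝ}
    (hle : ∀ t ∈ Ioc x y, p t ^ 2 ≤ q t ^ 2 + σ * (c' t * U t ^ 2 + 2 * c t * U t * v t))
    (hbd : σ * (c y * U y ^ 2 - c x * U x ^ 2) ≤ k) :
    ∫⁻ t in Ioc x y, ‖p t‖ₑ ^ 2 ≤ (∫⁻ t in Ioc x y, ‖q t‖ₑ ^ 2) + ofReal k := by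
  by_cases hq : ∫⁻ t in Ioc x y, ‖q t‖ₑ ^ 2 < ⊤
  swap
  · rw [not_lt_top_iff] at hq
    rw [hq]; simp
  have iq := intervalIntegrable_sq_of_lintegral hxy hqm hq
  have ip : IntervalIntegrable (fun t => p t ^ 2) volume x y :=
    ((hp.mono (hBo.uIcc_subset hx hy)).pow 2).intervalIntegrable
  obtain ⟨iE, hE⟩ := h.integral_sq hc hc' hx hy
  rw [← ofReal_integral_sq hxy ip, ← ofReal_integral_sq hxy iq, ← ENNReal.ofReal_add
    (intervalIntegral.integral_nonneg hxy fun t _ => sq_nonneg _) hk]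
  refine ofReal_le_ofReal ?_
  have h1 : ∫ t in x..y, p t ^ 2 ≤
      ∫ t in x..y, (q t ^ 2 + σ * (c' t * U t ^ 2 + 2 * c t * U t * v t)) := by
    rw [integral_of_le hxy, integral_of_le hxy]
    exact setIntegral_mono_on ((intervalIntegrable_iff_integrableOn_Ioc_of_le hxy).1 ip)
      ((intervalIntegrable_iff_integrableOn_Ioc_of_le hxy).1 (iq.add (iE.const_mul _)))
      measurableSet_Ioc hle
  rw [intervalIntegral.integral_add iq (iE.const_mul _), intervalIntegral.integral_const_mul,
    hE] at h1
  linarith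

lemma contDiffOn_radial_weight : ContDiffOn ℝ 1 (fun r => r * wRad r ^ 2) (Ioi 0) := by
  unfold wRad
  refine contDiffOn_id.mul (ContDiffOn.pow (ContDiffOn.div (by fun_prop) (by fun_prop)
    fun r hr => ?_) 2)
  have : (0 : ℝ) < r := hr
  positivity

/-- The bound `|u| ≤ |2u + R u'|` in `L²(w² dR)`. -/
lemma radial_slice {u v U : ℝ → ℝ} (h : IsPrim (Ioi 0) u (fun R => v R / R) U)
    (hu : ∫⁻ R in Ioi (0 : ℝ), ‖u R * wRad R‖ₑ ^ 2 < ⊤) :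
    ∫⁻ R in Ioi (0 : ℝ), ‖u R * wRad R‖ₑ ^ 2 ≤
      ∫⁻ R in Ioi (0 : ℝ), ‖(2 * u R + v R) * wRad R‖ₑ ^ 2 := by
  have hUc := h.continuousOn isOpen_Ioi
  have eU : ∫⁻ R in Ioi (0 : ℝ), ‖u R * wRad R‖ₑ ^ 2 =
      ∫⁻ R in Ioi (0 : ℝ), ‖U R * wRad R‖ₑ ^ 2 := by
    refine lintegral_congr_ae ?_
    filter_upwards [h.ae_eq] with R hR
    rw [hR]
  have eV : ∫⁻ R in Ioi (0 : ℝ), ‖(2 * u R + v R) * wRad R‖ₑ ^ 2 =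
      ∫⁻ R in Ioi (0 : ℝ), ‖(2 * U R + v R) * wRad R‖ₑ ^ 2 := by
    refine lintegral_congr_ae ?_
    filter_upwards [h.ae_eq] with R hR
    rw [hR]
  rw [eU] at hu ⊢
  rw [eV]
  have hvm : AEStronglyMeasurable v (volume.restrict (Ioi (0 : ℝ))) := by
    have := h.locInt.aestronglyMeasurable
    refine (this.mul (g := fun R => R) (by fun_prop)).congr ?_
    filter_upwards [ae_restrict_mem measurableSet_Ioi] with R hR
    have : R ≠ 0 := (mem_Ioi.1 hR).ne'
    simp only [Pi.mul_apply]
    field_simp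
  have hpt : ∀ n : ℕ, ∃ x ∈ Ioo (0 : ℝ) (1 / ((n : ℝ) + 1)),
      |x - 0| * (U x * wRad x) ^ 2 < 1 / ((n : ℝ) + 1) := fun n =>
    exists_small_of_lintegral (by positivity) (Or.inl rfl)
      ((lintegral_mono_set Ioo_subset_Ioi_self).trans_lt hu) (by positivity)
  choose x hx hxs using hpt
  have hx0 : Tendsto x atTop (𝓝 0) := squeeze_zero (fun n => (hx n).1.le) (fun n => (hx n).2.le)
      tendsto_one_div_add_atTop_nhds_zero_nat
  have hcov : AECover (volume.restrict (Ioi (0 : ℝ))) atTop fun n : ℕ => Ioc (x n) ((n : ℝ) + 1) :=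
    (aecover_Ioi_of_Ioi hx0).inter
      (aecover_Iic (tendsto_atTop_add_const_right _ 1 tendsto_natCast_atTop_atTop))
  have key : ∀ n : ℕ, ∫⁻ R in Ioc (x n) ((n : ℝ) + 1), ‖U R * wRad R‖ₑ ^ 2 ≤
      (∫⁻ R in Ioi (0 : ℝ), ‖(2 * U R + v R) * wRad R‖ₑ ^ 2) + ofReal (1 / ((n : ℝ) + 1)) := by
    intro n
    have hxn := (hx n).1
    have hy : (0 : ℝ) < (n : ℝ) + 1 := by positivity
    have hxy : x n ≤ (n : ℝ) + 1 := by
      have h1 : 1 / ((n : ℝ) + 1) ≤ (n : ℝ) + 1 := by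
        rw [div_le_iff₀ hy]; nlinarith [(Nat.cast_nonneg n : (0 : ℝ) ≤ n)]
      linarith [(hx n).2]
    have hsub : Ioc (x n) ((n : ℝ) + 1) ⊆ Ioi 0 := fun t ht => hxn.trans ht.1
    refine (IsPrim.lintegral_sq_le h contDiffOn_radial_weight
      (fun t ht => hasDerivAt_radial_weight ht) (p := fun R => U R * wRad R)
      (q := fun R => (2 * U R + v R) * wRad R)
      (x := x n) (y := (n : ℝ) + 1) (k := 1 / ((n : ℝ) + 1)) (σ := -1) hxn hy hxy
      (hUc.mul continuousOn_wRad) ?_ (by positivity) ?_ ?_).trans ?_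
    · refine AEStronglyMeasurable.mono_measure ?_ (Measure.restrict_mono hsub le_rfl)
      exact ((hUc.aestronglyMeasurable measurableSet_Ioi).const_mul 2 |>.add hvm).mul
        measurable_wRad.aestronglyMeasurable
    · intro t ht
      have ht0 : 0 < t := hsub ht
      have hq : 1 - 4 / (t + 1) ≤ 1 := by
        have : 0 < 4 / (t + 1) := by positivity
        linarith
      have e : 2 * (t * wRad t ^ 2) * U t * (v t / t) = 2 * wRad t ^ 2 * U t * v t := by
        field_simp
      rw [e]
      have hw := sq_nonneg (wRad t)
      have h3 : 0 ≤ wRad t ^ 2 * ((2 * U t + v t) ^ 2 - U t ^ 2 -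
          ((1 - 4 / (t + 1)) * U t ^ 2 + 2 * U t * v t)) := by
        refine mul_nonneg hw ?_
        nlinarith [mul_nonneg (sub_nonneg.2 hq) (sq_nonneg (U t)), sq_nonneg (U t + v t)]
      nlinarith [h3]
    · have h1 := hxs n
      rw [sub_zero, abs_of_pos hxn] at h1
      have h2 : 0 ≤ ((n : ℝ) + 1) * wRad ((n : ℝ) + 1) ^ 2 * U ((n : ℝ) + 1) ^ 2 := by positivity
      nlinarith
    · exact add_le_add (lintegral_mono_set hsub) le_rfl
  have hm : AEMeasurable (fun R => ‖U R * wRad R‖ₑ ^ 2) (volume.restrict (Ioi (0 : ℝ))) :=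
    (((hUc.mul continuousOn_wRad).aestronglyMeasurable measurableSet_Ioi).enorm).pow_const 2
  have hl := hcov.lintegral_tendsto_of_countably_generated hm
  have hr : Tendsto (fun n : ℕ => (∫⁻ R in Ioi (0 : ℝ), ‖(2 * U R + v R) * wRad R‖ₑ ^ 2) +
      ofReal (1 / ((n : ℝ) + 1))) atTop
      (𝓝 ((∫⁻ R in Ioi (0 : ℝ), ‖(2 * U R + v R) * wRad R‖ₑ ^ 2) + 0)) := by
    refine tendsto_const_nhds.add ?_
    have := ENNReal.tendsto_ofReal tendsto_one_div_add_atTop_nhds_zero_nat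
    simpa using this
  rw [add_zero] at hr
  refine le_of_tendsto_of_tendsto' hl hr fun n => ?_
  have hsub : Ioc (x n) ((n : ℝ) + 1) ⊆ Ioi 0 := fun t ht => (hx n).1.trans ht.1
  rw [Measure.restrict_restrict measurableSet_Ioc, inter_eq_left.2 hsub]
  exact key n

lemma sqL2_fubini {f : Fn} (hf : StripMeas f) :
    sqL2 f = ∫⁻ R in Ioi (0 : ℝ), ∫⁻ θ in J₀, ‖f (R, θ)‖ₑ ^ 2 := by
  have := hf.enorm_sq
  rw [volume_restrict_strip] at this
  rw [sqL2, volume_restrict_strip, lintegral_prod _ this]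

lemma sqL2_fubini_symm {f : Fn} (hf : StripMeas f) :
    sqL2 f = ∫⁻ θ in J₀, ∫⁻ R in Ioi (0 : ℝ), ‖f (R, θ)‖ₑ ^ 2 := by
  have := hf.enorm_sq
  rw [volume_restrict_strip] at this
  rw [sqL2, volume_restrict_strip, lintegral_prod_symm _ this]

lemma ae_slice_snd_lt_top {f : Fn} (hf : StripMeas f) (h : sqL2 f < ⊤) : ∀ᵐ θ ∂volume.restrict J₀,
      ∫⁻ R in Ioi (0 : ℝ), ‖f (R, θ)‖ₑ ^ 2 < ⊤ := by
  rw [sqL2_fubini_symm hf] at h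
  have hm := hf.enorm_sq
  rw [volume_restrict_strip] at hm
  exact ae_lt_top' hm.lintegral_prod_left h.ne

lemma ae_slice_fst_lt_top {f : Fn} (hf : StripMeas f) (h : sqL2 f < ⊤) :
    ∀ᵐ R ∂volume.restrict (Ioi (0 : ℝ)), ∫⁻ θ in J₀, ‖f (R, θ)‖ₑ ^ 2 < ⊤ := by
  rw [sqL2_fubini hf] at h
  have hm := hf.enorm_sq
  rw [volume_restrict_strip] at hm
  exact ae_lt_top' hm.lintegral_prod_right' h.ne

theorem sqL2_le_two_add_DR {u v : Fn} (h : HasWeakPartial (1, 0) u (divR v))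
    (hvm : StripMeas v) (hu : radSq u < ⊤) :
    radSq u ≤ sqL2 (fun p => (2 * u p + v p) * weightRad p) := by
  have hum : StripMeas u := h.locInt.aestronglyMeasurable
  have m1 : StripMeas fun p => u p * weightRad p := hum.mul isWeight_weightRad.meas
  have m2 : StripMeas fun p => (2 * u p + v p) * weightRad p :=
    ((hum.const_mul 2).add hvm).mul isWeight_weightRad.meas
  rw [sqL2_fubini_symm m2, sqL2_fubini_symm m1]
  refine lintegral_mono_ae ?_
  filter_upwards [h.ae_isPrim_fst, ae_slice_snd_lt_top m1 hu,
    ae_restrict_mem measurableSet_Ioo] with θ ⟨U, hU⟩ hf hθ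
  have hs : 0 < sin (2 * θ) ^ (eta / 2) := rpow_pos_of_pos (sin_two_pos hθ) _
  set κ := (sin (2 * θ) ^ (eta / 2))⁻¹ with hκ
  have e : ∀ (a : ℝ) (R : ℝ), ‖a * weightRad (R, θ)‖ₑ ^ 2 = ‖κ‖ₑ ^ 2 * ‖a * wRad R‖ₑ ^ 2 := by
    intro a R
    rw [← mul_pow, ← enorm_mul, weightRad, hκ]
    congr 2
    simp only
    field_simp
  have hκ0 : ‖κ‖ₑ ^ 2 ≠ 0 := by simp [hκ, hs.ne']
  have hκt : ‖κ‖ₑ ^ 2 ≠ ⊤ := by simp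
  simp only [e] at hf ⊢
  rw [lintegral_const_mul' _ _ hκt] at hf ⊢
  rw [lintegral_const_mul' _ _ hκt]
  refine mul_le_mul_right ?_ _
  refine radial_slice hU ?_
  exact ((ENNReal.mul_lt_top_iff).1 hf).elim (fun h => h.2) fun h =>
    h.elim (fun h => absurd h hκ0) fun h => by rw [h]; exact ENNReal.zero_lt_top


lemma half_strip_subset : Ioo (π / 4) (π / 2) ⊆ J₀ := Ioo_subset_Ioo_left (by linarith [pi_pos])

lemma sin_two_le_sub {θ : ℝ} (h : θ ≤ π / 2) : sin (2 * θ) ≤ 2 * |θ - π / 2| := by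
  rw [show 2 * θ = π - 2 * (π / 2 - θ) by ring, Real.sin_pi_sub, abs_sub_comm,
    abs_of_nonneg (by linarith)]
  exact Real.sin_le (by linarith)

lemma cos_two_nonpos {θ : ℝ} (h : π / 4 ≤ θ) (h2 : θ ≤ π / 2) : cos (2 * θ) ≤ 0 :=
  Real.cos_nonpos_of_pi_div_two_le_of_le (by linarith) (by linarith [pi_pos])

lemma hasDerivAt_reg_weight {δ γ θ : ℝ} (h : 0 < sin (2 * θ) + δ) :
    HasDerivAt (fun t => sin (2 * t) * (sin (2 * t) + δ) ^ (-γ))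
      (2 * cos (2 * θ) * (sin (2 * θ) + δ) ^ (-γ) *
        (1 - γ * (sin (2 * θ) / (sin (2 * θ) + δ)))) θ := by
  have h1 := hasDerivAt_sin_two θ
  have h2 := (h1.add_const δ).rpow_const (p := -γ) (Or.inl h.ne')
  refine (h1.mul h2).congr_deriv ?_
  rw [Real.rpow_sub_one h.ne']
  field_simp
  ring

/-- The angular Hardy inequality for solutions of `X' = 3 tan θ X - h'/sin 2θ` near `π/2`, with
a regularised weight. -/
lemma angular_slice_reg {X z H : ℝ → ℝ} {γ δ : ℝ} (hγ : 1 ≤ γ) (hγ2 : γ ≤ 2) (hδ : 0 < δ)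
    (h : IsPrim J₀ X (fun θ => (3 * ((1 - cos (2 * θ)) * X θ) - H θ) / sin (2 * θ)) z)
    (hX : ∫⁻ θ in J₀, ‖X θ‖ₑ ^ 2 < ⊤)
    (hHm : AEStronglyMeasurable H (volume.restrict J₀)) :
    ∫⁻ θ in Ioo (π / 4) (π / 2), ‖z θ * (sin (2 * θ) + δ) ^ (-γ / 2)‖ₑ ^ 2 ≤
      ∫⁻ θ in Ioo (π / 4) (π / 2), ‖H θ * sin (2 * θ) ^ (-γ / 2)‖ₑ ^ 2 := by
  set J := J₀ with hJ
  have hUc := h.continuousOn isOpen_Ioo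
  have hpi := pi_pos
  have h' : IsPrim J X (fun θ => (3 * ((1 - cos (2 * θ)) * z θ) - H θ) / sin (2 * θ)) z := by
    have hae : ∀ᵐ θ ∂volume.restrict J, (3 * ((1 - cos (2 * θ)) * X θ) - H θ) / sin (2 * θ) =
        (3 * ((1 - cos (2 * θ)) * z θ) - H θ) / sin (2 * θ) := by
      filter_upwards [h.ae_eq] with θ hθ
      rw [hθ]
    refine ⟨?_, fun x hx y hy => ?_, h.ae_eq⟩
    · have h1 := h.locInt
      rw [locallyIntegrableOn_iff isOpen_Ioo.isLocallyClosed] at h1 ⊢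
      intro k hk hkc
      exact (h1 k hk hkc).congr (ae_restrict_of_ae_restrict_of_subset hk hae)
    · rw [← h.ftc x hx y hy]
      refine intervalIntegral.integral_congr_ae ?_
      have := (ae_restrict_iff' measurableSet_Ioo).1 hae
      filter_upwards [this] with t ht htm
      exact (ht ((ordConnected_Ioo.uIcc_subset hx hy) (uIoc_subset_uIcc htm))).symm
  have eX : ∫⁻ θ in J, ‖X θ‖ₑ ^ 2 = ∫⁻ θ in J, ‖z θ‖ₑ ^ 2 := by
    refine lintegral_congr_ae ?_
    filter_upwards [h.ae_eq] with θ hθ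
    rw [hθ]
  rw [eX] at hX
  have hs : ∀ θ ∈ J, 0 < sin (2 * θ) + δ := fun θ hθ => by
    have := sin_two_pos hθ; linarith
  have hccont : ContDiffOn ℝ 1 (fun t => sin (2 * t) * (sin (2 * t) + δ) ^ (-γ)) J := by
    refine ContDiffOn.mul (by fun_prop) (ContDiffOn.rpow_const_of_ne (by fun_prop) fun t ht => (hs t ht).ne')
  set D := (δ ^ γ)⁻¹ with hD
  have hδγ : 0 < δ ^ γ := rpow_pos_of_pos hδ _
  have hpt : ∀ n : ℕ, ∃ y ∈ Ioo (max (π / 4) (π / 2 - 1 / ((n : ℝ) + 1)))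
      (π / 2), |y - π / 2| * z y ^ 2 < 1 / ((n : ℝ) + 1) := fun n => by
    have hn : (0 : ℝ) < 1 / ((n : ℝ) + 1) := by positivity
    refine exists_small_of_lintegral (max_lt (by linarith) (by linarith)) (Or.inr rfl)
      ((lintegral_mono_set fun t ht => ?_).trans_lt hX) hn
    exact ⟨by linarith [(le_max_left _ _).trans_lt ht.1], ht.2⟩
  choose y hy hys using hpt
  have hy0 : Tendsto y atTop (𝓝 (π / 2)) := by
    have h1 : Tendsto (fun n : ℕ => π / 2 - 1 / ((n : ℝ) + 1)) atTop (𝓝 (π / 2)) := by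
      simpa using tendsto_const_nhds.sub (tendsto_one_div_add_atTop_nhds_zero_nat (𝕜 := ℝ))
    exact tendsto_of_tendsto_of_tendsto_of_le_of_le h1 tendsto_const_nhds
      (fun n => (le_max_right _ _).trans (hy n).1.le) fun n => (hy n).2.le
  have hyJ : ∀ n, y n ∈ J := fun n =>
    ⟨by linarith [(le_max_left _ _).trans_lt (hy n).1], (hy n).2⟩
  have hcov : AECover (volume.restrict (Ioo (π / 4) (π / 2))) atTop
      fun n : ℕ => Ioc (π / 4) (y n) := by
    have h1 : AECover (volume.restrict (Ioo (π / 4) (π / 2))) atTop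
        fun n : ℕ => Iic (y n) := (aecover_Iio_of_Iic hy0).mono
          (Measure.restrict_mono Ioo_subset_Iio_self le_rfl)
    have h2 : AECover (volume.restrict (Ioo (π / 4) (π / 2))) atTop fun _ : ℕ => Ioi (π / 4) :=
      ⟨(ae_restrict_mem measurableSet_Ioo).mono fun x hx => Eventually.of_forall fun _ => hx.1,
        fun _ => measurableSet_Ioi⟩
    exact h2.inter h1
  have hpc : ContinuousOn (fun θ => z θ * (sin (2 * θ) + δ) ^ (-γ / 2)) J :=
    hUc.mul (ContinuousOn.rpow_const (by fun_prop) fun t ht => Or.inl (hs t ht).ne')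
  have hsplit : ∀ a : ℝ, 0 < a → (a ^ (-γ / 2)) ^ 2 = a ^ (-γ) := fun a ha => by
    rw [← Real.rpow_natCast, ← Real.rpow_mul ha.le]; congr 1; push_cast; ring
  have key : ∀ n : ℕ, ∫⁻ θ in Ioc (π / 4) (y n), ‖z θ * (sin (2 * θ) + δ) ^ (-γ / 2)‖ₑ ^ 2 ≤
      (∫⁻ θ in Ioo (π / 4) (π / 2), ‖H θ * sin (2 * θ) ^ (-γ / 2)‖ₑ ^ 2) +
        ofReal (2 * D * (1 / ((n : ℝ) + 1))) := by
    intro n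
    have hxJ : π / 4 ∈ J := ⟨by linarith, by linarith⟩
    have hxy : π / 4 ≤ y n := ((le_max_left _ _).trans_lt (hy n).1).le
    have hsubJ : Ioc (π / 4) (y n) ⊆ Ioo (π / 4) (π / 2) :=
      fun t ht => ⟨ht.1, ht.2.trans_lt (hy n).2⟩
    have hDn : 0 ≤ D := (inv_pos.2 hδγ).le
    refine (IsPrim.lintegral_sq_le h' hccont (fun t ht => hasDerivAt_reg_weight (hs t ht))
      (p := fun θ => z θ * (sin (2 * θ) + δ) ^ (-γ / 2))
      (q := fun θ => H θ * sin (2 * θ) ^ (-γ / 2))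
      (x := π / 4) (y := y n) (k := 2 * D * (1 / ((n : ℝ) + 1))) (σ := 1) hxJ (hyJ n) hxy
      hpc ?_ (by positivity) ?_ ?_).trans ?_
    · refine AEStronglyMeasurable.mono_measure (hHm.mul ?_)
        (Measure.restrict_mono (hsubJ.trans half_strip_subset) le_rfl)
      exact (ContinuousOn.rpow_const (by fun_prop) fun t ht =>
        Or.inl (sin_two_pos ht).ne').aestronglyMeasurable measurableSet_Ioo
    · intro t ht
      have ht' := hsubJ ht
      have htJ := half_strip_subset ht'
      have hst := sin_two_pos htJ
      have hsd := hs t htJ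
      have hy1 := cos_two_nonpos ht'.1.le ht'.2.le
      have hy2 := neg_one_le_cos (2 * t)
      have hw1 : 0 < (sin (2 * t) + δ) ^ (-γ) := rpow_pos_of_pos hsd _
      have hw2 : (sin (2 * t) + δ) ^ (-γ) ≤ sin (2 * t) ^ (-γ) :=
        Real.rpow_le_rpow_of_nonpos hst (by linarith) (by linarith)
      have hr0 : 0 ≤ sin (2 * t) / (sin (2 * t) + δ) := by positivity
      have hr1 : sin (2 * t) / (sin (2 * t) + δ) ≤ 1 := by
        rw [div_le_one hsd]; linarith
      simp only [mul_pow, hsplit _ hsd, hsplit _ hst]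
      set s := sin (2 * t)
      set w := (s + δ) ^ (-γ)
      set r := s / (s + δ)
      set c := cos (2 * t)
      have e : 2 * (s * w) * z t * ((3 * ((1 - c) * z t) - H t) / s) =
          w * (2 * z t * (3 * ((1 - c) * z t) - H t)) := by
        field_simp
      rw [e]
      have h1 : -2 ≤ 2 * c * (1 - γ * r) := by
        have : γ * r ≤ 2 := by nlinarith
        have : 0 ≤ γ * r := by positivity
        nlinarith
      have h2 : 0 ≤ w * (H t ^ 2 + (2 * c * (1 - γ * r) * z t ^ 2 +
          2 * z t * (3 * ((1 - c) * z t) - H t)) - z t ^ 2) := by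
        refine mul_nonneg hw1.le ?_
        nlinarith [mul_nonneg (by linarith : (0 : ℝ) ≤ 2 * c * (1 - γ * r) + 2) (sq_nonneg (z t)),
          mul_nonneg (by linarith : (0 : ℝ) ≤ -c) (sq_nonneg (z t)), sq_nonneg (z t - H t)]
      have h3 : H t ^ 2 * w ≤ H t ^ 2 * s ^ (-γ) := mul_le_mul_of_nonneg_left hw2 (sq_nonneg _)
      nlinarith [h2, h3]
    · have h1 := hys n
      have hsy := sin_two_pos (hyJ n)
      have h2 := sin_two_le_sub (hyJ n).2.le
      have hwy : (sin (2 * y n) + δ) ^ (-γ) ≤ D := by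
        rw [hD, ← rpow_neg hδ.le]
        exact Real.rpow_le_rpow_of_nonpos hδ (by linarith) (by linarith)
      have hwy0 : 0 < (sin (2 * y n) + δ) ^ (-γ) := rpow_pos_of_pos (hs _ (hyJ n)) _
      have h3 : 0 ≤ sin (2 * (π / 4)) * (sin (2 * (π / 4)) + δ) ^ (-γ) * z (π / 4) ^ 2 := by
        have := sin_two_pos hxJ
        have := rpow_pos_of_pos (hs _ hxJ) (-γ)
        positivity
      have h4 : sin (2 * y n) * (sin (2 * y n) + δ) ^ (-γ) * z (y n) ^ 2 ≤
          (2 * |y n - π / 2| * D) * z (y n) ^ 2 := by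
        refine mul_le_mul_of_nonneg_right ?_ (sq_nonneg _)
        exact mul_le_mul h2 hwy hwy0.le (by positivity)
      have h5 : (2 * |y n - π / 2| * D) * z (y n) ^ 2 ≤ 2 * D * (1 / ((n : ℝ) + 1)) := by
        have := mul_le_mul_of_nonneg_left h1.le (by positivity : 0 ≤ 2 * D)
        nlinarith
      linarith
    · exact add_le_add (lintegral_mono_set hsubJ) le_rfl
  have hm : AEMeasurable (fun θ => ‖z θ * (sin (2 * θ) + δ) ^ (-γ / 2)‖ₑ ^ 2)
      (volume.restrict (Ioo (π / 4) (π / 2))) :=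
    ((hpc.mono half_strip_subset).aestronglyMeasurable measurableSet_Ioo).enorm.pow_const 2
  have hl := hcov.lintegral_tendsto_of_countably_generated hm
  have hr : Tendsto (fun n : ℕ => (∫⁻ θ in Ioo (π / 4) (π / 2),
      ‖H θ * sin (2 * θ) ^ (-γ / 2)‖ₑ ^ 2) +
      ofReal (2 * D * (1 / ((n : ℝ) + 1)))) atTop
      (𝓝 ((∫⁻ θ in Ioo (π / 4) (π / 2),
      ‖H θ * sin (2 * θ) ^ (-γ / 2)‖ₑ ^ 2) + 0)) := by
    refine tendsto_const_nhds.add ?_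
    have := ENNReal.tendsto_ofReal
      ((tendsto_one_div_add_atTop_nhds_zero_nat (𝕜 := ℝ)).const_mul (2 * D))
    simpa using this
  rw [add_zero] at hr
  refine le_of_tendsto_of_tendsto' hl hr fun n => ?_
  have hsub : Ioc (π / 4) (y n) ⊆ Ioo (π / 4) (π / 2) := fun t ht => ⟨ht.1, ht.2.trans_lt (hy n).2⟩
  rw [Measure.restrict_restrict measurableSet_Ioc, inter_eq_left.2 hsub]
  exact key n

lemma angular_slice {X z H : ℝ → ℝ} {γ : ℝ} (hγ : 1 ≤ γ) (hγ2 : γ ≤ 2) (h : IsPrim J₀ X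
      (fun θ => (3 * ((1 - cos (2 * θ)) * X θ) - H θ) / sin (2 * θ)) z)
    (hX : ∫⁻ θ in J₀, ‖X θ‖ₑ ^ 2 < ⊤)
    (hHm : AEStronglyMeasurable H (volume.restrict J₀)) :
    ∫⁻ θ in Ioo (π / 4) (π / 2), ‖X θ * sin (2 * θ) ^ (-γ / 2)‖ₑ ^ 2 ≤
      ∫⁻ θ in Ioo (π / 4) (π / 2), ‖H θ * sin (2 * θ) ^ (-γ / 2)‖ₑ ^ 2 := by
  have hUc := h.continuousOn isOpen_Ioo
  have e : ∫⁻ θ in Ioo (π / 4) (π / 2), ‖X θ * sin (2 * θ) ^ (-γ / 2)‖ₑ ^ 2 =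
      ∫⁻ θ in Ioo (π / 4) (π / 2), ‖z θ * sin (2 * θ) ^ (-γ / 2)‖ₑ ^ 2 := by
    refine lintegral_congr_ae ?_
    filter_upwards [ae_restrict_of_ae_restrict_of_subset half_strip_subset h.ae_eq] with θ hθ
    rw [hθ]
  rw [e]
  set δ : ℕ → ℝ := fun n => 1 / ((n : ℝ) + 1)
  have hδ : ∀ n, 0 < δ n := fun n => by positivity
  have hlim : ∀ θ ∈ Ioo (π / 4) (π / 2),
      Tendsto (fun n => ‖z θ * (sin (2 * θ) + δ n) ^ (-γ / 2)‖ₑ ^ 2) atTop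
        (𝓝 (‖z θ * sin (2 * θ) ^ (-γ / 2)‖ₑ ^ 2)) := by
    intro θ hθ
    have hs := sin_two_pos (half_strip_subset hθ)
    have h1 : Tendsto (fun n => sin (2 * θ) + δ n) atTop (𝓝 (sin (2 * θ))) := by
      simpa [δ] using (tendsto_const_nhds (x := sin (2 * θ))).add
        (tendsto_one_div_add_atTop_nhds_zero_nat (𝕜 := ℝ))
    have h2 := (h1.rpow_const (p := -γ / 2) (Or.inl hs.ne')).const_mul (z θ)
    exact ENNReal.Tendsto.pow ((continuous_enorm.tendsto _).comp h2)
  have hf : ∫⁻ θ in Ioo (π / 4) (π / 2), ‖z θ * sin (2 * θ) ^ (-γ / 2)‖ₑ ^ 2 =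
      ∫⁻ θ in Ioo (π / 4) (π / 2),
        liminf (fun n => ‖z θ * (sin (2 * θ) + δ n) ^ (-γ / 2)‖ₑ ^ 2) atTop :=
    setLIntegral_congr_fun measurableSet_Ioo fun θ hθ => (hlim θ hθ).liminf_eq.symm
  rw [hf]
  refine (lintegral_liminf_le' fun n => ?_).trans ?_
  · have hpc : ContinuousOn (fun θ => z θ * (sin (2 * θ) + δ n) ^ (-γ / 2)) J₀ :=
      hUc.mul (ContinuousOn.rpow_const (by fun_prop) fun t ht => Or.inl (by
        have := sin_two_pos ht; have := hδ n; positivity))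
    exact ((hpc.mono half_strip_subset).aestronglyMeasurable measurableSet_Ioo).enorm.pow_const 2
  · refine liminf_le_of_frequently_le' (Frequently.of_forall fun n => ?_)
    exact angular_slice_reg hγ hγ2 (hδ n) h hX hHm

lemma weightAng_eq {α : ℝ} {p : ℝ × ℝ} (hp : p ∈ strip) :
    weightAng α p = wRad p.1 * sin (2 * p.2) ^ (-gam α / 2) := by
  rw [weightAng, div_eq_mul_inv, ← rpow_neg (sin_two_pos' hp).le, neg_div]

lemma gam_bounds {α : ℝ} (hα : 0 < α) (hα1 : α < 1) : 1 ≤ gam α ∧ gam α ≤ 11 / 10 := by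
  unfold gam; constructor <;> linarith

lemma abs_mul_weightAng_le {α : ℝ} (hα : 0 < α) (hα1 : α < 1) {p : ℝ × ℝ} (hp : p ∈ strip) {a : ℝ}
    (ha : |a| ≤ 2 * sin (2 * p.2)) : |a * weightAng α p| ≤ 2 * weightRad p := by
  have hs := sin_two_pos' hp
  have hs1 := sin_le_one (2 * p.2)
  obtain ⟨hγ, hγ2⟩ := gam_bounds hα hα1
  have hw := wRad_pos hp.1
  rw [weightAng_eq hp, weightRad, div_eq_mul_inv (wRad _), ← rpow_neg hs.le, abs_mul, abs_mul,
    abs_of_pos hw, abs_of_pos (rpow_pos_of_pos hs _)]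
  have h1 : sin (2 * p.2) * sin (2 * p.2) ^ (-gam α / 2) ≤ sin (2 * p.2) ^ (-(eta / 2)) := by
    rw [← Real.rpow_one_add' hs.le (by linarith)]
    exact Real.rpow_le_rpow_of_exponent_ge hs hs1 (by unfold eta; linarith)
  have h2 := rpow_pos_of_pos hs (-gam α / 2)
  calc |a| * (wRad p.1 * sin (2 * p.2) ^ (-gam α / 2))
      ≤ 2 * sin (2 * p.2) * (wRad p.1 * sin (2 * p.2) ^ (-gam α / 2)) := by gcongr
    _ = 2 * (wRad p.1 * (sin (2 * p.2) * sin (2 * p.2) ^ (-gam α / 2))) := by ring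
    _ ≤ _ := by gcongr

lemma one_sub_cos_two_le {θ : ℝ} (h0 : 0 ≤ θ) (h : θ ≤ π / 4) :
    |1 - cos (2 * θ)| ≤ 2 * sin (2 * θ) := by
  have hc : 0 ≤ cos (2 * θ) := cos_nonneg_of_mem_Icc ⟨by linarith [pi_pos], by linarith⟩
  have hs : 0 ≤ sin (2 * θ) := sin_nonneg_of_nonneg_of_le_pi (by linarith) (by linarith [pi_pos])
  have h1 := sin_sq_add_cos_sq (2 * θ)
  have hc1 := cos_le_one (2 * θ)
  have hs1 := sin_le_one (2 * θ)
  rw [abs_of_nonneg (by linarith)]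
  nlinarith

/-- The `γ`-weighted bound for `(1 - cos 2θ)(3Q - h)`. -/
theorem sqL2_hardy {α : ℝ} (hα : 0 < α) (hα1 : α < 1) {Q h h' : Fn} (hQ : HasWeakPartial (0, 1) Q
      (fun p => (1 - cos (2 * p.2)) * (3 * Q p - h p) / sin (2 * p.2)))
    (hh : HasWeakPartial (0, 1) h (divS h'))
    (hm : StripMeas h')
    (hX : sqL2 (fun p => (3 * Q p - h p) * weightRad p) < ⊤) :
    sqL2 (fun p => (1 - cos (2 * p.2)) * (3 * Q p - h p) * weightAng α p) ≤
      4 * sqL2 (fun p => (3 * Q p - h p) * weightRad p) + 4 * angSq α h' := by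
  obtain ⟨hγ, hγ2⟩ := gam_bounds hα hα1
  set X : Fn := fun p => 3 * Q p - h p with hXdef
  have hXw : HasWeakPartial (0, 1) X (fun p =>
      (3 * ((1 - cos (2 * p.2)) * X p) - h' p) / sin (2 * p.2)) := by
    refine ((hQ.const_mul 3).add (hh.const_mul (-1))).congr_on (fun p _ => ?_) fun p _ => ?_
    · simp only [hXdef]; ring
    · simp only [hXdef]; ring
  have hXm : StripMeas X := hXw.locInt.aestronglyMeasurable
  have mρ : StripMeas fun p => X p * weightRad p := hXm.mul isWeight_weightRad.meas
  have mh : StripMeas fun p => h' p * weightAng α p := hm.mul (isWeight_weightAng α).meas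
  have mZ : StripMeas fun p => (1 - cos (2 * p.2)) * X p * weightAng α p := by
    refine (StronglyMeasurable.aestronglyMeasurable ?_ |>.mul hXm).mul (isWeight_weightAng α).meas
    exact Continuous.stronglyMeasurable (by fun_prop)
  rw [sqL2_fubini mZ, sqL2_fubini mρ, sqL2_fubini mh, ← lintegral_const_mul' _ _ (by simp),
    ← lintegral_const_mul' _ _ (by simp), ← lintegral_add_left']
  swap
  · have := mρ.enorm_sq
    rw [volume_restrict_strip] at this
    exact this.lintegral_prod_right'.const_mul _
  refine lintegral_mono_ae ?_
  have hm2 : StripMeas h' := hm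
  rw [StripMeas, volume_restrict_strip] at hm2
  have mρ2 : StripMeas fun p => X p * weightRad p := mρ
  rw [StripMeas, volume_restrict_strip] at mρ2
  filter_upwards [hXw.ae_isPrim_snd, ae_slice_fst_lt_top mρ hX, ae_restrict_mem measurableSet_Ioi,
    hm2.prodMk_left, mρ2.prodMk_left] with R ⟨U, hU⟩ hf hR hmR hmρ
  have hw := wRad_pos (mem_Ioi.1 hR)
  have hXR : ∫⁻ θ in J₀, ‖X (R, θ)‖ₑ ^ 2 < ⊤ := by
    have h1 : ∫⁻ θ in J₀, ‖X (R, θ)‖ₑ ^ 2 ≤ ∫⁻ θ in J₀, ofReal ((wRad R)⁻¹ ^ 2) *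
          ‖X (R, θ) * weightRad (R, θ)‖ₑ ^ 2 := by
      refine setLIntegral_mono' measurableSet_Ioo fun θ hθ => ?_
      rw [enorm_sq_eq, enorm_sq_eq, ← ofReal_mul (by positivity)]
      refine ofReal_le_ofReal ?_
      have hs := sin_two_pos hθ
      have h2 : 1 ≤ sin (2 * θ) ^ (-(eta / 2)) :=
        Real.one_le_rpow_of_pos_of_le_one_of_nonpos hs (sin_le_one _) (by unfold eta; norm_num)
      have e : (wRad R)⁻¹ ^ 2 * (X (R, θ) * weightRad (R, θ)) ^ 2 =
          X (R, θ) ^ 2 * (sin (2 * θ) ^ (-(eta / 2))) ^ 2 := by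
        rw [weightRad, rpow_neg hs.le]
        simp only
        field_simp
      rw [e]
      exact le_mul_of_one_le_right (sq_nonneg _) (one_le_pow₀ h2)
    refine h1.trans_lt ?_
    rw [lintegral_const_mul' _ _ ofReal_ne_top]
    exact mul_lt_top ofReal_lt_top hf
  have hsl := angular_slice hγ (by linarith : gam α ≤ 2) hU hXR hmR
  have hpt : ∀ θ ∈ J₀, ‖(1 - cos (2 * θ)) * X (R, θ) * weightAng α (R, θ)‖ₑ ^ 2 ≤
      4 * ‖X (R, θ) * weightRad (R, θ)‖ₑ ^ 2 + (Ioo (π / 4) (π / 2)).indicator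
        (fun θ => 4 * (‖wRad R‖ₑ ^ 2 * ‖X (R, θ) * sin (2 * θ) ^ (-gam α / 2)‖ₑ ^ 2)) θ := by
    intro θ hθ
    have hp : ((R, θ) : ℝ × ℝ) ∈ strip := ⟨hR, hθ⟩
    rcases le_or_gt θ (π / 4) with hle | hgt
    · refine le_add_right ?_
      rw [enorm_sq_eq, enorm_sq_eq, show (4 : ℝ≥0∞) = ofReal 4 by simp, ← ofReal_mul (by norm_num)]
      refine ofReal_le_ofReal ?_
      have h1 := abs_mul_weightAng_le hα hα1 hp (one_sub_cos_two_le hθ.1.le hle)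
      have h2 : ((1 - cos (2 * θ)) * weightAng α (R, θ)) ^ 2 ≤ (2 * weightRad (R, θ)) ^ 2 :=
        sq_le_sq' (by linarith [abs_le.1 h1]) (abs_le.1 h1).2
      nlinarith [mul_le_mul_of_nonneg_left h2 (sq_nonneg (X (R, θ)))]
    · refine le_add_left ?_
      rw [indicator_of_mem (mem_Ioo.2 ⟨hgt, hθ.2⟩), ← mul_pow, ← enorm_mul, enorm_sq_eq, enorm_sq_eq,
        show (4 : ℝ≥0∞) = ofReal 4 by simp, ← ofReal_mul (by norm_num)]
      refine ofReal_le_ofReal ?_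
      rw [weightAng_eq hp]
      have hc : (1 - cos (2 * θ)) ^ 2 ≤ 4 := by
        nlinarith [neg_one_le_cos (2 * θ), cos_le_one (2 * θ)]
      have := mul_le_mul_of_nonneg_right hc
        (sq_nonneg (X (R, θ) * (wRad R * sin (2 * θ) ^ (-gam α / 2))))
      nlinarith
  refine (setLIntegral_mono' measurableSet_Ioo hpt).trans ?_
  rw [lintegral_add_left' ((hmρ.enorm.pow_const 2).const_mul _), lintegral_const_mul' _ _ (by simp)]
  refine add_le_add le_rfl ?_
  rw [lintegral_indicator measurableSet_Ioo, Measure.restrict_restrict measurableSet_Ioo,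
    inter_eq_left.2 half_strip_subset, lintegral_const_mul' _ _ (by simp),
    lintegral_const_mul' _ _ (by simp)]
  refine mul_le_mul_right ((mul_le_mul_right hsl _).trans ?_) _
  rw [← lintegral_const_mul' _ _ (by simp)]
  refine (lintegral_mono_set half_strip_subset).trans (setLIntegral_mono' measurableSet_Ioo
    fun θ hθ => le_of_eq ?_)
  have hp : ((R, θ) : ℝ × ℝ) ∈ strip := ⟨hR, hθ⟩
  rw [weightAng_eq hp, ← mul_pow, ← enorm_mul]
  congr 2
  simp only
  ring


/-! ### Linear functionals on test functions annihilating first-order operators -/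

/-- Test functions on the line. -/
structure Test (φ : ℝ → ℝ) : Prop where
  smooth : ContDiff ℝ ∞ φ
  supp : HasCompactSupport φ

section tests
variable {φ χ : ℝ → ℝ}

lemma Test.deriv (h : Test φ) : Test (deriv φ) :=
  ⟨(contDiff_infty_iff_deriv.1 h.smooth).2, h.supp.deriv⟩

lemma Test.hasDerivAt (h : Test φ) (t : ℝ) : HasDerivAt φ (_root_.deriv φ t) t :=
  (h.smooth.differentiable (by simp)).differentiableAt.hasDerivAt

lemma Test.add (h : Test φ) (h' : Test χ) : Test (fun t => φ t + χ t) :=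
  ⟨h.smooth.add h'.smooth, h.supp.add h'.supp⟩

lemma Test.mul_left (h : Test φ) {a : ℝ → ℝ} (ha : ContDiff ℝ ∞ a) : Test (fun t => a t * φ t) :=
  ⟨ha.mul h.smooth, h.supp.mul_left⟩

lemma Test.const_mul (h : Test φ) (c : ℝ) : Test (fun t => c * φ t) := h.mul_left contDiff_const

lemma Test.shift (h : Test φ) (N : ℝ) : Test (fun t => φ (t - N)) := by
  refine ⟨h.smooth.comp (contDiff_id.sub contDiff_const), ?_⟩
  exact h.supp.comp_homeomorph (Homeomorph.subRight N)

/-- The operator `∂ - a`. -/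
def opS (a : ℝ) (φ : ℝ → ℝ) (t : ℝ) : ℝ := deriv φ t - a * φ t

lemma Test.opS (h : Test φ) (a : ℝ) : Test (opS a φ) := by
  have := h.deriv.add (h.const_mul (-a))
  have e : PolarBiotSavart.opS a φ = fun t => _root_.deriv φ t + -a * φ t := by
    funext t; unfold PolarBiotSavart.opS; ring
  rw [e]; exact this

lemma opS_shift (a N : ℝ) : opS a (fun t => φ (t - N)) = fun t => opS a φ (t - N) := by
  funext t
  simp only [opS]
  rw [deriv_comp_sub_const]

lemma opS_add_mul (h : Test φ) (h' : Test χ) (a c : ℝ) :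
    opS a (fun t => φ t + c * χ t) = fun t => opS a φ t + c * opS a χ t := by
  funext t
  simp only [opS]
  have d : HasDerivAt (fun t => φ t + c * χ t) (deriv φ t + c * deriv χ t) t :=
    (h.hasDerivAt t).add ((h'.hasDerivAt t).const_mul c)
  rw [d.deriv]
  ring

lemma opS_opS (h : Test φ) (a₁ a₂ t : ℝ) :
    opS a₁ (opS a₂ φ) t = deriv (deriv φ) t - (a₁ + a₂) * deriv φ t + a₁ * a₂ * φ t := by
  have : HasDerivAt (opS a₂ φ) (deriv (deriv φ) t - a₂ * deriv φ t) t :=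
    (h.deriv.hasDerivAt t).sub ((h.hasDerivAt t).const_mul a₂)
  rw [opS, this.deriv, opS]
  ring

end tests

/-- Linearity on test functions. -/
def LinTest (L : (ℝ → ℝ) → ℝ) : Prop :=
  ∀ φ χ : ℝ → ℝ, Test φ → Test χ → ∀ c : ℝ, L (fun t => φ t + c * χ t) = L φ + c * L χ

lemma LinTest.comp_opS {L : (ℝ → ℝ) → ℝ} (hL : LinTest L) (a : ℝ) :
    LinTest (fun φ => L (opS a φ)) := fun φ χ h h' c => by
  simp only [opS_add_mul h h', hL _ _ (h.opS a) (h'.opS a)]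

/-- A functional annihilating the range of `∂ - a` is a multiple of `∫ e^{-at} φ`, hence zero if
its translates decay. -/
theorem LinTest.eq_zero {L : (ℝ → ℝ) → ℝ} (hL : LinTest L) {a : ℝ}
    (h : ∀ φ, Test φ → L (opS a φ) = 0) {N : ℕ → ℝ}
    (hdec : ∀ ξ, Test ξ → Tendsto (fun n => exp (a * N n) * L (fun t => ξ (t - N n))) atTop
      (𝓝 0)) : ∀ φ, Test φ → L φ = 0 := by
  obtain ⟨β0, h0, hc0, -, hi⟩ := exists_unit_bump isOpen_univ ⟨(0 : ℝ), trivial⟩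
  have hexp : ∀ c : ℝ, ContDiff ℝ ∞ fun t : ℝ => exp (c * t) := fun c => by fun_prop
  set η : ℝ → ℝ := fun t => exp (a * t) * β0 t with hη
  have tη : Test η := Test.mul_left ⟨h0, hc0⟩ (hexp a)
  set E : (ℝ → ℝ) → ℝ := fun f => ∫ t, exp (-a * t) * f t with hE
  have hcancel : ∀ t, exp (a * t) * exp (-a * t) = 1 := fun t => by
    rw [← exp_add]; simp
  have hrep : ∀ f, Test f → L f = E f * L η := by
    intro f hf
    have tβ : Test fun t => exp (-a * t) * f t := hf.mul_left (hexp (-a))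
    obtain ⟨b, hb, hbc, -, hbd⟩ := exists_primitive (B := univ) tβ.smooth tβ.supp
      (subset_univ _) h0 hc0 (subset_univ _) hi
    have tφ : Test fun t => exp (a * t) * b t := Test.mul_left ⟨hb, hbc⟩ (hexp a)
    have e : opS a (fun t => exp (a * t) * b t) = fun t => f t + (-E f) * η t := by
      funext t
      have d1 : HasDerivAt (fun t : ℝ => exp (a * t)) (exp (a * t) * a) t := by
        simpa using ((hasDerivAt_id t).const_mul a).exp
      have d2 : HasDerivAt (fun t => exp (a * t) * b t) _ t := d1.mul (hbd t)
      simp only [opS]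
      rw [d2.deriv]
      have := hcancel t
      simp only [hη]
      linear_combination f t * this
    have h1 := h _ tφ
    rw [e, hL _ _ hf tη] at h1
    linarith
  have hEη : E η = 1 := by
    rw [← hi]
    simp only [hE, hη]
    congr 1; funext t
    linear_combination β0 t * hcancel t
  clear_value η
  have hshift : ∀ n, L (fun t => η (t - N n)) = exp (-a * N n) * L η := by
    intro n
    rw [hrep _ (tη.shift _)]
    congr 1
    have e1 : ∀ t, exp (-a * t) * η (t - N n) =
        exp (-a * N n) * (exp (-a * (t - N n)) * η (t - N n)) := fun t => by
      rw [← mul_assoc, ← exp_add]; congr 2; ring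
    simp only [hE, e1]
    rw [integral_const_mul, integral_sub_right_eq_self (fun t => exp (-a * t) * η t) (N n)]
    have : ∫ t, exp (-a * t) * η t = 1 := hEη
    rw [this, mul_one]
  have hz : L η = 0 := by
    have := hdec η tη
    simp only [hshift, ← mul_assoc, hcancel, one_mul] at this
    exact tendsto_nhds_unique tendsto_const_nhds this
  intro φ hφ
  rw [hrep φ hφ, hz, mul_zero]

/-- A linear functional whose translates grow at most exponentially. -/
structure GrowthTest (e₁ e₂ : ℝ) (L : (ℝ → ℝ) → ℝ) : Prop where
  lin : LinTest L
  hi : ∀ ξ, Test ξ → ∃ C, ∀ n : ℕ, |L (fun t => ξ (t - n))| ≤ C * exp (e₁ * n)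
  lo : ∀ ξ, Test ξ → ∃ C, ∀ n : ℕ, |L (fun t => ξ (t - (-n)))| ≤ C * exp (e₂ * n)

section growth
variable {e₁ e₂ : ℝ} {L : (ℝ → ℝ) → ℝ}

lemma GrowthTest.comp_opS (h : GrowthTest e₁ e₂ L) (a : ℝ) :
    GrowthTest e₁ e₂ (fun φ => L (opS a φ)) := by
  refine ⟨h.lin.comp_opS a, fun ξ hξ => ?_, fun ξ hξ => ?_⟩
  · simp only [opS_shift]; exact h.hi _ (hξ.opS a)
  · simp only [opS_shift]; exact h.lo _ (hξ.opS a)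

lemma tendsto_exp_mul_of_bound {x : ℕ → ℝ} {c e C : ℝ} (hce : c + e < 0)
    (hx : ∀ n : ℕ, |x n| ≤ C * exp (e * n)) :
    Tendsto (fun n : ℕ => exp (c * n) * x n) atTop (𝓝 0) := by
  have h1 : Tendsto (fun n : ℕ => C * exp ((c + e) * n)) atTop (𝓝 0) := by
    have := Real.tendsto_exp_atBot.comp
      ((tendsto_natCast_atTop_atTop (R := ℝ)).const_mul_atTop_of_neg hce)
    simpa using this.const_mul C
  refine squeeze_zero_norm (fun n => ?_) h1
  rw [Real.norm_eq_abs, abs_mul, abs_of_pos (exp_pos _)]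
  refine (mul_le_mul_of_nonneg_left (hx n) (exp_pos _).le).trans (le_of_eq ?_)
  rw [add_mul, exp_add]; ring

lemma GrowthTest.eq_zero_hi (h : GrowthTest e₁ e₂ L) {a : ℝ} (ha : a + e₁ < 0)
    (hz : ∀ φ, Test φ → L (opS a φ) = 0) : ∀ φ, Test φ → L φ = 0 := by
  refine h.lin.eq_zero hz (N := fun n => n) fun ξ hξ => ?_
  obtain ⟨C, hC⟩ := h.hi ξ hξ
  exact tendsto_exp_mul_of_bound ha hC

lemma GrowthTest.eq_zero_lo (h : GrowthTest e₁ e₂ L) {a : ℝ} (ha : -a + e₂ < 0)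
    (hz : ∀ φ, Test φ → L (opS a φ) = 0) : ∀ φ, Test φ → L φ = 0 := by
  refine h.lin.eq_zero hz (N := fun n => -n) fun ξ hξ => ?_
  obtain ⟨C, hC⟩ := h.lo ξ hξ
  have := tendsto_exp_mul_of_bound ha hC
  refine this.congr fun n => ?_
  congr 2; ring

lemma GrowthTest.eq_zero_iterate (h : GrowthTest e₁ e₂ L) {a : ℝ} (ha : a + e₁ < 0) (k : ℕ)
    (hz : ∀ φ, Test φ → L ((opS a)^[k] φ) = 0) : ∀ φ, Test φ → L φ = 0 := by
  induction k generalizing L with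
  | zero => exact hz
  | succ k ih =>
    refine h.eq_zero_hi ha fun φ hφ => ?_
    refine ih (h.comp_opS a) (fun χ hχ => ?_) φ hφ
    have := hz χ hχ
    rwa [Function.iterate_succ_apply'] at this

lemma GrowthTest.iterate (h : GrowthTest e₁ e₂ L) (a : ℝ) (k : ℕ) :
    GrowthTest e₁ e₂ (fun φ => L ((opS a)^[k] φ)) := by
  induction k generalizing L with
  | zero => exact h
  | succ k ih => exact (ih h).comp_opS a

end growth

/-! ### Radial lifts of test functions in the logarithmic variable -/

/-- The function `R ↦ φ(log R)`, extended by zero. -/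
def liftR (φ : ℝ → ℝ) (R : ℝ) : ℝ := if 0 < R then φ (log R) else 0

lemma liftR_pos {φ : ℝ → ℝ} {R : ℝ} (h : 0 < R) : liftR φ R = φ (log R) := if_pos h

lemma Test.exists_bound {φ : ℝ → ℝ} (h : Test φ) : ∃ L, 0 < L ∧ ∀ t, φ t ≠ 0 → |t| ≤ L := by
  obtain ⟨L, hL⟩ := h.supp.isCompact.isBounded.exists_norm_le
  refine ⟨max L 1, by positivity, fun t ht => ?_⟩
  exact (hL t (subset_tsupport _ ht)).trans (le_max_left _ _)

lemma liftR_eq_zero {φ : ℝ → ℝ} {L : ℝ} (hL : ∀ t, φ t ≠ 0 → |t| ≤ L) {R : ℝ}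
    (hR : R ∉ Icc (exp (-L)) (exp L)) : liftR φ R = 0 := by
  unfold liftR
  split_ifs with h
  · by_contra hne
    have := abs_le.1 (hL _ hne)
    exact hR ⟨(Real.le_log_iff_exp_le h).1 this.1, (Real.log_le_iff_le_exp h).1 this.2⟩
  · rfl

lemma Test.hasDerivAt_liftR {φ : ℝ → ℝ} (h : Test φ) {R : ℝ} (hR : 0 < R) :
    HasDerivAt (liftR φ) (liftR (_root_.deriv φ) R / R) R := by
  have h1 := (h.hasDerivAt (log R)).comp R (Real.hasDerivAt_log hR.ne')
  rw [liftR_pos hR, div_eq_mul_inv]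
  refine h1.congr_of_eventuallyEq ?_
  filter_upwards [Ioi_mem_nhds hR] with r hr
  exact liftR_pos hr

lemma Test.contDiff_liftR {φ : ℝ → ℝ} (h : Test φ) : ContDiff ℝ ∞ (liftR φ) := by
  obtain ⟨L, hL0, hL⟩ := h.exists_bound
  rw [contDiff_iff_contDiffAt]
  intro R
  rcases lt_or_ge 0 R with hR | hR
  · have h1 : ContDiffAt ℝ ∞ (fun r => φ (log r)) R :=
      h.smooth.contDiffAt.comp R (Real.contDiffAt_log.2 hR.ne')
    refine h1.congr_of_eventuallyEq ?_
    filter_upwards [Ioi_mem_nhds hR] with r hr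
    exact liftR_pos hr
  · refine (contDiffAt_const (c := (0 : ℝ))).congr_of_eventuallyEq ?_
    filter_upwards [Iio_mem_nhds (hR.trans_lt (exp_pos (-L)))] with r hr
    exact liftR_eq_zero hL fun hh => absurd hh.1 (not_le.2 hr)

/-- The function `(R, θ) ↦ φ(log R) v(θ)`. -/
def gen (φ v : ℝ → ℝ) (p : ℝ × ℝ) : ℝ := liftR φ p.1 * v p.2

section gen
variable {φ v v' : ℝ → ℝ}

lemma Test.radTest_gen (h : Test φ) (hv : ContDiff ℝ ∞ v) : RadTest (gen φ v) := by
  obtain ⟨L, hL0, hL⟩ := h.exists_bound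
  refine ⟨(h.contDiff_liftR.comp contDiff_fst).mul (hv.comp contDiff_snd),
    exp (-L), exp L, exp_pos _, fun p hp => ?_⟩
  rw [gen, liftR_eq_zero hL hp, zero_mul]

lemma Test.DR_gen (h : Test φ) : DR (gen φ v) = gen (_root_.deriv φ) v := by
  funext p
  rcases lt_or_ge 0 p.1 with hR | hR
  · have : HasDerivAt (fun r => liftR φ r * v p.2) (liftR (_root_.deriv φ) p.1 / p.1 * v p.2) p.1 :=
      (h.hasDerivAt_liftR hR).mul_const _
    change p.1 * _root_.deriv (fun r => liftR φ r * v p.2) p.1 = _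
    rw [this.deriv, gen]
    field_simp
  · obtain ⟨L, hL0, hL⟩ := h.exists_bound
    have : (fun r => gen φ v (r, p.2)) =ᶠ[𝓝 p.1] fun _ => 0 := by
      filter_upwards [Iio_mem_nhds (hR.trans_lt (exp_pos (-L)))] with r hr
      rw [gen, liftR_eq_zero hL fun hh => absurd hh.1 (not_le.2 hr), zero_mul]
    rw [DR, this.deriv_eq, gen, liftR, if_neg (not_lt.2 hR)]
    simp

lemma dTheta_gen (hv : ∀ t, HasDerivAt v (v' t) t) : dTheta (gen φ v) = gen φ v' := by
  funext p
  exact ((hv p.2).const_mul (liftR φ p.1)).deriv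

lemma psi_gen : psi (gen φ v) = gen φ (fun θ => sin (2 * θ) * v θ) := by
  funext p; simp only [psi, gen]; ring

lemma liftR_add_mul (χ : ℝ → ℝ) (c R : ℝ) :
    liftR (fun t => φ t + c * χ t) R = liftR φ R + c * liftR χ R := by
  unfold liftR; split_ifs <;> simp

lemma gen_add_mul (χ : ℝ → ℝ) (c : ℝ) (p : ℝ × ℝ) :
    gen (fun t => φ t + c * χ t) v p = gen φ v p + c * gen χ v p := by
  simp only [gen, liftR_add_mul]; ring

end gen

/-! ### Angular profiles -/

/-- The constant making `sin(θ)^(2n) - meanC n` orthogonal to the weight `mW`. -/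
def meanC (n : ℕ) : ℝ := angInt (fun θ => mW θ * (sin θ ^ 2) ^ n) / angInt mW

/-- The profile `sin(θ)^(2n)` minus its mean. -/
def vPow (n : ℕ) (θ : ℝ) : ℝ := (sin θ ^ 2) ^ n - meanC n

lemma contDiff_vPow (n : ℕ) : ContDiff ℝ ∞ (vPow n) := by unfold vPow; fun_prop

lemma mW_pos {θ : ℝ} (h : θ ∈ J₀) : 0 < mW θ := by
  have := sin_two_pos h
  have := cos_pos_strip h
  unfold mW; positivity

lemma angInt_mW_pos : 0 < angInt mW := by
  rw [angInt, setIntegral_pos_iff_support_of_nonneg_ae]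
  · refine lt_of_lt_of_le ?_ (measure_mono fun θ hθ =>
      mem_inter (Function.mem_support.2 (mW_pos hθ).ne') hθ)
    simp [pi_pos]
  · filter_upwards [ae_restrict_mem measurableSet_Ioo] with θ hθ using (mW_pos hθ).le
  · exact integrableOn_cont continuous_mW

lemma angInt_mW_vPow (n : ℕ) : angInt (fun θ => mW θ * vPow n θ) = 0 := by
  have hm := continuous_mW
  have e : ∀ θ, mW θ * vPow n θ = mW θ * (sin θ ^ 2) ^ n - meanC n * mW θ := fun θ => by
    unfold vPow; ring
  have e2 : angInt (fun θ => mW θ * (sin θ ^ 2) ^ n) = meanC n * angInt mW := by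
    rw [meanC, div_mul_cancel₀ _ angInt_mW_pos.ne']
  simp only [e, angInt]
  rw [integral_sub (integrableOn_cont (by fun_prop)) (integrableOn_cont (by fun_prop)),
    integral_const_mul]
  unfold angInt at e2
  rw [e2, sub_self]

/-- `2n(2n+5)`. -/
def muC (n : ℕ) : ℝ := 2 * n * (2 * n + 5)

/-- `2n(2n+1)`. -/
def nuC (n : ℕ) : ℝ := 2 * n * (2 * n + 1)

/-- First derivative of `sin(θ)^(2n)`. -/
def vPow1 (n : ℕ) (θ : ℝ) : ℝ := n * (sin θ ^ 2) ^ (n - 1) * sin (2 * θ)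

/-- Second derivative of `sin(θ)^(2n)`. -/
def vPow2 (n : ℕ) (θ : ℝ) : ℝ := n * ((n - 1 : ℕ) * (sin θ ^ 2) ^ (n - 1 - 1) * sin (2 * θ) ^ 2 +
    (sin θ ^ 2) ^ (n - 1) * (2 * cos (2 * θ)))

lemma hasDerivAt_sin_sq (θ : ℝ) : HasDerivAt (fun t => sin t ^ 2) (sin (2 * θ)) θ := by
  refine ((hasDerivAt_sin θ).pow 2).congr_deriv ?_
  rw [sin_two_mul]; simp

lemma hasDerivAt_vPow (n : ℕ) (θ : ℝ) : HasDerivAt (vPow n) (vPow1 n θ) θ :=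
  ((hasDerivAt_sin_sq θ).pow n).sub_const _

lemma hasDerivAt_vPow1 (n : ℕ) (θ : ℝ) : HasDerivAt (vPow1 n) (vPow2 n θ) θ := by
  have := ((((hasDerivAt_sin_sq θ).pow (n - 1)).const_mul (n : ℝ)).mul (hasDerivAt_sin_two θ))
  refine this.congr_deriv ?_
  unfold vPow2; simp only [Pi.pow_apply]; ring

lemma angOp_vPow_aux (n : ℕ) (θ : ℝ) : angOp (vPow1 n) (vPow2 n) θ =
    sin (2 * θ) * (muC n * (sin θ ^ 2) ^ n - nuC n * (sin θ ^ 2) ^ (n - 1)) := by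
  have hs : sin (2 * θ) ^ 2 = 4 * sin θ ^ 2 * (1 - sin θ ^ 2) := by
    rw [sin_two_mul, ← Real.cos_sq']; ring
  have hc : cos (2 * θ) = 1 - 2 * sin θ ^ 2 := by
    rw [cos_two_mul, Real.cos_sq']; ring
  unfold angOp vPow1 vPow2 muC nuC
  rw [hs, hc]
  generalize sin θ ^ 2 = x
  rcases n with - | - | n
  · simp
  · simp; ring
  · simp only [Nat.add_sub_cancel]
    push_cast
    ring

lemma angInt_angOp_sin_cos (n : ℕ) :
    angInt (fun θ => sin (2 * θ) * cos θ * angOp (vPow1 n) (vPow2 n) θ) = 0 := by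
  have hm := continuous_mW
  have c1 : Continuous (vPow1 n) := by unfold vPow1; fun_prop
  have c2 : Continuous (vPow2 n) := by unfold vPow2; fun_prop
  have c3 := continuous_angOp c1 c2
  have key := angInt_deriv_eq (B := fun t => mW t * vPow1 n t) (by fun_prop)
    (fun θ _ => hasDerivAt_mW_mul (hasDerivAt_vPow1 n) θ) (integrableOn_cont (by fun_prop))
  have e0 : mW 0 = 0 := by simp [mW]
  have e1 : mW (π / 2) = 0 := by simp [mW]
  rw [e0, e1] at key
  unfold angInt at key ⊢
  rw [integral_neg] at key
  linarith

lemma muC_mul_meanC (n : ℕ) : muC n * meanC n = nuC n * meanC (n - 1) := by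
  have hm := continuous_mW
  have h := angInt_angOp_sin_cos n
  have e : ∀ θ, sin (2 * θ) * cos θ * angOp (vPow1 n) (vPow2 n) θ =
      muC n * (mW θ * (sin θ ^ 2) ^ n) - nuC n * (mW θ * (sin θ ^ 2) ^ (n - 1)) := by
    intro θ; rw [angOp_vPow_aux]; unfold mW; ring
  simp only [e, angInt] at h
  rw [integral_sub (integrableOn_cont (by fun_prop)) (integrableOn_cont (by fun_prop)),
    integral_const_mul, integral_const_mul] at h
  unfold meanC
  have hp := angInt_mW_pos.ne'
  unfold angInt at hp ⊢
  field_simp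
  linarith

lemma angOp_vPow (n : ℕ) (θ : ℝ) : angOp (vPow1 n) (vPow2 n) θ =
    sin (2 * θ) * (muC n * vPow n θ - nuC n * vPow (n - 1) θ) := by
  rw [angOp_vPow_aux, vPow, vPow]
  linear_combination sin (2 * θ) * muC_mul_meanC n

lemma vPow_zero : vPow 0 = fun _ => 0 := by
  funext θ
  have : meanC 0 = 1 := by
    simp only [meanC, pow_zero, mul_one]
    exact div_self angInt_mW_pos.ne'
  simp [vPow, this]

lemma Test.core_gen {φ : ℝ → ℝ} (h : Test φ) (n : ℕ) : Core (gen φ (vPow n)) := by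
  refine ⟨h.radTest_gen (contDiff_vPow n), fun R => ?_⟩
  have e : ∀ θ, mW θ * gen φ (vPow n) (R, θ) = liftR φ R * (mW θ * vPow n θ) := fun θ => by
    simp only [gen]; ring
  have := angInt_mW_vPow n
  unfold angInt at this ⊢
  simp only [e]
  rw [integral_const_mul, this, mul_zero]

/-- `sin(2θ)` times the profile. -/
def sv (n : ℕ) (θ : ℝ) : ℝ := sin (2 * θ) * vPow n θ

lemma contDiff_sv (n : ℕ) : ContDiff ℝ ∞ (sv n) := contDiff_sin_two.mul (contDiff_vPow n)

lemma Test.fullL_gen {φ : ℝ → ℝ} (h : Test φ) (α b : ℝ) (n : ℕ) (p : ℝ × ℝ) :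
    fullL α b (gen φ (vPow n)) p =
      gen (fun t => -α ^ 2 * _root_.deriv (_root_.deriv φ) t + -(b * α) * _root_.deriv φ t +
        muC n * φ t) (sv n) p + (-nuC n) * gen φ (sv (n - 1)) p := by
  have e := angOp_vPow n p.2
  unfold angOp at e
  rw [fullL, psi_gen, h.DR_gen, h.deriv.DR_gen, angL, dTheta_gen (hasDerivAt_vPow n),
    dTheta_gen (hasDerivAt_vPow1 n)]
  simp only [gen, sv]
  have l : liftR (fun t => -α ^ 2 * _root_.deriv (_root_.deriv φ) t + -(b * α) * _root_.deriv φ t +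
      muC n * φ t) p.1 = -α ^ 2 * liftR (_root_.deriv (_root_.deriv φ)) p.1 +
      -(b * α) * liftR (_root_.deriv φ) p.1 + muC n * liftR φ p.1 := by
    unfold liftR; split_ifs <;> simp
  rw [l]
  linear_combination liftR φ p.1 * e


/-! ### Pairings in `L²` of the strip -/

lemma memLp_of_sqL2 {f : Fn} (hf : StripMeas f) (h : sqL2 f < ⊤) : MemLp f 2 vol₊ := by
  refine ⟨hf, ?_⟩
  rw [sqL2_eq_eLpNorm] at h
  exact ((ENNReal.pow_lt_top_iff).1 h).resolve_right (by simp)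

lemma integrable_pair {y f : Fn} (hy : StripMeas y) (hf : StripMeas f)
    (h : sqL2 y < ⊤) (h' : sqL2 f < ⊤) :
    Integrable (fun p => y p * f p) vol₊ :=
  (memLp_of_sqL2 hy h).integrable_mul (memLp_of_sqL2 hf h')

lemma abs_pair_le {y f : Fn} (hy : StripMeas y) (hf : StripMeas f) (h : sqL2 y < ⊤)
    {X : ℝ} (h' : sqL2 f ≤ ofReal X) :
    |∫ p in strip, y p * f p| ≤ ((sqL2 y) ^ (1 / 2 : ℝ)).toReal * √X := by
  have h1 : ‖∫ p in strip, y p * f p‖ₑ ≤ sqL2 y ^ (1 / 2 : ℝ) * sqL2 f ^ (1 / 2 : ℝ) := by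
    refine (enorm_integral_le_lintegral_enorm _).trans ?_
    have e1 : ∫⁻ p in strip, ‖y p * f p‖ₑ =
        ∫⁻ p in strip, ((fun p => ‖y p‖ₑ) * fun p => ‖f p‖ₑ) p := by
      simp only [Pi.mul_apply, enorm_mul]
    rw [e1]
    refine (ENNReal.lintegral_mul_le_Lp_mul_Lq _ (Real.HolderConjugate.two_two)
      hy.enorm hf.enorm).trans ?_
    rw [sqL2, sqL2]
    simp only [← ENNReal.rpow_natCast]
    norm_num
  have h2 : ‖∫ p in strip, y p * f p‖ₑ ≤ sqL2 y ^ (1 / 2 : ℝ) * ofReal (√X) := by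
    refine h1.trans (mul_le_mul_right ?_ _)
    refine (ENNReal.rpow_le_rpow h' (by norm_num)).trans (le_of_eq ?_)
    rcases le_or_gt 0 X with hX | hX
    · rw [Real.sqrt_eq_rpow, ENNReal.ofReal_rpow_of_nonneg hX (by norm_num)]
    · rw [ENNReal.ofReal_of_nonpos hX.le, Real.sqrt_eq_zero_of_nonpos hX.le]
      simp
  rw [enorm_eq_ofReal_abs] at h2
  have hfin : sqL2 y ^ (1 / 2 : ℝ) ≠ ⊤ := ENNReal.rpow_ne_top_of_nonneg (by norm_num) h.ne
  have h3 := (ENNReal.ofReal_le_iff_le_toReal (ENNReal.mul_ne_top hfin ofReal_ne_top)).1 h2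
  rwa [ENNReal.toReal_mul, ENNReal.toReal_ofReal (Real.sqrt_nonneg _)] at h3

lemma wRad_le {a R : ℝ} (ha : 0 < a) (h : a ≤ R) : wRad R ≤ (1 + 1 / a) ^ 2 := by
  have hR : 0 < R := ha.trans_le h
  have : wRad R = (1 + 1 / R) ^ 2 := by unfold wRad; field_simp; ring
  rw [this]
  have := one_div_le_one_div_of_le ha h
  have : 0 < 1 / R := by positivity
  gcongr

lemma sin_mul_rpow_le_one {s : ℝ} (h : 0 < s) (h1 : s ≤ 1) : s / s ^ (eta / 2) ≤ 1 := by
  rw [div_le_one (rpow_pos_of_pos h _)]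
  calc s = s ^ (1 : ℝ) := (Real.rpow_one s).symm
    _ ≤ s ^ (eta / 2) := Real.rpow_le_rpow_of_exponent_ge h h1 (by unfold eta; norm_num)

lemma sqL2_product_le {ψ v : ℝ → ℝ} {M a b W V : ℝ} (hab : a ≤ b) (hM : 0 ≤ M)
    (hψ : ∀ R, 0 < R → |ψ R| ≤ M) (hψ2 : ∀ R, R ∉ Icc a b → ψ R = 0)
    (hW : ∀ R ∈ Icc a b, wRad R ≤ W)
    (hv : ∀ θ ∈ J₀, |v θ| ≤ V * sin (2 * θ)) :
    sqL2 (fun p => ψ p.1 * v p.2 * weightRad p) ≤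
      ofReal ((M * W * V) ^ 2 * ((b - a) * (π / 2))) := by
  have hle : ∀ p ∈ strip, ‖ψ p.1 * v p.2 * weightRad p‖ₑ ^ 2 ≤ (Icc a b ×ˢ J₀).indicator
        (fun _ => ofReal ((M * W * V) ^ 2)) p := by
    intro p hp
    by_cases hpa : p.1 ∈ Icc a b
    · rw [indicator_of_mem (mk_mem_prod hpa hp.2), enorm_sq_eq]
      refine ofReal_le_ofReal (sq_le_sq.2 ?_)
      have hs := sin_two_pos' hp
      have h1 := sin_mul_rpow_le_one hs (sin_le_one _)
      have h2 := hψ p.1 hp.1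
      have h3 := hW p.1 hpa
      have h4 := hv p.2 hp.2
      have hw := wRad_pos hp.1
      have hr : 0 < sin (2 * p.2) ^ (eta / 2) := rpow_pos_of_pos hs _
      have hV : 0 ≤ V := by
        have := (abs_nonneg _).trans h4
        exact nonneg_of_mul_nonneg_left this hs
      rw [abs_of_nonneg (by have := hw.le.trans h3; positivity : 0 ≤ M * W * V)]
      calc |ψ p.1 * v p.2 * weightRad p|
          = |ψ p.1| * wRad p.1 * (|v p.2| / sin (2 * p.2) ^ (eta / 2)) := by
            rw [weightRad, abs_mul, abs_mul, abs_div, abs_of_pos hw, abs_of_pos hr]; ring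
        _ ≤ M * W * (V * sin (2 * p.2) / sin (2 * p.2) ^ (eta / 2)) := by
            have hW0 := hw.le.trans h3
            have : 0 ≤ |v p.2| / sin (2 * p.2) ^ (eta / 2) := by positivity
            exact mul_le_mul (mul_le_mul h2 h3 hw.le hM)
              (div_le_div_of_nonneg_right h4 hr.le) this (mul_nonneg hM hW0)
        _ = M * W * V * (sin (2 * p.2) / sin (2 * p.2) ^ (eta / 2)) := by ring
        _ ≤ M * W * V := mul_le_of_le_one_right (by have := hw.le.trans h3; positivity) h1
    · rw [hψ2 p.1 hpa]; simp
  refine (setLIntegral_mono' measurableSet_strip hle).trans ?_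
  refine (setLIntegral_le_lintegral _ _).trans ?_
  rw [lintegral_indicator (measurableSet_Icc.prod measurableSet_Ioo), setLIntegral_const,
    Measure.volume_eq_prod, Measure.prod_prod, Real.volume_Icc, Real.volume_Ioo,
    ofReal_mul (by positivity), ofReal_mul (by linarith), sub_zero]

/-- Angular factors vanishing at both ends. -/
structure AngFactor (v : ℝ → ℝ) : Prop where
  cont : Continuous v
  bound : ∃ V, ∀ θ ∈ J₀, |v θ| ≤ V * sin (2 * θ)

lemma angFactor_sin_mul {a : ℝ → ℝ} (ha : Continuous a) : AngFactor fun θ => sin (2 * θ) * a θ := by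
  refine ⟨by fun_prop, ?_⟩
  obtain ⟨C, hC⟩ := (isCompact_Icc (a := (0 : ℝ)) (b := π / 2)).exists_bound_of_continuousOn
    ha.continuousOn
  refine ⟨C, fun θ hθ => ?_⟩
  rw [abs_mul, abs_of_pos (sin_two_pos hθ), mul_comm]
  exact mul_le_mul_of_nonneg_right (hC θ (Ioo_subset_Icc_self hθ)) (sin_two_pos hθ).le

lemma angFactor_sv (n : ℕ) : AngFactor (sv n) := angFactor_sin_mul (contDiff_vPow n).continuous

/-- The functional `φ ↦ ⟨y, φ(log R) v(θ)⟩`. -/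
def pairL (y : Fn) (v φ : ℝ → ℝ) : ℝ := ∫ p in strip, y p * (gen φ v p * weightRad p)

section pair
variable {y : Fn} {v : ℝ → ℝ}

lemma Test.stripMeas_gen {φ : ℝ → ℝ} (h : Test φ) (hv : Continuous v) :
    StripMeas fun p => gen φ v p * weightRad p := by
  refine AEStronglyMeasurable.mul ?_ isWeight_weightRad.meas
  have := h.contDiff_liftR.continuous
  exact Continuous.aestronglyMeasurable (by unfold gen; fun_prop)

lemma abs_liftR_le {φ : ℝ → ℝ} {M : ℝ} (hM : ∀ t, |φ t| ≤ M) (R : ℝ) : |liftR φ R| ≤ M := by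
  unfold liftR; split_ifs
  · exact hM _
  · simpa using (abs_nonneg _).trans (hM 0)

lemma Test.exists_sup {φ : ℝ → ℝ} (h : Test φ) : ∃ M, 0 ≤ M ∧ ∀ t, |φ t| ≤ M := by
  obtain ⟨M, hM⟩ := h.supp.exists_bound_of_continuous h.smooth.continuous
  exact ⟨M, (norm_nonneg _).trans (hM 0), hM⟩

lemma Test.sqL2_gen_lt_top {φ : ℝ → ℝ} (h : Test φ) (hv : AngFactor v) : radSq (gen φ v) < ⊤ := by
  obtain ⟨L, hL0, hL⟩ := h.exists_bound
  obtain ⟨M, hM0, hM⟩ := h.exists_sup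
  obtain ⟨V, hV⟩ := hv.bound
  exact (sqL2_product_le (a := exp (-L)) (b := exp L) (exp_le_exp.2 (by linarith)) hM0
    (fun R _ => abs_liftR_le hM R) (fun R => liftR_eq_zero hL)
    (fun R hR => wRad_le (exp_pos _) hR.1) hV).trans_lt ofReal_lt_top

lemma integrable_pairL (hy : StripMeas y) (h : sqL2 y < ⊤) (hv : AngFactor v) {φ : ℝ → ℝ}
    (hφ : Test φ) : Integrable (fun p => y p * (gen φ v p * weightRad p)) vol₊ :=
  integrable_pair hy (hφ.stripMeas_gen hv.cont) h (hφ.sqL2_gen_lt_top hv)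

lemma shift_support {ξ : ℝ → ℝ} {L N : ℝ} (hL : ∀ t, ξ t ≠ 0 → |t| ≤ L) {R : ℝ}
    (hR : R ∉ Icc (exp (N - L)) (exp (N + L))) : liftR (fun t => ξ (t - N)) R = 0 := by
  unfold liftR
  split_ifs with h
  · by_contra hne
    have := abs_le.1 (hL _ hne)
    exact hR ⟨(Real.le_log_iff_exp_le h).1 (by linarith), (Real.log_le_iff_le_exp h).1 (by linarith)⟩
  · rfl

lemma growthTest_pairL (hy : StripMeas y) (h : sqL2 y < ⊤) (hv : AngFactor v) :
    GrowthTest (1 / 2) (3 / 2) (pairL y v) := by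
  refine ⟨fun φ χ hφ hχ c => ?_, fun ξ hξ => ?_, fun ξ hξ => ?_⟩
  · have i1 := integrable_pairL hy h hv hφ
    have i2 := integrable_pairL hy h hv hχ
    rw [pairL, pairL, pairL, ← integral_const_mul, ← integral_add i1 (i2.const_mul c)]
    congr 1; funext p; rw [gen_add_mul]; ring
  all_goals
    obtain ⟨L, hL0, hL⟩ := hξ.exists_bound
    obtain ⟨M, hM0, hM⟩ := hξ.exists_sup
    obtain ⟨V, hV⟩ := hv.bound
    set A := ((sqL2 y) ^ (1 / 2 : ℝ)).toReal
    have hA : 0 ≤ A := ENNReal.toReal_nonneg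
    have hE : 1 ≤ exp L := Real.one_le_exp hL0.le
  · refine ⟨A * √((M * (1 + exp L) ^ 2 * V) ^ 2 * (exp L * (π / 2))), fun n => ?_⟩
    have hn : (1 : ℝ) ≤ exp n := Real.one_le_exp n.cast_nonneg
    have b1 := sqL2_product_le (ψ := liftR fun t => ξ (t - n)) (W := (1 + exp L) ^ 2)
      (a := exp ((n : ℝ) - L)) (b := exp (n + L))
      (exp_le_exp.2 (by linarith)) hM0 (fun R _ => abs_liftR_le (fun t => hM _) R)
      (fun R => shift_support hL) (fun R hR => (wRad_le (exp_pos _) hR.1).trans ?_) hV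
    · have b2 := abs_pair_le hy ((hξ.shift n).stripMeas_gen hv.cont) h b1
      refine b2.trans ?_
      rw [mul_assoc A]
      refine mul_le_mul_of_nonneg_left ?_ hA
      rw [show exp (1 / 2 * (n : ℝ)) = √(exp n) by
        rw [Real.sqrt_eq_rpow, ← Real.exp_mul]; ring_nf, ← Real.sqrt_mul (by positivity)]
      refine Real.sqrt_le_sqrt ?_
      rw [mul_assoc (_ ^ 2)]
      refine mul_le_mul_of_nonneg_left ?_ (sq_nonneg _)
      have : exp (n + L) - exp (n - L) ≤ exp L * exp n := by
        rw [add_comm, exp_add]; linarith [exp_pos (n - L)]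
      nlinarith [pi_pos]
    · have : 1 / exp (n - L) ≤ exp L := by
        rw [one_div, ← Real.exp_neg]
        exact exp_le_exp.2 (by linarith [(Nat.cast_nonneg n : (0 : ℝ) ≤ n)])
      have h0 : 0 < 1 / exp (n - L) := by positivity
      gcongr
  · refine ⟨A * √((M * (4 * exp (2 * L)) * V) ^ 2 * (exp L * (π / 2))), fun n => ?_⟩
    have hn : (1 : ℝ) ≤ exp n := Real.one_le_exp n.cast_nonneg
    have b1 := sqL2_product_le (ψ := liftR fun t => ξ (t - (-n)))
      (W := 4 * exp (2 * L) * exp (2 * n))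
      (a := exp (-(n : ℝ) - L)) (b := exp (-n + L))
      (exp_le_exp.2 (by linarith)) hM0 (fun R _ => abs_liftR_le (fun t => hM _) R)
      (fun R => shift_support hL) (fun R hR => (wRad_le (exp_pos _) hR.1).trans ?_) hV
    · have b2 := abs_pair_le hy ((hξ.shift (-n)).stripMeas_gen hv.cont) h b1
      refine b2.trans ?_
      rw [mul_assoc A]
      refine mul_le_mul_of_nonneg_left ?_ hA
      rw [show exp (3 / 2 * (n : ℝ)) = √(exp (3 * n)) by
        rw [Real.sqrt_eq_rpow, ← Real.exp_mul]; ring_nf, ← Real.sqrt_mul (by positivity)]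
      refine Real.sqrt_le_sqrt ?_
      have e3 : exp (3 * n) = exp (2 * n) ^ 2 * exp (-(n : ℝ)) := by
        rw [← Real.exp_nat_mul, ← exp_add]; congr 1; push_cast; ring
      have : exp (-n + L) - exp (-n - L) ≤ exp L * exp (-(n : ℝ)) := by
        rw [add_comm, exp_add]; linarith [exp_pos (-(n : ℝ) - L)]
      rw [e3]
      calc (M * (4 * exp (2 * L) * exp (2 * n)) * V) ^ 2 *
            ((exp (-n + L) - exp (-n - L)) * (π / 2))
          ≤ (M * (4 * exp (2 * L) * exp (2 * n)) * V) ^ 2 *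
            ((exp L * exp (-(n : ℝ))) * (π / 2)) := by
            gcongr
        _ = _ := by ring
    · have e1 : 1 / exp (-n - L) = exp L * exp n := by
        rw [one_div, ← Real.exp_neg, ← exp_add]; congr 1; ring
      have e2 : 4 * exp (2 * L) * exp (2 * n) = (2 * (exp L * exp n)) ^ 2 := by
        rw [mul_pow, mul_pow, ← Real.exp_nat_mul, ← Real.exp_nat_mul]; push_cast; ring
      rw [e1, e2]
      have : 1 ≤ exp L * exp n := by nlinarith
      gcongr
      linarith

end pair

/-! ### The operator `2 + D_R` and the annihilator of the range -/

/-- `2 + D_R`. -/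
def twoD (f : Fn) (p : ℝ × ℝ) : ℝ := 2 * f p + DR f p

lemma RadTest.twoD {f : Fn} (h : RadTest f) : RadTest (twoD f) := (h.const_mul 2).add h.DR

lemma RadTest.twoD_iterate {f : Fn} (h : RadTest f) (k : ℕ) :
    RadTest (PolarBiotSavart.twoD^[k] f) := by
  induction k generalizing f with
  | zero => exact h
  | succ k ih => exact ih h.twoD

lemma DR_add_mul {f g : Fn} (hf : RadTest f) (hg : RadTest g) (c : ℝ) :
    DR (fun p => f p + c * g p) = fun p => DR f p + c * DR g p := by
  funext p
  rw [DR_add hf.smooth (hg.const_mul c).smooth]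
  congr 1
  exact DR_angular_mul (a := fun _ => c) contDiff_const hg.smooth p

lemma dTheta_add_mul {f g : Fn} (hf : RadTest f) (hg : RadTest g) (c : ℝ) :
    dTheta (fun p => f p + c * g p) = fun p => dTheta f p + c * dTheta g p := by
  funext p
  rw [dTheta_add hf.smooth (hg.const_mul c).smooth]
  congr 1
  rw [dTheta_mul contDiff_const hg.smooth]
  simp [dTheta]

lemma twoD_add_mul {f g : Fn} (hf : RadTest f) (hg : RadTest g) (c : ℝ) :
    twoD (fun p => f p + c * g p) = fun p => twoD f p + c * twoD g p := by
  funext p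
  simp only [twoD, DR_add_mul hf hg]; ring

lemma twoD_iterate_add_mul {f g : Fn} (hf : RadTest f) (hg : RadTest g) (c : ℝ) (k : ℕ) :
    twoD^[k] (fun p => f p + c * g p) = fun p => twoD^[k] f p + c * twoD^[k] g p := by
  induction k generalizing f g with
  | zero => rfl
  | succ k ih =>
    rw [Function.iterate_succ_apply, twoD_add_mul hf hg, ih hf.twoD hg.twoD]
    rfl

lemma Test.twoD_iterate_gen {φ v : ℝ → ℝ} (h : Test φ) (k : ℕ) :
    twoD^[k] (gen φ v) = gen ((PolarBiotSavart.opS (-2))^[k] φ) v := by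
  induction k generalizing φ with
  | zero => rfl
  | succ k ih =>
    rw [Function.iterate_succ_apply, Function.iterate_succ_apply, ← ih (h.opS (-2))]
    congr 1
    funext p
    have e : liftR (PolarBiotSavart.opS (-2) φ) p.1 = 2 * liftR φ p.1 + liftR (_root_.deriv φ) p.1 := by
      unfold liftR PolarBiotSavart.opS; split_ifs <;> ring
    rw [twoD, h.DR_gen, gen, gen, gen, e]; ring

lemma Test.opS_iterate {φ : ℝ → ℝ} (h : Test φ) (a : ℝ) (k : ℕ) : Test ((PolarBiotSavart.opS a)^[k] φ) := by
  induction k generalizing φ with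
  | zero => exact h
  | succ k ih => exact ih (h.opS a)

lemma LinTest.const_mul {L : (ℝ → ℝ) → ℝ} (h : LinTest L) {φ : ℝ → ℝ} (hφ : Test φ) (c : ℝ) :
    L (fun t => c * φ t) = c * L φ := by
  have := h φ φ hφ hφ (c - 1)
  have e : (fun t => φ t + (c - 1) * φ t) = fun t => c * φ t := by funext t; ring
  rw [e] at this
  rw [this]; ring

/-- The two characteristic roots. -/
lemma exists_roots {α b μ : ℝ} (hα : 0 < α) (hα1 : α < alphaMax) (hb : 0 < b) (hb5 : b ≤ 5)
    (hμ : 14 ≤ μ) : ∃ a₁ a₂ : ℝ, 3 / 2 < a₁ ∧ a₂ < -1 / 2 ∧ a₁ + a₂ = -(b / α) ∧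
      a₁ * a₂ = -(μ / α ^ 2) := by
  set r := √(b ^ 2 + 4 * μ) with hr
  have hr2 : r ^ 2 = b ^ 2 + 4 * μ := Real.sq_sqrt (by positivity)
  have hr0 : 0 ≤ r := Real.sqrt_nonneg _
  have hrb : b + 4 ≤ r := by
    refine Real.le_sqrt_of_sq_le ?_
    nlinarith
  have hα2 : α < 1 / 10 ^ 12 := hα1
  refine ⟨(-b + r) / (2 * α), (-b - r) / (2 * α), ?_, ?_, ?_, ?_⟩
  · rw [lt_div_iff₀ (by positivity)]; nlinarith
  · rw [div_lt_iff₀ (by positivity)]; nlinarith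
  · field_simp; ring
  · field_simp; nlinarith

lemma muC_ge {n : ℕ} (hn : n ≠ 0) : 14 ≤ muC n := by
  have : (1 : ℝ) ≤ n := by exact_mod_cast Nat.one_le_iff_ne_zero.2 hn
  unfold muC; nlinarith

theorem pairL_eq_zero {α b : ℝ} (hα : 0 < α) (hα1 : α < alphaMax) (hb : 0 < b) (hb5 : b ≤ 5)
    {y : Fn} (hy : StripMeas y) (hyt : sqL2 y < ⊤) (k : ℕ)
    (h : ∀ n φ, Test φ → ∫ p in strip, y p *
      (twoD^[k] (fullL α b (gen φ (vPow n))) p * weightRad p) = 0) (n : ℕ) :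
    ∀ φ, Test φ → pairL y (sv n) φ = 0 := by
  induction n with
  | zero =>
    intro φ _
    have : sv 0 = fun _ => 0 := by funext θ; simp [sv, vPow_zero]
    simp [pairL, gen, this]
  | succ n ih =>
    obtain ⟨a₁, a₂, h1, h2, h3, h4⟩ := exists_roots hα hα1 hb hb5 (muC_ge (Nat.succ_ne_zero n))
    have G := growthTest_pairL hy hyt (angFactor_sv (n + 1))
    refine G.eq_zero_iterate (a := -2) (by norm_num) k fun φ hφ => ?_
    refine (G.iterate (-2) k).eq_zero_lo (a := a₁) (by linarith) (fun φ hφ => ?_) φ hφ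
    refine ((G.iterate (-2) k).comp_opS a₁).eq_zero_hi (a := a₂) (by linarith) (fun φ hφ => ?_) φ hφ
    have e : (fun t => -α ^ 2 * deriv (deriv φ) t + -(b * α) * deriv φ t + muC (n + 1) * φ t) =
        fun t => -α ^ 2 * opS a₁ (opS a₂ φ) t := by
      funext t
      rw [opS_opS hφ]
      have h3' : α ^ 2 * (a₁ + a₂) = -(b * α) := by rw [h3]; field_simp
      have h4' : α ^ 2 * (a₁ * a₂) = -muC (n + 1) := by rw [h4]; field_simp
      linear_combination (-1 * deriv φ t) * h3' + φ t * h4'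
    have t1 := (hφ.opS a₂).opS a₁
    have hz := h (n + 1) φ hφ
    have e2 : fullL α b (gen φ (vPow (n + 1))) = fun p =>
        gen (fun t => -α ^ 2 * opS a₁ (opS a₂ φ) t) (sv (n + 1)) p +
          (-nuC (n + 1)) * gen φ (sv n) p := by
      funext p
      rw [hφ.fullL_gen, e, Nat.add_sub_cancel]
    have t2 := t1.const_mul (-α ^ 2)
    rw [e2, twoD_iterate_add_mul (t2.radTest_gen (contDiff_sv _)) (hφ.radTest_gen (contDiff_sv _)),
      t2.twoD_iterate_gen, hφ.twoD_iterate_gen] at hz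
    have i1 := integrable_pairL hy hyt (angFactor_sv (n + 1)) (t2.opS_iterate (-2) k)
    have i2 := integrable_pairL hy hyt (angFactor_sv n) (hφ.opS_iterate (-2) k)
    have e3 : ∀ p, y p * ((gen ((opS (-2))^[k] fun t => -α ^ 2 * opS a₁ (opS a₂ φ) t)
        (sv (n + 1)) p + -nuC (n + 1) * gen ((opS (-2))^[k] φ) (sv n) p) * weightRad p) =
        y p * (gen ((opS (-2))^[k] fun t => -α ^ 2 * opS a₁ (opS a₂ φ) t)
        (sv (n + 1)) p * weightRad p) +
        -nuC (n + 1) * (y p * (gen ((opS (-2))^[k] φ) (sv n) p * weightRad p)) := fun p => by ring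
    simp only [e3] at hz
    rw [integral_add i1 (i2.const_mul _), integral_const_mul] at hz
    have z2 := ih _ (hφ.opS_iterate (-2) k)
    unfold pairL at z2
    rw [z2, mul_zero, add_zero] at hz
    have z3 := (G.iterate (-2) k).lin.const_mul t1 (-α ^ 2)
    have z4 : -α ^ 2 * pairL y (sv (n + 1)) ((opS (-2))^[k] (opS a₁ (opS a₂ φ))) = 0 := by
      rw [← z3]; exact hz
    exact (mul_eq_zero.1 z4).resolve_left (by simp [hα.ne'])


/-! ### Density of the range of the operator -/

section slices
variable {y : Fn}

lemma integrableOn_slab (hy : StripMeas y) (h : sqL2 y < ⊤) {v : ℝ → ℝ} (hv : AngFactor v)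
    {a b : ℝ} (ha : 0 < a) : Integrable (fun p : ℝ × ℝ => y p * weightRad p * v p.2)
      ((volume.restrict (Icc a b)).prod (volume.restrict J₀)) := by
  obtain ⟨V, hV⟩ := hv.bound
  rcases lt_or_ge b a with hba | hab
  · simp [Icc_eq_empty (not_le.2 hba)]
  have hm : StripMeas fun p : ℝ × ℝ => (Icc a b).indicator (fun _ => (1 : ℝ)) p.1 * v p.2 * weightRad p :=
    (((measurable_const.indicator measurableSet_Icc).comp measurable_fst).mul
      (hv.cont.measurable.comp measurable_snd)).aestronglyMeasurable.mul isWeight_weightRad.meas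
  have hb := sqL2_product_le (ψ := (Icc a b).indicator fun _ => (1 : ℝ)) (a := a) (b := b) (v := v)
    hab zero_le_one (fun R _ => by
      by_cases hR : R ∈ Icc a b
      · simp [indicator_of_mem hR]
      · simp [indicator_of_notMem hR]) (fun R hR => indicator_of_notMem hR _)
    (fun R hR => wRad_le ha hR.1) hV
  have hi := integrable_pair hy hm h (hb.trans_lt ofReal_lt_top)
  have hsub : Icc a b ×ˢ J₀ ⊆ strip := prod_mono (fun R hR => ha.trans_le hR.1) le_rfl
  rw [Measure.prod_restrict, ← Measure.volume_eq_prod]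
  refine (IntegrableOn.mono_set hi hsub).congr_fun (fun p hp => ?_)
    (measurableSet_Icc.prod measurableSet_Ioo)
  simp only [indicator_of_mem hp.1]; ring

lemma ae_slice_integrable (hy : StripMeas y) (h : sqL2 y < ⊤) {v : ℝ → ℝ} (hv : AngFactor v) :
    ∀ᵐ R ∂volume.restrict (Ioi (0 : ℝ)),
      IntegrableOn (fun θ => y (R, θ) * weightRad (R, θ) * v θ) J₀ := by
  refine ae_restrict_of_rat_Icc isOpen_Ioi fun p q hpq => ?_
  rcases lt_or_ge (q : ℝ) p with hlt | hle
  · simp [Icc_eq_empty (not_le.2 hlt)]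
  · exact (integrableOn_slab hy h hv (hpq (left_mem_Icc.2 hle))).prod_right_ae

lemma ae_integral_eq_zero_of_pairL (hy : StripMeas y) (h : sqL2 y < ⊤) {v : ℝ → ℝ}
    (hv : AngFactor v) (hz : ∀ φ, Test φ → pairL y v φ = 0) :
    ∀ᵐ R ∂volume.restrict (Ioi (0 : ℝ)), ∫ θ in J₀, y (R, θ) * weightRad (R, θ) * v θ = 0 := by
  rw [ae_restrict_iff' measurableSet_Ioi]
  refine IsOpen.ae_eq_zero_of_integral_contDiff_smul_eq_zero isOpen_Ioi ?_ fun a ha hac has => ?_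
  · refine locallyIntegrableOn_of_rat_Icc isOpen_Ioi fun p q hpq => ?_
    rcases lt_or_ge (q : ℝ) p with hlt | hle
    · simp [Icc_eq_empty (not_le.2 hlt)]
    · exact (integrableOn_slab hy h hv (hpq (left_mem_Icc.2 hle))).integral_prod_left
  · have hK := hac.isCompact
    have tφ : Test fun t => a (exp t) := by
      refine ⟨ha.comp Real.contDiff_exp, ?_⟩
      refine HasCompactSupport.of_support_subset_isCompact
        (hK.image_of_continuousOn (f := log) (Real.continuousOn_log.mono fun R hR =>
          (mem_Ioi.1 (has hR)).ne')) fun t ht => ?_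
      exact ⟨exp t, subset_tsupport _ ht, Real.log_exp t⟩
    have e := hz _ tφ
    have i := integrable_pairL hy h hv tφ
    rw [pairL, volume_restrict_strip] at e
    rw [volume_restrict_strip] at i
    rw [integral_prod _ i] at e
    rw [← setIntegral_eq_integral_of_forall_compl_eq_zero (s := Ioi (0 : ℝ)) fun R hR => by
      rw [image_eq_zero_of_notMem_tsupport fun hh => hR (has hh), zero_smul]]
    refine Eq.trans ?_ e
    refine setIntegral_congr_fun measurableSet_Ioi fun R hR => ?_
    simp only [smul_eq_mul, ← integral_const_mul]
    congr 1; funext θ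
    simp only [gen, liftR_pos (mem_Ioi.1 hR), Real.exp_log (mem_Ioi.1 hR)]
    ring

end slices

lemma ae_eq_zero_of_sin_moments {w : ℝ → ℝ} (hw : IntegrableOn w J₀)
    (h : ∀ n : ℕ, ∫ θ in J₀, w θ * (sin θ ^ 2) ^ n = 0) :
    ∀ᵐ θ ∂volume.restrict J₀, w θ = 0 := by
  have hpi := pi_pos
  refine ae_eq_zero_of_moments (τ := fun θ => sin θ ^ 2) (σ := fun x => Real.arcsin (√x))
    (c := 0) (d := 1) (by fun_prop) (fun θ _ => ⟨sq_nonneg _, sin_sq_le_one θ⟩)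
    (Real.continuous_arcsin.comp Real.continuous_sqrt).continuousOn (fun θ hθ => ?_)
    (by rwa [integrableOn_Icc_iff_integrableOn_Ioo]) fun n => ?_
  · have : 0 ≤ sin θ := sin_nonneg_of_nonneg_of_le_pi hθ.1 (by linarith [hθ.2])
    simp only [Real.sqrt_sq this]
    exact Real.arcsin_sin (by linarith [hθ.1]) hθ.2
  · rw [integral_Icc_eq_integral_Ioo]; exact h n

/-- An element annihilating the range annihilates everything orthogonal to the kernel. -/
theorem pair_eq_zero_of_orthK {y T : Fn} (hy : StripMeas y) (hyt : sqL2 y < ⊤)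
    (hz : ∀ n φ, Test φ → pairL y (sv n) φ = 0) (hT : StripMeas T)
    (hTt : radSq T < ⊤) (hK : OrthK T) :
    ∫ p in strip, y p * (T p * weightRad p) = 0 := by
  have i : Integrable (fun p => y p * (T p * weightRad p)) vol₊ :=
    integrable_pair hy (hT.mul isWeight_weightRad.meas) hyt hTt
  rw [volume_restrict_strip] at i ⊢
  rw [integral_prod _ i]
  refine integral_eq_zero_of_ae ?_
  have hall : ∀ᵐ R ∂volume.restrict (Ioi (0 : ℝ)), ∀ n : ℕ,
      ∫ θ in J₀, y (R, θ) * weightRad (R, θ) * sv n θ = 0 :=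
    ae_all_iff.2 fun n => ae_integral_eq_zero_of_pairL hy hyt (angFactor_sv n) (hz n)
  have hint : ∀ᵐ R ∂volume.restrict (Ioi (0 : ℝ)), ∀ n : ℕ,
      IntegrableOn (fun θ => y (R, θ) * weightRad (R, θ) * (sin (2 * θ) * (sin θ ^ 2) ^ n)) J₀ :=
    ae_all_iff.2 fun n => ae_slice_integrable hy hyt (angFactor_sin_mul (by fun_prop))
  filter_upwards [hall, hint, hK] with R h1 h2 h3
  have hm := continuous_mW
  set Y : ℝ → ℝ := fun θ => y (R, θ) * weightRad (R, θ) with hY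
  have h20 : IntegrableOn (fun θ => Y θ * sin (2 * θ)) J₀ := by
    simpa using h2 0
  set c : ℝ := (∫ θ in J₀, Y θ * sin (2 * θ)) / angInt mW with hc
  have hcm : c * angInt mW = ∫ θ in J₀, Y θ * sin (2 * θ) := div_mul_cancel₀ _ angInt_mW_pos.ne'
  have hae := ae_eq_zero_of_sin_moments (w := fun θ => Y θ * sin (2 * θ) - c * mW θ)
    (h20.sub (integrableOn_cont (by fun_prop))) fun n => by
      have e1 : ∀ θ, (Y θ * sin (2 * θ) - c * mW θ) * (sin θ ^ 2) ^ n =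
          Y θ * (sin (2 * θ) * (sin θ ^ 2) ^ n) - c * (mW θ * (sin θ ^ 2) ^ n) :=
        fun θ => by ring
      have e2 : ∀ θ, Y θ * sv n θ = Y θ * (sin (2 * θ) * (sin θ ^ 2) ^ n) -
          meanC n * (Y θ * sin (2 * θ)) := fun θ => by unfold sv vPow; ring
      have e3 : ∫ θ in J₀, Y θ * sv n θ = 0 := h1 n
      simp only [e2] at e3
      rw [integral_sub (h2 n) (h20.const_mul _), integral_const_mul, ← hcm] at e3
      have e4 : meanC n * angInt mW = ∫ θ in J₀, mW θ * (sin θ ^ 2) ^ n :=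
        div_mul_cancel₀ _ angInt_mW_pos.ne'
      simp only [e1]
      rw [integral_sub (h2 n) (integrableOn_cont (by fun_prop)), integral_const_mul, ← e4]
      linarith
  have e5 : ∫ θ in J₀, y (R, θ) * (T (R, θ) * weightRad (R, θ)) =
      ∫ θ in J₀, (2 / 3 * c) * (T (R, θ) * K θ) := by
    refine integral_congr_ae ?_
    filter_upwards [hae, ae_restrict_mem measurableSet_Ioo] with θ hθ hm
    have hs := sin_two_pos hm
    have h4 : Y θ = c * (sin (2 * θ) * cos θ) := by
      have h5 : Y θ * sin (2 * θ) = c * (sin (2 * θ) * cos θ) * sin (2 * θ) := by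
        unfold mW at hθ; linarith
      exact mul_right_cancel₀ hs.ne' h5
    simp only [hY] at h4
    have h6 : sin (2 * θ) * cos θ = 2 / 3 * K θ := by
      unfold K; rw [sin_two_mul]; ring
    rw [h6] at h4
    linear_combination T (R, θ) * h4
  rw [integral_of_le (by positivity), integral_Ioc_eq_integral_Ioo] at h3
  rw [e5, integral_const_mul, h3, mul_zero]
  rfl

lemma HasWeakPartial.orthK {f f1 : Fn} (h : HasWeakPartial (1, 0) f (fun p => f1 p / p.1))
    (hm : StripMeas f1) (hf : radSq f < ⊤)
    (hf1 : radSq f1 < ⊤) (hK : OrthK f) : OrthK f1 := by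
  have hfm : StripMeas f := h.locInt.aestronglyMeasurable
  have cK : Continuous K := by unfold K; fun_prop
  have hKv : ∀ θ, |K θ| ≤ 3 := fun θ => by
    have h1 := Real.abs_sin_le_one θ
    have h2 : cos θ ^ 2 ≤ 1 := Real.cos_sq_le_one θ
    unfold K
    rw [abs_mul, abs_mul, abs_of_nonneg (sq_nonneg (cos θ)), abs_of_pos (by norm_num : (0 : ℝ) < 3)]
    nlinarith [abs_nonneg (sin θ), sq_nonneg (cos θ)]
  have hint : ∀ {f : Fn}, StripMeas f → radSq f < ⊤ →
      ∀ {a : ℝ → ℝ}, ContinuousOn a (Ioi 0) → ∀ {l r : ℝ}, 0 < l →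
      Integrable (fun p : ℝ × ℝ => f p * (a p.1 * K p.2))
        ((volume.restrict (Icc l r)).prod (volume.restrict J₀)) := by
    intro f hfm hf a ha l r hl
    have hsub : Icc l r ×ˢ J₀ ⊆ strip := prod_mono (fun R hR => hl.trans_le hR.1) le_rfl
    obtain ⟨M, hM⟩ := isCompact_Icc.exists_bound_of_continuousOn
      (ha.mono fun R (hR : R ∈ Icc l r) => hl.trans_le hR.1)
    rw [Measure.prod_restrict, ← Measure.volume_eq_prod]
    have hfin : IsFiniteMeasure (volume.restrict (Icc l r ×ˢ J₀) : Measure (ℝ × ℝ)) := ⟨by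
      rw [Measure.restrict_apply_univ, Measure.volume_eq_prod, Measure.prod_prod, Real.volume_Icc,
        Real.volume_Ioo]
      exact mul_lt_top ofReal_lt_top ofReal_lt_top⟩
    have h1 : sqL2 f < ⊤ := by
      refine (sqL2_mono (g := fun p => f p * weightRad p) fun p hp => ?_).trans_lt hf
      rw [abs_mul]
      refine le_mul_of_one_le_right (abs_nonneg _) ((le_abs_self _).trans' ?_)
      have hs := sin_two_pos' hp
      have hw : 1 ≤ wRad p.1 := by
        have hR : 0 < p.1 := hp.1
        unfold wRad
        rw [one_le_div (by positivity)]
        nlinarith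
      have hr : 0 < sin (2 * p.2) ^ (eta / 2) := rpow_pos_of_pos hs _
      have hr1 : sin (2 * p.2) ^ (eta / 2) ≤ 1 :=
        Real.rpow_le_one hs.le (sin_le_one _) (by unfold eta; norm_num)
      rw [weightRad, one_le_div hr]
      linarith
    have h2 := (memLp_of_sqL2 hfm h1).mono_measure (Measure.restrict_mono hsub le_rfl)
    have h3 : Integrable f (volume.restrict (Icc l r ×ˢ J₀)) := h2.integrable (by norm_num)
    refine h3.mul_bdd (c := M * 3) ?_ ?_
    · refine ContinuousOn.aestronglyMeasurable ?_ (measurableSet_Icc.prod measurableSet_Ioo)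
      exact (ha.comp continuousOn_fst fun p hp => hl.trans_le hp.1.1).mul
        (cK.comp continuous_snd).continuousOn
    · filter_upwards [ae_restrict_mem (measurableSet_Icc.prod measurableSet_Ioo)] with p hp
      rw [norm_mul]
      exact mul_le_mul (hM p.1 hp.1) (hKv p.2) (norm_nonneg _) ((norm_nonneg _).trans (hM p.1 hp.1))
  have hl : LocallyIntegrableOn (fun R => ∫ θ in J₀, f1 (R, θ) * (R⁻¹ * K θ)) (Ioi 0) := by
    refine locallyIntegrableOn_of_rat_Icc isOpen_Ioi fun p q hpq => ?_
    rcases lt_or_ge (q : ℝ) p with hlt | hle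
    · simp [Icc_eq_empty (not_le.2 hlt)]
    · exact (hint hm hf1 (a := fun R => R⁻¹) (continuousOn_inv₀.mono fun R hR => (mem_Ioi.1 hR).ne')
        (hpq (left_mem_Icc.2 hle))).integral_prod_left
  have key : ∀ᵐ R : ℝ, R ∈ Ioi (0 : ℝ) → ∫ θ in J₀, f1 (R, θ) * (R⁻¹ * K θ) = 0 := by
    refine IsOpen.ae_eq_zero_of_integral_contDiff_smul_eq_zero isOpen_Ioi hl fun a ha hac has => ?_
    have hda : Continuous (deriv a) := ha.continuous_deriv (by simp)
    have hds : tsupport (deriv a) ⊆ tsupport a := tsupport_deriv_subset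
    by_cases hne : (tsupport a).Nonempty
    swap
    · rw [not_nonempty_iff_eq_empty, tsupport_eq_empty_iff] at hne
      simp [hne]
    set l := sInf (tsupport a)
    set r := sSup (tsupport a)
    have hl0 : 0 < l := has (hac.isCompact.sInf_mem hne)
    have hin : ∀ R ∈ tsupport a, R ∈ Icc l r := fun R hR =>
      ⟨csInf_le hac.isCompact.bddBelow hR, le_csSup hac.isCompact.bddAbove hR⟩
    have hsubI : Icc l r ⊆ Ioi 0 := fun R hR => hl0.trans_le hR.1
    have z1 : ∀ R ∉ Icc l r, a R = 0 := fun R hR =>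
      image_eq_zero_of_notMem_tsupport fun hh => hR (hin R hh)
    have z2 : ∀ R ∉ Icc l r, deriv a R = 0 := fun R hR =>
      image_eq_zero_of_notMem_tsupport fun hh => hR (hin R (hds hh))
    have i1 := hint hfm hf (a := deriv a) hda.continuousOn (l := l) (r := r) hl0
    have i2 := hint hm hf1 (a := fun R => R⁻¹ * a R)
      ((continuousOn_inv₀.mono fun R hR => (mem_Ioi.1 hR).ne').mul ha.continuous.continuousOn)
      (l := l) (r := r) hl0
    have hsl := h.sliceWeak_fst.ae_integral_eq_zero isOpen_Ioo isOpen_Ioi ha hac has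
    have e1 : ∫ θ in J₀, ∫ R in Icc l r,
        (f (R, θ) * (deriv a R * K θ) + f1 (R, θ) * (R⁻¹ * a R * K θ)) = 0 := by
      refine integral_eq_zero_of_ae ?_
      filter_upwards [hsl] with θ hθ
      have e2 : ∫ R in Ioi 0, ((fun p : ℝ × ℝ => f p.swap) (θ, R) * deriv a R +
          (fun p : ℝ × ℝ => (fun p => f1 p / p.1) p.swap) (θ, R) * a R) =
          ∫ R in Icc l r, (f (R, θ) * deriv a R + f1 (R, θ) / R * a R) :=
        setIntegral_eq_of_subset_of_forall_sdiff_eq_zero measurableSet_Ioi hsubI fun R hR => by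
          rw [z1 R hR.2, z2 R hR.2]; simp
      rw [e2] at hθ
      have e3 : ∀ R, f (R, θ) * (deriv a R * K θ) + f1 (R, θ) * (R⁻¹ * a R * K θ) =
          K θ * (f (R, θ) * deriv a R + f1 (R, θ) / R * a R) := fun R => by
        rw [div_eq_mul_inv]; ring
      simp only [e3, integral_const_mul, hθ, mul_zero]
      rfl
    have e4 := integral_integral_swap (f := fun R θ =>
      f (R, θ) * (deriv a R * K θ) + f1 (R, θ) * (R⁻¹ * a R * K θ)) (i1.add i2)
    rw [e1] at e4
    rw [← setIntegral_eq_integral_of_forall_compl_eq_zero (s := Icc l r) fun R hR => by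
      rw [z1 R hR, zero_smul]]
    refine Eq.trans (integral_congr_ae ?_) e4
    have hK' : ∀ᵐ R ∂volume.restrict (Icc l r), ∫ θ in (0 : ℝ)..(π / 2), f (R, θ) * K θ = 0 :=
      ae_restrict_of_ae_restrict_of_subset hsubI hK
    filter_upwards [hK', i1.prod_right_ae, i2.prod_right_ae] with R k1 k2 k3
    rw [integral_add k2 k3]
    have e5 : ∀ θ, f (R, θ) * (deriv a R * K θ) = deriv a R * (f (R, θ) * K θ) := fun θ => by ring
    have e6 : ∀ θ, f1 (R, θ) * (R⁻¹ * a R * K θ) = a R * (f1 (R, θ) * (R⁻¹ * K θ)) :=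
      fun θ => by ring
    rw [integral_of_le (by positivity), integral_Ioc_eq_integral_Ioo] at k1
    simp only [e5, e6, integral_const_mul, k1, mul_zero, zero_add, smul_eq_mul]
  rw [OrthK, ae_restrict_iff' measurableSet_Ioi]
  filter_upwards [key] with R hR hR0
  have h1 := hR hR0
  have e : ∀ θ, f1 (R, θ) * (R⁻¹ * K θ) = R⁻¹ * (f1 (R, θ) * K θ) := fun θ => by ring
  simp only [e, integral_const_mul] at h1
  rw [integral_of_le (by positivity), integral_Ioc_eq_integral_Ioo]
  exact (mul_eq_zero.1 h1).resolve_left (inv_ne_zero (mem_Ioi.1 hR0).ne')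


section linear
variable {g g' : Fn}

lemma RadTest.add_mul (hg : RadTest g) (hg' : RadTest g') (c : ℝ) :
    RadTest fun p => g p + c * g' p := hg.add (hg'.const_mul c)

lemma psi_add_mul (g g' : Fn) (c : ℝ) :
    psi (fun p => g p + c * g' p) = fun p => psi g p + c * psi g' p := by
  funext p; simp only [psi]; ring

lemma angL_add_mul (hg : RadTest g) (hg' : RadTest g') (c : ℝ) :
    angL (fun p => g p + c * g' p) = fun p => angL g p + c * angL g' p := by
  funext p
  simp only [angL, dTheta_add_mul hg hg', dTheta_add_mul hg.dTheta hg'.dTheta]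
  ring

lemma fullL_add_mul (hg : RadTest g) (hg' : RadTest g') (α b c : ℝ) :
    fullL α b (fun p => g p + c * g' p) = fun p => fullL α b g p + c * fullL α b g' p := by
  funext p
  simp only [fullL, psi_add_mul, DR_add_mul hg.psi hg'.psi, DR_add_mul hg.psi.DR hg'.psi.DR,
    angL_add_mul hg hg']
  ring

lemma DR_iterate_add_mul (hg : RadTest g) (hg' : RadTest g') (c : ℝ) (j : ℕ) :
    DR^[j] (fun p => g p + c * g' p) = fun p => DR^[j] g p + c * DR^[j] g' p := by
  induction j generalizing g g' with
  | zero => rfl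
  | succ j ih =>
    rw [Function.iterate_succ_apply, DR_add_mul hg hg', ih hg.DR hg'.DR]
    rfl

lemma RadTest.DR_iterate (hg : RadTest g) (j : ℕ) : RadTest (PolarBiotSavart.DR^[j] g) := by
  induction j generalizing g with
  | zero => exact hg
  | succ j ih => exact ih hg.DR

lemma Core.add_mul (hg : Core g) (hg' : Core g') (c : ℝ) : Core fun p => g p + c * g' p := by
  refine ⟨hg.test.add_mul hg'.test c, fun R => ?_⟩
  have hm := continuous_mW
  have c1 := continuous_slice hg.test.smooth R
  have c2 := continuous_slice hg'.test.smooth R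
  have e : ∀ θ, mW θ * (g (R, θ) + c * g' (R, θ)) = mW θ * g (R, θ) + c * (mW θ * g' (R, θ)) :=
    fun θ => by ring
  have h1 := hg.mean R
  have h2 := hg'.mean R
  unfold angInt at h1 h2 ⊢
  simp only [e]
  have i1 : IntegrableOn (fun θ => mW θ * g (R, θ)) J₀ := integrableOn_cont (hm.mul c1)
  have i2 : IntegrableOn (fun θ => mW θ * g' (R, θ)) J₀ := integrableOn_cont (hm.mul c2)
  rw [integral_add i1 (i2.const_mul _), integral_const_mul, h1, h2]
  ring

end linear

lemma weightRad_sq {p : ℝ × ℝ} (hp : p ∈ strip) : weightRad p ^ 2 = wRad p.1 ^ 2 * se p.2 := by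
  have hs := sin_two_pos' hp
  have : (sin (2 * p.2) ^ (eta / 2)) ^ 2 = sin (2 * p.2) ^ eta := by
    rw [← Real.rpow_natCast, ← Real.rpow_mul hs.le]; congr 1; push_cast; ring
  rw [weightRad, div_pow, this, se, rpow_neg hs.le, div_eq_mul_inv]

lemma sqL2_weightRad_eq {f : Fn} (h : WIntegrable se fun p => f p ^ 2) :
    radSq f = ofReal (wInt se fun p => f p ^ 2) := by
  rw [wInt, ofReal_integral_eq_lintegral_ofReal h]
  · refine setLIntegral_congr_fun measurableSet_strip fun p hp => ?_
    simp only [enorm_sq_eq]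
    congr 1
    rw [mul_pow, weightRad_sq hp]
  · refine ae_strip_of_forall fun p hp => ?_
    have := se_pos hp.2
    positivity

lemma RadTest.sqL2_eq {f : Fn} (h : RadTest f) : radSq f = ofReal (wInt se fun p => f p ^ 2) :=
  sqL2_weightRad_eq (h.sq.wIntegrable integrableOn_se)

lemma RadTest.sqL2_lt_top {f : Fn} (h : RadTest f) : radSq f < ⊤ := by
  rw [h.sqL2_eq]; exact ofReal_lt_top

lemma RadTest.stripMeas {f : Fn} (h : RadTest f) : StripMeas f :=
  h.smooth.continuous.aestronglyMeasurable

lemma RadTest.weak_DR {f : Fn} (h : RadTest f) :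
    HasWeakPartial (1, 0) f (fun p => PolarBiotSavart.DR f p / p.1) := by
  refine (HasWeakPartial.of_contDiff h.smooth (1, 0)).congr_on (fun _ _ => rfl) fun p hp => ?_
  have : p.1 ≠ 0 := (mem_Ioi.1 hp.1).ne'
  rw [DR_eq (ContDiff.diffAt h.smooth p)]
  field_simp

lemma radTest_zero : RadTest fun _ => 0 := ⟨contDiff_const, 1, 1, one_pos, fun _ _ => rfl⟩

lemma core_zero : Core fun _ => 0 := ⟨radTest_zero, fun R => by simp [angInt]⟩

/-- The range of `(2 + D_R)^k L` on the core, in the weighted `L²` space. -/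
def rangeSub (α b : ℝ) (k : ℕ) : Submodule ℝ (Lp ℝ 2 ((volume : Measure (ℝ × ℝ)).restrict strip)) where
  carrier := {z | ∃ g, Core g ∧ z =ᵐ[vol₊] fun p => twoD^[k] (fullL α b g) p * weightRad p}
  add_mem' := by
    rintro z z' ⟨g, hg, h⟩ ⟨g', hg', h'⟩
    refine ⟨_, hg.add_mul hg' 1, ?_⟩
    rw [fullL_add_mul hg.test hg'.test, twoD_iterate_add_mul (hg.test.fullL α b) (hg'.test.fullL α b)]
    filter_upwards [Lp.coeFn_add z z', h, h'] with p h1 h2 h3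
    rw [h1, Pi.add_apply, h2, h3]; ring
  zero_mem' := by
    refine ⟨_, core_zero.add_mul core_zero (-1), ?_⟩
    rw [fullL_add_mul radTest_zero radTest_zero,
      twoD_iterate_add_mul (radTest_zero.fullL α b) (radTest_zero.fullL α b)]
    filter_upwards [Lp.coeFn_zero ℝ 2 ((volume : Measure (ℝ × ℝ)).restrict strip)] with p h1
    rw [h1, Pi.zero_apply]; ring
  smul_mem' := by
    rintro c z ⟨g, hg, h⟩
    refine ⟨_, hg.add_mul hg (c - 1), ?_⟩
    rw [fullL_add_mul hg.test hg.test, twoD_iterate_add_mul (hg.test.fullL α b) (hg.test.fullL α b)]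
    filter_upwards [Lp.coeFn_smul c z, h] with p h1 h2
    rw [h1, Pi.smul_apply, h2, smul_eq_mul]; ring

theorem exists_core_approx {α b : ℝ} (hα : 0 < α) (hα1 : α < alphaMax) (hb : 0 < b) (hb5 : b ≤ 5)
    (k : ℕ) {T : Fn} (hT : StripMeas T) (hTt : radSq T < ⊤)
    (hann : ∀ y, StripMeas y → sqL2 y < ⊤ → (∀ n φ, Test φ → pairL y (sv n) φ = 0) →
      ∫ p in strip, y p * (T p * weightRad p) = 0) :
    ∃ g : ℕ → Fn, (∀ n, Core (g n)) ∧
      L2Tendsto weightRad (fun n => twoD^[k] (fullL α b (g n))) T := by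
  have mT : MemLp (fun p => T p * weightRad p) 2 vol₊ :=
    memLp_of_sqL2 (hT.mul isWeight_weightRad.meas) hTt
  have hcl : mT.toLp ∈ (rangeSub α b k).topologicalClosure := by
    rw [← Submodule.orthogonal_orthogonal_eq_closure, Submodule.mem_orthogonal]
    intro y hy
    rw [Submodule.mem_orthogonal'] at hy
    have hym := Lp.memLp y
    have hyt : sqL2 y < ⊤ := by rw [sqL2_eq_eLpNorm]; exact ENNReal.pow_lt_top hym.2
    have hz : ∀ n φ, Test φ → ∫ p in strip, y p *
        (twoD^[k] (fullL α b (gen φ (vPow n))) p * weightRad p) = 0 := by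
      intro n φ hφ
      have hc := hφ.core_gen n
      have tf := (hc.test.fullL α b).twoD_iterate k
      have mf : MemLp (fun p => twoD^[k] (fullL α b (gen φ (vPow n))) p * weightRad p) 2 vol₊ :=
        memLp_of_sqL2 (tf.stripMeas.mul isWeight_weightRad.meas) tf.sqL2_lt_top
      have h1 := hy mf.toLp ⟨_, hc, mf.coeFn_toLp⟩
      rw [L2.inner_def] at h1
      rw [← h1]
      refine integral_congr_ae ?_
      filter_upwards [mf.coeFn_toLp] with p hp
      rw [hp]; simp [mul_comm]
    have h2 := hann y hym.1 hyt (pairL_eq_zero hα hα1 hb hb5 hym.1 hyt k hz)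
    rw [L2.inner_def, ← h2]
    refine integral_congr_ae ?_
    filter_upwards [mT.coeFn_toLp] with p hp
    rw [hp]; simp [mul_comm]
  have hcl' : mT.toLp ∈ closure (rangeSub α b k : Set (Lp ℝ 2 _)) := hcl
  obtain ⟨z, hz, hlim⟩ := mem_closure_iff_seq_limit.1 hcl'
  choose g hg hgz using hz
  refine ⟨g, hg, ?_⟩
  have h3 : ∀ n, sqL2 (fun p => (twoD^[k] (fullL α b (g n)) p - T p) * weightRad p) =
      edist (z n) mT.toLp ^ 2 := by
    intro n
    rw [Lp.edist_def, sqL2_eq_eLpNorm]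
    congr 1
    refine eLpNorm_congr_ae ?_
    filter_upwards [hgz n, mT.coeFn_toLp] with p h1 h2
    rw [Pi.sub_apply, h1, h2]; ring
  unfold L2Tendsto
  simp only [h3]
  simpa using ENNReal.Tendsto.pow (n := 2) (tendsto_iff_edist_tendsto_0.1 hlim)

/-- Iterated `2 + D_R` on a sequence of radial derivatives. -/
def twoSeq (t : ℕ → Fn) : ℕ → ℕ → Fn
  | 0, j => t j
  | i + 1, j => fun p => 2 * twoSeq t i j p + twoSeq t i (j + 1) p

lemma twoSeq_sub (t t' : ℕ → Fn) (i j : ℕ) :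
    twoSeq (fun j p => t j p - t' j p) i j = fun p => twoSeq t i j p - twoSeq t' i j p := by
  induction i generalizing j with
  | zero => rfl
  | succ i ih => funext p; simp only [twoSeq, ih]; ring

lemma twoSeq_smooth {f : Fn} (hf : RadTest f) (i j : ℕ) :
    twoSeq (fun j => DR^[j] f) i j = DR^[j] (twoD^[i] f) := by
  induction i generalizing j with
  | zero => rfl
  | succ i ih =>
    funext p
    have e : twoD (twoD^[i] f) = fun p => DR (twoD^[i] f) p + 2 * twoD^[i] f p := by
      funext p; simp only [twoD]; ring
    have hi := hf.twoD_iterate i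
    rw [Function.iterate_succ_apply', e, DR_iterate_add_mul hi.DR hi]
    simp only [twoSeq, ih, Function.iterate_succ_apply]
    ring

/-- A finite sequence of weak radial derivatives in the weighted `L²` space. -/
structure RadSeq (k : ℕ) (t : ℕ → Fn) : Prop where
  meas : ∀ j ≤ k, StripMeas (t j)
  fin : ∀ j ≤ k, radSq (t j) < ⊤
  weak : ∀ j, j + 1 ≤ k → HasWeakPartial (1, 0) (t j) (divR (t (j + 1)))

section radseq
variable {k : ℕ} {t t' : ℕ → Fn}

lemma sqL2_lin_lt_top {f g ρ : Fn} (hρ : IsWeight ρ) (hf : StripMeas f) (c d : ℝ)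
    (h1 : wSq ρ f < ⊤) (h2 : wSq ρ g < ⊤) :
    sqL2 (fun p => (c * f p + d * g p) * ρ p) < ⊤ := by
  have e : (fun p => (c * f p + d * g p) * ρ p) = fun p => c * (f p * ρ p) + d * (g p * ρ p) := by
    funext p; ring
  rw [e]
  refine (sqL2_add_le ((hf.mul hρ.meas).const_mul c)).trans_lt ?_
  rw [sqL2_const_mul, sqL2_const_mul]
  exact ENNReal.add_lt_top.2 ⟨mul_lt_top (by simp) (mul_lt_top (by simp) h1),
    mul_lt_top (by simp) (mul_lt_top (by simp) h2)⟩

lemma RadSeq.sub (h : RadSeq k t) (h' : RadSeq k t') : RadSeq k fun j p => t j p - t' j p := by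
  refine ⟨fun j hj => (h.meas j hj).sub (h'.meas j hj), fun j hj => ?_, fun j hj => ?_⟩
  · have := sqL2_lin_lt_top isWeight_weightRad (h.meas j hj) 1 (-1) (h.fin j hj) (h'.fin j hj)
    simpa [sub_eq_add_neg] using this
  · refine ((h.weak j hj).add ((h'.weak j hj).const_mul (-1))).congr_on (fun p _ => by ring)
      fun p _ => by ring

lemma RadTest.radSeq {f : Fn} (hf : RadTest f) (k : ℕ) :
    RadSeq k fun j => PolarBiotSavart.DR^[j] f := by
  refine ⟨fun j _ => (hf.DR_iterate j).stripMeas, fun j _ => (hf.DR_iterate j).sqL2_lt_top,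
    fun j _ => ?_⟩
  simp only [Function.iterate_succ_apply']
  exact (hf.DR_iterate j).weak_DR

lemma RadSeq.two (h : RadSeq k t) (i : ℕ) (hi : i ≤ k) : RadSeq (k - i) (twoSeq t i) := by
  induction i with
  | zero => exact h
  | succ i ih =>
    have ih := ih (by omega)
    refine ⟨fun j hj => ?_, fun j hj => ?_, fun j hj => ?_⟩
    · exact ((ih.meas j (by omega)).const_mul 2).add (ih.meas (j + 1) (by omega))
    · have := sqL2_lin_lt_top isWeight_weightRad (ih.meas j (by omega)) 2 1 (ih.fin j (by omega))
        (ih.fin (j + 1) (by omega))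
      simpa [twoSeq] using this
    · refine (((ih.weak j (by omega)).const_mul 2).add (ih.weak (j + 1) (by omega))).congr_on
        (fun p _ => rfl) fun p _ => ?_
      simp only [twoSeq]; ring

lemma RadSeq.le_succ (h : RadSeq k t) {i j : ℕ} (hij : i + 1 + j ≤ k) : radSq (twoSeq t i j) ≤
      radSq (twoSeq t (i + 1) j) := by
  have h1 := h.two i (by omega)
  exact sqL2_le_two_add_DR (h1.weak j (by omega)) (h1.meas (j + 1) (by omega)) (h1.fin j (by omega))

lemma RadSeq.le_top (h : RadSeq k t) (d : ℕ) {i : ℕ} (hd : i + d = k) : radSq (twoSeq t i 0) ≤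
      radSq (twoSeq t k 0) := by
  induction d generalizing i with
  | zero => rw [← hd, add_zero]
  | succ d ih => exact (h.le_succ (by omega)).trans (ih (by omega))

lemma RadSeq.bound (h : RadSeq k t) (j : ℕ) {i : ℕ} (hij : i + j ≤ k) : radSq (twoSeq t i j) ≤
      10 ^ j * radSq (twoSeq t k 0) := by
  induction j generalizing i with
  | zero => simpa using h.le_top (k - i) (by omega)
  | succ j ih =>
    have h1 := ih (i := i + 1) (by omega)
    have h2 := ih (i := i) (by omega)
    have hi1 := (h.two (i + 1) (by omega)).meas j (by omega)
    have e : (fun p => twoSeq t i (j + 1) p * weightRad p) = fun p =>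
        twoSeq t (i + 1) j p * weightRad p - 2 * (twoSeq t i j p * weightRad p) := by
      funext p; simp only [twoSeq]; ring
    rw [e]
    refine (sqL2_sub_le (hi1.mul isWeight_weightRad.meas)).trans ?_
    rw [sqL2_const_mul]
    set X := radSq (twoSeq t k 0)
    calc _ ≤ 2 * (10 ^ j * X) + 2 * (ofReal (2 ^ 2) * (10 ^ j * X)) :=
        add_le_add (mul_le_mul_right h1 _) (mul_le_mul_right (mul_le_mul_right h2 _) _)
      _ = 10 ^ (j + 1) * X := by
        rw [show ofReal (2 ^ 2) = 4 by norm_num, pow_succ]; ring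

end radseq

/-- Simultaneous approximation of all radial derivatives of the right-hand side. -/
theorem exists_core_seq {α b : ℝ} (hα : 0 < α) (hα1 : α < alphaMax) (hb : 0 < b) (hb5 : b ≤ 5)
    {k : ℕ} {F : ℕ → Fn} (hF : RadSeq k F) (hK : OrthK (F 0)) :
    ∃ g : ℕ → Fn, (∀ n, Core (g n)) ∧
      ∀ j ≤ k, L2Tendsto weightRad (fun n => DR^[j] (fullL α b (g n))) (F j) := by
  have hKj : ∀ j ≤ k, OrthK (F j) := by
    intro j
    induction j with
    | zero => exact fun _ => hK
    | succ j ih =>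
      intro hj
      exact (hF.weak j hj).orthK (hF.meas _ hj) (hF.fin _ (by omega)) (hF.fin _ hj) (ih (by omega))
  have h2 := hF.two k le_rfl
  obtain ⟨g, hg, hlim⟩ := exists_core_approx hα hα1 hb hb5 k (T := twoSeq F k 0)
    (h2.meas 0 (by omega)) (h2.fin 0 (by omega)) fun y hy hyt hz => by
      have : ∀ i j, i + j ≤ k → ∫ p in strip, y p * (twoSeq F i j p * weightRad p) = 0 := by
        intro i
        induction i with
        | zero =>
          intro j hj
          exact pair_eq_zero_of_orthK hy hyt hz (hF.meas j (by omega)) (hF.fin j (by omega))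
            (hKj j (by omega))
        | succ i ih =>
          intro j hj
          have hi := hF.two i (by omega)
          have i1 : Integrable (fun p => y p * (twoSeq F i j p * weightRad p))
              vol₊ := integrable_pair hy
            ((hi.meas j (by omega)).mul isWeight_weightRad.meas) hyt (hi.fin j (by omega))
          have i2 : Integrable (fun p => y p * (twoSeq F i (j + 1) p * weightRad p))
              vol₊ := integrable_pair hy
            ((hi.meas (j + 1) (by omega)).mul isWeight_weightRad.meas) hyt
            (hi.fin (j + 1) (by omega))
          have e : ∀ p, y p * (twoSeq F (i + 1) j p * weightRad p) =
              2 * (y p * (twoSeq F i j p * weightRad p)) +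
                y p * (twoSeq F i (j + 1) p * weightRad p) := fun p => by
            simp only [twoSeq]; ring
          simp only [e]
          rw [integral_add (i1.const_mul _) i2, integral_const_mul, ih j (by omega),
            ih (j + 1) (by omega)]
          ring
      exact this k 0 (by omega)
  refine ⟨g, hg, fun j hj => ?_⟩
  have hb : ∀ n, sqL2 (fun p => (DR^[j] (fullL α b (g n)) p - F j p) * weightRad p) ≤
      10 ^ j * sqL2 (fun p => (twoD^[k] (fullL α b (g n)) p - twoSeq F k 0 p) * weightRad p) := by
    intro n
    have tf := (hg n).test.fullL α b
    have := ((tf.radSeq k).sub hF).bound j (i := 0) (by omega)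
    rw [twoSeq_sub (fun j => DR^[j] (fullL α b (g n))) F k 0, twoSeq_smooth tf] at this
    exact this
  refine tendsto_of_tendsto_of_tendsto_of_le_of_le tendsto_const_nhds ?_ (fun _ => zero_le) hb
  have := ENNReal.Tendsto.const_mul (a := (10 : ℝ≥0∞) ^ j) hlim (Or.inr (by simp))
  simpa using this


/-! ### Operators on the core and their closures -/

/-- Linear operators on test functions commuting with `D_R`. -/
structure CoreOp (T : (Fn) → Fn) : Prop where
  test : ∀ {g}, RadTest g → RadTest (T g)
  lin : ∀ {g g'}, RadTest g → RadTest g' → ∀ c,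
    T (fun p => g p + c * g' p) = fun p => T g p + c * T g' p
  comm : ∀ {g}, RadTest g → DR (T g) = T (DR g)

lemma Core.DR_iterate {g : Fn} (hg : Core g) (j : ℕ) : Core (PolarBiotSavart.DR^[j] g) := by
  induction j generalizing g with
  | zero => exact hg
  | succ j ih => exact ih hg.DR

section ops

variable {T A : (Fn) → Fn}

lemma CoreOp.DR_iterate (hT : CoreOp T) {g : Fn} (hg : RadTest g) (j : ℕ) :
    DR^[j] (T g) = T (DR^[j] g) := by
  induction j generalizing g with
  | zero => rfl
  | succ j ih => rw [Function.iterate_succ_apply, hT.comm hg, ih hg.DR]; rfl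

lemma CoreOp.comp_DR (hT : CoreOp T) (j : ℕ) : CoreOp fun g => T (DR^[j] g) := by
  refine ⟨fun hg => hT.test (hg.DR_iterate j), fun hg hg' c => ?_, fun hg => ?_⟩
  · rw [DR_iterate_add_mul hg hg', hT.lin (hg.DR_iterate j) (hg'.DR_iterate j)]
  · rw [hT.comm (hg.DR_iterate j), ← Function.iterate_succ_apply' DR, Function.iterate_succ_apply]

lemma coreOp_psi : CoreOp psi :=
  ⟨fun hg => hg.psi, fun _ _ c => psi_add_mul _ _ c, fun hg => DR_psi hg⟩

lemma coreOp_angL : CoreOp angL :=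
  ⟨fun hg => hg.angL, fun hg hg' c => angL_add_mul hg hg' c, fun hg => DR_angL hg⟩

lemma coreOp_dTheta : CoreOp dTheta :=
  ⟨fun hg => hg.dTheta, fun hg hg' c => by rw [dTheta_add_mul hg hg'],
    fun hg => (dTheta_DR hg.smooth).symm⟩

lemma CoreOp.ang_mul (hT : CoreOp T) {a : ℝ → ℝ} (ha : ContDiff ℝ ∞ a) :
    CoreOp fun g p => a p.2 * T g p := by
  refine ⟨fun hg => (hT.test hg).ang_mul ha, fun hg hg' c => ?_, fun hg => ?_⟩
  · funext p; rw [hT.lin hg hg']; ring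
  · funext p; rw [DR_angular_mul ha (hT.test hg).smooth, hT.comm hg]

lemma coreOp_auxQ : CoreOp auxQ :=
  coreOp_dTheta.ang_mul (a := fun θ => 1 - cos (2 * θ)) (by fun_prop)

lemma CoreOp.comp (hT : CoreOp T) (hA : CoreOp A) : CoreOp fun g => T (A g) := by
  refine ⟨fun hg => hT.test (hA.test hg), fun hg hg' c => ?_, fun hg => ?_⟩
  · rw [hA.lin hg hg', hT.lin (hA.test hg) (hA.test hg')]
  · rw [hT.comm (hA.test hg), hA.comm hg]

lemma coreOp_fullL (α b : ℝ) : CoreOp (fullL α b) := by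
  refine ⟨fun hg => hg.fullL α b, fun hg hg' c => fullL_add_mul hg hg' α b c, fun hg => ?_⟩
  funext p
  have t2 := hg.psi.DR.DR.const_mul (-α ^ 2)
  have t1 := hg.psi.DR.const_mul (-(b * α))
  have e1 : ∀ (c : ℝ) {f : Fn}, RadTest f → DR (fun p => c * f p) = fun p => c * DR f p :=
    fun c f hf => by
      have := DR_angular_mul (a := fun _ => c) contDiff_const hf.smooth
      exact funext this
  rw [show fullL α b _ = fun p => (-α ^ 2 * DR (DR (psi _)) p + -(b * α) * DR (psi _) p) + angL _ p
    from rfl, DR_add (t2.add t1).smooth hg.angL.smooth, DR_add t2.smooth t1.smooth,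
    e1 _ hg.psi.DR.DR, e1 _ hg.psi.DR, fullL, DR_angL hg, DR_psi hg]

/-- The angular derivative `sin(2θ) ∂_θ` of the stream function. -/
def angU (g : Fn) (p : ℝ × ℝ) : ℝ := sin (2 * p.2) * dTheta (psi g) p

lemma coreOp_angU : CoreOp angU := (coreOp_dTheta.comp coreOp_psi).ang_mul contDiff_sin_two

lemma dTheta_psi {g : Fn} (hg : RadTest g) (p : ℝ × ℝ) :
    dTheta (psi g) p = 2 * cos (2 * p.2) * g p + sin (2 * p.2) * dTheta g p := by
  refine ((hasDerivAt_sin_two p.2).mul (hasDerivAt_dTheta hg.smooth p.1 p.2)).deriv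

lemma dTheta_ang_mul {f : Fn} (hf : RadTest f) {a : ℝ → ℝ} {a' : ℝ} {p : ℝ × ℝ}
    (ha : HasDerivAt a a' p.2) :
    dTheta (fun p => a p.2 * f p) p = a' * f p + a p.2 * dTheta f p :=
  (ha.mul (hasDerivAt_dTheta hf.smooth p.1 p.2)).deriv

lemma dTheta_dTheta_psi {g : Fn} (hg : RadTest g) (p : ℝ × ℝ) :
    dTheta (dTheta (psi g)) p = auxQ g p - angL g p - 4 * psi g p := by
  have e : dTheta (psi g) = fun p => (fun q : ℝ × ℝ => 2 * cos (2 * q.2) * g q) p +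
      (fun q : ℝ × ℝ => sin (2 * q.2) * dTheta g q) p := funext fun p => dTheta_psi hg p
  have s1 : ContDiff ℝ ∞ fun θ : ℝ => 2 * cos (2 * θ) := by fun_prop
  rw [e, dTheta_add (hg.ang_mul s1).smooth (hg.dTheta.ang_mul contDiff_sin_two).smooth,
    dTheta_ang_mul hg ((hasDerivAt_cos_two p.2).const_mul 2),
    dTheta_ang_mul hg.dTheta (hasDerivAt_sin_two p.2)]
  simp only [auxQ, angL, psi]; ring

lemma dTheta_angU {g : Fn} (hg : RadTest g) (p : ℝ × ℝ) :
    sin (2 * p.2) * dTheta (angU g) p = 2 * cos (2 * p.2) * angU g p +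
      sin (2 * p.2) ^ 2 * (auxQ g p - angL g p - 4 * psi g p) := by
  rw [← dTheta_dTheta_psi hg, show angU g = fun p => sin (2 * p.2) * dTheta (psi g) p from rfl,
    dTheta_ang_mul hg.psi.dTheta (hasDerivAt_sin_two p.2)]
  ring

lemma dTheta_auxQ {g : Fn} (hg : RadTest g) (p : ℝ × ℝ) : sin (2 * p.2) * dTheta (auxQ g) p =
      (1 - cos (2 * p.2)) * (3 * auxQ g p - angL g p) := by
  rw [show auxQ g = fun p => (1 - cos (2 * p.2)) * dTheta g p from rfl,
    dTheta_ang_mul hg.dTheta ((hasDerivAt_cos_two p.2).const_sub 1)]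
  have := sin_sq_add_cos_sq (2 * p.2)
  simp only [angL]
  linear_combination (2 * dTheta g p) * this

lemma RadTest.weak_dTheta {f : Fn} (h : RadTest f) : HasWeakPartial (0, 1) f
    (fun p => (sin (2 * p.2) * PolarBiotSavart.dTheta f p) / sin (2 * p.2)) := by
  refine (HasWeakPartial.of_contDiff h.smooth (0, 1)).congr_on (fun _ _ => rfl) fun p hp => ?_
  have := (sin_two_pos' hp).ne'
  rw [dTheta_eq (ContDiff.diffAt h.smooth p)]
  field_simp

/-! ### Bounds by the right-hand side -/

/-- The constant in the bounds of the operators by the right-hand side. -/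
def cOp : ℝ≥0 := 20 * 10 ^ 20

lemma sqL2_le_of_wInt {f F : Fn} (hf : RadTest f) (hF : RadTest F) {a : ℝ} (ha : 0 ≤ a)
    (h : a * wInt se (fun p => f p ^ 2) ≤ 20 * cEn * wInt se fun p => F p ^ 2) :
    ofReal a * radSq f ≤ cOp * radSq F := by
  have e : (cOp : ℝ≥0∞) = ofReal (20 * cEn) := by
    rw [show 20 * cEn = ((cOp : ℝ≥0) : ℝ) by norm_num [cOp, cEn], ENNReal.ofReal_coe_nnreal]
  rw [hf.sqL2_eq, hF.sqL2_eq, e, ← ofReal_mul ha, ← ofReal_mul (by norm_num [cEn])]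
  exact ofReal_le_ofReal h

lemma wInt_sq_nonneg (f : Fn) : 0 ≤ wInt se fun p => f p ^ 2 :=
  wInt_nonneg se_nonneg fun _ _ => sq_nonneg _

variable {α b : ℝ} {g : Fn}

lemma wInt_dTheta_psi_sq_le (hg : RadTest g) :
    wInt se (fun p => dTheta (psi g) p ^ 2) ≤ 5 * wInt se (eDens g) := by
  rw [← wInt_const_mul]
  refine wInt_mono se_nonneg (hg.psi.dTheta.sq.wIntegrable integrableOn_se)
    ((hg.eDens.wIntegrable integrableOn_se).const_mul 5) fun p _ => ?_
  rw [dTheta_psi hg, eDens]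
  have hc := sin_sq_add_cos_sq (2 * p.2)
  have hc2 : (cos (2 * p.2) * g p) ^ 2 ≤ g p ^ 2 := by
    rw [mul_pow]; nlinarith [sq_nonneg (g p), sq_nonneg (sin (2 * p.2))]
  nlinarith [sq_nonneg (cos (2 * p.2) * g p - 2 * (sin (2 * p.2) * dTheta g p))]

lemma sqL2_angU_le_dTheta (hα : 0 < α) (hα1 : α < 1) (g : Fn) : angSq α (angU g) ≤
      4 * radSq (dTheta (psi g)) := by
  rw [show (4 : ℝ≥0∞) = ofReal (2 ^ 2) by norm_num]
  refine sqL2_le_of_abs_le fun p hp => ?_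
  have hs := sin_two_pos' hp
  have := abs_mul_weightAng_le hα hα1 hp (a := sin (2 * p.2))
    (by rw [abs_of_pos hs]; linarith)
  rw [angU, mul_right_comm, abs_mul, abs_mul (dTheta _ _), abs_of_pos (isWeight_weightRad.pos p hp)]
  calc _ ≤ 2 * weightRad p * |dTheta (psi g) p| :=
        mul_le_mul_of_nonneg_right this (abs_nonneg _)
    _ = _ := by ring

lemma sqL2_angU_le (hα : 0 < α) (hα1 : α < 1) (hg : RadTest g) {a : ℝ} (ha : 0 ≤ a)
    {F : Fn} (hF : RadTest F) (h : a * wInt se (eDens g) ≤ cEn * wInt se fun p => F p ^ 2) :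
    ofReal a * angSq α (angU g) ≤ 4 * cOp * radSq F := by
  have tv := hg.psi.dTheta
  have h1 := sqL2_angU_le_dTheta hα hα1 g
  have h2 := wInt_dTheta_psi_sq_le hg
  have h3 := sqL2_le_of_wInt tv hF ha (by
    have := mul_le_mul_of_nonneg_left h2 ha
    have := wInt_sq_nonneg F
    nlinarith [show (0 : ℝ) ≤ cEn by norm_num [cEn]])
  calc _ ≤ ofReal a * (4 * radSq (dTheta (psi g))) :=
        mul_le_mul_right h1 _
    _ = 4 * (ofReal a * radSq (dTheta (psi g))) := by ring
    _ ≤ 4 * (cOp * radSq F) := mul_le_mul_right h3 _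
    _ = _ := by ring

end ops

section estimates

variable {α b : ℝ} {g : Fn} (hα : 0 < α) (hα1 : α < alphaMax) (hb : 0 < b) (hb5 : b ≤ 5)
  (hg : Core g)

lemma cEn_pos : 0 < cEn := by norm_num [cEn]

lemma alphaMax_lt_one : alphaMax < 1 := by norm_num [alphaMax]

include hα hα1 hb hb5 hg

lemma sqL2_psi_le : ofReal 1 * radSq (psi g) ≤ cOp * radSq (fullL α b g) := by
  refine sqL2_le_of_wInt hg.test.psi (hg.test.fullL α b) zero_le_one ?_
  have h := (energy_estimate hα hα1 hb hb5 hg).1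
  have := wInt_psi_sq_le hg.test
  have := mul_nonneg cEn_pos.le (wInt_sq_nonneg (fullL α b g))
  linarith

lemma sqL2_psi_DR_le : ofReal (α ^ 2) * radSq (psi (DR g)) ≤ cOp * radSq (fullL α b g) := by
  refine sqL2_le_of_wInt hg.test.DR.psi (hg.test.fullL α b) (by positivity) ?_
  have h := (energy_estimate hα hα1 hb hb5 hg).2.1
  have := mul_le_mul_of_nonneg_left (wInt_psi_sq_le hg.test.DR) (sq_nonneg α)
  have := mul_nonneg cEn_pos.le (wInt_sq_nonneg (fullL α b g))
  linarith

lemma sqL2_psi_DR_DR_le : ofReal (α ^ 4) * radSq (psi (DR (DR g))) ≤ cOp * radSq (fullL α b g) := by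
  refine sqL2_le_of_wInt hg.test.DR.DR.psi (hg.test.fullL α b) (by positivity) ?_
  have h := (energy_estimate hα hα1 hb hb5 hg).2.2.1
  rw [DR_psi hg.test, DR_psi hg.test.DR] at h
  have := mul_nonneg cEn_pos.le (wInt_sq_nonneg (fullL α b g))
  linarith

lemma sqL2_angL_le : ofReal 1 * radSq (angL g) ≤ cOp * radSq (fullL α b g) := by
  refine sqL2_le_of_wInt hg.test.angL (hg.test.fullL α b) zero_le_one ?_
  have h := (energy_estimate hα hα1 hb hb5 hg).2.2.2
  have := mul_nonneg cEn_pos.le (wInt_sq_nonneg (fullL α b g))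
  linarith

lemma sqL2_auxQ_le : ofReal 1 * radSq (auxQ g) ≤ cOp * radSq (fullL α b g) := by
  refine sqL2_le_of_wInt hg.test.auxQ (hg.test.fullL α b) zero_le_one ?_
  have h := (energy_estimate hα hα1 hb hb5 hg).2.2.2
  have := wInt_auxQ_le hg.test
  have := mul_nonneg cEn_pos.le (wInt_sq_nonneg (fullL α b g))
  linarith

lemma sqL2_angU_le_one : ofReal 1 * angSq α (angU g) ≤ 4 * cOp * radSq (fullL α b g) :=
  sqL2_angU_le hα (hα1.trans alphaMax_lt_one) hg.test zero_le_one (hg.test.fullL α b)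
    (by rw [one_mul]; exact (energy_estimate hα hα1 hb hb5 hg).1)

lemma sqL2_angU_DR_le : ofReal (α ^ 2) * angSq α (angU (DR g)) ≤ 4 * cOp * radSq (fullL α b g) :=
  sqL2_angU_le hα (hα1.trans alphaMax_lt_one) hg.test.DR (sq_nonneg α) (hg.test.fullL α b)
    (energy_estimate hα hα1 hb hb5 hg).2.1

end estimates

/-! ### Limits -/

section limits

variable {T A : (Fn) → Fn} {σ F G : Fn} {g : ℕ → Fn} {a : ℝ} {C : ℝ≥0}

lemma le_div_of_mul_le {x y : ℝ≥0∞} (ha : 0 < a) (h : ofReal a * x ≤ C * y) :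
    x ≤ (C / a.toNNReal : ℝ≥0) * y := by
  have hne : a.toNNReal ≠ 0 := (Real.toNNReal_pos.2 ha).ne'
  rw [ENNReal.coe_div hne, ENNReal.div_eq_inv_mul, mul_assoc]
  change x ≤ (ofReal a)⁻¹ * _
  refine (ENNReal.le_div_iff_mul_le (Or.inl (by simpa using ha)) (Or.inl (by simp))).2 ?_ |>.trans
    (le_of_eq (ENNReal.div_eq_inv_mul ..))
  rwa [mul_comm]

lemma CoreOp.exists_limit (hT : CoreOp T) (hA : CoreOp A) (hσ : IsWeight σ)
    (hσt : ∀ f, RadTest f → wSq σ (T f) < ⊤) (hg : ∀ n, Core (g n))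
    (hlim : L2Tendsto weightRad (fun n => A (g n)) F) (hF : StripMeas F) (ha : 0 < a)
    (h : ∀ f, Core f → ofReal a * wSq σ (T f) ≤ C * radSq (A f)) :
    ∃ G, StripMeas G ∧ L2Tendsto σ (fun n => T (g n)) G ∧ wSq σ G < ⊤ := by
  set D := C / a.toNNReal
  have h' : ∀ f, Core f → wSq σ (T f) ≤ D * radSq (A f) := fun f hf => le_div_of_mul_le ha (h f hf)
  set e : ℕ → ℝ≥0∞ := fun n => 2 * D * sqL2 (fun p => (A (g n) p - F p) * weightRad p) with he
  have he0 : Tendsto e atTop (𝓝 0) := by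
    have := ENNReal.Tendsto.const_mul (a := 2 * (D : ℝ≥0∞)) hlim
      (Or.inr (ENNReal.mul_ne_top (by simp) (by simp)))
    simpa using this
  refine exists_l2Limit hσ he0 (fun n => (hT.test (hg n).test).stripMeas)
    (fun n => hσt _ (hg n).test) fun n m => ?_
  have hc := (hg n).add_mul (hg m) (-1)
  have e1 : (fun p => (T (g n) p - T (g m) p) * σ p) =
      fun p => T (fun p => g n p + -1 * g m p) p * σ p := by
    rw [hT.lin (hg n).test (hg m).test]; funext p; ring
  have e2 : (fun p => A (fun p => g n p + -1 * g m p) p * weightRad p) = fun p =>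
      (A (g n) p - F p) * weightRad p - (A (g m) p - F p) * weightRad p := by
    rw [hA.lin (hg n).test (hg m).test]; funext p; ring
  rw [e1]
  refine (h' _ hc).trans ?_
  rw [e2]
  refine (mul_le_mul_right (sqL2_sub_le (f := fun p => (A (g n) p - F p) * weightRad p)
    (((hA.test (hg n).test).stripMeas.sub hF).mul isWeight_weightRad.meas)) _).trans (le_of_eq ?_)
  simp only [he]; ring

lemma CoreOp.limit_bound (hT : CoreOp T) (hA : CoreOp A) (hσ : IsWeight σ) (hg : ∀ n, Core (g n))
    (hlim : L2Tendsto weightRad (fun n => A (g n)) F) (hF : StripMeas F) (ha : 0 < a)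
    (h : ∀ f, Core f → ofReal a * wSq σ (T f) ≤ C * radSq (A f)) (hG : StripMeas G)
    (hl : L2Tendsto σ (fun n => T (g n)) G) :
    ofReal a * wSq σ G ≤ 4 * C * radSq F := by
  have := L2Tendsto.sqL2_le hσ isWeight_weightRad (fun n => (hT.test (hg n).test).stripMeas)
    (fun n => (hA.test (hg n).test).stripMeas) hG hF hl hlim
    fun n => le_div_of_mul_le ha (h _ (hg n))
  refine (mul_le_mul_right this _).trans (le_of_eq ?_)
  have hne : a.toNNReal ≠ 0 := (Real.toNNReal_pos.2 ha).ne'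
  rw [ENNReal.coe_div hne]
  change ofReal a * (4 * (C / ofReal a) * _) = _
  rw [← mul_assoc, mul_left_comm, ENNReal.mul_div_cancel (by simpa using ha) (by simp)]

lemma L2Tendsto.of_le {ρ : Fn} {f : ℕ → Fn} {h : Fn} (hl : L2Tendsto ρ f h)
    {f' : ℕ → Fn} {h' : Fn} {c : ℝ}
    (hle : ∀ n, ∀ p ∈ strip, |(f' n p - h' p) * σ p| ≤ c * |(f n p - h p) * ρ p|) :
    L2Tendsto σ f' h' := by
  refine tendsto_of_tendsto_of_tendsto_of_le_of_le tendsto_const_nhds ?_ (fun _ => zero_le)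
    fun n => sqL2_le_of_abs_le (hle n)
  simpa using ENNReal.Tendsto.const_mul (a := ofReal (c ^ 2)) hl (Or.inr (by simp))

lemma L2Tendsto.add {ρ : Fn} (hρ : IsWeight ρ) {f f' : ℕ → Fn} {h h' : Fn}
    (hf : ∀ n, StripMeas (f n)) (hh : StripMeas h) (hl : L2Tendsto ρ f h)
    (hl' : L2Tendsto ρ f' h') :
    L2Tendsto ρ (fun n p => f n p + f' n p) (fun p => h p + h' p) := by
  have h1 := ENNReal.Tendsto.const_mul (a := 2) hl (Or.inr (by simp))
  have h2 := ENNReal.Tendsto.const_mul (a := 2) hl' (Or.inr (by simp))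
  have h3 := h1.add h2
  simp only [mul_zero, add_zero] at h3
  refine tendsto_of_tendsto_of_tendsto_of_le_of_le tendsto_const_nhds h3 (fun _ => zero_le)
    fun n => ?_
  have e : (fun p => (f n p + f' n p - (h p + h' p)) * ρ p) = fun p =>
      (f n p - h p) * ρ p + (f' n p - h' p) * ρ p := by funext p; ring
  simp only [e]
  exact sqL2_add_le (((hf n).sub hh).mul hρ.meas)

lemma L2Tendsto.bdd_mul {ρ : Fn} {f : ℕ → Fn} {h : Fn} (hl : L2Tendsto ρ f h)
    {a : Fn} {c : ℝ} (ha : ∀ p, |a p| ≤ c) :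
    L2Tendsto ρ (fun n p => a p * f n p) (fun p => a p * h p) := by
  refine hl.of_le (c := c) fun n p _ => ?_
  rw [← mul_sub, mul_assoc, abs_mul]
  exact mul_le_mul_of_nonneg_right (ha p) (abs_nonneg _)

lemma L2Tendsto.ae_unique {ρ : Fn} (hρ : IsWeight ρ) {f : ℕ → Fn} {h h' : Fn}
    (hf : ∀ n, StripMeas (f n)) (hh : StripMeas h) (hh' : StripMeas h') (hl : L2Tendsto ρ f h)
    (hl' : L2Tendsto ρ f h') : ∀ᵐ p ∂vol₊, h p = h' p := by
  have h1 := ENNReal.Tendsto.const_mul (a := 2) hl (Or.inr (by simp))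
  have h2 := ENNReal.Tendsto.const_mul (a := 2) hl' (Or.inr (by simp))
  have h3 := h1.add h2
  simp only [mul_zero, add_zero] at h3
  have h4 : sqL2 (fun p => (h p - h' p) * ρ p) = 0 := by
    refine le_antisymm (ge_of_tendsto' h3 fun n => ?_) zero_le
    have e : (fun p => (h p - h' p) * ρ p) = fun p =>
        (f n p - h' p) * ρ p - (f n p - h p) * ρ p := by funext p; ring
    rw [e, add_comm]
    exact sqL2_sub_le (((hf n).sub hh').mul hρ.meas)
  rw [sqL2, lintegral_eq_zero_iff' (StripMeas.enorm_sq
    (f := fun p => (h p - h' p) * ρ p) ((hh.sub hh').mul hρ.meas))] at h4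
  filter_upwards [h4, self_mem_ae_restrict measurableSet_strip] with p hp hps
  have hp : ‖(h p - h' p) * ρ p‖ₑ ^ 2 = 0 := hp
  rw [pow_eq_zero_iff two_ne_zero, enorm_eq_zero, mul_eq_zero] at hp
  exact sub_eq_zero.1 (hp.resolve_right (hρ.pos p hps).ne')

lemma weightRad_le_weightAng {α : ℝ} (hα : 0 < α) (hα1 : α < 1) {p : ℝ × ℝ} (hp : p ∈ strip) :
    weightRad p ≤ weightAng α p := by
  have hs := sin_two_pos' hp
  have h1 := (gam_bounds hα hα1).1
  refine div_le_div_of_nonneg_left (wRad_pos hp.1).le (rpow_pos_of_pos hs _) ?_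
  exact Real.rpow_le_rpow_of_exponent_ge hs (sin_le_one _) (by unfold eta; linarith)

lemma L2Tendsto.ang_to_rad {α : ℝ} (hα : 0 < α) (hα1 : α < 1) {f : ℕ → Fn} {h : Fn}
    (hl : L2Tendsto (weightAng α) f h) : L2Tendsto weightRad f h := by
  refine hl.of_le (c := 1) fun n p hp => ?_
  rw [one_mul, abs_mul, abs_mul, abs_of_pos (isWeight_weightRad.pos p hp),
    abs_of_pos ((isWeight_weightAng α).pos p hp)]
  exact mul_le_mul_of_nonneg_left (weightRad_le_weightAng hα hα1 hp) (abs_nonneg _)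

end limits


/-! ### The weak solution and its radial derivatives -/

/-- The radial derivatives `P j = D_R^jΨ`, `U j = D_θD_R^jΨ`, `H j`, `Q j` of the weak solution, where
`H` is the angular part of the operator and `∂_θθΨ = Q - H - 4Ψ`. -/
structure EllData (α b : ℝ) (k : ℕ) (N : ℝ≥0) (F P U Q H : ℕ → Fn) : Prop where
  measP : ∀ j ≤ k + 2, StripMeas (P j)
  measU : ∀ j ≤ k + 1, StripMeas (U j)
  measQ : ∀ j ≤ k, StripMeas (Q j)
  measH : ∀ j ≤ k, StripMeas (H j)
  leP : ∀ j ≤ k, radSq (P j) ≤ N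
  leP1 : ∀ j ≤ k, ofReal (α ^ 2) * radSq (P (j + 1)) ≤ N
  leP2 : ∀ j ≤ k, ofReal (α ^ 4) * radSq (P (j + 2)) ≤ N
  leU : ∀ j ≤ k, angSq α (U j) ≤ N
  leU1 : ∀ j ≤ k, ofReal (α ^ 2) * angSq α (U (j + 1)) ≤ N
  leQ : ∀ j ≤ k, radSq (Q j) ≤ N
  leH : ∀ j ≤ k, radSq (H j) ≤ N
  radP : ∀ j ≤ k + 1, HasWeakPartial (1, 0) (P j) (divR (P (j + 1)))
  radU : ∀ j ≤ k, HasWeakPartial (1, 0) (U j) (divR (U (j + 1)))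
  radQ : ∀ j, j + 1 ≤ k → HasWeakPartial (1, 0) (Q j) (divR (Q (j + 1)))
  radH : ∀ j, j + 1 ≤ k → HasWeakPartial (1, 0) (H j) (divR (H (j + 1)))
  angP : ∀ j ≤ k + 1, HasWeakPartial (0, 1) (P j) (divS (U j))
  angU : ∀ j ≤ k, HasWeakPartial (0, 1) (U j) (fun p => (2 * cos (2 * p.2) * U j p +
    sin (2 * p.2) ^ 2 * (Q j p - H j p - 4 * P j p)) / sin (2 * p.2))
  angQ : ∀ j ≤ k, HasWeakPartial (0, 1) (Q j) (fun p =>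
    (1 - cos (2 * p.2)) * (3 * Q j p - H j p) / sin (2 * p.2))
  rel : ∀ j ≤ k, ∀ᵐ p ∂vol₊, H j p = F j p + α ^ 2 * P (j + 2) p + b * α * P (j + 1) p
  relQ : ∀ᵐ p ∂vol₊, (1 + cos (2 * p.2)) * Q 0 p = U 0 p + (-2) * (cos (2 * p.2) * P 0 p)

section limits

variable {T : (Fn) → Fn} {σ ρ G G' : Fn} {g : ℕ → Fn} {j : ℕ}

lemma CoreOp.limit_weak_DR (hT : CoreOp T) (hσ : IsWeight σ) (hg : ∀ n, Core (g n))
    (hm : StripMeas G) (hm' : StripMeas G') (hf : wSq σ G < ⊤)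
    (hf' : sqL2 (fun p => G' p * σ p) < ⊤) (h : L2Tendsto σ (fun n => T (DR^[j] (g n))) G)
    (h' : L2Tendsto σ (fun n => T (DR^[j + 1] (g n))) G') :
    HasWeakPartial (1, 0) G (divR G') := by
  have t : ∀ n i, RadTest (T (DR^[i] (g n))) := fun n i => hT.test ((hg n).test.DR_iterate i)
  refine HasWeakPartial.of_tendsto hσ hσ continuousOn_fst (fun p hp => (mem_Ioi.1 hp.1).ne')
    (fun n => ?_) (fun n => (t n (j + 1)).stripMeas) (locallyIntegrableOn_of_sqL2 hσ hm hf)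
    (locallyIntegrableOn_of_sqL2 hσ hm' hf') h h'
  have := (t n j).weak_DR
  rwa [hT.comm ((hg n).test.DR_iterate j), ← Function.iterate_succ_apply' DR] at this

lemma limit_weak_dTheta {f f' : ℕ → Fn} (hσ : IsWeight σ) (hρ : IsWeight ρ)
    (ht : ∀ n, RadTest (f n)) (he : ∀ n p, sin (2 * p.2) * dTheta (f n) p = f' n p)
    (hm : StripMeas G) (hm' : StripMeas G') (hf : wSq σ G < ⊤)
    (hf' : sqL2 (fun p => G' p * ρ p) < ⊤) (h : L2Tendsto σ f G) (h' : L2Tendsto ρ f' G') :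
    HasWeakPartial (0, 1) G (divS G') := by
  have e : ∀ n, (fun p => sin (2 * p.2) * dTheta (f n) p) = f' n := fun n => funext (he n)
  refine HasWeakPartial.of_tendsto hσ hρ (by fun_prop) (fun p hp => (sin_two_pos' hp).ne')
    (fun n => ?_) (fun n => ?_) (locallyIntegrableOn_of_sqL2 hσ hm hf)
    (locallyIntegrableOn_of_sqL2 hρ hm' hf') h h'
  · rw [← e]; exact (ht n).weak_dTheta
  · rw [← e]; exact ((ht n).dTheta.ang_mul contDiff_sin_two).stripMeas

lemma sqL2_bdd_mul_le {f a : Fn} {c : ℝ} (ha : ∀ p ∈ strip, |a p| ≤ c) :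
    sqL2 (fun p => a p * f p * ρ p) ≤ ofReal (c ^ 2) * wSq ρ f := by
  refine sqL2_le_of_abs_le fun p hp => ?_
  rw [mul_assoc, abs_mul]
  exact mul_le_mul_of_nonneg_right (ha p hp) (abs_nonneg _)

end limits

theorem exists_ellData {α b : ℝ} (hα : 0 < α) (hα1 : α < alphaMax) (hb : 0 < b) (hb5 : b ≤ 5)
    {k : ℕ} {F : ℕ → Fn} (hF : RadSeq k F) (hK : OrthK (F 0)) {N : ℝ≥0}
    (hN : ∀ j ≤ k, radSq (F j) ≤ N) :
    ∃ (g : ℕ → Fn) (P U Q H : ℕ → Fn), (∀ n, Core (g n)) ∧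
      L2Tendsto weightRad (fun n => fullL α b (g n)) (F 0) ∧
      L2Tendsto weightRad (fun n => psi (g n)) (P 0) ∧
      EllData α b k (16 * cOp * N) F P U Q H := by
  obtain ⟨g, hg, hlim⟩ := exists_core_seq (α := α) (b := b) hα hα1 hb hb5 hF hK
  have hα1' := hα1.trans alphaMax_lt_one
  have oA := coreOp_fullL α b
  have wR := isWeight_weightRad
  have wA := isWeight_weightAng α
  have lA : ∀ j ≤ k, L2Tendsto weightRad (fun n => fullL α b (DR^[j] (g n))) (F j) := fun j hj => by
    have := hlim j hj
    simpa only [oA.DR_iterate (hg _).test] using this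
  have tR : ∀ {T}, CoreOp T → ∀ j f, RadTest f → radSq (T (DR^[j] f)) < ⊤ :=
    fun hT j f hf => (hT.test (hf.DR_iterate j)).sqL2_lt_top
  have tU : ∀ f, RadTest f → angSq α (angU f) < ⊤ := fun f hf => by
    exact (sqL2_angU_le_dTheta hα hα1' f).trans_lt (mul_lt_top (by simp) hf.psi.dTheta.sqL2_lt_top)
  have sc : ∀ (j : ℕ) (f : Fn), DR^[j + 1] f = DR (DR^[j] f) := fun j f =>
    Function.iterate_succ_apply' DR j f
  have hα2 : (0 : ℝ) < α ^ 2 := by positivity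
  have hα4 : (0 : ℝ) < α ^ 4 := by positivity
  -- the operator bounds along the radial derivatives
  have bP : ∀ (j : ℕ) f, Core f → ofReal 1 * radSq (psi (DR^[j] f)) ≤
      cOp * radSq (fullL α b (DR^[j] f)) := fun j f hf =>
    sqL2_psi_le hα hα1 hb hb5 (hf.DR_iterate j)
  have bP1 : ∀ (j : ℕ) f, Core f → ofReal (α ^ 2) * radSq (psi (DR^[j + 1] f)) ≤
      cOp * radSq (fullL α b (DR^[j] f)) := fun j f hf => by
    rw [sc]; exact sqL2_psi_DR_le hα hα1 hb hb5 (hf.DR_iterate j)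
  have bP2 : ∀ (j : ℕ) f, Core f → ofReal (α ^ 4) * radSq (psi (DR^[j + 2] f)) ≤
      cOp * radSq (fullL α b (DR^[j] f)) := fun j f hf => by
    rw [sc, sc]; exact sqL2_psi_DR_DR_le hα hα1 hb hb5 (hf.DR_iterate j)
  have bQ : ∀ (j : ℕ) f, Core f → ofReal 1 * radSq (auxQ (DR^[j] f)) ≤
      cOp * radSq (fullL α b (DR^[j] f)) := fun j f hf =>
    sqL2_auxQ_le hα hα1 hb hb5 (hf.DR_iterate j)
  have bH : ∀ (j : ℕ) f, Core f → ofReal 1 * radSq (angL (DR^[j] f)) ≤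
      cOp * radSq (fullL α b (DR^[j] f)) := fun j f hf =>
    sqL2_angL_le hα hα1 hb hb5 (hf.DR_iterate j)
  have bU : ∀ (j : ℕ) f, Core f → ofReal 1 * angSq α (angU (DR^[j] f)) ≤
      (4 * cOp : ℝ≥0) * radSq (fullL α b (DR^[j] f)) := fun j f hf =>
    sqL2_angU_le_one hα hα1 hb hb5 (hf.DR_iterate j)
  have bU1 : ∀ (j : ℕ) f, Core f → ofReal (α ^ 2) * angSq α (angU (DR^[j + 1] f)) ≤
      (4 * cOp : ℝ≥0) * radSq (fullL α b (DR^[j] f)) := fun j f hf => by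
    rw [sc]; exact sqL2_angU_DR_le hα hα1 hb hb5 (hf.DR_iterate j)
  have oP := fun j => coreOp_psi.comp_DR j
  have oQ := fun j => coreOp_auxQ.comp_DR j
  have oH := fun j => coreOp_angL.comp_DR j
  have oU := fun j => coreOp_angU.comp_DR j
  have oAj := fun j => oA.comp_DR j
  -- existence of the limits
  have exP : ∀ j, j ≤ k + 2 → ∃ G, StripMeas G ∧
      L2Tendsto weightRad (fun n => psi (DR^[j] (g n))) G ∧
      radSq G < ⊤ := fun j hj => by
    rcases Nat.lt_or_ge k j with h | h
    · rcases (by omega : j = k + 1 ∨ j = k + 2) with rfl | rfl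
      · exact (oP _).exists_limit (oAj k) wR (tR coreOp_psi _) hg (lA k le_rfl) (hF.meas k le_rfl) hα2
          (bP1 k)
      · exact (oP _).exists_limit (oAj k) wR (tR coreOp_psi _) hg (lA k le_rfl) (hF.meas k le_rfl) hα4
          (bP2 k)
    · exact (oP _).exists_limit (oAj j) wR (tR coreOp_psi _) hg (lA j h) (hF.meas j h) one_pos (bP j)
  have exU : ∀ j, j ≤ k + 1 → ∃ G, StripMeas G ∧
      L2Tendsto (weightAng α) (fun n => angU (DR^[j] (g n))) G ∧
      angSq α G < ⊤ := fun j hj => by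
    rcases Nat.lt_or_ge k j with h | h
    · obtain rfl : j = k + 1 := by omega
      exact (oU _).exists_limit (oAj k) wA (fun f hf => tU _ (hf.DR_iterate _)) hg (lA k le_rfl)
        (hF.meas k le_rfl) hα2 (bU1 k)
    · exact (oU _).exists_limit (oAj j) wA (fun f hf => tU _ (hf.DR_iterate _)) hg (lA j h)
        (hF.meas j h) one_pos (bU j)
  have exQ : ∀ j, j ≤ k → ∃ G, StripMeas G ∧ L2Tendsto weightRad (fun n => auxQ (DR^[j] (g n))) G ∧
      radSq G < ⊤ := fun j h =>
    (oQ _).exists_limit (oAj j) wR (tR coreOp_auxQ _) hg (lA j h) (hF.meas j h) one_pos (bQ j)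
  have exH : ∀ j, j ≤ k → ∃ G, StripMeas G ∧ L2Tendsto weightRad (fun n => angL (DR^[j] (g n))) G ∧
      radSq G < ⊤ := fun j h =>
    (oH _).exists_limit (oAj j) wR (tR coreOp_angL _) hg (lA j h) (hF.meas j h) one_pos (bH j)
  choose! P mP lP fP using exP
  choose! U mU lU fU using exU
  choose! Q mQ lQ fQ using exQ
  choose! H mH lH fH using exH
  have fin1 : ∀ {x : ℝ≥0∞} {j}, j ≤ k → x ≤ 4 * cOp * radSq (F j) → x ≤ (16 * cOp * N : ℝ≥0) := by
    intro x j hj hx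
    refine hx.trans ?_
    push_cast
    refine mul_le_mul' (mul_le_mul' (by norm_num) le_rfl) (hN j hj)
  have fin2 : ∀ {x : ℝ≥0∞} {j}, j ≤ k →
      x ≤ 4 * (4 * cOp : ℝ≥0) * radSq (F j) → x ≤ (16 * cOp * N : ℝ≥0) := by
    intro x j hj hx
    refine hx.trans ?_
    push_cast
    refine mul_le_mul' (le_of_eq (by ring)) (hN j hj)
  have one : ∀ x : ℝ≥0∞, ofReal 1 * x = x := fun x => by simp
  have lUr : ∀ j ≤ k + 1, L2Tendsto weightRad (fun n => angU (DR^[j] (g n))) (U j) := fun j hj =>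
    (lU j hj).ang_to_rad hα hα1'
  have fUr : ∀ j ≤ k + 1, radSq (U j) < ⊤ := fun j hj =>
    (sqL2_mono fun p hp => by
      rw [abs_mul, abs_mul, abs_of_pos (wR.pos p hp), abs_of_pos (wA.pos p hp)]
      exact mul_le_mul_of_nonneg_left (weightRad_le_weightAng hα hα1' hp) (abs_nonneg _)).trans_lt
      (fU j hj)
  have mc : ∀ {a : ℝ → ℝ}, Continuous a → StripMeas fun p => a p.2 := fun ha =>
    (ha.comp continuous_snd).aestronglyMeasurable
  have mlin : ∀ {f f' : Fn} (c d : ℝ), StripMeas f → StripMeas f' →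
      StripMeas fun p => c * f p + d * f' p := fun c d h h' => (h.const_mul c).add (h'.const_mul d)
  have llin : ∀ {f f' : ℕ → Fn} {G G' : Fn} (c d : ℝ), (∀ n, StripMeas (f n)) →
      StripMeas G → L2Tendsto weightRad f G → L2Tendsto weightRad f' G' →
      L2Tendsto weightRad (fun n p => c * f n p + d * f' n p) fun p => c * G p + d * G' p :=
    fun c d hf hG h h' => (h.bdd_mul (a := fun _ => c) (c := |c|) fun _ => le_rfl).add wR
      (fun n => (hf n).const_mul c) (hG.const_mul c)
      (h'.bdd_mul (a := fun _ => d) (c := |d|) fun _ => le_rfl)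
  have mn : ∀ {T}, CoreOp T → ∀ j n, StripMeas (T (DR^[j] (g n))) := fun hT j n =>
    (hT.test ((hg n).test.DR_iterate j)).stripMeas
  have cos_le : ∀ p : ℝ × ℝ, |cos (2 * p.2)| ≤ 1 := fun p => Real.abs_cos_le_one _
  have sin_le : ∀ p : ℝ × ℝ, |sin (2 * p.2) ^ 2| ≤ 1 := fun p => by
    rw [abs_of_nonneg (sq_nonneg _)]; exact sin_sq_le_one _
  have cos_le' : ∀ p : ℝ × ℝ, |1 - cos (2 * p.2)| ≤ 2 := fun p => by
    have h1 := cos_le_one (2 * p.2)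
    rw [abs_of_nonneg (by linarith)]; linarith [neg_one_le_cos (2 * p.2)]
  refine ⟨g, P, U, Q, H, hg, lA 0 (by omega), lP 0 (by omega), ?_⟩
  refine ⟨mP, mU, mQ, mH, fun j hj => ?_, fun j hj => ?_, fun j hj => ?_, fun j hj => ?_,
    fun j hj => ?_, fun j hj => ?_, fun j hj => ?_, fun j hj => ?_, fun j hj => ?_, fun j hj => ?_,
    fun j hj => ?_, fun j hj => ?_, fun j hj => ?_, fun j hj => ?_, fun j hj => ?_, ?_⟩
  · exact (one _).symm.trans_le <| fin1 hj ((oP _).limit_bound (oAj j) wR hg (lA j hj) (hF.meas j hj) one_pos (bP j)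
      (mP j (by omega)) (lP j (by omega)))
  · exact fin1 hj ((oP _).limit_bound (oAj j) wR hg (lA j hj) (hF.meas j hj) hα2 (bP1 j)
      (mP _ (by omega)) (lP _ (by omega)))
  · exact fin1 hj ((oP _).limit_bound (oAj j) wR hg (lA j hj) (hF.meas j hj) hα4 (bP2 j)
      (mP _ (by omega)) (lP _ (by omega)))
  · exact (one _).symm.trans_le <| fin2 hj ((oU _).limit_bound (oAj j) wA hg (lA j hj) (hF.meas j hj) one_pos (bU j)
      (mU j (by omega)) (lU j (by omega)))
  · exact fin2 hj ((oU _).limit_bound (oAj j) wA hg (lA j hj) (hF.meas j hj) hα2 (bU1 j)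
      (mU _ (by omega)) (lU _ (by omega)))
  · exact (one _).symm.trans_le <| fin1 hj ((oQ _).limit_bound (oAj j) wR hg (lA j hj) (hF.meas j hj) one_pos (bQ j)
      (mQ j hj) (lQ j hj))
  · exact (one _).symm.trans_le <| fin1 hj ((oH _).limit_bound (oAj j) wR hg (lA j hj) (hF.meas j hj) one_pos (bH j)
      (mH j hj) (lH j hj))
  · exact coreOp_psi.limit_weak_DR wR hg (mP _ (by omega)) (mP _ (by omega)) (fP _ (by omega))
      (fP _ (by omega)) (lP _ (by omega)) (lP _ (by omega))
  · exact coreOp_angU.limit_weak_DR wA hg (mU _ (by omega)) (mU _ (by omega)) (fU _ (by omega))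
      (fU _ (by omega)) (lU _ (by omega)) (lU _ (by omega))
  · exact coreOp_auxQ.limit_weak_DR wR hg (mQ _ (by omega)) (mQ _ (by omega)) (fQ _ (by omega))
      (fQ _ (by omega)) (lQ _ (by omega)) (lQ _ (by omega))
  · exact coreOp_angL.limit_weak_DR wR hg (mH _ (by omega)) (mH _ (by omega)) (fH _ (by omega))
      (fH _ (by omega)) (lH _ (by omega)) (lH _ (by omega))
  · exact limit_weak_dTheta wR wA (fun n => (oP j).test (hg n).test) (fun n p => rfl)
      (mP _ (by omega)) (mU _ (by omega)) (fP _ (by omega)) (fU _ (by omega)) (lP _ (by omega))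
      (lU _ (by omega))
  · have m1 := mlin 1 (-4) (mlin 1 (-1) (mQ j hj) (mH j hj)) (mP j (by omega))
    have m2 := mlin 2 1 ((mc (a := fun θ => cos (2 * θ)) (by fun_prop)).mul (mU j (by omega)))
      ((mc (a := fun θ => sin (2 * θ) ^ 2) (by fun_prop)).mul m1)
    have f1 := sqL2_lin_lt_top wR (mlin 1 (-1) (mQ j hj) (mH j hj)) 1 (-4)
      (sqL2_lin_lt_top wR (mQ j hj) 1 (-1) (fQ j hj) (fH j hj)) (fP j (by omega))
    have f2 := sqL2_lin_lt_top wR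
      ((mc (a := fun θ => cos (2 * θ)) (by fun_prop)).mul (mU j (by omega))) 2 1
      ((sqL2_bdd_mul_le fun p _ => cos_le p).trans_lt (mul_lt_top (by simp) (fUr j (by omega))))
      ((sqL2_bdd_mul_le fun p _ => sin_le p).trans_lt (mul_lt_top (by simp) f1))
    have l1 := llin 1 (-4) (fun n => mlin 1 (-1) (mn coreOp_auxQ j n) (mn coreOp_angL j n))
      (mlin 1 (-1) (mQ j hj) (mH j hj))
      (llin 1 (-1) (mn coreOp_auxQ j) (mQ j hj) (lQ j hj) (lH j hj)) (lP j (by omega))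
    have l2 := llin 2 1
      (fun n => (mc (a := fun θ => cos (2 * θ)) (by fun_prop)).mul (mn coreOp_angU j n))
      ((mc (a := fun θ => cos (2 * θ)) (by fun_prop)).mul (mU j (by omega)))
      ((lUr j (by omega)).bdd_mul cos_le) (l1.bdd_mul sin_le)
    refine (limit_weak_dTheta wA wR (fun n => (oU j).test (hg n).test) (fun n p => ?_)
      (mU _ (by omega)) m2 (fU _ (by omega)) f2 (lU _ (by omega)) l2).congr_on (fun _ _ => rfl)
      fun p _ => by simp only [Pi.mul_apply]; ring
    rw [dTheta_angU ((hg n).test.DR_iterate j)]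
    simp only [Pi.mul_apply]; ring
  · have m1 := mlin 3 (-1) (mQ j hj) (mH j hj)
    have f1 := sqL2_lin_lt_top wR (mQ j hj) 3 (-1) (fQ j hj) (fH j hj)
    have l1 := llin 3 (-1) (mn coreOp_auxQ j) (mQ j hj) (lQ j hj) (lH j hj)
    refine (limit_weak_dTheta wR wR (fun n => (oQ j).test (hg n).test) (fun n p => ?_)
      (mQ _ (by omega)) ((mc (a := fun θ => 1 - cos (2 * θ)) (by fun_prop)).mul m1)
      (fQ _ (by omega)) ((sqL2_bdd_mul_le fun p _ => cos_le' p).trans_lt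
        (mul_lt_top (by simp) f1)) (lQ _ (by omega)) (l1.bdd_mul cos_le')).congr_on
      (fun _ _ => rfl) fun p _ => by simp only [Pi.mul_apply]; ring
    rw [dTheta_auxQ ((hg n).test.DR_iterate j)]
    ring
  · refine (lH j hj).ae_unique wR (mn coreOp_angL j) (mH j hj)
      (((hF.meas j hj).add ((mP (j + 2) (by omega)).const_mul (α ^ 2))).add
        ((mP (j + 1) (by omega)).const_mul (b * α))) ?_
    have l1 := llin (α ^ 2) (b * α) (mn coreOp_psi (j + 2)) (mP _ (by omega))
      (lP (j + 2) (by omega)) (lP (j + 1) (by omega))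
    have l2 := (lA j hj).add wR (mn oA j) (hF.meas j hj) l1
    have e : (fun n => angL (DR^[j] (g n))) = fun n p => fullL α b (DR^[j] (g n)) p +
        (α ^ 2 * psi (DR^[j + 2] (g n)) p + b * α * psi (DR^[j + 1] (g n)) p) := by
      funext n p
      have t := (hg n).test.DR_iterate j
      rw [sc, sc, ← DR_psi t.DR, ← DR_psi t, fullL]
      ring
    rw [e]
    convert l2 using 1
    funext p
    ring
  · have cos_le'' : ∀ p : ℝ × ℝ, |1 + cos (2 * p.2)| ≤ 2 := fun p => by
      have h1 := cos_le_one (2 * p.2)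
      rw [abs_of_nonneg (by linarith [neg_one_le_cos (2 * p.2)])]; linarith
    have l1 := llin 1 (-2) (mn coreOp_angU 0) (mU 0 (by omega)) (lUr 0 (by omega))
      ((lP 0 (by omega)).bdd_mul cos_le)
    have l2 := (lQ 0 (by omega)).bdd_mul cos_le''
    have e : (fun n p => (1 + cos (2 * p.2)) * auxQ (DR^[0] (g n)) p) = fun n p =>
        1 * angU (DR^[0] (g n)) p + -2 * (cos (2 * p.2) * psi (DR^[0] (g n)) p) := by
      funext n p
      simp only [Function.iterate_zero, id, auxQ, angU, psi, dTheta_psi (hg n).test]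
      linear_combination (-dTheta (g n) p) * sin_sq_add_cos_sq (2 * p.2)
    rw [e] at l2
    have := l2.ae_unique wR (fun n => mlin 1 (-2) (mn coreOp_angU 0 n)
      ((mc (a := fun θ => cos (2 * θ)) (by fun_prop)).mul (mn coreOp_psi 0 n)))
      ((mc (a := fun θ => 1 + cos (2 * θ)) (by fun_prop)).mul (mQ 0 (by omega)))
      (mlin 1 (-2) (mU 0 (by omega)) ((mc (a := fun θ => cos (2 * θ)) (by fun_prop)).mul
        (mP 0 (by omega)))) l1
    simpa only [one_mul, Pi.mul_apply] using this


/-! ### Angular regularity -/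

/-- `D_θ^i f` is bounded by `c` in the weighted space, for all `i ≤ n`. -/
def AngReg (α : ℝ) : ℕ → ℝ≥0 → (Fn) → Prop
  | 0, c, f => StripMeas f ∧ angSq α f ≤ c
  | n + 1, c, f => (StripMeas f ∧ angSq α f ≤ c) ∧
      ∃ f', HasWeakPartial (0, 1) f (divS f') ∧ AngReg α n c f'

section angreg

variable {α : ℝ} {n : ℕ} {c d : ℝ≥0} {f g : Fn}

lemma AngReg.mono (h : AngReg α n c f) (hcd : c ≤ d) : AngReg α n d f := by
  have hcd' : (c : ℝ≥0∞) ≤ d := by exact_mod_cast hcd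
  induction n generalizing f with
  | zero => exact ⟨h.1, h.2.trans hcd'⟩
  | succ n ih =>
    obtain ⟨h0, f', h1, h2⟩ := h
    exact ⟨⟨h0.1, h0.2.trans hcd'⟩, f', h1, ih h2⟩

lemma AngReg.of_succ (h : AngReg α (n + 1) c f) : AngReg α n c f := by
  induction n generalizing f with
  | zero => exact h.1
  | succ n ih =>
    obtain ⟨h0, f', h1, h2⟩ := h
    exact ⟨h0, f', h1, ih h2⟩

lemma AngReg.of_le {m : ℕ} (h : AngReg α n c f) (hm : m ≤ n) : AngReg α m c f := by
  induction hm with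
  | refl => exact h
  | step _ ih => exact ih h.of_succ

lemma AngReg.add (h : AngReg α n c f) (h' : AngReg α n d g) :
    AngReg α n (2 * c + 2 * d) (fun p => f p + g p) := by
  have base : ∀ {f g : Fn}, (StripMeas f ∧ angSq α f ≤ c) → (StripMeas g ∧ angSq α g ≤ d) →
      StripMeas (fun p => f p + g p) ∧
        sqL2 (fun p => (f p + g p) * weightAng α p) ≤ (2 * c + 2 * d : ℝ≥0) := by
    intro f g h h'
    refine ⟨h.1.add h'.1, ?_⟩
    simp only [add_mul]
    refine (sqL2_add_le (h.1.mul (isWeight_weightAng α).meas)).trans ?_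
    push_cast
    exact add_le_add (mul_le_mul_right h.2 _) (mul_le_mul_right h'.2 _)
  induction n generalizing f g with
  | zero => exact base h h'
  | succ n ih =>
    obtain ⟨h0, f', h1, h2⟩ := h
    obtain ⟨h0', g', h1', h2'⟩ := h'
    refine ⟨base h0 h0', _, (h1.add h1').congr_on (fun _ _ => rfl) fun p _ => ?_, ih h2 h2'⟩
    ring

lemma AngReg.const_mul (h : AngReg α n c f) {r : ℝ} (hr : |r| ≤ 1) :
    AngReg α n c (fun p => r * f p) := by
  have base : ∀ {f : Fn}, (StripMeas f ∧ angSq α f ≤ c) →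
      StripMeas (fun p => r * f p) ∧ sqL2 (fun p => r * f p * weightAng α p) ≤ c := by
    intro f h
    refine ⟨h.1.const_mul r, (sqL2_mono fun p _ => ?_).trans h.2⟩
    rw [mul_assoc, abs_mul]
    exact mul_le_of_le_one_left (abs_nonneg _) hr
  induction n generalizing f with
  | zero => exact base h
  | succ n ih =>
    obtain ⟨h0, f', h1, h2⟩ := h
    refine ⟨base h0, _, (h1.const_mul r).congr_on (fun _ _ => rfl) fun p _ => ?_, ih h2⟩
    ring

open Polynomial in
lemma HasWeakPartial.poly_mul {f' : Fn} (h : HasWeakPartial (0, 1) f (divS f')) (a : ℝ[X]) :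
    HasWeakPartial (0, 1) (fun p => a.eval (cos (2 * p.2)) * f p) (fun p =>
      (a.eval (cos (2 * p.2)) * f' p +
        (-2 * (1 - X ^ 2) * derivative a).eval (cos (2 * p.2)) * f p) / sin (2 * p.2)) := by
  have hs : ContDiff ℝ ∞ fun p : ℝ × ℝ => a.eval (cos (2 * p.2)) :=
    (by simpa [Polynomial.coe_aeval_eq_eval] using a.contDiff_aeval (𝕜 := ℝ) ∞ :
      ContDiff ℝ ∞ fun x : ℝ => a.eval x).comp (by fun_prop)
  refine (h.smul_left hs).congr_on (fun _ _ => rfl) fun p hp => ?_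
  have hne := (sin_two_pos' hp).ne'
  have e : fderiv ℝ (fun p : ℝ × ℝ => a.eval (cos (2 * p.2))) p (0, 1) =
      (derivative a).eval (cos (2 * p.2)) * (-2 * sin (2 * p.2)) := by
    rw [← dTheta_eq (ContDiff.diffAt hs p)]
    exact (((a.hasDerivAt _).comp p.2 (hasDerivAt_cos_two p.2)).deriv).trans (by ring)
  rw [e]
  have := sin_sq_add_cos_sq (2 * p.2)
  simp only [eval_mul, eval_neg, eval_sub, eval_pow, eval_X, eval_one, eval_ofNat]
  field_simp
  rw [← this]; ring

open Polynomial in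
lemma exists_angReg_poly_mul (n : ℕ) (a : ℝ[X]) : ∃ C : ℝ≥0, ∀ α c f, AngReg α n c f →
    AngReg α n (C * c) (fun p => a.eval (cos (2 * p.2)) * f p) := by
  have base : ∀ a : ℝ[X], ∃ M : ℝ≥0, ∀ α (c : ℝ≥0) f, (StripMeas f ∧ angSq α f ≤ c) →
      StripMeas (fun p => a.eval (cos (2 * p.2)) * f p) ∧
        sqL2 (fun p => a.eval (cos (2 * p.2)) * f p * weightAng α p) ≤ (M * c : ℝ≥0) := by
    intro a
    obtain ⟨M, hM⟩ := (isCompact_Icc (a := (-1 : ℝ)) (b := 1)).exists_bound_of_continuousOn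
      (f := fun x => a.eval x) a.continuous.continuousOn
    refine ⟨(M ^ 2).toNNReal, fun α c f h => ⟨?_, ?_⟩⟩
    · exact ((a.continuous.comp (by fun_prop)).aestronglyMeasurable).mul h.1
    · refine (sqL2_bdd_mul_le (c := M) fun p _ =>
        hM _ ⟨neg_one_le_cos _, cos_le_one _⟩).trans ?_
      rw [ENNReal.coe_mul]
      exact mul_le_mul_right h.2 _
  induction n generalizing a with
  | zero => exact base a
  | succ n ih =>
    obtain ⟨M, hM⟩ := base a
    obtain ⟨C1, h1⟩ := ih a
    obtain ⟨C2, h2⟩ := ih (-2 * (1 - X ^ 2) * derivative a)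
    refine ⟨M + (2 * C1 + 2 * C2), fun α c f h => ?_⟩
    have hc := h.of_succ
    obtain ⟨h0, f', hw, hf'⟩ := h
    have hb := hM α c f h0
    refine ⟨⟨hb.1, hb.2.trans ?_⟩, _, hw.poly_mul a, ((h1 _ _ _ hf').add (h2 _ _ _ hc)).mono ?_⟩
    · rw [add_mul]; exact_mod_cast le_self_add
    · rw [add_mul]
      refine le_trans (le_of_eq ?_) le_add_self
      ring

end angreg

/-! ### Uniform estimates -/

section uniform

variable {ι : Type} {α : ι → ℝ} {N : ι → ℝ≥0} {n : ℕ} {f g f' : ι → Fn}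

/-- Angular regularity with a uniform constant. -/
def UReg (α : ι → ℝ) (N : ι → ℝ≥0) (n : ℕ) (f : ι → Fn) : Prop :=
  ∃ C : ℝ≥0, ∀ i, AngReg (α i) n (C * N i) (f i)

lemma UReg.of_le {m : ℕ} (h : UReg α N n f) (hm : m ≤ n) : UReg α N m f := by
  obtain ⟨C, h⟩ := h
  exact ⟨C, fun i => (h i).of_le hm⟩

lemma UReg.add (h : UReg α N n f) (h' : UReg α N n g) : UReg α N n fun i p => f i p + g i p := by
  obtain ⟨C, h⟩ := h
  obtain ⟨D, h'⟩ := h'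
  exact ⟨2 * C + 2 * D, fun i => ((h i).add (h' i)).mono (le_of_eq (by ring))⟩

lemma UReg.const_mul (h : UReg α N n f) {r : ι → ℝ} (hr : ∀ i, |r i| ≤ 1) :
    UReg α N n fun i p => r i * f i p := by
  obtain ⟨C, h⟩ := h
  exact ⟨C, fun i => (h i).const_mul (hr i)⟩

open Polynomial in
lemma UReg.poly_mul (h : UReg α N n f) (a : ℝ[X]) :
    UReg α N n fun i p => a.eval (cos (2 * p.2)) * f i p := by
  obtain ⟨C, h⟩ := h
  obtain ⟨D, hD⟩ := exists_angReg_poly_mul n a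
  exact ⟨D * C, fun i => mul_assoc D C (N i) ▸ hD _ _ _ (h i)⟩

lemma UReg.succ (h : UReg α N 0 f) (hw : ∀ i, HasWeakPartial (0, 1) (f i) (divS (f' i)))
    (h' : UReg α N n f') : UReg α N (n + 1) f := by
  obtain ⟨C, h⟩ := h
  obtain ⟨D, h'⟩ := h'
  have e : ∀ i, C * N i ≤ (C + D) * N i := fun i => mul_le_mul' le_self_add le_rfl
  exact ⟨C + D, fun i => ⟨((h i).mono (e i)), _, hw i,
    (h' i).mono (mul_le_mul' le_add_self le_rfl)⟩⟩

/-- A uniform bound with the radial weight. -/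
def URad (N : ι → ℝ≥0) (f : ι → Fn) : Prop :=
  ∃ C : ℝ≥0, ∀ i, StripMeas (f i) ∧ radSq (f i) ≤ (C * N i : ℝ≥0)

lemma URad.lin (h : URad N f) (h' : URad N g) (c d : ℝ) :
    URad N fun i p => c * f i p + d * g i p := by
  obtain ⟨C, h⟩ := h
  obtain ⟨D, h'⟩ := h'
  refine ⟨2 * ((c ^ 2).toNNReal * C) + 2 * ((d ^ 2).toNNReal * D),
    fun i => ⟨((h i).1.const_mul c).add ((h' i).1.const_mul d), ?_⟩⟩
  have e : (fun p => (c * f i p + d * g i p) * weightRad p) =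
      fun p => c * (f i p * weightRad p) + d * (g i p * weightRad p) := by funext p; ring
  rw [e]
  refine (sqL2_add_le (((h i).1.mul isWeight_weightRad.meas).const_mul c)).trans ?_
  rw [sqL2_const_mul, sqL2_const_mul, add_mul, ENNReal.coe_add, mul_assoc, mul_assoc, mul_assoc,
    mul_assoc, ENNReal.coe_mul 2, ENNReal.coe_mul, ENNReal.coe_mul 2, ENNReal.coe_mul (d ^ 2).toNNReal]
  exact add_le_add (mul_le_mul_right (mul_le_mul_right (h i).2 _) _)
    (mul_le_mul_right (mul_le_mul_right (h' i).2 _) _)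

lemma ureg_zero_of_abs_le (hf : ∀ i, StripMeas (f i)) (h : URad N g)
    (hle : ∀ i, ∀ p ∈ strip, |f i p * weightAng (α i) p| ≤ 2 * |g i p * weightRad p|) :
    UReg α N 0 f := by
  obtain ⟨C, h⟩ := h
  refine ⟨4 * C, fun i => ⟨hf i, (sqL2_le_of_abs_le (hle i)).trans ?_⟩⟩
  rw [mul_assoc, ENNReal.coe_mul, show ofReal (2 ^ 2) = ((4 : ℝ≥0) : ℝ≥0∞) by norm_num]
  exact mul_le_mul_right (h i).2 _

end uniform

section ell

variable {ι : Type} {α b : ι → ℝ} {k : ℕ} {N : ι → ℝ≥0} {F P U Q H G : ι → ℕ → Fn}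

/-- `∂_θθΨ` and its radial derivatives. -/
def secE (P Q H : ℕ → Fn) (j : ℕ) (p : ℝ × ℝ) : ℝ := Q j p - H j p - 4 * P j p

/-- `D_θ H`. -/
def angH (α b : ℝ) (U G : ℕ → Fn) (j : ℕ) (p : ℝ × ℝ) : ℝ :=
  G j p + α ^ 2 * U (j + 2) p + b * α * U (j + 1) p

/-- `D_θ Q`. -/
def angZ (Q H : ℕ → Fn) (j : ℕ) (p : ℝ × ℝ) : ℝ := (1 - cos (2 * p.2)) * (3 * Q j p - H j p)

section single

variable {α b : ℝ} {N : ℝ≥0} {F P U Q H G : ℕ → Fn} {j : ℕ}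

lemma EllData.ang_H (h : EllData α b k N F P U Q H) (hj : j + 1 ≤ k)
    (hG : HasWeakPartial (0, 1) (F j) (divS (G j))) :
    HasWeakPartial (0, 1) (H j) (fun p => angH α b U G j p / sin (2 * p.2)) := by
  refine ((hG.add ((h.angP (j + 2) (by omega)).const_mul (α ^ 2))).add
    ((h.angP (j + 1) (by omega)).const_mul (b * α))).congr (h.rel j (by omega))
    (Eventually.of_forall fun p => ?_)
  simp only [angH]; ring

lemma EllData.ang_E (h : EllData α b k N F P U Q H) (hj : j + 1 ≤ k)
    (hG : HasWeakPartial (0, 1) (F j) (divS (G j))) :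
    HasWeakPartial (0, 1) (secE P Q H j) (fun p =>
      (angZ Q H j p + (-1) * angH α b U G j p + (-4) * U j p) / sin (2 * p.2)) := by
  refine (((h.angQ j (by omega)).add ((h.ang_H hj hG).const_mul (-1))).add
    ((h.angP j (by omega)).const_mul (-4))).congr_on (fun p _ => ?_) fun p _ => ?_
  · simp only [secE]; ring
  · simp only [angZ]; ring

open Polynomial in
lemma EllData.ang_sE (h : EllData α b k N F P U Q H) (hj : j + 1 ≤ k)
    (hG : HasWeakPartial (0, 1) (F j) (divS (G j))) :
    HasWeakPartial (0, 1) (fun p => sin (2 * p.2) ^ 2 * secE P Q H j p) (fun p =>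
      ((1 - X ^ 2 : ℝ[X]).eval (cos (2 * p.2)) *
          (angZ Q H j p + (-1) * angH α b U G j p + (-4) * U j p) +
        (4 * X : ℝ[X]).eval (cos (2 * p.2)) * (sin (2 * p.2) ^ 2 * secE P Q H j p)) /
          sin (2 * p.2)) := by
  refine ((h.ang_E hj hG).poly_mul (1 - X ^ 2)).congr_on (fun p _ => ?_) fun p _ => ?_
  · simp only [eval_sub, eval_pow, eval_X, eval_one, Real.sin_sq]
  · simp only [Real.sin_sq]
    congr 2
    simp; ring

open Polynomial in
lemma EllData.ang_Z (h : EllData α b k N F P U Q H) (hj : j + 1 ≤ k)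
    (hG : HasWeakPartial (0, 1) (F j) (divS (G j))) :
    HasWeakPartial (0, 1) (angZ Q H j) (fun p =>
      ((5 - X : ℝ[X]).eval (cos (2 * p.2)) * angZ Q H j p +
        (X - 1 : ℝ[X]).eval (cos (2 * p.2)) * angH α b U G j p) / sin (2 * p.2)) := by
  have h1 : HasWeakPartial (0, 1) (fun p => 3 * Q j p + (-1) * H j p) (fun p =>
      (3 * angZ Q H j p - angH α b U G j p) / sin (2 * p.2)) :=
    (((h.angQ j (by omega)).const_mul 3).add ((h.ang_H hj hG).const_mul (-1))).congr_on
      (fun p _ => rfl) fun p _ => by simp only [angZ]; ring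
  refine (h1.poly_mul (1 - X)).congr_on (fun p _ => ?_) fun p _ => ?_
  · simp only [angZ, eval_sub, eval_one, eval_X]; ring
  · simp [angZ]; ring

end single

variable (hα : ∀ i, 0 < α i) (hα1 : ∀ i, α i < alphaMax) (hb : ∀ i, 0 < b i ∧ b i ≤ 5)
  (hD : ∀ i, EllData (α i) (b i) k (N i) (F i) (P i) (U i) (Q i) (H i))
  (hGw : ∀ i j, j + 1 ≤ k → HasWeakPartial (0, 1) (F i j) (divS (G i j)))
  (hG : ∀ j, j + 1 ≤ k → UReg α N (k - 1 - j) fun i => G i j)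

include hD in
lemma urad_P {j : ℕ} (hj : j ≤ k) : URad N fun i => P i j :=
  ⟨1, fun i => ⟨(hD i).measP j (by omega), by rw [one_mul]; exact (hD i).leP j hj⟩⟩

include hD in
lemma urad_Q {j : ℕ} (hj : j ≤ k) : URad N fun i => Q i j :=
  ⟨1, fun i => ⟨(hD i).measQ j (by omega), by rw [one_mul]; exact (hD i).leQ j hj⟩⟩

include hD in
lemma urad_H {j : ℕ} (hj : j ≤ k) : URad N fun i => H i j :=
  ⟨1, fun i => ⟨(hD i).measH j (by omega), by rw [one_mul]; exact (hD i).leH j hj⟩⟩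

include hD in
lemma urad_E {j : ℕ} (hj : j ≤ k) : URad N fun i => secE (P i) (Q i) (H i) j := by
  have h := ((urad_Q hD hj).lin (urad_H hD hj) 1 (-1)).lin (urad_P hD hj) 1 (-4)
  convert h using 3
  simp only [secE]; ring

include hD in
lemma ureg_U_zero {j : ℕ} (hj : j ≤ k) : UReg α N 0 fun i => U i j :=
  ⟨1, fun i => ⟨(hD i).measU j (by omega), by rw [one_mul]; exact (hD i).leU j hj⟩⟩

include hD in
lemma ureg_alpha_U_zero {j : ℕ} (hj : j ≤ k) : UReg α N 0 fun i p => α i * U i (j + 1) p :=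
  ⟨1, fun i => ⟨((hD i).measU (j + 1) (by omega)).const_mul _, by
    simp only [mul_assoc]
    rw [one_mul, sqL2_const_mul]; exact (hD i).leU1 j hj⟩⟩

open Polynomial in
include hD in
lemma ureg_U_succ {l m : ℕ} (hlm : m ≤ k) (hU : UReg α N l fun i => U i m)
    (hE : UReg α N l fun i p => sin (2 * p.2) ^ 2 * secE (P i) (Q i) (H i) m p) :
    UReg α N (l + 1) fun i => U i m := by
  refine (ureg_U_zero hD hlm).succ (fun i => ((hD i).angU m hlm).congr_on (fun _ _ => rfl) ?_)
    ((hU.poly_mul (2 * X)).add hE)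
  intro p _
  simp [secE]

include hα hα1 in
lemma alpha_bounds (i : ι) : |α i| ≤ 1 ∧ |α i ^ 2| ≤ 1 ∧ α i < 1 := by
  have h1 := hα i
  have h2 := (hα1 i).trans alphaMax_lt_one
  rw [abs_of_pos h1, abs_of_pos (by positivity)]
  exact ⟨h2.le, by nlinarith, h2⟩

include hα hα1 hb hD hGw hG in
open Polynomial in
theorem ureg_all (l : ℕ) : ∀ m, (l + m ≤ k → UReg α N l fun i => U i m) ∧
    (l + m ≤ k → UReg α N l fun i p => sin (2 * p.2) ^ 2 * secE (P i) (Q i) (H i) m p) ∧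
    (l + 1 + m ≤ k → UReg α N l fun i => angH (α i) (b i) (U i) (G i) m) ∧
    (l + 1 + m ≤ k → UReg α N l fun i => angZ (Q i) (H i) m) := by
  have hba : ∀ i, |b i * α i| ≤ 1 := fun i => by
    rw [abs_of_pos (mul_pos (hb i).1 (hα i))]
    have := hα1 i
    unfold alphaMax at this
    nlinarith [hb i, hα i]
  have hb5 : ∀ i, |b i / 5| ≤ 1 := fun i => by
    rw [abs_of_pos (by linarith [(hb i).1])]; linarith [(hb i).2]
  have ab := alpha_bounds hα hα1
  have H0 : ∀ m, m + 1 ≤ k → UReg α N 0 fun i => angH (α i) (b i) (U i) (G i) m := by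
    intro m hm
    have h1 := (ureg_alpha_U_zero hD (j := m + 1) hm).const_mul (r := α) fun i => (ab i).1
    have h2 := ((ureg_alpha_U_zero hD (j := m) (by omega)).const_mul hb5).poly_mul (C 5)
    have h := (((hG m hm).of_le (Nat.zero_le _)).add h1).add h2
    convert h using 3
    simp only [angH, eval_C]; ring
  have Z0 : ∀ m, m + 1 ≤ k → UReg α N 0 fun i => angZ (Q i) (H i) m := by
    intro m hm
    obtain ⟨C, hC⟩ := H0 m hm
    obtain ⟨D, hX⟩ := (urad_Q hD (j := m) (by omega)).lin (urad_H hD (j := m) (by omega)) 3 (-1)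
    refine ⟨4 * D + 4 * C, fun i => ⟨?_, ?_⟩⟩
    · have h3 := (hX i).1
      have h4 : StripMeas fun p => (1 - cos (2 * p.2)) := by
        exact Continuous.aestronglyMeasurable (by fun_prop)
      refine (h4.mul h3).congr (Eventually.of_forall fun p => ?_)
      simp only [Pi.mul_apply, angZ]; ring
    · have e : ∀ p, 3 * Q i m p + -1 * H i m p = 3 * Q i m p - H i m p := fun p => by ring
      have hX := (hX i).2
      simp only [e] at hX
      refine (sqL2_hardy (hα i) (ab i).2.2 ((hD i).angQ m (by omega))
        ((hD i).ang_H hm (hGw i m hm)) (hC i).1 (hX.trans_lt coe_lt_top)).trans ?_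
      rw [add_mul, mul_assoc, mul_assoc, ENNReal.coe_add, ENNReal.coe_mul, ENNReal.coe_mul 4 (C * _)]
      exact add_le_add (mul_le_mul_right hX _) (mul_le_mul_right (hC i).2 _)
  have E0 : ∀ m, m ≤ k → UReg α N 0 fun i p => sin (2 * p.2) ^ 2 * secE (P i) (Q i) (H i) m p := by
    intro m hm
    have hE := urad_E hD hm
    refine ureg_zero_of_abs_le (fun i => ?_) hE fun i p hp => ?_
    · obtain ⟨C, hE⟩ := hE
      exact (Continuous.aestronglyMeasurable (by fun_prop :
        Continuous fun p : ℝ × ℝ => sin (2 * p.2) ^ 2)).mul (hE i).1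
    · have hs := sin_two_pos' hp
      have hs1 := sin_le_one (2 * p.2)
      have := abs_mul_weightAng_le (hα i) (ab i).2.2 hp (a := sin (2 * p.2) ^ 2)
        (by rw [abs_of_pos (by positivity)]; nlinarith)
      rw [mul_right_comm, abs_mul, abs_mul (secE _ _ _ _ _),
        abs_of_pos (isWeight_weightRad.pos p hp)]
      calc _ ≤ 2 * weightRad p * |secE (P i) (Q i) (H i) m p| :=
            mul_le_mul_of_nonneg_right this (abs_nonneg _)
        _ = _ := by ring
  induction l with
  | zero =>
    exact fun m => ⟨fun h => ureg_U_zero hD (by omega), fun h => E0 m (by omega),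
      fun h => H0 m (by omega), fun h => Z0 m (by omega)⟩
  | succ l ih =>
    have hU : ∀ m, l + m ≤ k → UReg α N (l + 1) fun i => U i m := fun m h =>
      ureg_U_succ hD (by omega) ((ih m).1 h) ((ih m).2.1 h)
    refine fun m => ⟨fun h => hU m (by omega), fun h => ?_, fun h => ?_, fun h => ?_⟩
    · refine (E0 m (by omega)).succ (fun i => (hD i).ang_sE (by omega) (hGw i m (by omega)))
        ((UReg.poly_mul ?_ _).add (((ih m).2.1 (by omega)).poly_mul _))
      have h4 := ((ih m).1 (by omega)).poly_mul (C (-4))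
      simp only [eval_C] at h4
      exact (((ih m).2.2.2 (by omega)).add
        (((ih m).2.2.1 (by omega)).const_mul (r := fun _ => -1) fun _ => by simp)).add h4
    · have h1 := (hU (m + 2) (by omega)).const_mul (r := fun i => α i ^ 2) fun i => (ab i).2.1
      have h2 := (hU (m + 1) (by omega)).const_mul hba
      exact (((hG m (by omega)).of_le (by omega)).add h1).add h2
    · exact (Z0 m (by omega)).succ (fun i => (hD i).ang_Z (by omega) (hGw i m (by omega)))
        ((((ih m).2.2.2 (by omega)).poly_mul _).add (((ih m).2.2.1 (by omega)).poly_mul _))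

end ell


/-! ### Families of weak derivatives -/

/-- Prepend a function to a sequence. -/
def consSeq (f : Fn) (s : ℕ → Fn) : ℕ → Fn
  | 0 => f
  | i + 1 => s i

section family

variable {α : ℝ} {k n : ℕ} {c N : ℝ≥0} {f g : Fn} {G G' : ℕ → ℕ → Fn}

lemma AngReg.exists_seq (h : AngReg α n c f) : ∃ s : ℕ → Fn, s 0 = f ∧
    (∀ i ≤ n, StripMeas (s i) ∧ angSq α (s i) ≤ c) ∧
    ∀ i < n, HasWeakPartial (0, 1) (s i) (divS (s (i + 1))) := by
  induction n generalizing f with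
  | zero => exact ⟨fun _ => f, rfl, fun i _ => h, fun i hi => absurd hi (Nat.not_lt_zero i)⟩
  | succ n ih =>
    obtain ⟨h0, f', hw, h'⟩ := h
    obtain ⟨s, hs0, hs, hsw⟩ := ih h'
    refine ⟨consSeq f s, rfl, fun i hi => ?_, fun i hi => ?_⟩
    · cases i with
      | zero => exact h0
      | succ i => exact hs i (by omega)
    · cases i with
      | zero => simpa only [consSeq, hs0] using hw
      | succ i => exact hsw i (by omega)

lemma exists_family {f f' : ℕ → Fn} (h0 : ∀ j ≤ k, StripMeas (f j) ∧ radSq (f j) ≤ c)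
    (hr : ∀ j, j + 1 ≤ k → HasWeakPartial (1, 0) (f j) (divR (f (j + 1))))
    (ha : ∀ j, j + 1 ≤ k → HasWeakPartial (0, 1) (f j) (divS (f' j)) ∧
      AngReg α (k - 1 - j) c (f' j)) :
    ∃ G, IsDerivFamily k (f 0) G ∧ energy α k G ≤ (((k + 1 : ℕ) + k * (k + 1 : ℕ)) * c : ℝ≥0) := by
  have hs : ∀ j, ∃ s : ℕ → Fn, j + 1 ≤ k → s 0 = f' j ∧
      (∀ i ≤ k - 1 - j, StripMeas (s i) ∧ angSq α (s i) ≤ c) ∧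
      ∀ i < k - 1 - j, HasWeakPartial (0, 1) (s i) (divS (s (i + 1))) := by
    intro j
    by_cases hj : j + 1 ≤ k
    · obtain ⟨s, hs⟩ := (ha j hj).2.exists_seq
      exact ⟨s, fun _ => hs⟩
    · exact ⟨fun _ => f 0, fun h => absurd h hj⟩
  choose s hs using hs
  refine ⟨fun i j => consSeq (f j) (s j) i, ⟨rfl, fun i j hij => ?_, hr, fun i j hij => ?_⟩, ?_⟩
  · cases i with
    | zero =>
      exact locallyIntegrableOn_of_sqL2 isWeight_weightRad (h0 j (by omega)).1
        ((h0 j (by omega)).2.trans_lt coe_lt_top)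
    | succ i =>
      have := (hs j (by omega)).2.1 i (by omega)
      exact locallyIntegrableOn_of_sqL2 (isWeight_weightAng α) this.1 (this.2.trans_lt coe_lt_top)
  · cases i with
    | zero => simpa only [consSeq, (hs j (by omega)).1] using (ha j (by omega)).1
    | succ i => exact (hs j (by omega)).2.2 i (by omega)
  · have e1 := Finset.sum_le_card_nsmul (Finset.range (k + 1)) (fun j => radSq (f j)) c fun j hj =>
        (h0 j (by rw [Finset.mem_range] at hj; omega)).2
    have e2 : ∀ i ∈ Finset.Icc 1 k, ∑ j ∈ Finset.range (k + 1 - i),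
        angSq α (consSeq (f j) (s j) i) ≤ (k + 1 : ℕ) • (c : ℝ≥0∞) := by
      intro i hi
      obtain ⟨hi1, hi2⟩ := Finset.mem_Icc.1 hi
      obtain ⟨i, rfl⟩ : ∃ m, i = m + 1 := ⟨i - 1, by omega⟩
      refine (Finset.sum_le_card_nsmul _ _ (c : ℝ≥0∞) fun j hj => ?_).trans ?_
      · rw [Finset.mem_range] at hj
        exact ((hs j (by omega)).2.1 i (by omega)).2
      · rw [Finset.card_range]
        exact nsmul_le_nsmul_left zero_le (by omega)
    have e3 := Finset.sum_le_card_nsmul _ _ _ e2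
    rw [Finset.card_range] at e1
    rw [Nat.card_Icc, Nat.add_sub_cancel] at e3
    refine (add_le_add e1 e3).trans (le_of_eq ?_)
    push_cast [nsmul_eq_mul]
    ring

lemma IsDerivFamily.congr (h : IsDerivFamily k f G) (hg : ∀ᵐ p ∂vol₊, g p = f p) :
    ∃ G', IsDerivFamily k g G' ∧ energy α k G' = energy α k G := by
  set G' : ℕ → ℕ → Fn := fun i j => if i = 0 ∧ j = 0 then g else G i j with hG'
  have e : ∀ i j, ∀ᵐ p ∂vol₊, G' i j p = G i j p := by
    intro i j
    by_cases hij : i = 0 ∧ j = 0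
    · obtain ⟨rfl, rfl⟩ := hij
      filter_upwards [hg] with p hp
      rw [h.zero, ← hp]; simp [hG']
    · exact Eventually.of_forall fun _ => by simp only [hG', if_neg hij]
  refine ⟨G', ⟨by simp [hG'], fun i j hij => ?_, fun j hj => ?_, fun i j hij => ?_⟩, ?_⟩
  · have h1 := h.locInt i j hij
    rw [locallyIntegrableOn_iff isOpen_strip.isLocallyClosed] at h1 ⊢
    intro K hK hKc
    exact (h1 K hK hKc).congr (by
      filter_upwards [ae_restrict_of_ae_restrict_of_subset hK (e i j)] with p hp using hp.symm)
  · exact (h.radial j hj).congr (e 0 j) (by filter_upwards [e 0 (j + 1)] with p hp; rw [hp])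
  · exact (h.angular i j hij).congr (e i j) (by filter_upwards [e (i + 1) j] with p hp; rw [hp])
  · unfold energy
    congr 1
    · refine Finset.sum_congr rfl fun j _ => sqL2_congr_ae ?_
      filter_upwards [e 0 j] with p hp; rw [hp]
    · refine Finset.sum_congr rfl fun i _ => Finset.sum_congr rfl fun j _ => sqL2_congr_ae ?_
      filter_upwards [e i j] with p hp; rw [hp]

lemma IsDerivFamily.const_mul (h : IsDerivFamily k f G) (r : ℝ) :
    IsDerivFamily k (fun p => r * f p) (fun i j p => r * G i j p) := by
  refine ⟨by rw [h.zero], fun i j hij => (h.locInt i j hij).continuousOn_mul continuousOn_const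
    isOpen_strip.isLocallyClosed, fun j hj => ?_, fun i j hij => ?_⟩
  · exact ((h.radial j hj).const_mul r).congr_on (fun _ _ => rfl) fun p _ => by ring
  · exact ((h.angular i j hij).const_mul r).congr_on (fun _ _ => rfl) fun p _ => by ring

lemma energy_const_mul (r : ℝ) (G : ℕ → ℕ → Fn) :
    energy α k (fun i j p => r * G i j p) = ofReal (r ^ 2) * energy α k G := by
  simp only [energy, mul_assoc, sqL2_const_mul, mul_add, Finset.mul_sum]

lemma hnorm_le (h : IsDerivFamily k f G) : Hnorm α k f ≤ energy α k G ^ (1 / 2 : ℝ) :=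
  ENNReal.rpow_le_rpow (iInf₂_le G h) (by norm_num)

/-- Scaled bound of the norm. -/
lemma const_mul_hnorm_le {r : ℝ} (hr : 0 < r) (h : IsDerivFamily k (fun p => r * f p) G)
    (hg : ∀ᵐ p ∂vol₊, g p = f p) :
    ofReal r * Hnorm α k g ≤ energy α k G ^ (1 / 2 : ℝ) := by
  obtain ⟨G', h', e⟩ := (h.const_mul r⁻¹).congr (g := g) (α := α) (by
    filter_upwards [hg] with p hp
    rw [hp, inv_mul_cancel_left₀ hr.ne'])
  refine (mul_le_mul_right (hnorm_le h') _).trans (le_of_eq ?_)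
  rw [e, energy_const_mul, ENNReal.mul_rpow_of_nonneg _ _ (by norm_num),
    ENNReal.ofReal_rpow_of_nonneg (by positivity) (by norm_num), ← Real.sqrt_eq_rpow,
    Real.sqrt_sq (by positivity), ← mul_assoc, ← ofReal_mul hr.le, mul_inv_cancel₀ hr.ne',
    ENNReal.ofReal_one, one_mul]

lemma IsDerivFamily.ae_eq (h : IsDerivFamily k f G) (h' : IsDerivFamily k f G') (i : ℕ) :
    ∀ j, i + j ≤ k → ∀ᵐ p ∂vol₊, G' i j p = G i j p := by
  induction i with
  | zero =>
    intro j
    induction j with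
    | zero => exact fun _ => Eventually.of_forall fun p => by rw [h.zero, h'.zero]
    | succ j ih =>
      intro hj
      filter_upwards [(h.radial j (by omega)).unique (h'.radial j (by omega)) (ih (by omega)),
        self_mem_ae_restrict measurableSet_strip] with p hp hps
      exact (div_left_inj' (mem_Ioi.1 hps.1).ne').1 hp
  | succ i ih =>
    intro j hj
    filter_upwards [(h.angular i j (by omega)).unique (h'.angular i j (by omega))
      (ih j (by omega)), self_mem_ae_restrict measurableSet_strip] with p hp hps
    exact (div_left_inj' (sin_two_pos' hps).ne').1 hp

lemma IsDerivFamily.hnorm_eq (h : IsDerivFamily k f G) :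
    Hnorm α k f = energy α k G ^ (1 / 2 : ℝ) := by
  refine le_antisymm (hnorm_le h) (ENNReal.rpow_le_rpow (le_iInf₂ fun G' h' => le_of_eq ?_)
    (by norm_num))
  have e := h.ae_eq h'
  unfold energy
  congr 1
  · refine Finset.sum_congr rfl fun j hj => sqL2_congr_ae ?_
    rw [Finset.mem_range] at hj
    filter_upwards [e 0 j (by omega)] with p hp; rw [hp]
  · refine Finset.sum_congr rfl fun i hi => Finset.sum_congr rfl fun j hj => sqL2_congr_ae ?_
    rw [Finset.mem_range] at hj
    filter_upwards [e i j (by omega)] with p hp; rw [hp]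

lemma MemH.exists_family (h : MemH α k f) : ∃ G, IsDerivFamily k f G ∧ energy α k G < ⊤ := by
  have h1 : (⨅ (G : ℕ → ℕ → Fn) (_ : IsDerivFamily k f G), energy α k G) < ⊤ :=
    (ENNReal.rpow_lt_top_iff_of_pos (by norm_num)).1 h
  obtain ⟨G, hG⟩ := iInf_lt_iff.1 h1
  obtain ⟨h2, h3⟩ := iInf_lt_iff.1 hG
  exact ⟨G, h2, h3⟩

lemma IsDerivFamily.stripMeas (h : IsDerivFamily k f G) {i j : ℕ} (hij : i + j ≤ k) :
    StripMeas (G i j) := (h.locInt i j hij).aestronglyMeasurable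

lemma sqL2_rad_le_energy {j : ℕ} (hj : j ≤ k) : radSq (G 0 j) ≤ energy α k G :=
  le_trans (Finset.single_le_sum (f := fun j => radSq (G 0 j))
    (fun _ _ => zero_le) (Finset.mem_range.2 (by omega))) le_self_add

lemma sqL2_ang_le_energy {i j : ℕ} (hi : 1 ≤ i) (hij : i + j ≤ k) :
    angSq α (G i j) ≤ energy α k G :=
  (Finset.single_le_sum (f := fun j => angSq α (G i j))
    (fun _ _ => zero_le) (Finset.mem_range.2 (by omega))).trans
    ((Finset.single_le_sum (f := fun i => ∑ j ∈ Finset.range (k + 1 - i),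
      angSq α (G i j)) (fun _ _ => zero_le)
      (Finset.mem_Icc.2 ⟨hi, by omega⟩)).trans le_add_self)

lemma IsDerivFamily.radSeq (h : IsDerivFamily k f G) (he : energy α k G < ⊤) : RadSeq k (G 0) :=
  ⟨fun _ hj => h.stripMeas (by omega), fun _ hj => (sqL2_rad_le_energy hj).trans_lt he, h.radial⟩

lemma IsDerivFamily.angReg (h : IsDerivFamily k f G) (he : energy α k G ≤ N) (n : ℕ) {i j : ℕ}
    (hi : 1 ≤ i) (hij : i + n + j ≤ k) : AngReg α n N (G i j) := by
  induction n generalizing i with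
  | zero => exact ⟨h.stripMeas (by omega), (sqL2_ang_le_energy hi (by omega)).trans he⟩
  | succ n ih => exact ⟨⟨h.stripMeas (by omega), (sqL2_ang_le_energy hi (by omega)).trans he⟩, _,
      h.angular i j (by omega), ih (by omega) (by omega)⟩

end family

section uniform

variable {ι : Type} {α b : ι → ℝ} {k : ℕ} {N : ι → ℝ≥0} {F P U Q H G : ι → ℕ → Fn}

lemma exists_uniform_family {f f' : ι → ℕ → Fn} (h0 : ∀ j ≤ k, URad N fun i => f i j)
    (hr : ∀ i j, j + 1 ≤ k → HasWeakPartial (1, 0) (f i j) (divR (f i (j + 1))))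
    (ha : ∀ i j, j + 1 ≤ k → HasWeakPartial (0, 1) (f i j) (divS (f' i j)))
    (hu : ∀ j, j + 1 ≤ k → UReg α N (k - 1 - j) fun i => f' i j) :
    ∃ C : ℝ≥0, ∀ i, ∃ G, IsDerivFamily k (f i 0) G ∧ energy (α i) k G ≤ (C * N i : ℝ≥0) := by
  choose! C hC using h0
  choose! D hD using hu
  set B := ∑ j ∈ Finset.range (k + 1), (C j + D j) with hB
  have hle : ∀ j, j ≤ k → C j + D j ≤ B := fun j hj =>
    Finset.single_le_sum (f := fun j => C j + D j) (fun _ _ => zero_le)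
      (Finset.mem_range.2 (by omega))
  refine ⟨((k + 1 : ℕ) + k * (k + 1 : ℕ)) * B, fun i => ?_⟩
  rw [mul_assoc]
  refine exists_family (f' := f' i) (fun j hj => ⟨(hC j hj i).1, (hC j hj i).2.trans ?_⟩) (hr i)
    fun j hj => ⟨ha i j hj, (hD j hj i).mono (mul_le_mul' (le_add_self.trans (hle j (by omega)))
      le_rfl)⟩
  exact coe_le_coe.2 (mul_le_mul' (le_self_add.trans (hle j hj)) le_rfl)

variable (hα : ∀ i, 0 < α i) (hα1 : ∀ i, α i < alphaMax) (hb : ∀ i, 0 < b i ∧ b i ≤ 5)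
  (hD : ∀ i, EllData (α i) (b i) k (N i) (F i) (P i) (U i) (Q i) (H i))
  (hGw : ∀ i j, j + 1 ≤ k → HasWeakPartial (0, 1) (F i j) (divS (G i j)))
  (hG : ∀ j, j + 1 ≤ k → UReg α N (k - 1 - j) fun i => G i j)

include hα hα1 hb hD hGw hG

/-- The bounds on `α² D_R²Ψ`, `α D_RΨ` and `∂_θθΨ`. -/
theorem exists_solution_families : ∃ C : ℝ≥0, ∀ i,
    (∃ G, IsDerivFamily k (fun p => α i ^ 2 * P i 2 p) G ∧ energy (α i) k G ≤ (C * N i : ℝ≥0)) ∧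
    (∃ G, IsDerivFamily k (fun p => α i * P i 1 p) G ∧ energy (α i) k G ≤ (C * N i : ℝ≥0)) ∧
    (∃ G, IsDerivFamily k (secE (P i) (Q i) (H i) 0) G ∧ energy (α i) k G ≤ (C * N i : ℝ≥0)) := by
  have ab := alpha_bounds hα hα1
  have all := ureg_all hα hα1 hb hD hGw hG
  have hU : ∀ l m, l + m ≤ k → UReg α N (l + 1) fun i => U i m := fun l m h =>
    ureg_U_succ hD (by omega) ((all l m).1 h) ((all l m).2.1 h)
  obtain ⟨C2, h2⟩ := exists_uniform_family (α := α) (N := N) (k := k)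
    (f := fun i j p => α i ^ 2 * P i (j + 2) p) (f' := fun i j p => α i ^ 2 * U i (j + 2) p)
    (fun j hj => ⟨1, fun i => ⟨((hD i).measP _ (by omega)).const_mul _, by
      simp only [mul_assoc]
      rw [one_mul, sqL2_const_mul, ← pow_mul]; exact (hD i).leP2 j hj⟩⟩)
    (fun i j hj => (((hD i).radP (j + 2) (by omega)).const_mul (α i ^ 2)).congr_on
      (fun _ _ => rfl) fun p _ => by ring)
    (fun i j hj => (((hD i).angP (j + 2) (by omega)).const_mul (α i ^ 2)).congr_on
      (fun _ _ => rfl) fun p _ => by ring)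
    (fun j hj => by
      rcases Nat.eq_zero_or_pos (k - 1 - j) with h | h
      · rw [h]
        have h1 := (ureg_alpha_U_zero hD (j := j + 1) hj).const_mul (r := α) fun i => (ab i).1
        convert h1 using 3
        ring
      · obtain ⟨l, hl⟩ : ∃ l, k - 1 - j = l + 1 := ⟨k - 1 - j - 1, by omega⟩
        rw [hl]
        exact (hU l (j + 2) (by omega)).const_mul fun i => (ab i).2.1)
  obtain ⟨C1, h1⟩ := exists_uniform_family (α := α) (N := N) (k := k)
    (f := fun i j p => α i * P i (j + 1) p) (f' := fun i j p => α i * U i (j + 1) p)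
    (fun j hj => ⟨1, fun i => ⟨((hD i).measP _ (by omega)).const_mul _, by
      simp only [mul_assoc]
      rw [one_mul, sqL2_const_mul]; exact (hD i).leP1 j hj⟩⟩)
    (fun i j hj => (((hD i).radP (j + 1) (by omega)).const_mul (α i)).congr_on
      (fun _ _ => rfl) fun p _ => by ring)
    (fun i j hj => (((hD i).angP (j + 1) (by omega)).const_mul (α i)).congr_on
      (fun _ _ => rfl) fun p _ => by ring)
    (fun j hj => by
      rcases Nat.eq_zero_or_pos (k - 1 - j) with h | h
      · rw [h]
        exact ureg_alpha_U_zero hD (j := j) (by omega)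
      · obtain ⟨l, hl⟩ : ∃ l, k - 1 - j = l + 1 := ⟨k - 1 - j - 1, by omega⟩
        rw [hl]
        exact (hU l (j + 1) (by omega)).const_mul fun i => (ab i).1)
  obtain ⟨C0, h0⟩ := exists_uniform_family (α := α) (N := N) (k := k)
    (f := fun i => secE (P i) (Q i) (H i))
    (f' := fun i j p => angZ (Q i) (H i) j p + (-1) * angH (α i) (b i) (U i) (G i) j p +
      (-4) * U i j p)
    (fun j hj => urad_E hD hj)
    (fun i j hj => ((((hD i).radQ j hj).add (((hD i).radH j hj).const_mul (-1))).add
      (((hD i).radP j (by omega)).const_mul (-4))).congr_on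
      (fun p _ => by simp only [secE]; ring) fun p _ => by simp only [secE]; ring)
    (fun i j hj => (hD i).ang_E hj (hGw i j hj))
    (fun j hj => by
      have a := all (k - 1 - j) j
      have h4 := (a.1 (by omega)).poly_mul (Polynomial.C (-4))
      simp only [Polynomial.eval_C] at h4
      exact ((a.2.2.2 (by omega)).add
        ((a.2.2.1 (by omega)).const_mul (r := fun _ => -1) fun _ => by simp)).add h4)
  refine ⟨C0 + C1 + C2, fun i => ⟨?_, ?_, ?_⟩⟩
  · obtain ⟨G, hG, e⟩ := h2 i
    exact ⟨G, hG, e.trans (coe_le_coe.2 (mul_le_mul' le_add_self le_rfl))⟩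
  · obtain ⟨G, hG, e⟩ := h1 i
    exact ⟨G, hG, e.trans (coe_le_coe.2 (mul_le_mul' (le_add_self.trans le_self_add) le_rfl))⟩
  · obtain ⟨G, hG, e⟩ := h0 i
    exact ⟨G, hG, e.trans (coe_le_coe.2 (mul_le_mul' (le_self_add.trans le_self_add) le_rfl))⟩

end uniform


/-! ### Continuous representatives -/

lemma IsPrim.eq_integral_Iic {B : Set ℝ} [B.OrdConnected] (hBo : IsOpen B) {u v U : ℝ → ℝ}
    (h : IsPrim B u v U)
    (hB0 : B ⊆ Ioi 0) (hB : ∀ y ∈ B, Ioc 0 y ⊆ B) {δ : ℝ} (hδ : 0 < δ) (hu : ∀ s < δ, u s = 0)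
    (hv : ∀ s < δ, v s = 0) {y : ℝ} (hy : y ∈ B) : U y = ∫ s in Iic y, v s := by
  have hy0 : 0 < y := hB0 hy
  set c := min δ y
  have hc : 0 < c := lt_min hδ hy0
  have hsub : Ioo 0 c ⊆ B := fun s hs => hB y hy ⟨hs.1, hs.2.le.trans (min_le_right _ _)⟩
  have hz : ∀ᵐ s ∂volume.restrict (Ioo 0 c), U s = 0 := by
    filter_upwards [ae_restrict_of_ae_restrict_of_subset hsub h.ae_eq,
      ae_restrict_mem measurableSet_Ioo] with s hs hs'
    rw [← hs, hu s (hs'.2.trans_le (min_le_left _ _))]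
  have hU : EqOn U (fun _ => 0) (Ioo 0 c) := Measure.eqOn_open_of_ae_eq hz isOpen_Ioo
    ((h.continuousOn hBo).mono hsub) continuousOn_const
  have hm : c / 2 ∈ Ioo 0 c := ⟨by linarith, by linarith⟩
  have h1 := h.ftc _ (hsub hm) y hy
  rw [hU hm, sub_zero] at h1
  rw [← h1, integral_of_le (by linarith [min_le_right δ y])]
  refine (setIntegral_eq_of_subset_of_forall_sdiff_eq_zero measurableSet_Iic
    (fun s hs => hs.2) fun s hs => hv s ?_).symm
  have : s ≤ c / 2 := by
    by_contra hh
    exact hs.2 ⟨not_le.1 hh, hs.1⟩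
  linarith [min_le_left δ y]

lemma continuous_quadrant_integral {m : Fn} (hm : Integrable m) :
    Continuous fun p : ℝ × ℝ => ∫ q in Iic p.1 ×ˢ Iic p.2, m q := by
  have e : ∀ p : ℝ × ℝ, ∫ q in Iic p.1 ×ˢ Iic p.2, m q =
      ∫ q, (Iic p.1 ×ˢ Iic p.2).indicator m q := fun p =>
    (integral_indicator (measurableSet_Iic.prod measurableSet_Iic)).symm
  simp only [e]
  refine continuous_iff_continuousAt.2 fun p => ?_
  refine continuousAt_of_dominated (bound := fun q => ‖m q‖)
    (Eventually.of_forall fun p => hm.1.indicator (measurableSet_Iic.prod measurableSet_Iic))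
    (Eventually.of_forall fun p => Eventually.of_forall fun q => norm_indicator_le_norm_self _ _)
    hm.norm ?_
  have h1 : ∀ᵐ q : ℝ × ℝ, q.1 ≠ p.1 := by
    have := Measure.quasiMeasurePreserving_fst (μ := (volume : Measure ℝ)) (ν := (volume : Measure ℝ))
    exact this.ae (Measure.ae_ne volume p.1)
  have h2 : ∀ᵐ q : ℝ × ℝ, q.2 ≠ p.2 := by
    have := Measure.quasiMeasurePreserving_snd (μ := (volume : Measure ℝ)) (ν := (volume : Measure ℝ))
    exact this.ae (Measure.ae_ne volume p.2)
  filter_upwards [h1, h2] with q h1 h2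
  have c1 : ∀ᶠ p' : ℝ × ℝ in 𝓝 p, (q.1 ≤ p'.1 ↔ q.1 ≤ p.1) := by
    rcases h1.lt_or_gt with h | h
    · filter_upwards [continuousAt_fst.eventually (lt_mem_nhds h)] with p' hp'
      exact ⟨fun _ => h.le, fun _ => (show q.1 < p'.1 from hp').le⟩
    · filter_upwards [continuousAt_fst.eventually (gt_mem_nhds h)] with p' hp'
      exact ⟨fun hh => absurd hh (not_le.2 hp'), fun hh => absurd hh (not_le.2 h)⟩
  have c2 : ∀ᶠ p' : ℝ × ℝ in 𝓝 p, (q.2 ≤ p'.2 ↔ q.2 ≤ p.2) := by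
    rcases h2.lt_or_gt with h | h
    · filter_upwards [continuousAt_snd.eventually (lt_mem_nhds h)] with p' hp'
      exact ⟨fun _ => h.le, fun _ => (show q.2 < p'.2 from hp').le⟩
    · filter_upwards [continuousAt_snd.eventually (gt_mem_nhds h)] with p' hp'
      exact ⟨fun hh => absurd hh (not_le.2 hp'), fun hh => absurd hh (not_le.2 h)⟩
  refine ContinuousAt.congr continuousAt_const (f := fun _ => (Iic p.1 ×ˢ Iic p.2).indicator m q) ?_
  filter_upwards [c1, c2] with p' h1 h2
  simp only [indicator, mem_prod, mem_Iic, h1, h2]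

/-- A compactly supported function with an integrable weak mixed derivative agrees almost everywhere
with a continuous function. -/
theorem exists_continuous_rep_of_compact {F F1 m : Fn} {K : Set (ℝ × ℝ)} (hK : IsCompact K)
    (hKs : K ⊆ strip) (hF : HasWeakPartial (1, 0) F F1) (h1 : HasWeakPartial (0, 1) F1 m)
    (zF : ∀ p ∉ K, F p = 0) (zF1 : ∀ p ∉ K, F1 p = 0) (zm : ∀ p ∉ K, m p = 0) :
    ∃ M, Continuous M ∧ ∀ᵐ p ∂vol₊, F p = M p := by
  have him : Integrable m := (integrableOn_iff_integrable_of_support_subset fun p hp => by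
    by_contra hh; exact hp (zm p hh)).1 (h1.locInt_deriv.integrableOn_compact_subset hKs hK)
  set m' := strip.indicator (him.1.mk m) with hm'
  have hmm : m =ᵐ[volume] m' := by
    filter_upwards [him.1.ae_eq_mk] with p hp
    by_cases h : p ∈ strip
    · rw [hm', indicator_of_mem h, hp]
    · rw [hm', indicator_of_notMem h, zm p fun hh => h (hKs hh)]
  have sm' : StronglyMeasurable m' := him.1.stronglyMeasurable_mk.indicator measurableSet_strip
  have im' : Integrable m' := him.congr hmm
  set M1 : Fn := fun p => ∫ t in Iic p.2, m' (p.1, t) with hM1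
  have sM1 : StronglyMeasurable M1 := by
    have e : M1 = fun p => ∫ t, {q : (ℝ × ℝ) × ℝ | q.2 ≤ q.1.2}.indicator
        (fun q => m' (q.1.1, q.2)) (p, t) := by
      funext p
      change ∫ t in Iic p.2, m' (p.1, t) = _
      rw [← integral_indicator measurableSet_Iic]
      rfl
    rw [e]
    exact StronglyMeasurable.integral_prod_right (f := fun p t =>
      {q : (ℝ × ℝ) × ℝ | q.2 ≤ q.1.2}.indicator (fun q => m' (q.1.1, q.2)) (p, t))
      ((sm'.comp_measurable (by fun_prop)).indicator
        (measurableSet_le measurable_snd (by fun_prop)))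
  have cM := continuous_quadrant_integral im'
  set M : Fn := fun p => ∫ q in Iic p.1 ×ˢ Iic p.2, m' q with hM
  have eM : ∀ p, M p = ∫ s in Iic p.1, M1 (s, p.2) := fun p => by
    have := setIntegral_prod (μ := (volume : Measure ℝ)) (ν := (volume : Measure ℝ))
      (s := Iic p.1) (t := Iic p.2) m' im'.integrableOn
    exact this
  -- positive distance of the support from the axes
  obtain ⟨δ1, hδ1, hK1⟩ : ∃ δ > 0, ∀ p ∈ K, δ ≤ p.1 := by
    rcases K.eq_empty_or_nonempty with rfl | hne
    · exact ⟨1, one_pos, fun p hp => hp.elim⟩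
    · obtain ⟨q, hq, hmin⟩ := hK.exists_isMinOn hne continuous_fst.continuousOn
      exact ⟨q.1, (hKs hq).1, fun p hp => hmin hp⟩
  obtain ⟨δ2, hδ2, hK2⟩ : ∃ δ > 0, ∀ p ∈ K, δ ≤ p.2 := by
    rcases K.eq_empty_or_nonempty with rfl | hne
    · exact ⟨1, one_pos, fun p hp => hp.elim⟩
    · obtain ⟨q, hq, hmin⟩ := hK.exists_isMinOn hne continuous_snd.continuousOn
      exact ⟨q.2, (hKs hq).2.1, fun p hp => hmin hp⟩
  have z1 : ∀ {f : Fn}, (∀ p ∉ K, f p = 0) → ∀ θ, ∀ s < δ1, f (s, θ) = 0 :=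
    fun hf θ s hs => hf _ fun hh => absurd (hK1 _ hh) (not_le.2 hs)
  have z2 : ∀ {f : Fn}, (∀ p ∉ K, f p = 0) → ∀ s, ∀ θ < δ2, f (s, θ) = 0 :=
    fun hf s θ hs => hf _ fun hh => absurd (hK2 _ hh) (not_le.2 hs)
  have mF1 : StripMeas F1 := h1.locInt.aestronglyMeasurable
  have mF : StripMeas F := hF.locInt.aestronglyMeasurable
  have hmm' : ∀ᵐ s : ℝ, ∀ᵐ t : ℝ, m (s, t) = m' (s, t) :=
    Measure.ae_ae_of_ae_prod (μ := (volume : Measure ℝ)) (ν := (volume : Measure ℝ)) hmm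
  have s1 : ∀ᵐ s ∂volume.restrict (Ioi (0 : ℝ)), ∀ᵐ θ ∂volume.restrict J₀,
      F1 (s, θ) = M1 (s, θ) := by
    filter_upwards [h1.ae_isPrim_snd, ae_restrict_of_ae hmm'] with s ⟨U, hU⟩ hs
    filter_upwards [hU.ae_eq, ae_restrict_mem measurableSet_Ioo] with θ hθ hθ'
    rw [hθ, hU.eq_integral_Iic isOpen_Ioo (fun x hx => hx.1)
      (fun y hy x hx => ⟨hx.1, hx.2.trans_lt hy.2⟩) hδ2 (z2 zF1 s) (z2 zm s) hθ']
    exact integral_congr_ae (ae_restrict_of_ae hs)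
  have s2 : ∀ᵐ θ ∂volume.restrict J₀, ∀ᵐ s ∂volume.restrict (Ioi (0 : ℝ)),
      F1 (s, θ) = M1 (s, θ) := by
    have hm : StripMeas fun p => F1 p - M1 p := mF1.sub sM1.aestronglyMeasurable
    have h0 : sqL2 (fun p => F1 p - M1 p) = 0 := by
      rw [sqL2_fubini hm, lintegral_congr_ae (g := fun _ => 0), lintegral_zero]
      filter_upwards [s1] with s hs
      rw [lintegral_congr_ae (g := fun _ => 0), lintegral_zero]
      filter_upwards [hs] with θ hθ
      simp [hθ]
    rw [sqL2, lintegral_eq_zero_iff' hm.enorm_sq, volume_restrict_strip, ← Measure.prod_swap] at h0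
    have h3 := Measure.ae_ae_of_ae_prod (ae_of_ae_map measurable_swap.aemeasurable h0)
    filter_upwards [h3] with θ hθ
    filter_upwards [hθ] with s hs
    have hs : ‖F1 (s, θ) - M1 (s, θ)‖ₑ ^ 2 = 0 := hs
    rw [pow_eq_zero_iff two_ne_zero, enorm_eq_zero] at hs
    exact sub_eq_zero.1 hs
  have hm : StripMeas fun p => F p - M p := mF.sub cM.aestronglyMeasurable
  have h0 : sqL2 (fun p => F p - M p) = 0 := by
    rw [sqL2_fubini_symm hm, lintegral_congr_ae (g := fun _ => 0), lintegral_zero]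
    filter_upwards [hF.ae_isPrim_fst, s2] with θ ⟨U, hU⟩ hs
    rw [lintegral_congr_ae (g := fun _ => 0), lintegral_zero]
    filter_upwards [hU.ae_eq, ae_restrict_mem measurableSet_Ioi] with R hR hR'
    rw [hR, hU.eq_integral_Iic isOpen_Ioi (fun x hx => hx) (fun y hy x hx => hx.1) hδ1 (z1 zF θ)
      (z1 zF1 θ) hR', eM]
    have : ∫ s in Iic R, F1 (s, θ) = ∫ s in Iic R, M1 (s, θ) := by
      refine setIntegral_congr_ae measurableSet_Iic ?_
      filter_upwards [(ae_restrict_iff' measurableSet_Ioi).1 hs] with s hs _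
      rcases lt_or_ge 0 s with h | h
      · exact hs h
      · rw [z1 zF1 θ s (by linarith)]
        have : ∀ t, m' (s, t) = 0 := fun t => indicator_of_notMem (fun hh => absurd hh.1 (not_lt.2 h)) _
        simp [hM1, this]
    rw [this]; simp
  refine ⟨M, cM, ?_⟩
  rw [sqL2, lintegral_eq_zero_iff' hm.enorm_sq] at h0
  filter_upwards [h0] with p hp
  have hp : ‖F p - M p‖ₑ ^ 2 = 0 := hp
  rw [pow_eq_zero_iff two_ne_zero, enorm_eq_zero] at hp
  exact sub_eq_zero.1 hp

lemma fderiv_eq_zero_of_notMem_tsupport {a : Fn} {p v : ℝ × ℝ} (h : p ∉ tsupport a) :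
    fderiv ℝ a p v = 0 :=
  image_eq_zero_of_notMem_tsupport (f := fun p => fderiv ℝ a p v)
    fun hh => h (tsupport_fderiv_apply_subset' a v hh)

lemma ContinuousOn.exists_continuous_eqOn {f : Fn} {x : ℝ × ℝ} {ε : ℝ}
    (hf : ContinuousOn f (closedBall x ε)) :
    ∃ M, Continuous M ∧ EqOn M f (closedBall x ε) := by
  obtain ⟨M, hM⟩ := ContinuousMap.exists_restrict_eq isClosed_closedBall
    ⟨_, continuousOn_iff_continuous_domRestrict.1 hf⟩
  exact ⟨M, M.continuous, fun p hp => congrArg (fun F => F ⟨p, hp⟩) hM⟩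

/-- A function with weak derivatives `f_θ`, `D_R f`, `(D_R f)_θ` has local continuous
representatives. -/
theorem exists_continuous_rep {f g d r : Fn} (hg : HasWeakPartial (0, 1) f g)
    (hd : HasWeakPartial (1, 0) f (divR d)) (hr : HasWeakPartial (0, 1) d r)
    {x : ℝ × ℝ} {ε : ℝ} (hε : 0 < ε) (hx : closedBall x (2 * ε) ⊆ strip) :
    ∃ M, Continuous M ∧ ∀ᵐ p ∂volume.restrict (closedBall x ε), f p = M p := by
  set χ : ContDiffBump x := ⟨ε, 2 * ε, hε, by linarith⟩
  have hχ : ContDiff ℝ ∞ χ := χ.contDiff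
  have ts : tsupport χ = closedBall x (2 * ε) := χ.tsupport_eq
  set a : Fn := fun p => p.1 * χ p with ha
  have ca : ContDiff ℝ ∞ a := contDiff_fst.mul hχ
  have ta : tsupport a ⊆ tsupport χ := closure_mono (Function.support_mul_subset_right _ _)
  have cda := contDiff_fderiv_apply ca (1, 0)
  have tda : tsupport (fun p => fderiv ℝ a p (1, 0)) ⊆ tsupport χ :=
    (tsupport_fderiv_apply_subset' a (1, 0)).trans ta
  have hF : HasWeakPartial (1, 0) (fun p => a p * f p)
      (fun p => χ p * d p + fderiv ℝ a p (1, 0) * f p) := by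
    refine (hd.smul_left ca).congr_on (fun _ _ => rfl) fun p hp => ?_
    have : p.1 ≠ 0 := (mem_Ioi.1 hp.1).ne'
    simp only [ha]
    field_simp
  have h1 := (hr.smul_left hχ).add (hg.smul_left cda)
  have zz : ∀ p ∉ tsupport χ, χ p = 0 := fun p hp => image_eq_zero_of_notMem_tsupport hp
  have za : ∀ p ∉ tsupport χ, fderiv ℝ a p (1, 0) = 0 := fun p hp =>
    fderiv_eq_zero_of_notMem_tsupport fun h => hp (ta h)
  obtain ⟨M, hM, h⟩ := exists_continuous_rep_of_compact χ.hasCompactSupport.isCompact (ts ▸ hx) hF h1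
    (fun p hp => by simp only [ha, zz p hp]; ring)
    (fun p hp => by rw [zz p hp, za p hp]; ring)
    (fun p hp => by
      rw [zz p hp, za p hp, fderiv_eq_zero_of_notMem_tsupport hp,
        fderiv_eq_zero_of_notMem_tsupport fun h => hp (tda h)]; ring)
  have hsub : closedBall x ε ⊆ strip := (closedBall_subset_closedBall (by linarith)).trans hx
  have hc : ContinuousOn (divR M) (closedBall x ε) :=
    hM.continuousOn.div continuousOn_fst fun p hp => (mem_Ioi.1 (hsub hp).1).ne'
  obtain ⟨M', hMc, hM'⟩ := ContinuousOn.exists_continuous_eqOn hc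
  refine ⟨M', hMc, ?_⟩
  filter_upwards [ae_restrict_of_ae_restrict_of_subset hsub h,
    ae_restrict_mem isClosed_closedBall.measurableSet] with p hp hpx
  have e : M' p = M p / p.1 := hM' hpx
  have : p.1 ≠ 0 := (mem_Ioi.1 (hsub hpx).1).ne'
  rw [e, ← hp, ha]
  have h1 : χ p = 1 := χ.one_of_mem_closedBall hpx
  simp only [h1]
  field_simp

/-! ### Classical derivatives -/

lemma hasDerivAt_of_slices {B I J : Set ℝ} [B.OrdConnected] [I.OrdConnected] (hB : IsOpen B)
    (hI : IsOpen I) (hJ : IsOpen J) (hIB : I ⊆ B) {f a M A : ℝ → ℝ → ℝ}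
    (hM : Continuous (Function.uncurry M)) (hA : Continuous (Function.uncurry A))
    (hs : ∀ᵐ y ∂volume.restrict J, (∃ U, IsPrim B (f y) (a y) U) ∧
      (∀ᵐ s ∂volume.restrict I, f y s = M y s) ∧ ∀ᵐ s ∂volume.restrict I, a y s = A y s)
    {y s : ℝ} (hy : y ∈ J) (hs' : s ∈ I) : HasDerivAt (M y) (A y s) s := by
  have key : ∀ᵐ y ∂volume.restrict J, ∀ s ∈ I, ∀ s' ∈ I, M y s' - M y s = ∫ t in s..s', A y t := by
    filter_upwards [hs] with y ⟨⟨U, hU⟩, h1, h2⟩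
    have cM : Continuous (M y) := by fun_prop
    have e : EqOn U (M y) I := by
      refine Measure.eqOn_open_of_ae_eq (μ := volume) ?_ hI ((hU.continuousOn hB).mono hIB) cM.continuousOn
      filter_upwards [h1, ae_restrict_of_ae_restrict_of_subset hIB hU.ae_eq] with s h1 h2
      rw [← h1, h2]
    intro s hs s' hs'
    rw [← e hs, ← e hs', ← hU.ftc s (hIB hs) s' (hIB hs')]
    refine intervalIntegral.integral_congr_ae ?_
    filter_upwards [(ae_restrict_iff' hI.measurableSet).1 h2] with t ht ht'
    exact ht (OrdConnected.uIcc_subset ‹_› hs hs' (uIoc_subset_uIcc ht'))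
  have all : ∀ s' ∈ I, M y s' - M y s = ∫ t in s..s', A y t := by
    intro s' hs''
    have : EqOn (fun y => M y s' - M y s) (fun y => ∫ t in s..s', A y t) J := by
      refine Measure.eqOn_open_of_ae_eq (μ := volume) ?_ hJ ?_ ?_
      · filter_upwards [key] with y hy using hy s hs' s' hs''
      · exact Continuous.continuousOn (by fun_prop)
      · exact (intervalIntegral.continuous_parametric_intervalIntegral_of_continuous' hA s s').continuousOn
    exact this hy
  have h1 : HasDerivAt (fun s' => ∫ t in s..s', A y t) (A y s) s :=
    integral_hasDerivAt_right (by simp)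
      (Continuous.stronglyMeasurableAtFilter (by fun_prop) _ _) (Continuous.continuousAt (by fun_prop))
  refine (h1.add_const (M y s)).congr_of_eventuallyEq ?_
  filter_upwards [hI.mem_nhds hs'] with s' h
  rw [← all s' h]; ring

lemma ball_eq_prod (x : ℝ × ℝ) (ε : ℝ) :
    ball x ε = ball x.1 ε ×ˢ ball x.2 ε := by rw [ball_prod_same]

section local_reps

variable {x : ℝ × ℝ} {ε : ℝ} {f a M A C : Fn}

lemma ae_ball_slices {P : ℝ × ℝ → Prop} (h : ∀ᵐ p ∂volume.restrict (ball x ε), P p) :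
    (∀ᵐ R ∂volume.restrict (ball x.1 ε), ∀ᵐ θ ∂volume.restrict (ball x.2 ε), P (R, θ)) ∧
    (∀ᵐ θ ∂volume.restrict (ball x.2 ε), ∀ᵐ R ∂volume.restrict (ball x.1 ε), P (R, θ)) := by
  rw [ball_eq_prod, Measure.volume_eq_prod, ← Measure.prod_restrict] at h
  refine ⟨Measure.ae_ae_of_ae_prod h, ?_⟩
  rw [← Measure.prod_swap] at h
  exact Measure.ae_ae_of_ae_prod (ae_of_ae_map measurable_swap.aemeasurable h)

lemma ball_subset_slices (hx : ball x ε ⊆ strip) (hε : 0 < ε) :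
    ball x.1 ε ⊆ Ioi 0 ∧ ball x.2 ε ⊆ J₀ := by
  rw [ball_eq_prod] at hx
  exact ⟨fun s hs => (hx (mk_mem_prod hs (mem_ball_self hε))).1,
    fun s hs => (hx (mk_mem_prod (mem_ball_self hε) hs)).2⟩

lemma ordConnected_ball (c ε : ℝ) : (ball c ε).OrdConnected := by
  rw [Real.ball_eq_Ioo]; infer_instance

theorem HasWeakPartial.hasDerivAt_fst (h : HasWeakPartial (1, 0) f a) (hε : 0 < ε)
    (hx : ball x ε ⊆ strip) (hM : Continuous M) (hA : Continuous A)
    (hf : ∀ᵐ p ∂volume.restrict (ball x ε), f p = M p)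
    (ha : ∀ᵐ p ∂volume.restrict (ball x ε), a p = A p) {p : ℝ × ℝ}
    (hp : p ∈ ball x ε) : HasDerivAt (fun r => M (r, p.2)) (A p) p.1 := by
  have := ordConnected_ball x.1 ε
  obtain ⟨i1, i2⟩ := ball_subset_slices hx hε
  rw [ball_eq_prod] at hp
  refine hasDerivAt_of_slices (f := fun y s => f (s, y)) (a := fun y s => a (s, y))
    (M := fun y s => M (s, y)) (A := fun y s => A (s, y)) isOpen_Ioi isOpen_ball
    isOpen_ball i1 (hM.comp continuous_swap) (hA.comp continuous_swap) ?_ hp.2 hp.1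
  filter_upwards [ae_restrict_of_ae_restrict_of_subset i2 h.ae_isPrim_fst, (ae_ball_slices hf).2,
    (ae_ball_slices ha).2] with y h1 h2 h3 using ⟨h1, h2, h3⟩

theorem HasWeakPartial.hasDerivAt_snd (h : HasWeakPartial (0, 1) f a) (hε : 0 < ε)
    (hx : ball x ε ⊆ strip) (hM : Continuous M) (hA : Continuous A)
    (hf : ∀ᵐ p ∂volume.restrict (ball x ε), f p = M p)
    (ha : ∀ᵐ p ∂volume.restrict (ball x ε), a p = A p) {p : ℝ × ℝ}
    (hp : p ∈ ball x ε) : HasDerivAt (fun t => M (p.1, t)) (A p) p.2 := by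
  have := ordConnected_ball x.2 ε
  obtain ⟨i1, i2⟩ := ball_subset_slices hx hε
  rw [ball_eq_prod] at hp
  refine hasDerivAt_of_slices (f := fun y s => f (y, s)) (a := fun y s => a (y, s))
    (M := fun y s => M (y, s)) (A := fun y s => A (y, s)) isOpen_Ioo isOpen_ball
    isOpen_ball i2 hM hA ?_ hp.1 hp.2
  filter_upwards [ae_restrict_of_ae_restrict_of_subset i1 h.ae_isPrim_snd, (ae_ball_slices hf).1,
    (ae_ball_slices ha).1] with y h1 h2 h3 using ⟨h1, h2, h3⟩

lemma contDiffOn_succ_of_partials {B : Set (ℝ × ℝ)} (hB : IsOpen B) {n : ℕ}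
    (h1 : ∀ p ∈ B, HasDerivAt (fun r => M (r, p.2)) (A p) p.1)
    (h2 : ∀ p ∈ B, HasDerivAt (fun t => M (p.1, t)) (C p) p.2)
    (hA : ContDiffOn ℝ n A B) (hC : ContDiffOn ℝ n C B) : ContDiffOn ℝ (n + 1) M B := by
  have hfd : ∀ p ∈ B, HasFDerivAt M ((ContinuousLinearMap.toSpanSingleton ℝ (A p)).coprod
      (ContinuousLinearMap.toSpanSingleton ℝ (C p))) p := by
    intro p hp
    have hn := hB.mem_nhds hp
    exact (hasStrictFDerivAt_uncurry_coprod (𝕜 := ℝ) (u := p) (f := fun r t => M (r, t))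
      (f₁ := fun r t => ContinuousLinearMap.toSpanSingleton ℝ (A (r, t)))
      (f₂ := fun r t => ContinuousLinearMap.toSpanSingleton ℝ (C (r, t)))
      (by filter_upwards [hn] with q hq using (h1 q hq).hasFDerivAt)
      (by filter_upwards [hn] with q hq using (h2 q hq).hasFDerivAt)
      ((ContinuousLinearMap.toSpanSingletonCLE (𝕜 := ℝ) (E := ℝ)).continuous.continuousAt.comp
        ((hA.continuousOn).continuousAt hn))
      ((ContinuousLinearMap.toSpanSingletonCLE (𝕜 := ℝ) (E := ℝ)).continuous.continuousAt.comp
        ((hC.continuousOn).continuousAt hn))).hasFDerivAt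
  rw [contDiffOn_succ_iff_fderiv_of_isOpen hB]
  refine ⟨fun p hp => (hfd p hp).differentiableAt.differentiableWithinAt, by simp, ?_⟩
  have e : ContDiffOn ℝ n (fun p => A p • ContinuousLinearMap.fst ℝ ℝ ℝ +
      C p • ContinuousLinearMap.snd ℝ ℝ ℝ) B :=
    (hA.smul contDiffOn_const).add (hC.smul contDiffOn_const)
  refine e.congr fun p hp => ?_
  rw [(hfd p hp).fderiv]
  ext <;> simp

end local_reps


/-! ### The continuous solution up to the boundary -/

lemma enorm_psi_le {g : Fn} (hg : RadTest g) {R θ : ℝ} (hθ : θ ∈ Icc 0 (π / 2)) :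
    ‖psi g (R, θ)‖ₑ ≤ ∫⁻ p in strip, ‖dTheta (psi (DR g)) p * p.1⁻¹‖ₑ := by
  have tu := hg.psi.dTheta
  obtain ⟨a, b, ha, hab⟩ := tu.supp
  obtain ⟨a', b', ha', hab'⟩ := hg.supp
  rcases le_or_gt R 0 with hR | hR
  · rw [psi, hab' (R, θ) (fun h => by linarith [h.1])]; simp
  have e : dTheta (psi (DR g)) = DR (dTheta (psi g)) := by
    rw [← DR_psi hg, dTheta_DR hg.psi.smooth]
  have inner : ∀ t, ‖dTheta (psi g) (R, t)‖ₑ ≤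
      ∫⁻ r in Ioi (0 : ℝ), ‖dTheta (psi (DR g)) (r, t) * r⁻¹‖ₑ := by
    intro t
    set B := max R (b + 1)
    have hd : ∀ r, HasDerivAt (fun r => dTheta (psi g) (r, t))
        (fderiv ℝ (dTheta (psi g)) (r, t) (1, 0)) r := fun r =>
      hasDerivAt_fst (p := (r, t)) (ContDiff.diffAt tu.smooth _)
    have hc : Continuous fun r => fderiv ℝ (dTheta (psi g)) (r, t) (1, 0) :=
      (contDiff_fderiv_apply tu.smooth (1, 0)).continuous.comp (by fun_prop)
    have h1 := intervalIntegral.integral_eq_sub_of_hasDerivAt (fun r _ => hd r)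
      (hc.intervalIntegrable R B)
    rw [hab (B, t) (fun h => by linarith [h.2, le_max_right R (b + 1)]), zero_sub] at h1
    rw [← enorm_neg, ← h1, integral_of_le (le_max_left _ _)]
    refine (enorm_integral_le_lintegral_enorm _).trans ?_
    refine (lintegral_mono_set (fun r hr => mem_Ioi.2 (hR.trans hr.1))).trans (le_of_eq ?_)
    refine setLIntegral_congr_fun measurableSet_Ioi fun r hr => ?_
    have hr : r ≠ 0 := (mem_Ioi.1 hr).ne'
    simp only [e, DR_eq (ContDiff.diffAt tu.smooth (r, t))]
    congr 1
    field_simp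
  have h1 : ‖psi g (R, θ)‖ₑ ≤ ∫⁻ t in J₀, ‖dTheta (psi g) (R, t)‖ₑ := by
    have h2 := intervalIntegral.integral_eq_sub_of_hasDerivAt
      (fun t _ => hasDerivAt_dTheta hg.psi.smooth R t)
      ((continuous_slice tu.smooth R).intervalIntegrable 0 θ)
    rw [show psi g (R, 0) = 0 by simp [psi], sub_zero] at h2
    rw [← h2, integral_of_le hθ.1, restrict_Ioo_eq_restrict_Ioc]
    exact (enorm_integral_le_lintegral_enorm _).trans
      (lintegral_mono_set (Ioc_subset_Ioc_right hθ.2))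
  refine h1.trans ((lintegral_mono inner).trans (le_of_eq ?_))
  rw [volume_restrict_strip, lintegral_prod_symm]
  have : Measurable fun p : ℝ × ℝ => ‖dTheta (psi (DR g)) p * p.1⁻¹‖ₑ :=
    ((hg.DR.psi.dTheta.smooth.continuous.measurable).mul (by fun_prop)).enorm
  exact this.aemeasurable

lemma sqL2_inv_weight_lt_top : sqL2 (fun p => (p.1 * weightRad p)⁻¹) < ⊤ := by
  have hle : ∀ p ∈ strip, ‖(p.1 * weightRad p)⁻¹‖ₑ ^ 2 ≤ ofReal ((1 + p.1 ^ 2)⁻¹) := by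
    intro p hp
    rw [enorm_sq_eq]
    refine ofReal_le_ofReal ?_
    have hR : 0 < p.1 := hp.1
    have hse := one_le_se hp.2
    rw [inv_pow, mul_pow, weightRad_sq hp]
    refine inv_anti₀ (by positivity) ?_
    have h1 : 1 + p.1 ^ 2 ≤ p.1 ^ 2 * wRad p.1 ^ 2 := by
      unfold wRad
      rw [div_pow, ← mul_div_assoc, le_div_iff₀ (by positivity)]
      nlinarith [pow_pos hR 2, pow_pos hR 3, pow_pos hR 4, pow_pos hR 5, pow_pos hR 6]
    calc _ ≤ p.1 ^ 2 * wRad p.1 ^ 2 * 1 := by linarith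
      _ ≤ p.1 ^ 2 * wRad p.1 ^ 2 * se p.2 := mul_le_mul_of_nonneg_left hse (by positivity)
      _ = _ := by ring
  refine (setLIntegral_mono' measurableSet_strip hle).trans_lt ?_
  rw [volume_restrict_strip, lintegral_prod _ (by fun_prop)]
  simp only [lintegral_const, Measure.restrict_apply_univ, Real.volume_Ioo]
  rw [lintegral_mul_const _ (by fun_prop)]
  refine mul_lt_top ?_ ofReal_lt_top
  rw [← ofReal_integral_eq_lintegral_ofReal integrable_inv_one_add_sq.integrableOn
    (Eventually.of_forall fun x => by positivity)]
  exact ofReal_lt_top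

lemma enorm_psi_le_sqL2 {g : Fn} (hg : RadTest g) {R θ : ℝ} (hθ : θ ∈ Icc 0 (π / 2)) :
    ‖psi g (R, θ)‖ₑ ≤ radSq (dTheta (psi (DR g))) ^ (1 / 2 : ℝ) *
      sqL2 (fun p => (p.1 * weightRad p)⁻¹) ^ (1 / 2 : ℝ) := by
  refine (enorm_psi_le hg hθ).trans ?_
  have m1 : StripMeas fun p => dTheta (psi (DR g)) p * weightRad p :=
    hg.DR.psi.dTheta.stripMeas.mul isWeight_weightRad.meas
  have m2 : StripMeas fun p => (p.1 * weightRad p)⁻¹ :=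
    ((ContinuousOn.mul continuousOn_fst isWeight_weightRad.cont).inv₀ fun p hp =>
      (mul_pos hp.1 (isWeight_weightRad.pos p hp)).ne').aestronglyMeasurable measurableSet_strip
  have e1 : ∫⁻ p in strip, ‖dTheta (psi (DR g)) p * p.1⁻¹‖ₑ =
      ∫⁻ p in strip, ((fun p => ‖dTheta (psi (DR g)) p * weightRad p‖ₑ) *
        fun p => ‖(p.1 * weightRad p)⁻¹‖ₑ) p := by
    refine setLIntegral_congr_fun measurableSet_strip fun p hp => ?_
    simp only [Pi.mul_apply, ← enorm_mul]
    congr 1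
    have h1 := (mem_Ioi.1 hp.1).ne'
    have h2 := (isWeight_weightRad.pos p hp).ne'
    field_simp
  rw [e1]
  refine (ENNReal.lintegral_mul_le_Lp_mul_Lq _ (Real.HolderConjugate.two_two) m1.enorm m2.enorm).trans
    ?_
  rw [sqL2, sqL2]
  simp only [← ENNReal.rpow_natCast]
  norm_num

theorem exists_continuous_limit {α b : ℝ} (hα : 0 < α) (hα1 : α < alphaMax) (hb : 0 < b)
    (hb5 : b ≤ 5) {g : ℕ → Fn} (hg : ∀ n, Core (g n)) {F P : Fn} (hF : StripMeas F)
    (hP : StripMeas P) (hlF : L2Tendsto weightRad (fun n => fullL α b (g n)) F)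
    (hlP : L2Tendsto weightRad (fun n => psi (g n)) P) :
    ∃ Ψ : Fn, ContinuousOn Ψ closedStrip ∧ (∀ R, 0 ≤ R → Ψ (R, 0) = 0) ∧
      (∀ R, 0 ≤ R → Ψ (R, π / 2) = 0) ∧
      TendstoUniformlyOn (fun R θ => Ψ (R, θ)) (fun _ => 0) atTop (Icc 0 (π / 2)) ∧
      ∀ᵐ p ∂vol₊, P p = Ψ p := by
  have hpi := pi_pos
  set B := sqL2 (fun p => (p.1 * weightRad p)⁻¹) ^ (1 / 2 : ℝ) with hB
  have hBt : B ≠ ⊤ := (ENNReal.rpow_lt_top_of_nonneg (by norm_num) sqL2_inv_weight_lt_top.ne).ne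
  set D : ℝ≥0 := cOp / (α ^ 2).toNNReal
  have bd : ∀ f, Core f → radSq (dTheta (psi (DR f))) ≤ D * radSq (fullL α b f) := by
    intro f hf
    refine le_div_of_mul_le (by positivity) (sqL2_le_of_wInt hf.test.DR.psi.dTheta
      (hf.test.fullL α b) (sq_nonneg α) ?_)
    have h1 := (energy_estimate hα hα1 hb hb5 hf).2.1
    have h2 := mul_le_mul_of_nonneg_left (wInt_dTheta_psi_sq_le hf.test.DR) (sq_nonneg α)
    have h3 := mul_nonneg cEn_pos.le (wInt_sq_nonneg (fullL α b f))
    linarith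
  set a : ℕ → ℝ≥0∞ := fun n =>
    (D * (2 * sqL2 (fun p => (fullL α b (g n) p - F p) * weightRad p))) ^ (1 / 2 : ℝ) * B with ha
  have ha0 : Tendsto a atTop (𝓝 0) := by
    have h1 := ENNReal.Tendsto.const_mul (a := (D : ℝ≥0∞))
      (ENNReal.Tendsto.const_mul (a := 2) hlF (Or.inr (by simp))) (Or.inr (by simp))
    have h2 := ENNReal.Tendsto.mul_const (b := B) (h1.ennrpow_const (1 / 2)) (Or.inr hBt)
    simpa [ha] using h2
  have key : ∀ n m, ∀ p ∈ closedStrip, ‖psi (g n) p - psi (g m) p‖ₑ ≤ a n + a m := by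
    intro n m p hp
    have hc := (hg n).add_mul (hg m) (-1)
    have e1 : psi (g n) p - psi (g m) p = psi (fun p => g n p + -1 * g m p) (p.1, p.2) := by
      simp only [psi]; ring
    have e2 : (fun p => fullL α b (fun p => g n p + -1 * g m p) p * weightRad p) = fun p =>
        (fullL α b (g n) p - F p) * weightRad p - (fullL α b (g m) p - F p) * weightRad p := by
      rw [fullL_add_mul (hg n).test (hg m).test]; funext p; ring
    rw [e1]
    refine (enorm_psi_le_sqL2 hc.test hp.2).trans ?_
    have h3 := bd _ hc
    rw [e2] at h3
    have h4 := h3.trans (mul_le_mul_right (sqL2_sub_le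
      (f := fun p => (fullL α b (g n) p - F p) * weightRad p)
      ((((hg n).test.fullL α b).stripMeas.sub hF).mul isWeight_weightRad.meas)) _)
    simp only [ha]
    rw [← add_mul]
    refine mul_le_mul_left ?_ _
    refine (ENNReal.rpow_le_rpow h4 (by norm_num)).trans ?_
    rw [mul_add]
    exact ENNReal.rpow_add_le_add_rpow _ _ (by norm_num) (by norm_num)
  have hcs : UniformCauchySeqOn (fun n => psi (g n)) atTop closedStrip := by
    rw [uniformCauchySeqOn_iff]
    intro ε hε
    have h1 : ∀ᶠ n in atTop, a n < ofReal (ε / 2) :=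
      ha0.eventually (gt_mem_nhds (by simpa using hε))
    obtain ⟨N, hN⟩ := eventually_atTop.1 h1
    refine ⟨N, fun m hm n hn p hp => ?_⟩
    have h2 := (key m n p hp).trans_lt (ENNReal.add_lt_add (hN m hm) (hN n hn))
    rw [← ENNReal.ofReal_add (by positivity) (by positivity), add_halves,
      enorm_eq_ofReal_abs, ENNReal.ofReal_lt_ofReal_iff hε] at h2
    rwa [Real.dist_eq]
  have hex : ∀ p, ∃ y, p ∈ closedStrip → Tendsto (fun n => psi (g n) p) atTop (𝓝 y) := by
    intro p
    by_cases hp : p ∈ closedStrip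
    · obtain ⟨y, hy⟩ := cauchySeq_tendsto_of_complete (hcs.cauchySeq hp)
      exact ⟨y, fun _ => hy⟩
    · exact ⟨0, fun h => absurd h hp⟩
  choose Ψ hΨ using hex
  have hu := hcs.tendstoUniformlyOn_of_tendsto hΨ
  have hsub : strip ⊆ closedStrip := prod_mono Ioi_subset_Ici_self Ioo_subset_Icc_self
  refine ⟨Ψ, hu.continuousOn (Frequently.of_forall fun n =>
    (hg n).test.psi.smooth.continuous.continuousOn), fun R hR => ?_, fun R hR => ?_, ?_, ?_⟩
  · refine tendsto_nhds_unique (hΨ (R, 0) ⟨hR, by constructor <;> simp; positivity⟩) ?_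
    simp [psi]
  · refine tendsto_nhds_unique (hΨ (R, π / 2) ⟨hR, by constructor <;> simp; positivity⟩) ?_
    have : (2 : ℝ) * (π / 2) = π := by ring
    simp [psi, this]
  · rw [tendstoUniformlyOn_iff]
    intro ε hε
    obtain ⟨n, hn⟩ := (tendstoUniformlyOn_iff.1 hu ε hε).exists
    obtain ⟨a, c, ha, hac⟩ := (hg n).test.supp
    filter_upwards [eventually_gt_atTop (max c 0)] with R hR θ hθ
    have h1 := hn (R, θ) ⟨mem_Ici.2 ((le_max_right c 0).trans hR.le), hθ⟩
    rw [psi, hac (R, θ) (fun h => by linarith [h.2, le_max_left c 0]), mul_zero] at h1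
    rwa [dist_comm]
  · have hc : ContinuousOn Ψ strip := (hu.continuousOn (Frequently.of_forall fun n =>
      (hg n).test.psi.smooth.continuous.continuousOn)).mono hsub
    have hm := hc.aestronglyMeasurable (μ := volume) measurableSet_strip
    have h0 : sqL2 (fun p => (Ψ p - P p) * weightRad p) = 0 := by
      refine le_antisymm ?_ zero_le
      have h1 := lintegral_liminf_le' (μ := vol₊) (u := atTop)
        (f := fun n p => ‖(psi (g n) p - P p) * weightRad p‖ₑ ^ 2) fun n => StripMeas.enorm_sq
          (f := fun p => (psi (g n) p - P p) * weightRad p)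
          (((hg n).test.psi.stripMeas.sub hP).mul isWeight_weightRad.meas)
      refine le_trans (le_of_eq ?_) (h1.trans (le_of_eq hlP.liminf_eq))
      refine setLIntegral_congr_fun measurableSet_strip fun p hp => ?_
      refine (Tendsto.liminf_eq ?_).symm
      have h2 := ((hΨ p (hsub hp)).sub_const (P p)).mul_const (weightRad p)
      exact ENNReal.Tendsto.pow h2.enorm
    refine L2Tendsto.ae_unique isWeight_weightRad (f := fun _ => Ψ) (fun _ => hm) hP hm ?_ ?_
    · exact (tendsto_const_nhds (x := (0 : ℝ≥0∞))).congr fun _ => h0.symm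
    · unfold L2Tendsto; simp [sqL2]


/-! ### Interior regularity and the equation -/

lemma DR_congr_of_eqOn {B : Set (ℝ × ℝ)} (hB : IsOpen B) {f g : Fn} (h : EqOn f g B)
    {p : ℝ × ℝ} (hp : p ∈ B) : DR f p = DR g p := by
  have : (fun r => f (r, p.2)) =ᶠ[𝓝 p.1] fun r => g (r, p.2) := by
    have hc : ContinuousAt (fun r : ℝ => (r, p.2)) p.1 := by fun_prop
    filter_upwards [hc.eventually (hB.mem_nhds hp)] with r hr using h hr
  rw [DR, DR, this.deriv_eq]

lemma dTheta_congr_of_eqOn {B : Set (ℝ × ℝ)} (hB : IsOpen B) {f g : Fn} (h : EqOn f g B)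
    {p : ℝ × ℝ} (hp : p ∈ B) : dTheta f p = dTheta g p := by
  have : (fun r => f (p.1, r)) =ᶠ[𝓝 p.2] fun r => g (p.1, r) := by
    have hc : ContinuousAt (fun r : ℝ => (p.1, r)) p.2 := by fun_prop
    filter_upwards [hc.eventually (hB.mem_nhds hp)] with r hr using h hr
  rw [dTheta, dTheta, this.deriv_eq]

section local_reps

variable {x : ℝ × ℝ} {ε : ℝ} {f a M A : Fn}

lemma HasWeakPartial.hasDerivAt_fst_div (h : HasWeakPartial (1, 0) f (divR a))
    (hε : 0 < ε) (hx : closedBall x ε ⊆ strip) (hM : Continuous M) (hA : Continuous A)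
    (hf : ∀ᵐ p ∂volume.restrict (ball x ε), f p = M p)
    (ha : ∀ᵐ p ∂volume.restrict (ball x ε), a p = A p) {p : ℝ × ℝ}
    (hp : p ∈ ball x ε) : HasDerivAt (fun r => M (r, p.2)) (A p / p.1) p.1 := by
  have hc : ContinuousOn (divR A) (closedBall x ε) :=
    hA.continuousOn.div continuousOn_fst fun p hp => (mem_Ioi.1 (hx hp).1).ne'
  obtain ⟨A', hA', e⟩ := ContinuousOn.exists_continuous_eqOn hc
  have hsub := ball_subset_closedBall (x := x) (ε := ε)
  rw [← show A' p = A p / p.1 from e (hsub hp)]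
  refine h.hasDerivAt_fst hε (hsub.trans hx) hM hA' hf ?_ hp
  filter_upwards [ha, ae_restrict_mem isOpen_ball.measurableSet] with q hq hqb
  rw [hq, e (hsub hqb)]

lemma HasWeakPartial.hasDerivAt_snd_div (h : HasWeakPartial (0, 1) f (divS a))
    (hε : 0 < ε) (hx : closedBall x ε ⊆ strip) (hM : Continuous M) (hA : Continuous A)
    (hf : ∀ᵐ p ∂volume.restrict (ball x ε), f p = M p)
    (ha : ∀ᵐ p ∂volume.restrict (ball x ε), a p = A p) {p : ℝ × ℝ}
    (hp : p ∈ ball x ε) :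
    HasDerivAt (fun t => M (p.1, t)) (A p / sin (2 * p.2)) p.2 := by
  have hc : ContinuousOn (divS A) (closedBall x ε) :=
    hA.continuousOn.div (by fun_prop) fun p hp => (sin_two_pos' (hx hp)).ne'
  obtain ⟨A', hA', e⟩ := ContinuousOn.exists_continuous_eqOn hc
  have hsub := ball_subset_closedBall (x := x) (ε := ε)
  rw [← show A' p = A p / sin (2 * p.2) from e (hsub hp)]
  refine h.hasDerivAt_snd hε (hsub.trans hx) hM hA' hf ?_ hp
  filter_upwards [ha, ae_restrict_mem isOpen_ball.measurableSet] with q hq hqb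
  rw [hq, e (hsub hqb)]

end local_reps

/-- The classical derivatives of `Ψ` at `p` are the values of the weak ones. -/
def ClassicalAt (P U E : ℕ → Fn) (Ψ : Fn) (p : ℝ × ℝ) : Prop :=
  DR Ψ p = P 1 p ∧ DR (DR Ψ) p = P 2 p ∧ dTheta (dTheta Ψ) p = E 0 p ∧
    dTheta (fun q => tan q.2 * Ψ q) p = (Ψ p + U 0 p / 2) / cos p.2 ^ 2

section reg

variable {α b : ℝ} {k : ℕ} {N : ℝ≥0} {F P U Q H G : ℕ → Fn} {Ψ : Fn}

theorem EllData.local_regularity (h : EllData α b k N F P U Q H) (hk : 2 ≤ k)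
    (hG : ∀ j, j + 1 ≤ k → HasWeakPartial (0, 1) (F j) (divS (G j)))
    (hΨ : ContinuousOn Ψ strip) (hΨP : ∀ᵐ p ∂vol₊, P 0 p = Ψ p) {x : ℝ × ℝ}
    (hx : x ∈ strip) : ∃ V ∈ 𝓝 x, V ⊆ strip ∧ ContDiffOn ℝ 2 Ψ V ∧
      ∀ᵐ p ∂volume.restrict V, ClassicalAt P U (secE P Q H) Ψ p := by
  obtain ⟨δ, hδ, hδs⟩ := nhds_basis_closedBall.mem_iff.1 (isOpen_strip.mem_nhds hx)
  set ε := δ / 2 with hεdef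
  have hε : 0 < ε := by positivity
  have hx2 : closedBall x (2 * ε) ⊆ strip := by rwa [hεdef, mul_div_cancel₀ _ two_ne_zero]
  have hx1 : closedBall x ε ⊆ strip := (closedBall_subset_closedBall (by linarith)).trans hx2
  set B := ball x ε with hB
  have hBc : B ⊆ closedBall x ε := ball_subset_closedBall
  have hBo : IsOpen B := isOpen_ball
  have hBs : B ⊆ strip := hBc.trans hx1
  have rE : HasWeakPartial (1, 0) (secE P Q H 0) (fun p => secE P Q H 1 p / p.1) :=
    (((h.radQ 0 (by omega)).add ((h.radH 0 (by omega)).const_mul (-1))).add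
      ((h.radP 0 (by omega)).const_mul (-4))).congr_on
      (fun p _ => by simp only [secE]; ring) fun p _ => by simp only [secE]; ring
  have rep : ∀ {f g d r : Fn}, HasWeakPartial (0, 1) f g →
      HasWeakPartial (1, 0) f (divR d) → HasWeakPartial (0, 1) d r →
      ∃ M, Continuous M ∧ ∀ᵐ p ∂volume.restrict B, f p = M p := fun h1 h2 h3 => by
    obtain ⟨M, hM, e⟩ := exists_continuous_rep h1 h2 h3 hε hx2
    exact ⟨M, hM, ae_restrict_of_ae_restrict_of_subset hBc e⟩
  obtain ⟨M0, cM0, e0⟩ := rep (h.angP 0 (by omega)) (h.radP 0 (by omega)) (h.angP 1 (by omega))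
  obtain ⟨M1, cM1, e1⟩ := rep (h.angP 1 (by omega)) (h.radP 1 (by omega)) (h.angP 2 (by omega))
  obtain ⟨M2, cM2, e2⟩ := rep (h.angP 2 (by omega)) (h.radP 2 (by omega)) (h.angP 3 (by omega))
  obtain ⟨N0, cN0, f0⟩ := rep (h.angU 0 (by omega)) (h.radU 0 (by omega)) (h.angU 1 (by omega))
  obtain ⟨N1, cN1, f1⟩ := rep (h.angU 1 (by omega)) (h.radU 1 (by omega)) (h.angU 2 (by omega))
  obtain ⟨L, cL, eL⟩ := rep (h.ang_E (by omega) (hG 0 (by omega))) rE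
    (h.ang_E (by omega) (hG 1 (by omega)))
  have d1 := fun p hp => (h.radP 0 (by omega)).hasDerivAt_fst_div hε hx1 cM0 cM1 e0 e1 (p := p) hp
  have d2 := fun p hp => (h.radP 1 (by omega)).hasDerivAt_fst_div hε hx1 cM1 cM2 e1 e2 (p := p) hp
  have d3 := fun p hp => (h.radU 0 (by omega)).hasDerivAt_fst_div hε hx1 cN0 cN1 f0 f1 (p := p) hp
  have t1 := fun p hp => (h.angP 0 (by omega)).hasDerivAt_snd_div hε hx1 cM0 cN0 e0 f0 (p := p) hp
  have t2 := fun p hp => (h.angP 1 (by omega)).hasDerivAt_snd_div hε hx1 cM1 cN1 e1 f1 (p := p) hp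
  have t3 := fun p hp => (h.angU 0 (by omega)).hasDerivAt_snd_div hε hx1 cN0
    (A := fun p => 2 * cos (2 * p.2) * N0 p + sin (2 * p.2) ^ 2 * L p) (by fun_prop) f0
    (by filter_upwards [f0, eL] with q h1 h2; rw [← h1, ← h2, secE]) (p := p) hp
  have r0 : ∀ p ∈ B, p.1 ≠ 0 := fun p hp => (mem_Ioi.1 (hBs hp).1).ne'
  have s0 : ∀ p ∈ B, sin (2 * p.2) ≠ 0 := fun p hp => (sin_two_pos' (hBs hp)).ne'
  have z : ∀ {f : Fn}, ContinuousOn f B → ContDiffOn ℝ (0 : ℕ) f B := fun hf =>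
    contDiffOn_zero.2 hf
  have cs : ContinuousOn (fun p : ℝ × ℝ => sin (2 * p.2)) B := by fun_prop
  have hs' : ContDiff ℝ 1 fun p : ℝ × ℝ => sin (2 * p.2) := by fun_prop
  have dM1 : ContDiffOn ℝ 1 M1 B := by
    simpa using contDiffOn_succ_of_partials hBo (n := 0) d2 t2
      (z (cM2.continuousOn.div continuousOn_fst r0)) (z (cN1.continuousOn.div cs s0))
  have dN0 : ContDiffOn ℝ 1 N0 B := by
    simpa using contDiffOn_succ_of_partials hBo (n := 0) d3 t3
      (z (cN1.continuousOn.div continuousOn_fst r0)) (z (ContinuousOn.div (by fun_prop) cs s0))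
  have dM0 : ContDiffOn ℝ 2 M0 B := by
    have := contDiffOn_succ_of_partials hBo (n := 1) d1 t1
      (dM1.div contDiffOn_fst r0) (dN0.div hs'.contDiffOn s0)
    exact this
  have eΨ : EqOn Ψ M0 B := by
    refine Measure.eqOn_open_of_ae_eq (μ := volume) ?_ hBo (hΨ.mono hBs) cM0.continuousOn
    filter_upwards [ae_restrict_of_ae_restrict_of_subset hBs hΨP, e0] with p h1 h2
    rw [← h1, h2]
  have D1 : EqOn (DR Ψ) M1 B := fun p hp => by
    rw [DR_congr_of_eqOn hBo eΨ hp, DR, (d1 p hp).deriv]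
    have := r0 p hp
    field_simp
  have D2 : EqOn (DR (DR Ψ)) M2 B := fun p hp => by
    rw [DR_congr_of_eqOn hBo D1 hp, DR, (d2 p hp).deriv]
    have := r0 p hp
    field_simp
  have T1 : EqOn (dTheta Ψ) (fun p => N0 p / sin (2 * p.2)) B := fun p hp => by
    rw [dTheta_congr_of_eqOn hBo eΨ hp, dTheta, (t1 p hp).deriv]
  have T2 : EqOn (dTheta (dTheta Ψ)) L B := fun p hp => by
    rw [dTheta_congr_of_eqOn hBo T1 hp]
    refine ((t3 p hp).div (hasDerivAt_sin_two p.2) (s0 p hp)).deriv.trans ?_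
    have := s0 p hp
    field_simp
    ring
  refine ⟨B, ball_mem_nhds x hε, hBs, dM0.congr eΨ, ?_⟩
  filter_upwards [e1, e2, f0, eL, ae_restrict_mem hBo.measurableSet] with p h1 h2 h3 h4 hp
  refine ⟨(D1 hp).trans h1.symm, (D2 hp).trans h2.symm, (T2 hp).trans h4.symm, ?_⟩
  have hcos : cos p.2 ≠ 0 := (cos_pos_strip (hBs hp).2).ne'
  have e : EqOn (fun q => tan q.2 * Ψ q) (fun q => tan q.2 * M0 q) B := fun q hq => by
    simp only [eΨ hq]
  rw [dTheta_congr_of_eqOn hBo e hp]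
  refine ((hasDerivAt_tan hcos).mul (t1 p hp)).deriv.trans ?_
  rw [eΨ hp, h3, Real.tan_eq_sin_div_cos, sin_two_mul]
  have hsin := (sin_pos_strip (hBs hp).2).ne'
  field_simp

theorem EllData.regularity (h : EllData α b k N F P U Q H) (hk : 2 ≤ k)
    (hG : ∀ j, j + 1 ≤ k → HasWeakPartial (0, 1) (F j) (divS (G j)))
    (hΨ : ContinuousOn Ψ strip) (hΨP : ∀ᵐ p ∂vol₊, P 0 p = Ψ p) :
    ContDiffOn ℝ 2 Ψ strip ∧ ∀ᵐ p ∂vol₊, ClassicalAt P U (secE P Q H) Ψ p := by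
  have hl := fun x hx => h.local_regularity hk hG hΨ hΨP (x := x) hx
  refine ⟨fun x hx => ?_, ?_⟩
  · obtain ⟨V, hV, -, hc, -⟩ := hl x hx
    exact (hc.contDiffAt hV).contDiffWithinAt
  · rw [ae_restrict_iff' measurableSet_strip, ae_iff]
    refine measure_null_of_locally_null _ fun x hx => ?_
    have hxs : x ∈ strip := by by_contra hh; exact hx fun h => absurd h hh
    obtain ⟨V, hV, -, -, hae⟩ := hl x hxs
    obtain ⟨W, hWV, hWo, hxW⟩ := _root_.mem_nhds_iff.1 hV
    have h2 := (ae_restrict_iff' hWo.measurableSet).1 (ae_restrict_of_ae_restrict_of_subset hWV hae)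
    rw [ae_iff] at h2
    refine ⟨_ ∩ W, inter_mem_nhdsWithin _ (hWo.mem_nhds hxW), measure_mono_null (fun p hp => ?_) h2⟩
    exact fun hh => hp.1 fun _ => hh hp.2

theorem EllData.equation (h : EllData α b k N F P U Q H) (hΨP : ∀ᵐ p ∂vol₊, P 0 p = Ψ p)
    (hc : ∀ᵐ p ∂vol₊, ClassicalAt P U (secE P Q H) Ψ p) :
    ∀ᵐ p ∂vol₊, - α ^ 2 * DR (DR Ψ) p - b * α * DR Ψ p - dTheta (dTheta Ψ) p
      + dTheta (fun q => tan q.2 * Ψ q) p - 6 * Ψ p = F 0 p := by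
  filter_upwards [hΨP, hc, h.rel 0 (by omega), h.relQ, ae_restrict_mem measurableSet_strip] with
    p h0 ⟨h1, h2, h3, h4⟩ h5 h6 hp
  have hcos : cos p.2 ≠ 0 := (cos_pos_strip hp.2).ne'
  rw [h1, h2, h3, h4, secE, h5, ← h0]
  rw [cos_two_mul] at h6
  have hq : Q 0 p = U 0 p / (2 * cos p.2 ^ 2) - 2 * P 0 p + P 0 p / cos p.2 ^ 2 := by
    field_simp
    linear_combination h6
  rw [hq]
  field_simp
  ring

end reg


/-! ### Uniqueness -/

section slices

variable {f g : Fn}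

lemma hasDerivAt_slice_fst (h : ContDiffOn ℝ 1 f strip) {p : ℝ × ℝ} (hp : p ∈ strip) :
    HasDerivAt (fun r => f (r, p.2)) (fderiv ℝ f p (1, 0)) p.1 :=
  ((h.contDiffAt (isOpen_strip.mem_nhds hp)).differentiableAt one_ne_zero).hasFDerivAt.comp_hasDerivAt
    (f := fun r : ℝ => (r, p.2)) p.1 ((hasDerivAt_id p.1).prodMk (hasDerivAt_const p.1 p.2))

lemma hasDerivAt_slice_snd (h : ContDiffOn ℝ 1 f strip) {p : ℝ × ℝ} (hp : p ∈ strip) :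
    HasDerivAt (fun t => f (p.1, t)) (dTheta f p) p.2 ∧ dTheta f p = fderiv ℝ f p (0, 1) := by
  have : HasDerivAt (fun t => f (p.1, t)) (fderiv ℝ f p (0, 1)) p.2 :=
    ((h.contDiffAt (isOpen_strip.mem_nhds hp)).differentiableAt
      one_ne_zero).hasFDerivAt.comp_hasDerivAt (f := fun t : ℝ => (p.1, t)) p.2
      ((hasDerivAt_const p.2 p.1).prodMk (hasDerivAt_id p.2))
  exact ⟨this.differentiableAt.hasDerivAt, this.deriv⟩

lemma contDiffOn_DR {n : ℕ} (h : ContDiffOn ℝ (n + 1) f strip) : ContDiffOn ℝ n (DR f) strip := by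
  have h1 : ContDiffOn ℝ 1 f strip := h.of_le (by simp)
  refine (contDiffOn_fst.mul (((h.fderiv_of_isOpen isOpen_strip le_rfl).clm_apply
    (contDiffOn_const (c := ((1, 0) : ℝ × ℝ)))))).congr fun p hp => ?_
  rw [DR, (hasDerivAt_slice_fst h1 hp).deriv]

lemma contDiffOn_dTheta {n : ℕ} (h : ContDiffOn ℝ (n + 1) f strip) :
    ContDiffOn ℝ n (dTheta f) strip := by
  have h1 : ContDiffOn ℝ 1 f strip := h.of_le (by simp)
  exact ((h.fderiv_of_isOpen isOpen_strip le_rfl).clm_apply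
    (contDiffOn_const (c := ((0, 1) : ℝ × ℝ)))).congr fun p hp => (hasDerivAt_slice_snd h1 hp).2

lemma DR_sub (hf : ContDiffOn ℝ 1 f strip) (hg : ContDiffOn ℝ 1 g strip) :
    EqOn (DR fun p => f p - g p) (fun p => DR f p - DR g p) strip := fun p hp => by
  have := ((hasDerivAt_slice_fst hf hp).sub (hasDerivAt_slice_fst hg hp)).deriv
  simp only [DR]
  rw [(hasDerivAt_slice_fst hf hp).deriv, (hasDerivAt_slice_fst hg hp).deriv, ← mul_sub]
  exact congrArg _ this

lemma dTheta_sub (hf : ContDiffOn ℝ 1 f strip) (hg : ContDiffOn ℝ 1 g strip) :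
    EqOn (dTheta fun p => f p - g p) (fun p => dTheta f p - dTheta g p) strip := fun _ hp =>
  ((hasDerivAt_slice_snd hf hp).1.sub (hasDerivAt_slice_snd hg hp).1).deriv

lemma contDiffOn_tan_mul (hf : ContDiffOn ℝ 1 f strip) :
    ContDiffOn ℝ 1 (fun q => tan q.2 * f q) strip := by
  refine ContDiffOn.mul (fun p hp => ?_) hf
  exact ((Real.contDiffAt_tan.2 (cos_pos_strip hp.2).ne').comp p contDiffAt_snd).contDiffWithinAt

lemma dTheta_tan_mul (hf : ContDiffOn ℝ 1 f strip) {p : ℝ × ℝ} (hp : p ∈ strip) :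
    dTheta (fun q => tan q.2 * f q) p = 1 / cos p.2 ^ 2 * f p + tan p.2 * dTheta f p :=
  ((hasDerivAt_tan (cos_pos_strip hp.2).ne').mul (hasDerivAt_slice_snd hf hp).1).deriv

end slices

section difference

variable {α b : ℝ} {F Ψ Ψ' : Fn}

theorem IsSolution.sub (h : IsSolution α b F Ψ) (h' : IsSolution α b F Ψ') :
    IsSolution α b (fun _ => 0) (fun p => Ψ p - Ψ' p) := by
  have c1 : ContDiffOn ℝ 1 Ψ strip := h.smooth.of_le (by norm_num)
  have c1' : ContDiffOn ℝ 1 Ψ' strip := h'.smooth.of_le (by norm_num)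
  have s : ContDiffOn ℝ ((1 : ℕ) + 1) Ψ strip := h.smooth.of_le (by norm_num)
  have s' : ContDiffOn ℝ ((1 : ℕ) + 1) Ψ' strip := h'.smooth.of_le (by norm_num)
  refine ⟨h.cont.sub h'.cont, h.smooth.sub h'.smooth, ?_, fun R hR => ?_, fun R hR => ?_, ?_⟩
  · filter_upwards [h.eqn, h'.eqn, ae_restrict_mem measurableSet_strip] with p h1 h2 hp
    have e1 := DR_sub c1 c1' hp
    have e2 := (DR_congr_of_eqOn isOpen_strip (DR_sub c1 c1') hp).trans
      (DR_sub (contDiffOn_DR s) (contDiffOn_DR s') hp)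
    have e3 := (dTheta_congr_of_eqOn isOpen_strip (dTheta_sub c1 c1') hp).trans
      (dTheta_sub (contDiffOn_dTheta s) (contDiffOn_dTheta s') hp)
    have e4 := dTheta_sub (contDiffOn_tan_mul c1) (contDiffOn_tan_mul c1') hp
    simp only [← mul_sub] at e4
    rw [e1, e2, e3, e4]
    linarith
  · simp [h.bc_zero R hR, h'.bc_zero R hR]
  · simp [h.bc_top R hR, h'.bc_top R hR]
  · simpa using h.decay.fun_sub h'.decay

/-- The homogeneous equation holds everywhere. -/
theorem IsSolution.eqn_homogeneous (h : IsSolution α b (fun _ => 0) Ψ) {p : ℝ × ℝ}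
    (hp : p ∈ strip) :
    - α ^ 2 * DR (DR Ψ) p - b * α * DR Ψ p - dTheta (dTheta Ψ) p
      + (1 / cos p.2 ^ 2 * Ψ p + tan p.2 * dTheta Ψ p) - 6 * Ψ p = 0 := by
  have c1 : ContDiffOn ℝ 1 Ψ strip := h.smooth.of_le (by norm_num)
  have s : ContDiffOn ℝ ((1 : ℕ) + 1) Ψ strip := h.smooth.of_le (by norm_num)
  have k1 := (contDiffOn_DR s).continuousOn
  have k2 := contDiffOn_DR (n := 0) (by simpa using (contDiffOn_DR s)) |>.continuousOn
  have k3 := (contDiffOn_dTheta s).continuousOn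
  have k4 := contDiffOn_dTheta (n := 0) (by simpa using (contDiffOn_dTheta s)) |>.continuousOn
  have k5 := c1.continuousOn
  have hc : ∀ q ∈ strip, cos q.2 ≠ 0 := fun q hq => (cos_pos_strip hq.2).ne'
  have k6 : ContinuousOn (fun q : ℝ × ℝ => cos q.2) strip := by fun_prop
  have k7 : ContinuousOn (fun q : ℝ × ℝ => tan q.2) strip := fun q hq =>
    ((Real.continuousAt_tan.2 (hc q hq)).comp (f := Prod.snd) continuousAt_snd).continuousWithinAt
  refine Measure.eqOn_open_of_ae_eq (μ := volume) (g := fun _ => (0 : ℝ))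
    (f := fun p : ℝ × ℝ => - α ^ 2 * DR (DR Ψ) p - b * α * DR Ψ p - dTheta (dTheta Ψ) p
      + (1 / cos p.2 ^ 2 * Ψ p + tan p.2 * dTheta Ψ p) - 6 * Ψ p) ?_ isOpen_strip
    ?_ continuousOn_const hp
  · filter_upwards [h.eqn, ae_restrict_mem measurableSet_strip] with q h1 hq
    rwa [dTheta_tan_mul c1 hq] at h1
  · have k8 : ContinuousOn (fun q : ℝ × ℝ => 1 / cos q.2 ^ 2) strip :=
      continuousOn_const.div (k6.pow 2) fun q hq => pow_ne_zero 2 (hc q hq)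
    exact ((((continuousOn_const.mul k2).sub (continuousOn_const.mul k1)).sub k4).add
      ((k8.mul k5).add (k7.mul k3))).sub (continuousOn_const.mul k5)

lemma IsSolution.exists_bound (h : IsSolution α b F Ψ) : ∃ B, ∀ p ∈ closedStrip, |Ψ p| ≤ B := by
  have h1 := (tendstoUniformlyOn_iff.1 h.decay) 1 one_pos
  obtain ⟨A, hA⟩ := eventually_atTop.1 h1
  obtain ⟨B, hB⟩ := (isCompact_Icc (a := (0 : ℝ)) (b := A)).prod
    (isCompact_Icc (a := (0 : ℝ)) (b := π / 2)) |>.exists_bound_of_continuousOn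
    (h.cont.mono (prod_mono (fun _ hx => hx.1) subset_rfl))
  refine ⟨max B 1, fun p hp => ?_⟩
  rcases le_total p.1 A with hh | hh
  · exact (hB p ⟨⟨hp.1, hh⟩, hp.2⟩).trans (le_max_left _ _)
  · have := hA p.1 hh p.2 hp.2
    rw [Real.dist_eq, zero_sub, abs_neg] at this
    exact this.le.trans (le_max_right _ _)

end difference

/-! #### Moments in the logarithmic radial variable -/

/-- The integral of `f` against `φ(log R) dR / R`. -/
def logMoment (f : Fn) (φ : ℝ → ℝ) (θ : ℝ) : ℝ := ∫ t, f (exp t, θ) * φ t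

section moments

variable {f : Fn} {φ : ℝ → ℝ} {θ : ℝ}

lemma exp_mem_strip (hθ : θ ∈ J₀) (t : ℝ) : (exp t, θ) ∈ strip := ⟨exp_pos t, hθ⟩

lemma continuous_exp_slice (hf : ContinuousOn f strip) (hθ : θ ∈ J₀) :
    Continuous fun t => f (exp t, θ) :=
  hf.comp_continuous (by fun_prop) (exp_mem_strip hθ)

lemma Test.integrable_mul (h : Test φ) {u : ℝ → ℝ} (hu : Continuous u) :
    Integrable fun t => u t * φ t :=
  (hu.mul h.smooth.continuous).integrable_of_hasCompactSupport h.supp.mul_left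

lemma hasDerivAt_logMoment (hf : ContDiffOn ℝ 1 f strip) (h : Test φ) (hθ : θ ∈ J₀) :
    HasDerivAt (logMoment f φ) (logMoment (dTheta f) φ θ) θ := by
  have hd : ContinuousOn (dTheta f) strip :=
    (contDiffOn_dTheta (n := 0) (by simpa using hf)).continuousOn
  obtain ⟨L, hL0, hL⟩ := h.exists_bound
  obtain ⟨δ, hδ, hδs⟩ := nhds_basis_closedBall.mem_iff.1 (isOpen_Ioo.mem_nhds hθ)
  obtain ⟨B, hB⟩ := (isCompact_Icc (a := -L) (b := L)).prod
    (isCompact_closedBall θ δ) |>.exists_bound_of_continuousOn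
    (f := fun q : ℝ × ℝ => dTheta f (exp q.1, q.2)) (hd.comp (by fun_prop) fun q hq =>
      exp_mem_strip (hδs hq.2) q.1)
  refine (hasDerivAt_integral_of_dominated_loc_of_deriv_le (μ := volume)
    (F := fun θ t => f (exp t, θ) * φ t) (F' := fun θ t => dTheta f (exp t, θ) * φ t)
    (bound := fun t => B * ‖φ t‖) (closedBall_mem_nhds θ hδ) ?_
    (h.integrable_mul (continuous_exp_slice hf.continuousOn hθ))
    ((continuous_exp_slice hd hθ).mul h.smooth.continuous).aestronglyMeasurable ?_
    ((h.smooth.continuous.integrable_of_hasCompactSupport h.supp).norm.const_mul B) ?_).2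
  · filter_upwards [isOpen_Ioo.mem_nhds hθ] with x hx
    exact (h.integrable_mul (continuous_exp_slice hf.continuousOn hx)).aestronglyMeasurable
  · refine Eventually.of_forall fun t x hx => ?_
    rw [norm_mul]
    by_cases ht : φ t = 0
    · simp [ht]
    · exact mul_le_mul_of_nonneg_right (hB (t, x) ⟨abs_le.1 (hL t ht), hx⟩) (norm_nonneg _)
  · exact Eventually.of_forall fun t x hx =>
      (hasDerivAt_slice_snd hf (exp_mem_strip (hδs hx) t)).1.mul_const (φ t)

lemma logMoment_DR (hf : ContDiffOn ℝ 1 f strip) (h : Test φ) (hθ : θ ∈ J₀) :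
    logMoment (DR f) φ θ = -logMoment f (deriv φ) θ := by
  have hd : ContinuousOn (DR f) strip := (contDiffOn_DR (n := 0) (by simpa using hf)).continuousOn
  have i1 := h.integrable_mul (continuous_exp_slice hf.continuousOn hθ)
  have i2 := h.integrable_mul (continuous_exp_slice hd hθ)
  have i3 := h.deriv.integrable_mul (continuous_exp_slice hf.continuousOn hθ)
  have key := integral_eq_zero_of_hasDerivAt_of_integrable
    (f := fun t => f (exp t, θ) * φ t) (f' := fun t => DR f (exp t, θ) * φ t +
      f (exp t, θ) * deriv φ t) (fun t => ?_) (i2.add i3) i1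
  · rw [integral_add i2 i3] at key
    simp only [logMoment]
    linarith
  · have hp := exp_mem_strip hθ t
    have h1 := (hasDerivAt_slice_fst hf) hp
    have e : DR f (exp t, θ) = fderiv ℝ f (exp t, θ) (1, 0) * exp t := by
      rw [DR, h1.deriv, mul_comm]
    rw [e]
    exact (h1.comp t (Real.hasDerivAt_exp t)).mul (h.hasDerivAt t)

variable {B : ℝ}

lemma continuousOn_logMoment (hf : ContinuousOn f closedStrip)
    (hB : ∀ p ∈ closedStrip, |f p| ≤ B) (h : Test φ) :
    ContinuousOn (logMoment f φ) (Icc 0 (π / 2)) := by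
  have hm : ∀ θ ∈ Icc 0 (π / 2), ∀ t, (exp t, θ) ∈ closedStrip := fun θ hθ t =>
    ⟨(exp_pos t).le, hθ⟩
  refine continuousOn_of_dominated (bound := fun t => B * ‖φ t‖) (fun θ hθ => ?_)
    (fun θ hθ => Eventually.of_forall fun t => ?_)
    ((h.smooth.continuous.integrable_of_hasCompactSupport h.supp).norm.const_mul B)
    (Eventually.of_forall fun t => ?_)
  · exact (h.integrable_mul (hf.comp_continuous (by fun_prop) (hm θ hθ))).aestronglyMeasurable
  · rw [norm_mul]
    exact mul_le_mul_of_nonneg_right (hB _ (hm θ hθ t)) (norm_nonneg _)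
  · exact (hf.comp (by fun_prop) fun θ hθ => hm θ hθ t).mul continuousOn_const

end moments


/-- The adjoint angular operator on `sin(2θ) cos(θ) sin(θ)^(2n)`, for solutions of the angular
equation which are merely continuous up to the boundary. -/
theorem integral_angular_adjoint {f f' f'' g : ℝ → ℝ} (hf : ContinuousOn f (Icc 0 (π / 2)))
    (hg : ContinuousOn g (Icc 0 (π / 2))) (h0 : f 0 = 0) (h1 : f (π / 2) = 0)
    (hd : ∀ θ ∈ J₀, HasDerivAt f (f' θ) θ)
    (hd' : ∀ θ ∈ J₀, HasDerivAt f' (f'' θ) θ)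
    (heq : ∀ θ ∈ J₀, g θ - f'' θ + (1 / cos θ ^ 2 * f θ + tan θ * f' θ) - 6 * f θ = 0) (n : ℕ) :
    ∫ θ in J₀, (g θ * (sin (2 * θ) * cos θ * (sin θ ^ 2) ^ n) +
      f θ * (cos θ * angOp (vPow1 n) (vPow2 n) θ)) = 0 := by
  have hpi : 0 < π / 2 := by positivity
  set G : ℝ → ℝ := fun θ => f' θ - tan θ * f θ with hG
  have hGd : ∀ θ ∈ J₀, HasDerivAt G (g θ - 6 * f θ) θ := fun θ hθ => by
    refine ((hd' θ hθ).sub ((hasDerivAt_tan (cos_pos_strip hθ).ne').mul (hd θ hθ))).congr_deriv ?_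
    linarith [heq θ hθ]
  obtain ⟨A, hA⟩ := isCompact_Icc.exists_bound_of_continuousOn
    (hg.sub (continuousOn_const.mul hf : ContinuousOn (fun θ => 6 * f θ) _))
  have hm : π / 4 ∈ J₀ := ⟨by positivity, by linarith⟩
  have hGb : ∀ θ ∈ J₀, ‖G θ‖ ≤ ‖G (π / 4)‖ + A * (π / 2) := fun θ hθ => by
    have k1 := (convex_Ioo 0 (π / 2)).norm_image_sub_le_of_norm_hasDerivWithin_le
      (fun x hx => (hGd x hx).hasDerivWithinAt) (fun x hx => hA x (Ioo_subset_Icc_self hx)) hm hθ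
    have k2 : ‖θ - π / 4‖ ≤ π / 2 := abs_le.2 ⟨by linarith [hθ.1], by linarith [hθ.2]⟩
    have k3 : 0 ≤ A := (norm_nonneg _).trans (hA _ (Ioo_subset_Icc_self hm))
    have k4 := norm_le_norm_add_norm_sub' (G θ) (G (π / 4))
    nlinarith
  set β : ℝ → ℝ := fun θ => sin (2 * θ) * cos θ * (sin θ ^ 2) ^ n with hβ
  set σ' : ℝ → ℝ := fun θ => 2 * cos (2 * θ) * cos θ - sin (2 * θ) * sin θ with hσ'
  set β' : ℝ → ℝ := fun θ => σ' θ * (sin θ ^ 2) ^ n + sin (2 * θ) * cos θ * vPow1 n θ with hβ'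
  have dp : ∀ θ, HasDerivAt (fun t => (sin t ^ 2) ^ n) (vPow1 n θ) θ := fun θ =>
    (hasDerivAt_sin_sq θ).pow n
  have dσ : ∀ θ, HasDerivAt (fun t => sin (2 * t) * cos t) (σ' θ) θ := fun θ =>
    ((hasDerivAt_sin_two θ).mul (hasDerivAt_cos θ)).congr_deriv (by simp only [hσ']; ring)
  have dβ : ∀ θ, HasDerivAt β (β' θ) θ := fun θ => (dσ θ).mul (dp θ)
  have dσ' : ∀ θ, HasDerivAt σ' (-5 * sin (2 * θ) * cos θ - 4 * cos (2 * θ) * sin θ) θ := fun θ =>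
    ((((hasDerivAt_cos_two θ).const_mul 2).mul (hasDerivAt_cos θ)).sub
      ((hasDerivAt_sin_two θ).mul (hasDerivAt_sin θ))).congr_deriv (by ring)
  have dβ' : ∀ θ, HasDerivAt β' _ θ := fun θ =>
    ((dσ' θ).mul (dp θ)).add ((dσ θ).mul (hasDerivAt_vPow1 n θ))
  have c1 : Continuous (vPow1 n) := by unfold vPow1; fun_prop
  have c2 : Continuous (vPow2 n) := by unfold vPow2; fun_prop
  have c3 := continuous_angOp c1 c2
  have cβ : Continuous β := by fun_prop
  have cβ' : Continuous β' := by fun_prop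
  have hlim : ∀ {x : ℝ} {l : Filter ℝ}, x ∈ Icc 0 (π / 2) → f x = 0 → β x = 0 →
      l ≤ 𝓝[Icc 0 (π / 2)] x → (∀ᶠ θ in l, θ ∈ J₀) →
      Tendsto (fun θ => G θ * β θ - f θ * β' θ) l (𝓝 0) := fun {x l} hx fx bx hl he => by
    have t1 : Tendsto f l (𝓝 0) := by
      have := (hf x hx).tendsto.mono_left hl
      rwa [fx] at this
    have t2 : Tendsto β l (𝓝 0) := by
      have := cβ.continuousAt.tendsto.mono_left (hl.trans nhdsWithin_le_nhds)
      rwa [bx] at this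
    have t3 := t1.mul (cβ'.continuousAt.tendsto.mono_left (hl.trans nhdsWithin_le_nhds))
    have t4 : Tendsto (fun θ => G θ * β θ) l (𝓝 0) := by
      have := t2.zero_mul_isBoundedUnder_le (g := G)
        ⟨_, eventually_map.2 (he.mono fun θ hθ => hGb θ hθ)⟩
      simpa only [mul_comm] using this
    simpa using t4.sub t3
  have key := intervalIntegral.integral_eq_sub_of_hasDerivAt_of_tendsto (a := 0) (fa := 0) (fb := 0)
    (f := fun θ => G θ * β θ - f θ * β' θ) (f' := fun θ => g θ * β θ +
      f θ * (cos θ * angOp (vPow1 n) (vPow2 n) θ)) hpi (fun θ hθ => ?_) ?_ ?_ ?_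
  · rw [integral_of_le hpi.le, integral_Ioc_eq_integral_Ioo, sub_zero] at key
    exact key
  · refine (((hGd θ hθ).mul (dβ θ)).sub ((hd θ hθ).mul (dβ' θ))).congr_deriv ?_
    have hT := Real.tan_mul_cos (cos_pos_strip hθ).ne'
    have hsc := sin_sq_add_cos_sq θ
    simp only [hG, hβ', hβ, hσ', angOp]
    rw [sin_two_mul, cos_two_mul]
    linear_combination f θ * (sin θ ^ 2) ^ n * (-(2 * (2 * cos θ ^ 2 - 1) -
      2 * sin θ ^ 2) * hT + 2 * sin θ * hsc) + f θ * vPow1 n θ *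
      (-2 * sin θ * cos θ * hT + 2 * cos θ * hsc)
  · refine ContinuousOn.intervalIntegrable ?_
    rw [uIcc_of_le hpi.le]
    exact (hg.mul cβ.continuousOn).add (hf.mul (by fun_prop))
  · refine hlim (x := 0) ⟨le_rfl, hpi.le⟩ h0 (by simp [hβ]) ?_ (Ioo_mem_nhdsGT hpi)
    rw [nhdsWithin_Icc_eq_nhdsGE hpi]
    exact nhdsWithin_mono _ Ioi_subset_Ici_self
  · refine hlim (x := π / 2) ⟨hpi.le, le_rfl⟩ h1 (by simp [hβ]) ?_ (Ioo_mem_nhdsLT hpi)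
    rw [nhdsWithin_Icc_eq_nhdsLE hpi]
    exact nhdsWithin_mono _ Iio_subset_Iic_self

/-- Moments of `Ψ` against `φ(log R) sin(2θ) cos(θ) sin(θ)^(2n)`. -/
def pairS (Ψ : Fn) (n : ℕ) (φ : ℝ → ℝ) : ℝ := ∫ θ in J₀,
    logMoment Ψ φ θ * (sin (2 * θ) * cos θ * (sin θ ^ 2) ^ n)

section

variable {α b B : ℝ} {Ψ : Fn} {φ χ : ℝ → ℝ}

lemma logMoment_add_mul (hc : ContinuousOn Ψ strip) (h : Test φ) (h' : Test χ) (c : ℝ) {θ : ℝ}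
    (hθ : θ ∈ J₀) :
    logMoment Ψ (fun t => φ t + c * χ t) θ = logMoment Ψ φ θ + c * logMoment Ψ χ θ := by
  have i1 := h.integrable_mul (continuous_exp_slice hc hθ)
  have i2 := h'.integrable_mul (continuous_exp_slice hc hθ)
  simp only [logMoment]
  rw [← integral_const_mul, ← integral_add i1 (i2.const_mul c)]
  congr 1; funext t; ring

lemma integrableOn_logMoment_mul (hf : ContinuousOn Ψ closedStrip)
    (hB : ∀ p ∈ closedStrip, |Ψ p| ≤ B) (h : Test φ) {v : ℝ → ℝ} (hv : Continuous v) :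
    IntegrableOn (fun θ => logMoment Ψ φ θ * v θ) J₀ :=
  ((continuousOn_logMoment hf hB h).mul hv.continuousOn).integrableOn_Icc.mono_set
    Ioo_subset_Icc_self

lemma strip_subset_closedStrip : strip ⊆ closedStrip :=
  prod_mono Ioi_subset_Ici_self Ioo_subset_Icc_self

lemma linTest_pairS (hf : ContinuousOn Ψ closedStrip)
    (hB : ∀ p ∈ closedStrip, |Ψ p| ≤ B) (n : ℕ) : LinTest (pairS Ψ n) := fun φ χ h h' c => by
  have hv : Continuous fun θ => sin (2 * θ) * cos θ * (sin θ ^ 2) ^ n := by fun_prop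
  rw [pairS, pairS, pairS, ← integral_const_mul, ← integral_add
    (integrableOn_logMoment_mul hf hB h hv) ((integrableOn_logMoment_mul hf hB h' hv).const_mul c)]
  refine setIntegral_congr_fun measurableSet_Ioo fun θ hθ => ?_
  simp only [logMoment_add_mul (hf.mono strip_subset_closedStrip) h h' c hθ]
  ring

lemma abs_pairS_le {A : ℝ} (h : Test φ) (hA : ∀ t, φ t ≠ 0 → ∀ θ ∈ J₀, |Ψ (exp t, θ)| ≤ A) (n : ℕ) :
    |pairS Ψ n φ| ≤ A * (∫ t, ‖φ t‖) * (π / 2) := by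
  have h1 := norm_setIntegral_le_of_norm_le_const (μ := volume) (s := J₀)
    (C := A * ∫ t, ‖φ t‖) (f := fun θ => logMoment Ψ φ θ *
      (sin (2 * θ) * cos θ * (sin θ ^ 2) ^ n)) (by simp) fun θ hθ => ?_
  · refine h1.trans (le_of_eq ?_)
    rw [Measure.real, Real.volume_Ioo, sub_zero, ENNReal.toReal_ofReal (by positivity)]
  · have k1 : ‖logMoment Ψ φ θ‖ ≤ A * ∫ t, ‖φ t‖ := by
      rw [← integral_const_mul]
      refine norm_integral_le_of_norm_le ((h.smooth.continuous.integrable_of_hasCompactSupport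
        h.supp).norm.const_mul A) (Eventually.of_forall fun t => ?_)
      rw [norm_mul]
      by_cases ht : φ t = 0
      · simp [ht]
      · exact mul_le_mul_of_nonneg_right (hA t ht θ hθ) (norm_nonneg _)
    have k2 : ‖sin (2 * θ) * cos θ * (sin θ ^ 2) ^ n‖ ≤ 1 := by
      rw [norm_mul, norm_mul, norm_pow, norm_pow]
      exact mul_le_one₀ (mul_le_one₀ (Real.abs_sin_le_one _) (norm_nonneg _)
        (Real.abs_cos_le_one _)) (by positivity)
        (pow_le_one₀ (by positivity) (pow_le_one₀ (norm_nonneg _) (Real.abs_sin_le_one _)))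
    rw [norm_mul]
    exact (mul_le_of_le_one_right (norm_nonneg _) k2).trans k1

lemma growthTest_pairS (hf : ContinuousOn Ψ closedStrip)
    (hB : ∀ p ∈ closedStrip, |Ψ p| ≤ B) (n : ℕ) : GrowthTest 0 0 (pairS Ψ n) := by
  have key : ∀ ξ, Test ξ → ∀ s, |pairS Ψ n (fun t => ξ (t - s))| ≤
      B * (∫ t, ‖ξ t‖) * (π / 2) := fun ξ hξ s => by
    rw [← integral_sub_right_eq_self (fun t => ‖ξ t‖) s]
    exact abs_pairS_le (hξ.shift s) (fun t _ θ hθ =>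
      hB _ (strip_subset_closedStrip (exp_mem_strip hθ t))) n
  exact ⟨linTest_pairS hf hB n, fun ξ hξ => ⟨_, fun m => by simpa using key ξ hξ m⟩,
    fun ξ hξ => ⟨_, fun m => by simpa using key ξ hξ (-m)⟩⟩

lemma tendsto_pairS_shift (hd : TendstoUniformlyOn (fun R θ => Ψ (R, θ)) (fun _ => 0) atTop
    (Icc 0 (π / 2))) (h : Test φ) (n : ℕ) :
    Tendsto (fun m : ℕ => pairS Ψ n (fun t => φ (t - m))) atTop (𝓝 0) := by
  obtain ⟨L, hL0, hL⟩ := h.exists_bound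
  set D := (∫ t, ‖φ t‖) * (π / 2) with hD
  have hD0 : 0 ≤ D := mul_nonneg (integral_nonneg fun _ => norm_nonneg _) (by positivity)
  rw [Metric.tendsto_atTop]
  intro ε hε
  obtain ⟨A, hA⟩ := eventually_atTop.1 ((tendstoUniformlyOn_iff.1 hd) (ε / (D + 1)) (by positivity))
  obtain ⟨m0, hm0⟩ := exists_nat_ge (A + L)
  refine ⟨m0, fun m hm => ?_⟩
  have hmr : (m0 : ℝ) ≤ m := by exact_mod_cast hm
  have h1 := abs_pairS_le (h.shift m) (A := ε / (D + 1)) (Ψ := Ψ) (fun t ht θ hθ => ?_) n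
  · rw [integral_sub_right_eq_self (fun t => ‖φ t‖) (m : ℝ), mul_assoc, ← hD] at h1
    rw [Real.dist_eq, sub_zero]
    refine h1.trans_lt ?_
    rw [div_mul_eq_mul_div, div_lt_iff₀ (by positivity)]
    nlinarith
  · have := abs_le.1 (hL _ ht)
    have h2 := hA (exp t) (by linarith [Real.add_one_le_exp t]) θ (Ioo_subset_Icc_self hθ)
    rw [Real.dist_eq, zero_sub, abs_neg] at h2
    exact h2.le

/-- The moments satisfy a triangular system of ordinary differential equations. -/
lemma IsSolution.pairS_rec (h : IsSolution α b (fun _ => 0) Ψ) (hφ : Test φ) (n : ℕ) :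
    pairS Ψ n (fun t => -α ^ 2 * deriv (deriv φ) t + b * α * deriv φ t + muC n * φ t) =
      nuC n * pairS Ψ (n - 1) φ := by
  obtain ⟨B, hB⟩ := h.exists_bound
  have c1 : ContDiffOn ℝ 1 Ψ strip := h.smooth.of_le (by norm_num)
  have s : ContDiffOn ℝ ((1 : ℕ) + 1) Ψ strip := h.smooth.of_le (by norm_num)
  have cD : ContDiffOn ℝ 1 (DR Ψ) strip := by simpa using contDiffOn_DR s
  have cT : ContDiffOn ℝ 1 (dTheta Ψ) strip := by simpa using contDiffOn_dTheta s
  have cDD := (contDiffOn_DR (n := 0) (by simpa using cD)).continuousOn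
  have cTT := (contDiffOn_dTheta (n := 0) (by simpa using cT)).continuousOn
  have c0 := c1.continuousOn
  have tm := (continuousOn_logMoment h.cont hB hφ)
  have tm1 := (continuousOn_logMoment h.cont hB hφ.deriv)
  have tm2 := (continuousOn_logMoment h.cont hB hφ.deriv.deriv)
  have key := integral_angular_adjoint (f := logMoment Ψ φ) (f' := logMoment (dTheta Ψ) φ)
    (f'' := logMoment (dTheta (dTheta Ψ)) φ)
    (g := fun θ => -α ^ 2 * logMoment Ψ (deriv (deriv φ)) θ + b * α * logMoment Ψ (deriv φ) θ)
    tm ((continuousOn_const.mul tm2).add (continuousOn_const.mul tm1))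
    (by simp [logMoment, fun t : ℝ => h.bc_zero _ (exp_pos t).le])
    (by simp [logMoment, fun t : ℝ => h.bc_top _ (exp_pos t).le])
    (fun θ hθ => hasDerivAt_logMoment c1 hφ hθ) (fun θ hθ => hasDerivAt_logMoment cT hφ hθ)
    (fun θ hθ => ?_) n
  · have e2 : ∀ θ ∈ J₀, logMoment Ψ (fun t => -α ^ 2 * deriv (deriv φ) t +
        b * α * deriv φ t + muC n * φ t) θ = -α ^ 2 * logMoment Ψ (deriv (deriv φ)) θ +
        b * α * logMoment Ψ (deriv φ) θ + muC n * logMoment Ψ φ θ := fun θ hθ => by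
      have t1 := hφ.deriv.deriv.const_mul (-α ^ 2)
      rw [logMoment_add_mul c0 (t1.add (hφ.deriv.const_mul (b * α))) hφ _ hθ,
        logMoment_add_mul c0 t1 hφ.deriv _ hθ]
      congr 2
      simp only [logMoment, ← integral_const_mul]
      congr 1; funext t; ring
    rw [pairS, pairS, ← integral_const_mul]
    refine sub_eq_zero.1 ?_
    rw [← integral_sub]
    · refine Eq.trans ?_ key
      refine setIntegral_congr_fun measurableSet_Ioo fun θ hθ => ?_
      simp only [e2 θ hθ, angOp_vPow_aux]
      ring
    · refine integrableOn_logMoment_mul h.cont hB ?_ (by fun_prop)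
      exact ((hφ.deriv.deriv.const_mul _).add (hφ.deriv.const_mul _)).add (hφ.const_mul _)
    · exact (integrableOn_logMoment_mul h.cont hB hφ (by fun_prop)).const_mul _
  · have eD : logMoment (DR Ψ) φ θ = -logMoment Ψ (deriv φ) θ := logMoment_DR c1 hφ hθ
    have eDD : logMoment (DR (DR Ψ)) φ θ = logMoment Ψ (deriv (deriv φ)) θ := by
      rw [logMoment_DR cD hφ hθ, logMoment_DR c1 hφ.deriv hθ, neg_neg]
    have eb : b * α * logMoment Ψ (deriv φ) θ = -(b * α * logMoment (DR Ψ) φ θ) := by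
      rw [eD]; ring
    simp only [eb, ← eDD]
    have ii := fun {f : Fn} (hf : ContinuousOn f strip) =>
      hφ.integrable_mul (continuous_exp_slice hf hθ)
    set f1 : ℝ → ℝ := fun t => -α ^ 2 * (DR (DR Ψ) (exp t, θ) * φ t) with hf1
    set f2 : ℝ → ℝ := fun t => -(b * α) * (DR Ψ (exp t, θ) * φ t) with hf2
    set f3 : ℝ → ℝ := fun t => -1 * (dTheta (dTheta Ψ) (exp t, θ) * φ t) with hf3
    set f4 : ℝ → ℝ := fun t => (1 / cos θ ^ 2 - 6) * (Ψ (exp t, θ) * φ t) with hf4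
    set f5 : ℝ → ℝ := fun t => tan θ * (dTheta Ψ (exp t, θ) * φ t) with hf5
    have i1 : Integrable f1 := (ii cDD).const_mul _
    have i2 : Integrable f2 := (ii cD.continuousOn).const_mul _
    have i3 : Integrable f3 := (ii cTT).const_mul _
    have i4 : Integrable f4 := (ii c0).const_mul _
    have i5 : Integrable f5 := (ii cT.continuousOn).const_mul _
    have e3 : ∫ t, (f1 + f2 + f3 + f4 + f5) t = 0 := by
      refine integral_eq_zero_of_ae (Eventually.of_forall fun t => ?_)
      have := h.eqn_homogeneous (exp_mem_strip hθ t)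
      simp only [Pi.add_apply, Pi.zero_apply, hf1, hf2, hf3, hf4, hf5] at this ⊢
      linear_combination φ t * this
    rw [integral_add' (((i1.add i2).add i3).add i4) i5, integral_add' ((i1.add i2).add i3) i4,
      integral_add' (i1.add i2) i3, integral_add' i1 i2] at e3
    simp only [hf1, hf2, hf3, hf4, hf5, integral_const_mul] at e3
    simp only [logMoment]
    linarith

lemma muC_nonneg (n : ℕ) : 0 ≤ muC n := by unfold muC; positivity

theorem IsSolution.pairS_eq_zero (h : IsSolution α b (fun _ => 0) Ψ) (hα : 0 < α) (hb : 0 < b)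
    (n : ℕ) : ∀ φ, Test φ → pairS Ψ n φ = 0 := by
  obtain ⟨B, hB⟩ := h.exists_bound
  have step : ∀ n, (∀ φ, Test φ → nuC n * pairS Ψ (n - 1) φ = 0) →
      ∀ φ, Test φ → pairS Ψ n φ = 0 := fun n hz => by
    have hG := growthTest_pairS h.cont hB n
    have hμ := muC_nonneg n
    set r := √(b ^ 2 + 4 * muC n) with hr
    have hr2 : r ^ 2 = b ^ 2 + 4 * muC n := Real.sq_sqrt (by positivity)
    have hrb : b ≤ r := Real.le_sqrt_of_sq_le (by linarith)
    set a₁ := (b + r) / (2 * α) with ha₁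
    set a₂ := (b - r) / (2 * α) with ha₂
    have p1 : 0 < a₁ := by positivity
    have p2 : a₂ ≤ 0 := div_nonpos_of_nonpos_of_nonneg (by linarith) (by positivity)
    have q1 : α ^ 2 * (a₁ + a₂) = b * α := by rw [ha₁, ha₂]; field_simp; ring
    have q2 : α ^ 2 * (a₁ * a₂) = -muC n := by rw [ha₁, ha₂]; field_simp; linarith
    refine hG.eq_zero_lo (a := a₁) (by linarith) ?_
    refine (hG.comp_opS a₁).lin.eq_zero (a := a₂) (N := fun m => m) (fun φ hφ => ?_) fun ξ hξ => ?_
    · have t2 := (hφ.opS a₂).opS a₁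
      have k := h.pairS_rec hφ n
      rw [hz φ hφ] at k
      have e : (fun t => -α ^ 2 * deriv (deriv φ) t + b * α * deriv φ t + muC n * φ t) =
          fun t => opS a₁ (opS a₂ φ) t + (-α ^ 2 - 1) * opS a₁ (opS a₂ φ) t := by
        funext t
        rw [opS_opS hφ]
        linear_combination deriv φ t * -q1 + φ t * q2
      rw [e, hG.lin _ _ t2 t2] at k
      have : α ^ 2 * pairS Ψ n (opS a₁ (opS a₂ φ)) = 0 := by linarith
      exact (mul_eq_zero.1 this).resolve_left (by positivity)
    · simp only [opS_shift]
      have h1 := (tendsto_pairS_shift h.decay (hξ.opS a₁) n).norm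
      rw [norm_zero] at h1
      refine squeeze_zero_norm (fun m => ?_) h1
      rw [norm_mul, Real.norm_eq_abs (exp _), Real.abs_exp]
      exact mul_le_of_le_one_left (norm_nonneg _)
        (Real.exp_le_one_iff.2 (mul_nonpos_of_nonpos_of_nonneg p2 m.cast_nonneg))
  induction n with
  | zero => exact step 0 fun φ _ => by simp [nuC]
  | succ n ih => exact step _ fun φ hφ => by rw [Nat.add_sub_cancel, ih φ hφ, mul_zero]

theorem IsSolution.eq_zero (h : IsSolution α b (fun _ => 0) Ψ) (hα : 0 < α) (hb : 0 < b) :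
    EqOn Ψ (fun _ => 0) closedStrip := by
  obtain ⟨B, hB⟩ := h.exists_bound
  have hc := h.smooth.continuousOn
  have hm : ∀ φ, Test φ → ∀ θ ∈ J₀, logMoment Ψ φ θ = 0 := fun φ hφ => by
    have h1 := ae_eq_zero_of_sin_moments (w := fun θ => logMoment Ψ φ θ *
      (sin (2 * θ) * cos θ)) (integrableOn_logMoment_mul h.cont hB hφ (by fun_prop))
      fun n => by
        simp only [mul_assoc]
        simpa only [pairS, mul_assoc] using h.pairS_eq_zero hα hb n φ hφ
    refine Measure.eqOn_open_of_ae_eq (μ := volume) ?_ isOpen_Ioo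
      ((continuousOn_logMoment h.cont hB hφ).mono Ioo_subset_Icc_self) continuousOn_const
    filter_upwards [h1, ae_restrict_mem measurableSet_Ioo] with θ h2 hθ
    exact (mul_eq_zero.1 h2).resolve_right (mul_pos (sin_two_pos hθ) (cos_pos_strip hθ)).ne'
  have hs : EqOn Ψ (fun _ => 0) strip := fun p hp => by
    have hcs := continuous_exp_slice hc hp.2
    have h1 := ae_eq_zero_of_integral_contDiff_smul_eq_zero hcs.locallyIntegrable fun φ h1 h2 => by
        simpa only [logMoment, smul_eq_mul, mul_comm] using hm φ ⟨h1, h2⟩ p.2 hp.2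
    have h2 := congrFun ((Continuous.ae_eq_iff_eq volume hcs continuous_const).1 h1) (log p.1)
    simpa only [Real.exp_log hp.1] using h2
  refine hs.of_subset_closure h.cont continuousOn_const strip_subset_closedStrip ?_
  rw [strip, closure_prod_eq, closure_Ioi, closure_Ioo (by positivity)]
  exact subset_rfl

theorem IsSolution.unique {F Ψ' : Fn} (h : IsSolution α b F Ψ) (h' : IsSolution α b F Ψ')
    (hα : 0 < α) (hb : 0 < b) : EqOn Ψ Ψ' closedStrip := fun _ hp =>
  sub_eq_zero.1 ((h.sub h').eq_zero hα hb hp)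

end


/-! ### Existence, uniqueness and the estimate -/

/-- A right-hand side with its derivatives, together with the weak solution data. -/
structure EllConfig (b : ℝ) (k : ℕ) where
  α : ℝ
  N : ℝ≥0
  F : Fn
  G : ℕ → ℕ → Fn
  P : ℕ → Fn
  U : ℕ → Fn
  Q : ℕ → Fn
  H : ℕ → Fn
  pos : 0 < α
  lt : α < alphaMax
  fam : IsDerivFamily k F G
  le : energy α k G ≤ N
  data : EllData α b k (16 * cOp * N) (G 0) P U Q H

lemma one_le_sixteen_mul_cOp : 1 ≤ 16 * cOp := by norm_num [cOp]

theorem exists_config_bound {b : ℝ} (hb : 0 < b) (hb5 : b ≤ 5) (k : ℕ) :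
    ∃ C : ℝ≥0, ∀ (c : EllConfig b k) (Ψ : Fn),
      (∀ᵐ p ∂vol₊, ClassicalAt c.P c.U (secE c.P c.Q c.H) Ψ p) →
      ofReal (c.α ^ 2) * Hnorm c.α k (DR (DR Ψ)) + ofReal c.α * Hnorm c.α k (DR Ψ)
        + Hnorm c.α k (dTheta (dTheta Ψ)) ≤ C * (c.N : ℝ≥0∞) ^ (1 / 2 : ℝ) := by
  obtain ⟨C, hC⟩ := exists_solution_families (ι := EllConfig b k) (α := fun c => c.α)
    (b := fun _ => b) (k := k) (N := fun c => 16 * cOp * c.N) (F := fun c => c.G 0)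
    (P := fun c => c.P) (U := fun c => c.U) (Q := fun c => c.Q) (H := fun c => c.H)
    (G := fun c => c.G 1) (fun c => c.pos) (fun c => c.lt) (fun _ => ⟨hb, hb5⟩) (fun c => c.data)
    (fun c j hj => c.fam.angular 0 j (by omega)) fun j hj => ⟨1, fun c =>
      c.fam.angReg (c.le.trans (by
        rw [one_mul, coe_le_coe]
        exact le_mul_of_one_le_left' one_le_sixteen_mul_cOp)) _ le_rfl (by omega)⟩
  refine ⟨3 * (C * (16 * cOp)) ^ (1 / 2 : ℝ), fun c Ψ hΨ => ?_⟩
  obtain ⟨⟨G2, f2, e2⟩, ⟨G1, f1, e1⟩, ⟨G0, f0, e0⟩⟩ := hC c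
  have b2 := const_mul_hnorm_le (α := c.α) (pow_pos c.pos 2) f2 (hΨ.mono fun p hp => hp.2.1)
  have b1 := const_mul_hnorm_le (α := c.α) c.pos f1 (hΨ.mono fun p hp => hp.1)
  obtain ⟨G', f', e'⟩ := f0.congr (α := c.α) (hΨ.mono fun p hp => hp.2.2.1)
  have b0 := hnorm_le (α := c.α) f'
  rw [e'] at b0
  have key : ∀ {E : ℝ≥0∞}, E ≤ (C * (16 * cOp * c.N) : ℝ≥0) →
      E ^ (1 / 2 : ℝ) ≤ ((C * (16 * cOp)) ^ (1 / 2 : ℝ) : ℝ≥0) * (c.N : ℝ≥0∞) ^ (1 / 2 : ℝ) :=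
    fun {E} h => by
      refine (ENNReal.rpow_le_rpow h (by norm_num)).trans (le_of_eq ?_)
      rw [← mul_assoc, ENNReal.coe_mul, ENNReal.mul_rpow_of_nonneg _ _ (by norm_num),
        ENNReal.coe_rpow_of_nonneg (C * (16 * cOp)) (by norm_num)]
  refine (add_le_add (add_le_add (b2.trans (key e2)) (b1.trans (key e1)))
    (b0.trans (key e0))).trans (le_of_eq ?_)
  rw [ENNReal.coe_mul, ENNReal.coe_ofNat]
  ring

theorem exists_solution {α b : ℝ} (hα : 0 < α) (hα1 : α < alphaMax) (hb : 0 < b) (hb5 : b ≤ 5)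
    {k : ℕ} (hk : 2 ≤ k) {F : Fn} (hF : MemH α k F) (hK : OrthK F) :
    ∃ (c : EllConfig b k) (Ψ : Fn), c.α = α ∧ (c.N : ℝ≥0∞) ^ (1 / 2 : ℝ) = Hnorm α k F ∧
      IsSolution α b F Ψ ∧
      ∀ᵐ p ∂vol₊, ClassicalAt c.P c.U (secE c.P c.Q c.H) Ψ p := by
  obtain ⟨G, hG, he⟩ := hF.exists_family
  lift energy α k G to ℝ≥0 using he.ne with N hN
  have hs := hG.radSeq (α := α) (by rw [← hN]; exact coe_lt_top)
  obtain ⟨g, P, U, Q, H, hg, hlF, hlP, hD⟩ := exists_ellData hα hα1 hb hb5 hs (by rwa [hG.zero])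
    (N := N) fun j hj => (sqL2_rad_le_energy hj).trans hN.ge
  obtain ⟨Ψ, h1, h2, h3, h4, h5⟩ := exists_continuous_limit hα hα1 hb hb5 hg
    (hs.meas 0 (by omega)) (hD.measP 0 (by omega)) hlF hlP
  obtain ⟨h6, h7⟩ := hD.regularity hk (fun j hj => hG.angular 0 j (by omega))
    (h1.mono strip_subset_closedStrip) h5
  refine ⟨⟨α, N, F, G, P, U, Q, H, hα, hα1, hG, hN.ge, hD⟩, Ψ, rfl, ?_,
    ⟨h1, h6, ?_, h2, h3, h4⟩, h7⟩
  · exact (congrArg (· ^ (1 / 2 : ℝ)) hN).trans hG.hnorm_eq.symm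
  · simpa only [hG.zero] using hD.equation h5 h7

end PolarBiotSavart

end

theorem theorem5p1 (b : ℝ) (hb : b = 1 ∨ b = 5) :
    ∃ α₀ : ℝ, 0 < α₀ ∧ ∀ k : ℕ, 2 ≤ k → ∃ C : ℝ, 0 < C ∧ ∀ α : ℝ, 0 < α → α < α₀ → ∀ F : ℝ × ℝ → ℝ,
        PolarBiotSavart.MemH α k F → PolarBiotSavart.OrthK F →
        ∃ Ψ : ℝ × ℝ → ℝ, PolarBiotSavart.IsSolution α b F Ψ ∧
          (∀ Ψ' : ℝ × ℝ → ℝ, PolarBiotSavart.IsSolution α b F Ψ' →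
            EqOn Ψ' Ψ PolarBiotSavart.closedStrip) ∧
          ENNReal.ofReal (α ^ 2) *
              PolarBiotSavart.Hnorm α k (PolarBiotSavart.DR (PolarBiotSavart.DR Ψ))
            + ENNReal.ofReal α * PolarBiotSavart.Hnorm α k (PolarBiotSavart.DR Ψ)
            + PolarBiotSavart.Hnorm α k (PolarBiotSavart.dTheta (PolarBiotSavart.dTheta Ψ))
            ≤ ENNReal.ofReal C * PolarBiotSavart.Hnorm α k F := by
  have hb0 : 0 < b := by rcases hb with rfl | rfl <;> norm_num
  have hb5 : b ≤ 5 := by rcases hb with rfl | rfl <;> norm_num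
  refine ⟨PolarBiotSavart.alphaMax, by norm_num [PolarBiotSavart.alphaMax], fun k hk => ?_⟩
  obtain ⟨C, hC⟩ := PolarBiotSavart.exists_config_bound hb0 hb5 k
  refine ⟨C + 1, by positivity, fun α hα hα1 F hF hK => ?_⟩
  obtain ⟨c, Ψ, rfl, hN, hΨ, hc⟩ := PolarBiotSavart.exists_solution hα hα1 hb0 hb5 hk hF hK
  refine ⟨Ψ, hΨ, fun Ψ' hΨ' => hΨ'.unique hΨ hα hb0, ?_⟩
  rw [← hN]
  refine (hC c Ψ hc).trans (mul_le_mul_left ?_ _)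
  rw [ENNReal.le_ofReal_iff_toReal_le ENNReal.coe_ne_top (by positivity), ENNReal.coe_toReal]
  linarith
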